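/- Let $\sigma^2>0$, $\vartheta_2>0$, $\vartheta_1,\vartheta_0\in\mathbb R$, put $\kappa=\vartheta_1/\vartheta_2$ and $\Gamma=\frac{\vartheta_1^2}{4\vartheta_2^2}-\frac{\vartheta_0}{\vartheta_2}$, and assume $\Gamma+\pi^2>0$. Let $X=(X_t(x))_{t\ge 0,\,x\in[0,1]}$ be the stationary solution of $$dX_t(x)=\big(\vartheta_2\partial_x^2X_t(x)+\vartheta_1\partial_xX_t(x)+\vartheta_0X_t(x)\big)\,dt+\sigma\,dW_t(x),\qquad X_t(0)=X_t(1)=0,$$ with $W$ a cylindrical Brownian motion. That is, for all $t\ge0$, $x\in[0,1]$, almost surely $X_t(x)=\sum_{\ell\ge1}u_\ell(t)e_\ell(x)$, where $e_\ell(x)=\sqrt2\sin(\pi\ell x)e^{-\kappa x/2}$, $\lambda_\ell=\vartheta_2(\pi^2\ell^2+\Gamma)$, $du_\ell(t)=-\lambda_\ell u_\ell(t)\,dt+\sigma\,d\beta_\ell(t)$, the $\beta_\ell$ are standard Brownian motions, $u_\ell(0)\sim\mathcal N(0,\sigma^2/(2\lambda_\ell))$, and $\{\beta_\ell,u_\ell(0):\ell\ge1\}$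 is an independent family. Let $T>0$ and $b\in[0,1/2)$ be fixed. For $M,N\in\mathbb N$ let $\delta=\frac{1-2b}{M}$, $\Delta=\frac TN$, $y_k=b+k\delta$, $t_i=i\Delta$, and suppose that $X_{t_i}(y_k)$, $0\le i\le N$, $0\le k\le M$, is observed. Let $$D_{ik}=X_{t_{i+1}}(y_{k+1})-X_{t_{i+1}}(y_k)-X_{t_i}(y_{k+1})+X_{t_i}(y_k),$$ $$F(z,\Delta)=\sum_{\ell\ge1}\frac{1-e^{-\pi^2\vartheta_2\ell^2\Delta}}{\pi^2\vartheta_2\ell^2}\cos(\pi\ell z),\qquad \Phi(\delta,\Delta)=F(0,\Delta)(1+e^{-\kappa\delta})-2F(\delta,\Delta)e^{-\kappa\delta/2}.$$ With $\vartheta_2$ and $\kappa$ known, consider the volatility estimators $$\hat\sigma^2_{\mathrm{sp}}=\frac{2\vartheta_2}{NM\delta}\sum_{i=0}^{N-1}\sum_{k=0}^{M-1}e^{\kappa y_k}\big(X_{t_i}(y_{k+1})-X_{t_i}(y_k)\big)^2,$$ $$\hat\sigma^2_{\mathrm{t}}=\frac{\sqrt{\pi\vartheta_2}}{MN\sqrt\Delta}\sum_{i=0}^{N-1}\sum_{k=0}^{M-1}e^{\kappa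 y_k}\big(X_{t_{i+1}}(y_k)-X_{t_i}(y_k)\big)^2,$$ $$\hat\sigma^2=\frac1{MN\,\Phi(\delta,\Delta)}\sum_{k=0}^{M-1}\sum_{i=0}^{N-1}e^{\kappa y_k}D_{ik}^2 .$$ Put $B=2+\sum_{J\ge1}\big(2\sqrt J-\sqrt{J+1}-\sqrt{J-1}\big)^2$ and define $C:[0,\infty]\to\mathbb R$ by $C(0)=3$, $C(\infty)=3+\frac32\sum_{J\ge1}\big(\sqrt{J-1}+\sqrt{J+1}-2\sqrt J\big)^2$ and, for $h\in(0,\infty)$, $$C(h)=\frac{2}{\Lambda_{0,0}^2(h)}\sum_{j,l\in\mathbb Z}\Lambda_{j,l}^2(h),\qquad \Lambda_{j,l}(h)=(D_x^2D_y^2G_h)(|j|-1,|l|-1),$$ where $D_x^2f(x,y)=f(x+2,y)+f(x,y)-2f(x+1,y)$, $D_y^2f(x,y)=f(x,y+2)+f(x,y)-2f(x,y+1)$, $$G_h(j,l)=\sqrt{|j|}\,H\!\left(\frac{h|l|}{\sqrt{|j|}}\right)\mathbf 1_{\{j\neq0\}},\qquad H(x)=\frac1{2\sqrt\pi}\Big(e^{-x^2/4}-x\int_{x/2}^\infty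 e^{-z^2}\,dz\Big).$$ Let $N=N_n\to\infty$ and $M=M_n\to\infty$. Then the following hold. 1. If $N=o(M)$, then $\sqrt{MN}\,(\hat\sigma^2_{\mathrm{sp}}-\sigma^2)\xrightarrow{\mathcal D}\mathcal N(0,2\sigma^4)$. 2. If $b>0$ and $M=o(N^\rho)$ for some $\rho\in(0,1/2)$, then $\sqrt{MN}\,(\hat\sigma^2_{\mathrm t}-\sigma^2)\xrightarrow{\mathcal D}\mathcal N(0,B\sigma^4)$. 3. If $b>0$ and either $\sqrt N=o(M)$ (put $r=0$), or $M=o(\sqrt N)$ (put $r=\infty$), or $\sqrt N/M\equiv r_0$ for a constant $r_0>0$ (put $r=r_0\frac{1-2b}{\sqrt T}$), then $\sqrt{MN}\,(\hat\sigma^2-\sigma^2)\xrightarrow{\mathcal D}\mathcal N\big(0,C(r/\sqrt{\vartheta_2})\,\sigma^4\big)$. -/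

import Mathlib

open MeasureTheory ProbabilityTheory Filter Topology Asymptotics
open scoped NNReal ENNReal

namespace SPDEVolatility

noncomputable section

/-! ### The linear parabolic SPDE on the unit interval -/

/-- The parameters of the equation
`dX_t(x) = (θ₂ ∂²X_t(x) + θ₁ ∂X_t(x) + θ₀ X_t(x)) dt + σ dW_t(x)` on `[0,1]`
with Dirichlet boundary conditions. -/
structure Params where
  /-- the volatility -/
  σ : ℝ
  /-- the diffusivity -/
  θ₂ : ℝ
  /-- the coefficient of the first order term -/
  θ₁ : ℝ
  /-- the coefficient of the zero order term -/
  θ₀ : ℝ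

namespace Params

/-- `κ = θ₁ / θ₂`. -/
def κ (p : Params) : ℝ := p.θ₁ / p.θ₂

/-- `Γ = θ₁² / (4 θ₂²) - θ₀ / θ₂`. -/
def Γ (p : Params) : ℝ := p.θ₁ ^ 2 / (4 * p.θ₂ ^ 2) - p.θ₀ / p.θ₂

/-- The parameter space `Θ`: `σ² > 0`, `θ₂ > 0` and `Γ + π² > 0`. -/
structure Admissible (p : Params) : Prop where
  sq_pos : 0 < p.σ ^ 2
  diffusivity_pos : 0 < p.θ₂
  spectral_gap : 0 < p.Γ + Real.pi ^ 2

/-- `λ_ℓ = θ₂ (π² ℓ² + Γ)`, so that `-λ_ℓ`, `ℓ ≥ 1`, are the eigenvalues of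
`θ₂ ∂² + θ₁ ∂ + θ₀` with Dirichlet boundary conditions. -/
def eigenvalue (p : Params) (ℓ : ℕ) : ℝ := p.θ₂ * (Real.pi ^ 2 * (ℓ : ℝ) ^ 2 + p.Γ)

/-- The eigenfunctions `e_ℓ(y) = √2 sin(π ℓ y) exp(-κ y / 2)`, `ℓ ≥ 1`. -/
def eigenfunction (p : Params) (ℓ : ℕ) (y : ℝ) : ℝ :=
  √2 * Real.sin (Real.pi * ℓ * y) * Real.exp (-(p.κ * y / 2))

end Params

/-- `X = (X_t(x))`, `t ≥ 0`, `x ∈ [0,1]`, is the stationary solution of the SPDE with parameters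
`p`, given by its Fourier expansion `X_t(x) = ∑_{ℓ ≥ 1} u_ℓ(t) e_ℓ(x)` with Ornstein-Uhlenbeck
coefficient processes driven by the independent Brownian motions of a cylindrical Brownian motion.

The sequences `β` and `u` are indexed from `0`: `β ℓ` and `u ℓ` belong to the mode `ℓ + 1`. -/
structure IsStationarySolution {Ω : Type*} [MeasurableSpace Ω] (P : Measure Ω) (p : Params)
    (β : ℕ → ℝ≥0 → Ω → ℝ) (u : ℕ → ℝ → Ω → ℝ) (X : ℝ → ℝ → Ω → ℝ) : Prop where
  /-- each `β_ℓ` is a standard Brownian motion -/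
  brownian : ∀ ℓ, IsBrownianReal (β ℓ) P
  /-- `u_ℓ(0) ~ N(0, σ² / (2 λ_ℓ))` -/
  initial_law : ∀ ℓ,
    HasLaw (u ℓ 0) (gaussianReal 0 (p.σ ^ 2 / (2 * p.eigenvalue (ℓ + 1))).toNNReal) P
  /-- the pairs `(u_ℓ(0), β_ℓ)`, `ℓ ≥ 1`, are independent ... -/
  indep_modes : iIndepFun (fun ℓ ω => (u ℓ 0 ω, fun t : ℝ≥0 => β ℓ t ω)) P
  /-- ... and the two entries of each pair are independent, so that
  `{β_ℓ, u_ℓ(0) : ℓ ≥ 1}` is an independent family -/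
  indep_initial : ∀ ℓ, IndepFun (u ℓ 0) (fun ω => fun t : ℝ≥0 => β ℓ t ω) P
  /-- `u_ℓ` is the continuous solution of `du_ℓ(t) = -λ_ℓ u_ℓ(t) dt + σ dβ_ℓ(t)`; as the noise is
  additive, the equation is written in its integrated form -/
  ornstein_uhlenbeck : ∀ ℓ, ∀ᵐ ω ∂P,
    ContinuousOn (fun t => u ℓ t ω) (Set.Ici 0) ∧
    ∀ t : ℝ, 0 ≤ t →
      u ℓ t ω = u ℓ 0 ω - p.eigenvalue (ℓ + 1) * (∫ s in (0 : ℝ)..t, u ℓ s ω)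
        + p.σ * β ℓ t.toNNReal ω
  /-- `X_t(x) = ∑_{ℓ ≥ 1} u_ℓ(t) e_ℓ(x)` almost surely, for all `t ≥ 0` and `x ∈ [0,1]` -/
  expansion : ∀ t : ℝ, 0 ≤ t → ∀ x ∈ Set.Icc (0 : ℝ) 1, ∀ᵐ ω ∂P,
    Tendsto (fun n : ℕ => ∑ ℓ ∈ Finset.range n, u ℓ t ω * p.eigenfunction (ℓ + 1) x) atTop
      (𝓝 (X t x ω))

/-! ### Discrete observations -/

/-- The spatial mesh `δ = (1 - 2b) / M`. -/
def spaceMesh (b : ℝ) (M : ℕ) : ℝ := (1 - 2 * b) / M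

/-- The temporal mesh `Δ = T / N`. -/
def timeMesh (T : ℝ) (N : ℕ) : ℝ := T / N

/-- The spatial grid points `y_k = b + k δ`. -/
def gridPoint (b : ℝ) (M k : ℕ) : ℝ := b + k * spaceMesh b M

/-- The observations `X_{t_i}(y_k)`, `0 ≤ i ≤ N`, `0 ≤ k ≤ M`, with `t_i = i Δ`. -/
def observe {Ω : Type*} (X : ℝ → ℝ → Ω → ℝ) (T b : ℝ) (N M : ℕ) (ω : Ω) (i k : ℕ) : ℝ :=
  X (i * timeMesh T N) (gridPoint b M k) ω

/-! ### The realized quadratic variations and the volatility estimators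

All statistics are functions of the observations `Z i k = X_{t_i}(y_k)`, of the design `(T, b, N, M)`
and of the known parameters `θ₂` and `κ`. -/

/-- The rescaled realized spatial quadratic variation
`V_sp = (N M δ)⁻¹ ∑_i ∑_k exp(κ y_k) (X_{t_i}(y_{k+1}) - X_{t_i}(y_k))²`. -/
def spatialVariation (κ b : ℝ) (N M : ℕ) (Z : ℕ → ℕ → ℝ) : ℝ :=
  1 / (N * M * spaceMesh b M) *
    ∑ i ∈ Finset.range N, ∑ k ∈ Finset.range M,
      Real.exp (κ * gridPoint b M k) * (Z i (k + 1) - Z i k) ^ 2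

/-- The rescaled realized temporal quadratic variation
`V_t = (M N √Δ)⁻¹ ∑_i ∑_k exp(κ y_k) (X_{t_{i+1}}(y_k) - X_{t_i}(y_k))²`. -/
def temporalVariation (κ T b : ℝ) (N M : ℕ) (Z : ℕ → ℕ → ℝ) : ℝ :=
  1 / (M * N * √(timeMesh T N)) *
    ∑ i ∈ Finset.range N, ∑ k ∈ Finset.range M,
      Real.exp (κ * gridPoint b M k) * (Z (i + 1) k - Z i k) ^ 2

/-- The double increments
`D_{ik} = X_{t_{i+1}}(y_{k+1}) - X_{t_{i+1}}(y_k) - X_{t_i}(y_{k+1}) + X_{t_i}(y_k)`. -/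
def doubleIncrement (Z : ℕ → ℕ → ℝ) (i k : ℕ) : ℝ :=
  Z (i + 1) (k + 1) - Z (i + 1) k - Z i (k + 1) + Z i k

/-- `F(δ, Δ) = ∑_{ℓ ≥ 1} (1 - exp(-π² θ₂ ℓ² Δ)) / (π² θ₂ ℓ²) cos(π ℓ δ)`. -/
def doubleF (θ₂ δ Δ : ℝ) : ℝ :=
  ∑' ℓ : ℕ, (1 - Real.exp (-(Real.pi ^ 2 * θ₂ * ((ℓ : ℝ) + 1) ^ 2 * Δ))) /
    (Real.pi ^ 2 * θ₂ * ((ℓ : ℝ) + 1) ^ 2) * Real.cos (Real.pi * ((ℓ : ℝ) + 1) * δ)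

/-- The normalization `Φ(δ, Δ) = F(0, Δ) (1 + exp(-κ δ)) - 2 F(δ, Δ) exp(-κ δ / 2)`. -/
def doubleΦ (θ₂ κ δ Δ : ℝ) : ℝ :=
  doubleF θ₂ 0 Δ * (1 + Real.exp (-(κ * δ))) - 2 * doubleF θ₂ δ Δ * Real.exp (-(κ * δ / 2))

/-- The rescaled realized space-time quadratic variation
`(M N Φ(δ, Δ))⁻¹ ∑_k ∑_i exp(κ y_k) D_{ik}²`. -/
def doubleVariation (θ₂ κ T b : ℝ) (N M : ℕ) (Z : ℕ → ℕ → ℝ) : ℝ :=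
  1 / (M * N * doubleΦ θ₂ κ (spaceMesh b M) (timeMesh T N)) *
    ∑ k ∈ Finset.range M, ∑ i ∈ Finset.range N,
      Real.exp (κ * gridPoint b M k) * doubleIncrement Z i k ^ 2

/-- The estimator of `σ²` based on spatial increments, `2 θ₂ V_sp`. -/
def sigmaSqSpatial (θ₂ κ b : ℝ) (N M : ℕ) (Z : ℕ → ℕ → ℝ) : ℝ :=
  2 * θ₂ * spatialVariation κ b N M Z

/-- The estimator of `σ²` based on temporal increments, `√(π θ₂) V_t`. -/
def sigmaSqTemporal (θ₂ κ T b : ℝ) (N M : ℕ) (Z : ℕ → ℕ → ℝ) : ℝ :=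
  √(Real.pi * θ₂) * temporalVariation κ T b N M Z

/-- The estimator of `σ²` based on double increments. -/
def sigmaSqDouble (θ₂ κ T b : ℝ) (N M : ℕ) (Z : ℕ → ℕ → ℝ) : ℝ :=
  doubleVariation θ₂ κ T b N M Z

/-! ### The constants in the asymptotic variances -/

/-- `B = 2 + ∑_{J ≥ 1} (2√J - √(J+1) - √(J-1))²`. -/
def constB : ℝ :=
  2 + ∑' J : ℕ, (2 * √((J : ℝ) + 1) - √((J : ℝ) + 2) - √(J : ℝ)) ^ 2

/-- `H(x) = (2√π)⁻¹ (exp(-x²/4) - x ∫_{x/2}^∞ exp(-z²) dz)`. -/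
def auxH (x : ℝ) : ℝ :=
  1 / (2 * √Real.pi) *
    (Real.exp (-(x ^ 2 / 4)) - x * ∫ z in Set.Ioi (x / 2), Real.exp (-z ^ 2))

/-- `G_h(j, l) = √|j| H(h |l| / √|j|)` for `j ≠ 0`, and `G_h(0, l) = 0`. -/
def auxG (h : ℝ) (j l : ℤ) : ℝ :=
  if j = 0 then 0 else √|(j : ℝ)| * auxH (h * |(l : ℝ)| / √|(j : ℝ)|)

/-- The second order difference in the first variable, `f(x+2, y) + f(x, y) - 2 f(x+1, y)`. -/
def diffX (f : ℤ → ℤ → ℝ) (x y : ℤ) : ℝ := f (x + 2) y + f x y - 2 * f (x + 1) y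

/-- The second order difference in the second variable, `f(x, y+2) + f(x, y) - 2 f(x, y+1)`. -/
def diffY (f : ℤ → ℤ → ℝ) (x y : ℤ) : ℝ := f x (y + 2) + f x y - 2 * f x (y + 1)

/-- `Λ_{j,l}(h) = (D²_x D²_y G_h)(|j| - 1, |l| - 1)`. -/
def auxΛ (h : ℝ) (j l : ℤ) : ℝ := diffX (diffY (auxG h)) (|j| - 1) (|l| - 1)

/-- The function `C` on `[0, ∞]`: for `h ∈ (0, ∞)` it is
`C(h) = 2 Λ_{0,0}(h)⁻² ∑_{j,l ∈ ℤ} Λ_{j,l}(h)²`, and at the end points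
`C(0) = 3`, `C(∞) = 3 + (3/2) ∑_{J ≥ 1} (√(J-1) + √(J+1) - 2√J)²`. -/
def constC (h : ℝ≥0∞) : ℝ :=
  if h = 0 then 3
  else if h = ⊤ then
    3 + 3 / 2 * ∑' J : ℕ, (√(J : ℝ) + √((J : ℝ) + 2) - 2 * √((J : ℝ) + 1)) ^ 2
  else 2 / auxΛ h.toReal 0 0 ^ 2 * ∑' q : ℤ × ℤ, auxΛ h.toReal q.1 q.2 ^ 2

/-! ### The central limit statement -/

/-- `√(M_n N_n) (S_n - σ²)` converges in distribution to `N(0, v)`. -/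
def CLT {Ω : Type*} [MeasurableSpace Ω] (P : Measure Ω) [IsProbabilityMeasure P]
    (N M : ℕ → ℕ) (S : ℕ → Ω → ℝ) (target v : ℝ) : Prop :=
  TendstoInDistribution (fun (n : ℕ) (ω : Ω) => √((M n : ℝ) * (N n : ℝ)) * (S n ω - target))
    atTop (id : ℝ → ℝ) (fun _ => P) (gaussianReal 0 v.toNNReal)

end

end SPDEVolatility

namespace SPDEVolatility

/-! ### Central limit theorem for quadratic forms of Gaussian vectors -/

theorem integral_cexp_sq_gaussianReal (s : ℝ) :
    ∫ z, Complex.exp (Complex.I * (s * z ^ 2 : ℝ)) ∂gaussianReal 0 1 =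
      Complex.exp (-(1 / 2) * Complex.log (1 - 2 * Complex.I * s)) := by
  rw [integral_gaussianReal_eq_integral_smul (by norm_num)]
  set b : ℂ := 1 / 2 - Complex.I * s with hb
  have hbre : 0 < b.re := by simp [hb]
  have hb0 : b ≠ 0 := fun h => by simp [h] at hbre
  have h1 : ∀ z : ℝ, gaussianPDFReal 0 1 z • Complex.exp (Complex.I * (s * z ^ 2 : ℝ)) =
      ((√(2 * Real.pi))⁻¹ : ℂ) * Complex.exp (-b * (z : ℂ) ^ 2) := by
    intro z
    simp only [gaussianPDFReal, sub_zero, NNReal.coe_one, mul_one, Complex.real_smul]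
    push_cast
    rw [mul_assoc, ← Complex.exp_add, hb]
    congr 2
    ring
  simp_rw [h1]
  rw [integral_const_mul, integral_gaussian_complex hbre]
  have h2 : (Real.pi : ℂ) / b = ((2 * Real.pi : ℝ) : ℂ) * (1 - 2 * Complex.I * s)⁻¹ := by
    have : (1 - 2 * Complex.I * s : ℂ) = 2 * b := by rw [hb]; ring
    rw [this]
    push_cast
    field_simp
  have h3 : (1 - 2 * Complex.I * s : ℂ) ≠ 0 := by
    intro h
    have := congrArg Complex.re h
    simp at this
  have harg : (1 - 2 * Complex.I * s : ℂ).arg ≠ Real.pi := by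
    intro h
    rw [Complex.arg_eq_pi_iff] at h
    simp at h
    linarith [h.1]
  have hpi : (0 : ℝ) < 2 * Real.pi := by positivity
  rw [h2, Complex.cpow_def_of_ne_zero
    (mul_ne_zero (by exact_mod_cast hpi.ne') (inv_ne_zero h3)),
    Complex.log_ofReal_mul hpi (inv_ne_zero h3), Complex.log_inv _ harg, add_mul, Complex.exp_add,
    ← mul_assoc]
  have h4 : Complex.exp ((Real.log (2 * Real.pi) : ℂ) * (1 / 2)) = (√(2 * Real.pi) : ℂ) := by
    rw [Real.sqrt_eq_rpow, Real.rpow_def_of_pos hpi]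
    push_cast
    rfl
  rw [h4, inv_mul_cancel₀ (by exact_mod_cast (Real.sqrt_pos.2 hpi).ne'), one_mul]
  congr 1
  ring

section Spectral

variable {ι : Type*} [Fintype ι] [DecidableEq ι] {B : Matrix ι ι ℝ}

theorem apply_eq_sum_eigenvalues (hB : B.IsHermitian) (i j : ι) :
    B i j = ∑ a, hB.eigenvalues a * hB.eigenvectorBasis a i * hB.eigenvectorBasis a j := by
  conv_lhs => rw [hB.spectral_theorem]
  rw [Unitary.conjStarAlgAut_apply, Matrix.mul_apply]
  refine Finset.sum_congr rfl fun a _ => ?_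
  rw [Matrix.mul_diagonal, Matrix.star_apply]
  simp only [Matrix.IsHermitian.eigenvectorUnitary_apply, star_trivial, Function.comp_apply,
    RCLike.ofReal_real_eq_id, id]
  ring

theorem sum_eigenvectorBasis_mul (hB : B.IsHermitian) (a b : ι) :
    ∑ i, hB.eigenvectorBasis a i * hB.eigenvectorBasis b i = if a = b then 1 else 0 := by
  have := orthonormal_iff_ite.1 hB.eigenvectorBasis.orthonormal a b
  rw [← this, PiLp.inner_apply]
  simp [mul_comm]

theorem quadratic_eq_sum_eigenvalues (hB : B.IsHermitian) (c : ι → ℝ) :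
    ∑ i, ∑ j, c i * c j * B i j =
      ∑ a, hB.eigenvalues a * (∑ i, c i * hB.eigenvectorBasis a i) ^ 2 := by
  simp_rw [apply_eq_sum_eigenvalues hB, Finset.mul_sum]
  rw [Finset.sum_congr rfl fun i _ => Finset.sum_comm, Finset.sum_comm]
  refine Finset.sum_congr rfl fun a _ => ?_
  rw [sq, Finset.sum_mul_sum, Finset.mul_sum]
  refine Finset.sum_congr rfl fun i _ => ?_
  rw [Finset.mul_sum]
  exact Finset.sum_congr rfl fun j _ => by ring

theorem sum_sq_eq_sum_eigenvalues_sq (hB : B.IsHermitian) :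
    ∑ i, ∑ j, B i j ^ 2 = ∑ a, hB.eigenvalues a ^ 2 := by
  have h1 : ∀ a, ∑ i, ∑ j, hB.eigenvectorBasis a i * hB.eigenvectorBasis a j * B i j =
      hB.eigenvalues a := by
    intro a
    rw [quadratic_eq_sum_eigenvalues hB]
    simp [sum_eigenvectorBasis_mul hB]
  calc ∑ i, ∑ j, B i j ^ 2
      = ∑ i, ∑ j, ∑ a, hB.eigenvalues a *
          (hB.eigenvectorBasis a i * hB.eigenvectorBasis a j * B i j) := by
        refine Finset.sum_congr rfl fun i _ => Finset.sum_congr rfl fun j _ => ?_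
        rw [sq]
        nth_rewrite 1 [apply_eq_sum_eigenvalues hB i j]
        rw [Finset.sum_mul]
        exact Finset.sum_congr rfl fun a _ => by ring
    _ = ∑ a, hB.eigenvalues a ^ 2 := by
        rw [Finset.sum_congr rfl fun i _ => Finset.sum_comm, Finset.sum_comm]
        refine Finset.sum_congr rfl fun a _ => ?_
        simp_rw [← Finset.mul_sum]
        rw [h1, sq]

theorem sum_diag_eq_sum_eigenvalues (hB : B.IsHermitian) :
    ∑ i, B i i = ∑ a, hB.eigenvalues a := by
  simpa [Matrix.trace] using hB.trace_eq_sum_eigenvalues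

theorem abs_eigenvalues_le_of_row_sum (hB : B.IsHermitian) {ε : ℝ}
    (hε : ∀ i, ∑ j, |B i j| ≤ ε) (a : ι) : |hB.eigenvalues a| ≤ ε := by
  obtain ⟨i, -, hi⟩ := Finset.exists_max_image Finset.univ
    (fun i => |hB.eigenvectorBasis a i|) ⟨a, Finset.mem_univ a⟩
  have hpos : 0 < |hB.eigenvectorBasis a i| := by
    rw [abs_pos]
    intro h0
    have h := sum_eigenvectorBasis_mul hB a a
    rw [Finset.sum_eq_zero] at h
    · simp at h
    · intro j _
      have := hi j (Finset.mem_univ j)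
      rw [h0, abs_zero] at this
      simp [abs_nonpos_iff.1 this]
  have h1 := congrFun (hB.mulVec_eigenvectorBasis a) i
  rw [Matrix.mulVec, dotProduct, Pi.smul_apply, smul_eq_mul] at h1
  have h2 : |hB.eigenvalues a| * |hB.eigenvectorBasis a i| ≤ ε * |hB.eigenvectorBasis a i| := by
    rw [← abs_mul, ← h1]
    refine (Finset.abs_sum_le_sum_abs _ _).trans ?_
    refine le_trans (Finset.sum_le_sum fun j _ => ?_)
      ((Finset.sum_mul _ _ _).symm.le.trans (mul_le_mul_of_nonneg_right (hε i) hpos.le))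
    rw [abs_mul]
    exact mul_le_mul_of_nonneg_left (hi j (Finset.mem_univ j)) (abs_nonneg _)
  exact le_of_mul_le_mul_right h2 hpos

end Spectral

section CharFun

variable {Ω : Type*} [MeasurableSpace Ω] {P : Measure Ω} [IsProbabilityMeasure P]

/-- `Y` is a centered Gaussian vector with covariance matrix `B`. -/
structure IsCenteredGaussian {ι : Type*} [Fintype ι] (P : Measure Ω) (Y : ι → Ω → ℝ)
    (B : ι → ι → ℝ) : Prop where
  aemeasurable : ∀ a, AEMeasurable (Y a) P
  symm : ∀ a b, B a b = B b a
  charFun_eq : ∀ c : ι → ℝ, ∫ ω, Complex.exp ((∑ a, c a * Y a ω : ℝ) * Complex.I) ∂P =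
    Complex.exp (-(1 / 2) * (∑ a, ∑ b, c a * c b * B a b : ℝ))

variable {ι : Type*} [Fintype ι] {Y : ι → Ω → ℝ} {B : ι → ι → ℝ}

theorem IsCenteredGaussian.quadratic_nonneg (h : IsCenteredGaussian P Y B) (c : ι → ℝ) :
    0 ≤ ∑ a, ∑ b, c a * c b * B a b := by
  have h1 : ‖∫ ω, Complex.exp ((∑ a, c a * Y a ω : ℝ) * Complex.I) ∂P‖ ≤ 1 := by
    refine (norm_integral_le_integral_norm _).trans ?_
    simp only [Complex.norm_exp_ofReal_mul_I]
    simp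
  rw [h.charFun_eq c, Complex.norm_exp] at h1
  have h2 := Real.exp_le_one_iff.1 h1
  have h3 : (-(1 / 2) * ((∑ a, ∑ b, c a * c b * B a b : ℝ) : ℂ)).re =
      -(1 / 2) * ∑ a, ∑ b, c a * c b * B a b := by
    rw [show (-(1 / 2) : ℂ) = ((-(1 / 2) : ℝ) : ℂ) by push_cast; ring, ← Complex.ofReal_mul,
      Complex.ofReal_re]
  rw [h3] at h2
  linarith

variable [DecidableEq ι]

theorem IsCenteredGaussian.integral_cexp_sum_sq (h : IsCenteredGaussian P Y B)
    (hB : (Matrix.of B).IsHermitian) (t : ℝ) :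
    ∫ ω, Complex.exp ((t * ∑ a, Y a ω ^ 2 : ℝ) * Complex.I) ∂P =
      ∏ a, Complex.exp (-(1 / 2) * Complex.log (1 - 2 * Complex.I * (t * hB.eigenvalues a : ℝ))) := by
  have hnn : ∀ a, 0 ≤ hB.eigenvalues a := by
    intro a
    have h1 := h.quadratic_nonneg (fun i => hB.eigenvectorBasis a i)
    have h2 := quadratic_eq_sum_eigenvalues hB (fun i => hB.eigenvectorBasis a i)
    simp only [Matrix.of_apply, sum_eigenvectorBasis_mul hB] at h2
    rw [h2] at h1
    simpa using h1
  let f : (ι → ℝ) → EuclideanSpace ℝ ι :=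
    fun z => ∑ a, (√(hB.eigenvalues a) * z a) • hB.eigenvectorBasis a
  have hf : Measurable f := by fun_prop
  have hY : AEMeasurable (fun ω => WithLp.toLp 2 (fun a => Y a ω)) P :=
    (WithLp.measurable_toLp 2 _).comp_aemeasurable (aemeasurable_pi_lambda _ h.aemeasurable)
  have hlaw : P.map (fun ω => WithLp.toLp 2 (fun a => Y a ω)) =
      (Measure.pi fun _ : ι => gaussianReal 0 1).map f := by
    have := Measure.isProbabilityMeasure_map (μ := P) hY
    have := Measure.isProbabilityMeasure_map (μ := Measure.pi fun _ : ι => gaussianReal 0 1)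
      hf.aemeasurable
    refine Measure.ext_of_charFun (funext fun x => ?_)
    rw [charFun_apply, charFun_apply, integral_map hY (by fun_prop),
      integral_map hf.aemeasurable (by fun_prop)]
    have hin : ∀ ω, inner ℝ (WithLp.toLp 2 (fun a => Y a ω)) x = ∑ a, x a * Y a ω := by
      intro ω
      rw [PiLp.inner_apply]
      simp
    have hin2 : ∀ z : ι → ℝ, inner ℝ (f z) x =
        ∑ a, √(hB.eigenvalues a) * (∑ i, x i * hB.eigenvectorBasis a i) * z a := by
      intro z
      simp only [f, sum_inner, real_inner_smul_left]
      refine Finset.sum_congr rfl fun a _ => ?_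
      rw [PiLp.inner_apply]
      simp
      ring
    simp_rw [hin, hin2]
    rw [h.charFun_eq]
    simp_rw [Complex.ofReal_sum, Finset.sum_mul, Complex.exp_sum]
    rw [integral_fintype_prod_eq_prod (f := fun a (z : ℝ) =>
      Complex.exp (((√(hB.eigenvalues a) * (∑ i, x i * hB.eigenvectorBasis a i) * z : ℝ) : ℂ)
        * Complex.I))]
    have hc : ∀ s : ℝ, ∫ z, Complex.exp (((s * z : ℝ) : ℂ) * Complex.I) ∂gaussianReal 0 1 =
        Complex.exp (-(1 / 2) * (s ^ 2 : ℝ)) := by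
      intro s
      have := charFun_gaussianReal (μ := 0) (v := 1) s
      rw [charFun_apply_real] at this
      push_cast at this ⊢
      rw [this]
      congr 1
      simp
      ring
    simp_rw [hc]
    rw [← Complex.exp_sum, ← Finset.mul_sum]
    congr 2
    norm_cast
    have h2 := quadratic_eq_sum_eigenvalues hB (fun i => x i)
    simp only [Matrix.of_apply] at h2
    rw [h2]
    refine Finset.sum_congr rfl fun a _ => ?_
    rw [mul_pow, Real.sq_sqrt (hnn a)]
  have hn : ∀ z, ‖f z‖ ^ 2 = ∑ a, hB.eigenvalues a * z a ^ 2 := by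
    intro z
    rw [← real_inner_self_eq_norm_sq, hB.eigenvectorBasis.orthonormal.inner_sum]
    refine Finset.sum_congr rfl fun a _ => ?_
    simp only [conj_trivial]
    rw [← sq, mul_pow, Real.sq_sqrt (hnn a)]
  have h1 : ∫ ω, Complex.exp ((t * ∑ a, Y a ω ^ 2 : ℝ) * Complex.I) ∂P =
      ∫ x, Complex.exp ((t * ‖x‖ ^ 2 : ℝ) * Complex.I)
        ∂(P.map (fun ω => WithLp.toLp 2 (fun a => Y a ω))) := by
    rw [integral_map hY (by fun_prop)]
    simp [EuclideanSpace.norm_sq_eq]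
  rw [h1, hlaw, integral_map hf.aemeasurable (by fun_prop)]
  simp_rw [hn, Finset.mul_sum, Complex.ofReal_sum, Finset.sum_mul, Complex.exp_sum]
  rw [integral_fintype_prod_eq_prod (f := fun a (z : ℝ) =>
      Complex.exp (((t * (hB.eigenvalues a * z ^ 2) : ℝ) : ℂ) * Complex.I))]
  refine Finset.prod_congr rfl fun a _ => ?_
  rw [← integral_cexp_sq_gaussianReal]
  refine integral_congr_ae (.of_forall fun z => ?_)
  simp only
  rw [mul_comm, mul_assoc]

end CharFun

theorem norm_log_one_sub_add_le {z : ℂ} (hz : ‖z‖ ≤ 1 / 2) :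
    ‖Complex.log (1 - z) + z + z ^ 2 / 2‖ ≤ ‖z‖ ^ 3 := by
  have h := Complex.norm_log_sub_logTaylor_le 2 (z := -z) (by rw [norm_neg]; linarith)
  have h1 : Complex.log (1 + -z) - Complex.logTaylor (2 + 1) (-z) =
      Complex.log (1 - z) + z + z ^ 2 / 2 := by
    simp [Complex.logTaylor, Finset.sum_range_succ, sub_eq_add_neg]
    ring
  rw [h1, norm_neg] at h
  refine h.trans ?_
  have h2 : (1 - ‖z‖)⁻¹ ≤ 2 := by
    rw [inv_le_comm₀ (by linarith) (by norm_num)]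
    linarith
  have h3 : 0 ≤ ‖z‖ ^ 3 := by positivity
  have h4 := mul_le_mul_of_nonneg_left h2 h3
  norm_num at h4 ⊢
  linarith

/-- A quadratic form in Gaussian variables is asymptotically normal as soon as the largest
absolute row sum of the covariance matrix is negligible. -/
theorem tendstoInDistribution_sum_sq {Ω : Type*} [MeasurableSpace Ω] {P : Measure Ω}
    [IsProbabilityMeasure P] {ι : ℕ → Type*} [∀ n, Fintype (ι n)]
    {Y : ∀ n, ι n → Ω → ℝ} {B : ∀ n, ι n → ι n → ℝ}
    (hG : ∀ n, IsCenteredGaussian P (Y n) (B n)) {τ : ℕ → ℝ} {v : ℝ}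
    (hτ : Tendsto (fun n => ∑ a, B n a a - τ n) atTop (𝓝 0))
    (hv : Tendsto (fun n => 2 * ∑ a, ∑ b, B n a b ^ 2) atTop (𝓝 v))
    {ε : ℕ → ℝ} (hε : Tendsto ε atTop (𝓝 0)) (hrow : ∀ᶠ n in atTop, ∀ a, ∑ b, |B n a b| ≤ ε n) :
    TendstoInDistribution (fun n ω => ∑ a, Y n a ω ^ 2 - τ n) atTop (id : ℝ → ℝ)
      (fun _ => P) (gaussianReal 0 v.toNNReal) where
  forall_aemeasurable n :=
    (Finset.aemeasurable_fun_sum _ fun a _ => ((hG n).aemeasurable a).pow_const 2).sub_const _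
  tendsto := by
    classical
    have hv0 : 0 ≤ v := ge_of_tendsto' hv fun n => by positivity
    refine ProbabilityMeasure.tendsto_iff_tendsto_charFun.2 fun t => ?_
    have hB : ∀ n, (Matrix.of (B n)).IsHermitian := fun n => by
      ext a b
      simp [(hG n).symm a b]
    set μ : ∀ n, ι n → ℝ := fun n => (hB n).eigenvalues with hμ
    have htr : ∀ n, ∑ a, B n a a = ∑ a, μ n a := fun n => sum_diag_eq_sum_eigenvalues (hB n)
    have hsq : ∀ n, ∑ a, ∑ b, B n a b ^ 2 = ∑ a, μ n a ^ 2 :=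
      fun n => sum_sq_eq_sum_eigenvalues_sq (hB n)
    have hcf : ∀ n, charFun (P.map (fun ω => ∑ a, Y n a ω ^ 2 - τ n)) t =
        Complex.exp (-(t * τ n : ℝ) * Complex.I +
          ∑ a, -(1 / 2) * Complex.log (1 - 2 * Complex.I * (t * μ n a : ℝ))) := by
      intro n
      have hm : AEMeasurable (fun ω => ∑ a, Y n a ω ^ 2 - τ n) P :=
        (Finset.aemeasurable_fun_sum _ fun a _ => ((hG n).aemeasurable a).pow_const 2).sub_const _
      rw [charFun_apply_real, integral_map hm (by fun_prop), Complex.exp_add, Complex.exp_sum,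
        ← (hG n).integral_cexp_sum_sq (hB n) t, ← integral_const_mul]
      refine integral_congr_ae (.of_forall fun ω => ?_)
      simp only
      rw [← Complex.exp_add]
      congr 1
      push_cast
      ring
    have hlim : Tendsto (fun n => -((t * τ n : ℝ) : ℂ) * Complex.I +
          ∑ a, -(1 / 2) * Complex.log (1 - 2 * Complex.I * (t * μ n a : ℝ))) atTop
        (𝓝 (-(v * t ^ 2 / 2 : ℝ))) := by
      have hmain : Tendsto (fun n => ((t * (∑ a, B n a a - τ n) : ℝ) : ℂ) * Complex.I -
          ((t ^ 2 / 2 * (2 * ∑ a, ∑ b, B n a b ^ 2) : ℝ) : ℂ)) atTop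
          (𝓝 (-(v * t ^ 2 / 2 : ℝ))) := by
        have h1 : Tendsto (fun n => ((t * (∑ a, B n a a - τ n) : ℝ) : ℂ) * Complex.I) atTop
            (𝓝 (((t * 0 : ℝ) : ℂ) * Complex.I)) :=
          ((Complex.continuous_ofReal.tendsto _).comp (hτ.const_mul t)).mul_const Complex.I
        have h2 : Tendsto (fun n => ((t ^ 2 / 2 * (2 * ∑ a, ∑ b, B n a b ^ 2) : ℝ) : ℂ)) atTop
            (𝓝 ((t ^ 2 / 2 * v : ℝ) : ℂ)) :=
          (Complex.continuous_ofReal.tendsto _).comp (hv.const_mul (t ^ 2 / 2))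
        have h3 := h1.sub h2
        have h4 : ((t * 0 : ℝ) : ℂ) * Complex.I - ((t ^ 2 / 2 * v : ℝ) : ℂ) =
            -((v * t ^ 2 / 2 : ℝ) : ℂ) := by
          push_cast
          ring
        rwa [h4] at h3
      have herr : Tendsto (fun n => 2 * |t| ^ 3 * ε n * (2 * ∑ a, ∑ b, B n a b ^ 2)) atTop (𝓝 0) := by
        simpa using (hε.const_mul (2 * |t| ^ 3)).mul hv
      have hsmall : ∀ᶠ n in atTop, 2 * |t| * ε n ≤ 1 / 2 := by
        have := hε.const_mul (2 * |t|)
        rw [mul_zero] at this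
        exact this.eventually_le_const (by norm_num)
      refine hmain.congr_dist (squeeze_zero' (.of_forall fun n => dist_nonneg) ?_ herr)
      filter_upwards [hsmall, hrow] with n hn hr
      have hle : ∀ a, |μ n a| ≤ ε n := abs_eigenvalues_le_of_row_sum (hB n) hr
      rw [dist_comm, dist_eq_norm]
      have heq : -((t * τ n : ℝ) : ℂ) * Complex.I +
          ∑ a, -(1 / 2) * Complex.log (1 - 2 * Complex.I * (t * μ n a : ℝ)) -
          (((t * (∑ a, B n a a - τ n) : ℝ) : ℂ) * Complex.I -
          ((t ^ 2 / 2 * (2 * ∑ a, ∑ b, B n a b ^ 2) : ℝ) : ℂ)) =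
          ∑ a, -(1 / 2) * (Complex.log (1 - 2 * Complex.I * (t * μ n a : ℝ)) +
            2 * Complex.I * (t * μ n a : ℝ) + (2 * Complex.I * (t * μ n a : ℝ)) ^ 2 / 2) := by
        rw [htr, hsq]
        have h3 : ∀ a, -(1 / 2) * (Complex.log (1 - 2 * Complex.I * (t * μ n a : ℝ)) +
            2 * Complex.I * (t * μ n a : ℝ) + (2 * Complex.I * (t * μ n a : ℝ)) ^ 2 / 2) =
            -(1 / 2) * Complex.log (1 - 2 * Complex.I * (t * μ n a : ℝ)) -
              Complex.I * t * (μ n a : ℂ) + (t : ℂ) ^ 2 * (μ n a : ℂ) ^ 2 := by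
          intro a
          push_cast
          ring_nf
          simp only [Complex.I_sq]
          ring
        simp_rw [h3]
        rw [Finset.sum_add_distrib, Finset.sum_sub_distrib, ← Finset.mul_sum, ← Finset.mul_sum,
          ← Finset.mul_sum]
        push_cast
        ring
      rw [heq, hsq]
      refine (norm_sum_le _ _).trans ?_
      rw [Finset.mul_sum, Finset.mul_sum]
      refine Finset.sum_le_sum fun a _ => ?_
      have hz : ‖2 * Complex.I * (t * μ n a : ℝ)‖ = 2 * (|t| * |μ n a|) := by
        rw [norm_mul, Complex.norm_real]
        simp
      have hε0 : 0 ≤ ε n := (abs_nonneg _).trans (hle a)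
      have h5 : |t| * |μ n a| ≤ |t| * ε n := mul_le_mul_of_nonneg_left (hle a) (abs_nonneg t)
      have h4 := norm_log_one_sub_add_le (z := 2 * Complex.I * (t * μ n a : ℝ)) (by
        rw [hz]; linarith)
      rw [norm_mul]
      have h6 : ‖(-(1 / 2) : ℂ)‖ = 1 / 2 := by simp
      rw [h6]
      rw [hz] at h4
      have h7 : (2 * (|t| * |μ n a|)) ^ 3 = 8 * |t| ^ 3 * (|μ n a| * μ n a ^ 2) := by
        rw [← sq_abs (μ n a)]; ring
      have h8 : |μ n a| * μ n a ^ 2 ≤ ε n * μ n a ^ 2 :=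
        mul_le_mul_of_nonneg_right (hle a) (sq_nonneg _)
      have h9 : 0 ≤ |t| ^ 3 := by positivity
      have h10 := mul_le_mul_of_nonneg_left h8 h9
      rw [h7] at h4
      nlinarith
    have hexp : Tendsto (fun n => Complex.exp (-((t * τ n : ℝ) : ℂ) * Complex.I +
          ∑ a, -(1 / 2) * Complex.log (1 - 2 * Complex.I * (t * μ n a : ℝ)))) atTop
        (𝓝 (Complex.exp (-(v * t ^ 2 / 2 : ℝ)))) :=
      (Complex.continuous_exp.tendsto _).comp hlim
    refine Tendsto.congr' (.of_forall fun n => (hcf n).symm) ?_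
    have hgauss : charFun ((gaussianReal 0 v.toNNReal).map id) t =
        Complex.exp (-(v * t ^ 2 / 2 : ℝ)) := by
      rw [Measure.map_id, charFun_gaussianReal]
      congr 1
      rw [Real.coe_toNNReal _ hv0]
      push_cast
      ring
    exact hgauss.symm ▸ hexp

/-! ### Gaussianity of the observations -/

section Pathwise

/-- The stochastic convolution along a path, discretised with `m` steps per unit of length `Δ`. -/
noncomputable def convolutionSum (lam σ Δ u₀ : ℝ) (b : ℝ≥0 → ℝ) (i m : ℕ) : ℝ :=
  Real.exp (-lam * (i * Δ)) * u₀ + σ * ∑ j ∈ Finset.range (i * m),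
    Real.exp (-lam * (i * Δ - j * (Δ / m))) *
      (b (((j + 1 : ℕ) : ℝ) * (Δ / m)).toNNReal - b ((j : ℝ) * (Δ / m)).toNNReal)

theorem tendsto_convolutionSum {lam σ Δ : ℝ} (hΔ : 0 < Δ) {u : ℝ → ℝ} {b : ℝ≥0 → ℝ}
    (hu : ContinuousOn u (Set.Ici 0))
    (hub : ∀ t : ℝ, 0 ≤ t → u t = u 0 - lam * (∫ s in (0 : ℝ)..t, u s) + σ * b t.toNNReal)
    (i : ℕ) :
    Tendsto (convolutionSum lam σ Δ (u 0) b i) atTop (𝓝 (u (i * Δ))) := by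
  set t : ℝ := i * Δ with ht
  have ht0 : 0 ≤ t := by positivity
  set E : ℝ → ℝ := fun s => Real.exp (-lam * (t - s)) with hE
  have hEc : Continuous E := by fun_prop
  have hcomp : IsCompact (Set.Icc (0 : ℝ) t ×ˢ Set.Icc (0 : ℝ) t) := isCompact_Icc.prod isCompact_Icc
  have hcont : ContinuousOn (fun x : ℝ × ℝ => E x.1 * u x.2)
      (Set.Icc (0 : ℝ) t ×ˢ Set.Icc (0 : ℝ) t) :=
    (hEc.comp_continuousOn continuousOn_fst).mul
      (hu.comp continuousOn_snd fun x hx => hx.2.1)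
  have huc := hcomp.uniformContinuousOn_of_continuous hcont
  rw [Metric.uniformContinuousOn_iff] at huc
  have h_int : ∀ c d : ℝ, 0 ≤ c → 0 ≤ d → IntervalIntegrable u volume c d := fun c d hc hd =>
    (hu.mono fun x hx => (le_min hc hd).trans hx.1).intervalIntegrable
  rw [Metric.tendsto_atTop]
  intro ε hε
  obtain ⟨r, hr, hru⟩ := huc (ε / (|lam| * t + 1)) (by positivity)
  obtain ⟨m₀, hm₀⟩ := exists_nat_gt (Δ / r)
  refine ⟨m₀ + 1, fun m hm => ?_⟩
  have hmpos : (0 : ℝ) < m := by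
    have : 0 < m := by omega
    exact_mod_cast this
  set h : ℝ := Δ / m with hh
  have hh0 : 0 < h := by positivity
  have hhr : h < r := by
    rw [hh, div_lt_iff₀ hmpos]
    have h1 : (m₀ : ℝ) < m := by exact_mod_cast (by omega : m₀ < m)
    have h2 := hm₀.trans h1
    rw [div_lt_iff₀ hr] at h2
    linarith
  have hnh : ((i * m : ℕ) : ℝ) * h = t := by
    rw [hh, ht]
    push_cast
    field_simp
  set s : ℕ → ℝ := fun j => j * h with hs
  have hs0 : ∀ j, 0 ≤ s j := fun j => by positivity
  have hsucc : ∀ j, s (j + 1) = s j + h := fun j => by simp only [hs]; push_cast; ring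
  have hst : ∀ j, j ≤ i * m → s j ≤ t := fun j hj => by
    rw [← hnh]
    exact mul_le_mul_of_nonneg_right (by exact_mod_cast hj) hh0.le
  have hstep : ∀ j ∈ Finset.range (i * m), |(E (s (j + 1)) * u (s (j + 1)) - E (s j) * u (s j)) -
      σ * (E (s j) * (b (s (j + 1)).toNNReal - b (s j).toNNReal))| ≤
      |lam| * (ε / (|lam| * t + 1)) * h := by
    intro j hj
    have hj' : j + 1 ≤ i * m := Finset.mem_range.1 hj
    have hle : s j ≤ s (j + 1) := by rw [hsucc]; linarith
    have hder : ∫ x in (s j)..(s (j + 1)), lam * E x = E (s (j + 1)) - E (s j) := by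
      refine intervalIntegral.integral_eq_sub_of_hasDerivAt (fun x _ => ?_)
        ((continuous_const.mul hEc).intervalIntegrable _ _)
      have : HasDerivAt (fun x => -lam * (t - x)) lam x := by
        simpa using ((hasDerivAt_id x).const_sub t).const_mul (-lam)
      simpa only [hE, mul_comm] using this.exp
    have hdiff : u (s (j + 1)) - u (s j) - σ * (b (s (j + 1)).toNNReal - b (s j).toNNReal) =
        -lam * ∫ x in (s j)..(s (j + 1)), u x := by
      have h1 := hub _ (hs0 j)
      have h2 := hub _ (hs0 (j + 1))
      have h3 := intervalIntegral.integral_add_adjacent_intervals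
        (h_int 0 (s j) le_rfl (hs0 j)) (h_int (s j) (s (j + 1)) (hs0 j) (hs0 _))
      rw [← h3] at h2
      linear_combination h2 - h1
    have hkey : (E (s (j + 1)) * u (s (j + 1)) - E (s j) * u (s j)) -
        σ * (E (s j) * (b (s (j + 1)).toNNReal - b (s j).toNNReal)) =
        ∫ x in (s j)..(s (j + 1)), lam * (E x * u (s (j + 1)) - E (s j) * u x) := by
      have h4 : (fun x => lam * (E x * u (s (j + 1)) - E (s j) * u x)) =
          fun x => lam * E x * u (s (j + 1)) - lam * E (s j) * u x := by
        funext x; ring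
      have h5 : IntervalIntegrable (fun x => lam * E x * u (s (j + 1))) volume (s j) (s (j + 1)) :=
        Continuous.intervalIntegrable (by fun_prop) _ _
      rw [h4, intervalIntegral.integral_sub h5 ((h_int _ _ (hs0 _) (hs0 _)).const_mul _),
        intervalIntegral.integral_mul_const, hder, intervalIntegral.integral_const_mul]
      linear_combination E (s j) * hdiff
    rw [hkey]
    have hb := intervalIntegral.norm_integral_le_of_norm_le_const
      (a := s j) (b := s (j + 1)) (C := |lam| * (ε / (|lam| * t + 1)))
      (f := fun x => lam * (E x * u (s (j + 1)) - E (s j) * u x)) (fun x hx => ?_)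
    · have h6 : |s (j + 1) - s j| = h := by rw [hsucc, add_sub_cancel_left, abs_of_pos hh0]
      rwa [Real.norm_eq_abs, h6] at hb
    · rw [Set.uIoc_of_le hle] at hx
      rw [norm_mul, Real.norm_eq_abs]
      refine mul_le_mul_of_nonneg_left ?_ (abs_nonneg _)
      have hsj := hst (j + 1) hj'
      have hx0 : 0 ≤ x := (hs0 j).trans hx.1.le
      have hxh : x ≤ s j + h := hsucc j ▸ hx.2
      have := hru (x, s (j + 1)) ⟨⟨hx0, hx.2.trans hsj⟩, hs0 _, hsj⟩ (s j, x)
        ⟨⟨hs0 j, hle.trans hsj⟩, hx0, hx.2.trans hsj⟩ (by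
          rw [Prod.dist_eq, max_lt_iff, Real.dist_eq, Real.dist_eq, hsucc, abs_lt, abs_lt]
          have := hx.1
          exact ⟨⟨by linarith, by linarith⟩, by linarith, by linarith⟩)
      rw [dist_eq_norm] at this
      exact this.le
  have htel := Finset.sum_range_sub (fun j => E (s j) * u (s j)) (i * m)
  have hsn : s (i * m) = t := hnh
  have hs00 : s 0 = 0 := by simp [hs]
  have hEt : E t = 1 := by simp [hE]
  have hE0 : E 0 = Real.exp (-lam * t) := by simp [hE]
  have hexp : u t - convolutionSum lam σ Δ (u 0) b i m =
      ∑ j ∈ Finset.range (i * m), ((E (s (j + 1)) * u (s (j + 1)) - E (s j) * u (s j)) -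
      σ * (E (s j) * (b (s (j + 1)).toNNReal - b (s j).toNNReal))) := by
    rw [Finset.sum_sub_distrib, htel, ← Finset.mul_sum, hsn, hs00, hEt, hE0, convolutionSum]
    ring
  rw [dist_comm, Real.dist_eq, hexp]
  refine (Finset.abs_sum_le_sum_abs _ _).trans_lt ((Finset.sum_le_sum hstep).trans_lt ?_)
  rw [Finset.sum_const, Finset.card_range, nsmul_eq_mul]
  have h5 : ((i * m : ℕ) : ℝ) * (|lam| * (ε / (|lam| * t + 1)) * h) =
      ε * (|lam| * t / (|lam| * t + 1)) := by
    rw [← hnh]; ring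
  rw [h5]
  refine mul_lt_of_lt_one_right hε ?_
  rw [div_lt_one (by positivity)]
  linarith

end Pathwise

section Modes

theorem tendsto_geometric_riemann {c Δ : ℝ} (hc : 0 < c) (hΔ : 0 < Δ) (k : ℕ) :
    Tendsto (fun m : ℕ => Δ / m * ∑ j ∈ Finset.range (k * m), Real.exp (c * (j * (Δ / m)))) atTop
      (𝓝 ((Real.exp (c * (k * Δ)) - 1) / c)) := by
  have h0 : Tendsto (fun m : ℕ => Δ / m) atTop (𝓝[≠] 0) := by
    refine tendsto_nhdsWithin_iff.2 ⟨tendsto_const_div_atTop_nhds_zero_nat Δ, ?_⟩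
    filter_upwards [eventually_gt_atTop 0] with m hm
    have : (0 : ℝ) < m := by exact_mod_cast hm
    exact (div_pos hΔ this).ne'
  have hd : HasDerivAt (fun x => Real.exp (c * x)) c 0 := by
    have := ((hasDerivAt_id (0 : ℝ)).const_mul c).exp
    simpa using this
  have h1 := (hd.tendsto_slope_zero.comp h0).inv₀ hc.ne'
  have h2 := h1.const_mul (Real.exp (c * (k * Δ)) - 1)
  rw [← div_eq_mul_inv] at h2
  refine h2.congr' ?_
  filter_upwards [eventually_gt_atTop 0] with m hm
  have hm' : (0 : ℝ) < m := by exact_mod_cast hm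
  have hh : 0 < Δ / m := div_pos hΔ hm'
  have hr : Real.exp (c * (Δ / m)) ≠ 1 := by
    rw [Ne, Real.exp_eq_one_iff]
    positivity
  have h3 : ∀ j : ℕ, Real.exp (c * (j * (Δ / m))) = Real.exp (c * (Δ / m)) ^ j := by
    intro j
    rw [← Real.exp_nat_mul]
    ring_nf
  simp_rw [h3]
  rw [geom_sum_eq hr, ← h3]
  have h4 : c * (((k * m : ℕ) : ℝ) * (Δ / m)) = c * (k * Δ) := by
    push_cast
    field_simp
  rw [h4]
  have h5 : Real.exp (c * (Δ / m)) - 1 ≠ 0 := sub_ne_zero.2 hr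
  simp only [Function.comp, zero_add, mul_zero, Real.exp_zero, smul_eq_mul]
  field_simp

variable {Ω : Type*} [MeasurableSpace Ω] {P : Measure Ω} [IsProbabilityMeasure P]

theorem charFun_initial_add_increments {β : ℝ≥0 → Ω → ℝ} (hβ : IsPreBrownianReal β P)
    {U : Ω → ℝ} {V : ℝ} (hV : 0 ≤ V) (hU : HasLaw U (gaussianReal 0 V.toNNReal) P)
    (hind : IndepFun U (fun ω => fun t : ℝ≥0 => β t ω) P) (a : ℝ) (c : ℕ → ℝ) {h : ℝ} (hh : 0 ≤ h)
    (n : ℕ) :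
    charFun (P.map fun ω => a * U ω + ∑ j ∈ Finset.range n,
      c j * (β (((j + 1 : ℕ) : ℝ) * h).toNNReal ω - β ((j : ℝ) * h).toNNReal ω)) 1 =
    Complex.exp (-(1 / 2) * (a ^ 2 * V + ∑ j ∈ Finset.range n, c j ^ 2 * h : ℝ)) := by
  have hmono : Monotone fun j : ℕ => ((j : ℝ) * h).toNNReal := fun i j hij =>
    Real.toNNReal_mono (mul_le_mul_of_nonneg_right (by exact_mod_cast hij) hh)
  have hinc : ∀ j : ℕ, AEMeasurable (fun ω => c j *
      (β (((j + 1 : ℕ) : ℝ) * h).toNNReal ω - β ((j : ℝ) * h).toNNReal ω)) P := fun j =>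
    ((hβ.aemeasurable _).sub (hβ.aemeasurable _)).const_mul _
  have h1 : IndepFun (fun ω => a * U ω) (fun ω => ∑ j ∈ Finset.range n,
      c j * (β (((j + 1 : ℕ) : ℝ) * h).toNNReal ω - β ((j : ℝ) * h).toNNReal ω)) P :=
    hind.comp (φ := fun x => a * x) (ψ := fun f : ℝ≥0 → ℝ => ∑ j ∈ Finset.range n,
      c j * (f (((j + 1 : ℕ) : ℝ) * h).toNNReal - f ((j : ℝ) * h).toNNReal))
      (by fun_prop) (by fun_prop)
  have h2 : iIndepFun (fun (j : ℕ) ω => c j *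
      (β (((j + 1 : ℕ) : ℝ) * h).toNNReal ω - β ((j : ℝ) * h).toNNReal ω)) P :=
    (hβ.hasIndepIncrements.nat hmono).comp (fun j x => c j * x) (fun j => by fun_prop)
  have h3 := h1.charFun_map_add_eq_mul (hU.aemeasurable.const_mul a)
    (Finset.aemeasurable_fun_sum _ fun j _ => hinc j)
  have h4 := congrFun h3 1
  have h5 := (h2.restrict (Finset.range n)).charFun_map_fun_finsetSum_eq_prod
    (s := Finset.range n) (fun j _ => hinc j)
  rw [Pi.mul_apply, h5, Finset.prod_apply] at h4
  refine h4.trans ?_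
  have hg : ∀ j : ℕ, charFun (P.map fun ω => c j *
      (β (((j + 1 : ℕ) : ℝ) * h).toNNReal ω - β ((j : ℝ) * h).toNNReal ω)) 1 =
      Complex.exp (-(1 / 2) * (c j ^ 2 * h : ℝ)) := by
    intro j
    have hm : AEMeasurable (fun ω => β (((j + 1 : ℕ) : ℝ) * h).toNNReal ω -
        β ((j : ℝ) * h).toNNReal ω) P := (hβ.aemeasurable _).sub (hβ.aemeasurable _)
    rw [charFun_map_mul_comp hm]
    have := (hβ.hasLaw_sub (((j + 1 : ℕ) : ℝ) * h).toNNReal ((j : ℝ) * h).toNNReal).map_eq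
    rw [show (fun ω => β (((j + 1 : ℕ) : ℝ) * h).toNNReal ω - β ((j : ℝ) * h).toNNReal ω) =
      β (((j + 1 : ℕ) : ℝ) * h).toNNReal - β ((j : ℝ) * h).toNNReal from rfl, this,
      charFun_gaussianReal]
    have hd : ((nndist (((j + 1 : ℕ) : ℝ) * h).toNNReal.1 ((j : ℝ) * h).toNNReal.1 : ℝ≥0) : ℝ)
        = h := by
      change dist (((((j + 1 : ℕ) : ℝ) * h).toNNReal : ℝ≥0) : ℝ) ((((j : ℝ) * h).toNNReal : ℝ≥0) : ℝ)
        = h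
      rw [Real.dist_eq, Real.coe_toNNReal _ (by positivity), Real.coe_toNNReal _ (by positivity)]
      push_cast
      rw [show ((j : ℝ) + 1) * h - j * h = h by ring, abs_of_nonneg hh]
    rw [hd]
    congr 1
    push_cast
    ring
  have hU' : charFun (P.map fun ω => a * U ω) 1 = Complex.exp (-(1 / 2) * (a ^ 2 * V : ℝ)) := by
    rw [charFun_map_mul_comp hU.aemeasurable, hU.map_eq, charFun_gaussianReal,
      Real.coe_toNNReal _ hV]
    congr 1
    push_cast
    ring
  simp_rw [hg, hU']
  rw [← Complex.exp_sum, ← Complex.exp_add, ← Finset.mul_sum]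
  congr 1
  push_cast
  ring

theorem sum_mul_convolutionSum (lam σ Δ u₀ : ℝ) (b : ℝ≥0 → ℝ) (w : ℕ → ℝ) (I m : ℕ) :
    ∑ i ∈ Finset.range I, w i * convolutionSum lam σ Δ u₀ b i m =
      (∑ i ∈ Finset.range I, w i * Real.exp (-lam * (i * Δ))) * u₀ +
      ∑ j ∈ Finset.range (I * m), (σ * ∑ i ∈ Finset.range I, w i *
        (if j < i * m then Real.exp (-lam * (i * Δ - j * (Δ / m))) else 0)) *
        (b (((j + 1 : ℕ) : ℝ) * (Δ / m)).toNNReal - b ((j : ℝ) * (Δ / m)).toNNReal) := by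
  have h1 : ∀ i ∈ Finset.range I, convolutionSum lam σ Δ u₀ b i m =
      Real.exp (-lam * (i * Δ)) * u₀ + ∑ j ∈ Finset.range (I * m), σ *
        ((if j < i * m then Real.exp (-lam * (i * Δ - j * (Δ / m))) else 0) *
        (b (((j + 1 : ℕ) : ℝ) * (Δ / m)).toNNReal - b ((j : ℝ) * (Δ / m)).toNNReal)) := by
    intro i hi
    rw [convolutionSum, Finset.mul_sum]
    congr 1
    have hsub : Finset.range (i * m) ⊆ Finset.range (I * m) :=
      Finset.range_subset_range.2 (Nat.mul_le_mul_right m (Finset.mem_range.1 hi).le)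
    rw [← Finset.sum_subset hsub]
    · refine Finset.sum_congr rfl fun j hj => ?_
      rw [if_pos (Finset.mem_range.1 hj)]
    · intro j _ hj
      rw [if_neg (by simpa using hj)]
      ring
  rw [Finset.sum_congr rfl fun i hi => by rw [h1 i hi]]
  simp_rw [mul_add, Finset.sum_add_distrib, Finset.mul_sum, Finset.sum_mul]
  congr 1
  · exact Finset.sum_congr rfl fun i _ => by ring
  · rw [Finset.sum_comm]
    exact Finset.sum_congr rfl fun j _ => Finset.sum_congr rfl fun i _ => by ring

theorem tendsto_variance_convolutionSum {lam σ Δ : ℝ} (hlam : 0 < lam) (hΔ : 0 < Δ)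
    (w : ℕ → ℝ) (I : ℕ) :
    Tendsto (fun m : ℕ => (∑ i ∈ Finset.range I, w i * Real.exp (-lam * (i * Δ))) ^ 2 *
        (σ ^ 2 / (2 * lam)) + ∑ j ∈ Finset.range (I * m), (σ * ∑ i ∈ Finset.range I, w i *
        (if j < i * m then Real.exp (-lam * (i * Δ - j * (Δ / m))) else 0)) ^ 2 * (Δ / m)) atTop
      (𝓝 (∑ i ∈ Finset.range I, ∑ j ∈ Finset.range I, w i * w j *
        (σ ^ 2 / (2 * lam) * Real.exp (-(lam * (|(i : ℝ) - j| * Δ)))))) := by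
  have hR : ∀ i j : ℕ, Tendsto (fun m : ℕ => Real.exp (-lam * ((i + j) * Δ)) *
      (Δ / m * ∑ k ∈ Finset.range (min i j * m), Real.exp (2 * lam * (k * (Δ / m))))) atTop
      (𝓝 ((Real.exp (-(lam * (|(i : ℝ) - j| * Δ))) - Real.exp (-lam * ((i + j) * Δ))) /
        (2 * lam))) := by
    intro i j
    convert (tendsto_geometric_riemann (c := 2 * lam) (by positivity) hΔ (min i j)).const_mul
      (Real.exp (-lam * ((i + j) * Δ))) using 2
    rw [← mul_div_assoc, mul_sub, ← Real.exp_add, mul_one]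
    congr 4
    have h2 : |(i : ℝ) - j| = i + j - 2 * (min i j : ℕ) := by
      rcases le_total i j with hij | hij
      · rw [min_eq_left hij, abs_of_nonpos (by simpa using hij)]; ring
      · rw [min_eq_right hij, abs_of_nonneg (by simpa using hij)]; ring
    rw [h2]
    ring
  have hlim := tendsto_finsetSum (Finset.range I) fun i _ =>
    tendsto_finsetSum (Finset.range I) fun j _ => ((hR i j).const_mul (σ ^ 2 * (w i * w j)))
  have hlim2 := hlim.const_add ((∑ i ∈ Finset.range I, w i * Real.exp (-lam * (i * Δ))) ^ 2 *
        (σ ^ 2 / (2 * lam)))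
  refine (hlim2.congr fun m => ?_).trans (le_of_eq (congrArg 𝓝 ?_))
  · congr 1
    have h3 : ∀ k : ℕ, (σ * ∑ i ∈ Finset.range I, w i *
        (if k < i * m then Real.exp (-lam * (i * Δ - k * (Δ / m))) else 0)) ^ 2 * (Δ / m) =
        ∑ i ∈ Finset.range I, ∑ j ∈ Finset.range I, σ ^ 2 * (w i * w j) *
          (Real.exp (-lam * ((i + j) * Δ)) * (Δ / m * (if k < min i j * m then
            Real.exp (2 * lam * (k * (Δ / m))) else 0))) := by
      intro k
      rw [mul_pow, sq (∑ i ∈ Finset.range I, _), Finset.sum_mul_sum, Finset.mul_sum,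
        Finset.sum_mul]
      refine Finset.sum_congr rfl fun i _ => ?_
      rw [Finset.mul_sum, Finset.sum_mul]
      refine Finset.sum_congr rfl fun j _ => ?_
      have hmin : k < min i j * m ↔ k < i * m ∧ k < j * m := by
        rw [min_mul_of_nonneg _ _ (Nat.zero_le m), lt_min_iff]
      by_cases h1 : k < i * m <;> by_cases h2 : k < j * m <;> simp only [hmin, h1, h2, if_true,
        if_false, and_true, and_false, mul_zero, zero_mul]
      have h4 : Real.exp (-lam * ((i + j) * Δ)) * Real.exp (2 * lam * (k * (Δ / m))) =
          Real.exp (-lam * (i * Δ - k * (Δ / m))) * Real.exp (-lam * (j * Δ - k * (Δ / m))) := by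
        rw [← Real.exp_add, ← Real.exp_add]
        congr 1
        ring
      linear_combination (-(σ ^ 2 * (w i * w j)) * (Δ / m)) * h4
    simp_rw [h3]
    symm
    rw [Finset.sum_comm]
    refine Finset.sum_congr rfl fun i hi => ?_
    rw [Finset.sum_comm]
    refine Finset.sum_congr rfl fun j hj => ?_
    rw [← Finset.mul_sum, ← Finset.mul_sum, ← Finset.mul_sum]
    congr 3
    symm
    have hsub : Finset.range (min i j * m) ⊆ Finset.range (I * m) :=
      Finset.range_subset_range.2 (Nat.mul_le_mul_right m
        ((min_le_left i j).trans (Finset.mem_range.1 hi).le))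
    rw [← Finset.sum_subset hsub]
    · exact Finset.sum_congr rfl fun k hk => by rw [if_pos (Finset.mem_range.1 hk)]
    · intro k _ hk
      rw [if_neg (by simpa using hk)]
  · rw [sq, Finset.sum_mul_sum, Finset.sum_mul, ← Finset.sum_add_distrib]
    refine Finset.sum_congr rfl fun i _ => ?_
    rw [Finset.sum_mul, ← Finset.sum_add_distrib]
    refine Finset.sum_congr rfl fun j _ => ?_
    have h5 : Real.exp (-lam * (((i : ℝ) + j) * Δ)) =
        Real.exp (-lam * (i * Δ)) * Real.exp (-lam * (j * Δ)) := by
      rw [← Real.exp_add]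
      congr 1
      ring
    rw [h5]
    field_simp
    ring

end Modes

section Observations

variable {Ω : Type*} [MeasurableSpace Ω] {P : Measure Ω}

theorem Params.Admissible.eigenvalue_pos {p : Params} (hp : p.Admissible) (ℓ : ℕ) :
    0 < p.eigenvalue (ℓ + 1) := by
  refine mul_pos hp.diffusivity_pos ?_
  have h1 := hp.spectral_gap
  have h2 : (1 : ℝ) ≤ ((ℓ + 1 : ℕ) : ℝ) ^ 2 := one_le_pow₀ (by push_cast; linarith [Nat.cast_nonneg (α := ℝ) ℓ])
  nlinarith [Real.pi_pos, sq_nonneg Real.pi]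

/-- Characteristic functions converge along almost surely converging sequences. -/
theorem tendsto_integral_cexp [IsProbabilityMeasure P] {f : ℕ → Ω → ℝ} {g : Ω → ℝ} (hf : ∀ n, AEMeasurable (f n) P)
    (hfg : ∀ᵐ ω ∂P, Tendsto (fun n => f n ω) atTop (𝓝 (g ω))) :
    Tendsto (fun n => ∫ ω, Complex.exp ((f n ω : ℂ) * Complex.I) ∂P) atTop
      (𝓝 (∫ ω, Complex.exp ((g ω : ℂ) * Complex.I) ∂P)) := by
  refine tendsto_integral_of_dominated_convergence (fun _ => 1) (fun n => ?_)
    (integrable_const 1) (fun n => .of_forall fun ω => ?_) ?_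
  · have : Measurable fun x : ℝ => Complex.exp ((x : ℂ) * Complex.I) := by fun_prop
    exact (this.comp_aemeasurable (hf n)).aestronglyMeasurable
  · rw [Complex.norm_exp_ofReal_mul_I]
  · filter_upwards [hfg] with ω hω
    have : Continuous fun x : ℝ => Complex.exp ((x : ℂ) * Complex.I) := by fun_prop
    exact (this.tendsto _).comp hω

variable {p : Params} {β : ℕ → ℝ≥0 → Ω → ℝ} {u : ℕ → ℝ → Ω → ℝ} {X : ℝ → ℝ → Ω → ℝ}

/-- The covariance of the `ℓ`-th Fourier mode at the times `i * Δ` and `j * Δ`. -/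
noncomputable def Params.modeCov (p : Params) (Δ : ℝ) (ℓ i j : ℕ) : ℝ :=
  p.σ ^ 2 / (2 * p.eigenvalue (ℓ + 1)) * Real.exp (-(p.eigenvalue (ℓ + 1) * (|(i : ℝ) - j| * Δ)))

theorem IsStationarySolution.aemeasurable_convolutionSum (hX : IsStationarySolution P p β u X)
    (Δ : ℝ) (ℓ i m : ℕ) : AEMeasurable (fun ω =>
      convolutionSum (p.eigenvalue (ℓ + 1)) p.σ Δ (u ℓ 0 ω) (fun t => β ℓ t ω) i m) P := by
  have h0 := (hX.initial_law ℓ).aemeasurable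
  have hβ := (hX.brownian ℓ).toIsPreBrownianReal.aemeasurable
  unfold convolutionSum
  exact (h0.const_mul _).add ((Finset.aemeasurable_fun_sum _ fun j _ =>
    ((hβ _).sub (hβ _)).const_mul _).const_mul _)

theorem IsStationarySolution.ae_tendsto_convolutionSum (hX : IsStationarySolution P p β u X)
    {Δ : ℝ} (hΔ : 0 < Δ) : ∀ᵐ ω ∂P, ∀ ℓ i, Tendsto
      (convolutionSum (p.eigenvalue (ℓ + 1)) p.σ Δ (u ℓ 0 ω) (fun t => β ℓ t ω) i) atTop
      (𝓝 (u ℓ (i * Δ) ω)) := by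
  refine ae_all_iff.2 fun ℓ => ?_
  filter_upwards [hX.ornstein_uhlenbeck ℓ] with ω hω i
  exact tendsto_convolutionSum hΔ (u := fun t => u ℓ t ω) hω.1 hω.2 i

theorem IsStationarySolution.aemeasurable_mode (hX : IsStationarySolution P p β u X)
    {Δ : ℝ} (hΔ : 0 < Δ) (ℓ i : ℕ) : AEMeasurable (u ℓ (i * Δ)) P :=
  aemeasurable_of_tendsto_metrizable_ae atTop
    (fun m => hX.aemeasurable_convolutionSum Δ ℓ i m)
    ((hX.ae_tendsto_convolutionSum hΔ).mono fun _ h => h ℓ i)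

theorem IsStationarySolution.integral_cexp_modes [IsProbabilityMeasure P] (hX : IsStationarySolution P p β u X)
    (hp : p.Admissible) {Δ : ℝ} (hΔ : 0 < Δ) (w : ℕ → ℕ → ℝ) (I n : ℕ) :
    ∫ ω, Complex.exp ((∑ ℓ ∈ Finset.range n, ∑ i ∈ Finset.range I, w ℓ i * u ℓ (i * Δ) ω : ℝ) *
        Complex.I) ∂P =
      Complex.exp (-(1 / 2) * (∑ ℓ ∈ Finset.range n, ∑ i ∈ Finset.range I, ∑ j ∈ Finset.range I,
        w ℓ i * w ℓ j * p.modeCov Δ ℓ i j : ℝ)) := by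
  set Z : ℕ → ℕ → Ω → ℝ := fun m ℓ ω => ∑ i ∈ Finset.range I, w ℓ i *
    convolutionSum (p.eigenvalue (ℓ + 1)) p.σ Δ (u ℓ 0 ω) (fun t => β ℓ t ω) i m with hZ
  set v : ℕ → ℕ → ℝ := fun m ℓ => (∑ i ∈ Finset.range I, w ℓ i *
      Real.exp (-p.eigenvalue (ℓ + 1) * (i * Δ))) ^ 2 * (p.σ ^ 2 / (2 * p.eigenvalue (ℓ + 1))) +
      ∑ j ∈ Finset.range (I * m), (p.σ * ∑ i ∈ Finset.range I, w ℓ i * (if j < i * m then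
        Real.exp (-p.eigenvalue (ℓ + 1) * (i * Δ - j * (Δ / m))) else 0)) ^ 2 * (Δ / m) with hv
  have hZm : ∀ m ℓ, AEMeasurable (Z m ℓ) P := fun m ℓ => Finset.aemeasurable_fun_sum _ fun i _ =>
    (hX.aemeasurable_convolutionSum Δ ℓ i m).const_mul _
  have hZc : ∀ m ℓ, charFun (P.map (Z m ℓ)) 1 = Complex.exp (-(1 / 2) * (v m ℓ : ℝ)) := by
    intro m ℓ
    simp only [hZ, sum_mul_convolutionSum]
    have hpos := hp.eigenvalue_pos ℓ
    exact charFun_initial_add_increments (hX.brownian ℓ).toIsPreBrownianReal (by positivity)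
      (hX.initial_law ℓ) (hX.indep_initial ℓ) _ _ (by positivity) (I * m)
  have hind : ∀ m, iIndepFun (Z m) P := fun m =>
    hX.indep_modes.comp (fun ℓ (x : ℝ × (ℝ≥0 → ℝ)) => ∑ i ∈ Finset.range I, w ℓ i *
      convolutionSum (p.eigenvalue (ℓ + 1)) p.σ Δ x.1 x.2 i m) fun ℓ => by
        unfold convolutionSum
        fun_prop
  have hm : ∀ m, ∫ ω, Complex.exp ((∑ ℓ ∈ Finset.range n, Z m ℓ ω : ℝ) * Complex.I) ∂P =
      Complex.exp (-(1 / 2) * (∑ ℓ ∈ Finset.range n, v m ℓ : ℝ)) := by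
    intro m
    have h1 := congrFun (((hind m).restrict (Finset.range n)).charFun_map_fun_finsetSum_eq_prod
      (s := Finset.range n) (fun ℓ _ => hZm m ℓ)) 1
    rw [charFun_apply_real, integral_map (Finset.aemeasurable_fun_sum _ fun ℓ _ => hZm m ℓ)
      (by fun_prop), Finset.prod_apply] at h1
    simp_rw [hZc] at h1
    rw [← Complex.exp_sum, ← Finset.mul_sum] at h1
    simpa using h1
  have hlim1 : Tendsto (fun m => ∫ ω, Complex.exp ((∑ ℓ ∈ Finset.range n, Z m ℓ ω : ℝ) *
      Complex.I) ∂P) atTop (𝓝 (∫ ω, Complex.exp ((∑ ℓ ∈ Finset.range n, ∑ i ∈ Finset.range I,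
        w ℓ i * u ℓ (i * Δ) ω : ℝ) * Complex.I) ∂P)) := by
    refine tendsto_integral_cexp (fun m => Finset.aemeasurable_fun_sum _ fun ℓ _ => hZm m ℓ) ?_
    filter_upwards [hX.ae_tendsto_convolutionSum hΔ] with ω hω
    exact tendsto_finsetSum _ fun ℓ _ => tendsto_finsetSum _ fun i _ => (hω ℓ i).const_mul _
  have hlim2 : Tendsto (fun m => ∑ ℓ ∈ Finset.range n, v m ℓ) atTop (𝓝 (∑ ℓ ∈ Finset.range n,
      ∑ i ∈ Finset.range I, ∑ j ∈ Finset.range I, w ℓ i * w ℓ j * p.modeCov Δ ℓ i j)) :=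
    tendsto_finsetSum _ fun ℓ _ =>
      tendsto_variance_convolutionSum (hp.eigenvalue_pos ℓ) hΔ (w ℓ) I
  have hcont : Continuous fun x : ℝ => Complex.exp (-(1 / 2) * (x : ℂ)) := by fun_prop
  refine tendsto_nhds_unique hlim1 ?_
  simp_rw [hm]
  exact (hcont.tendsto _).comp hlim2

/-- Linear statistics of the Fourier modes are jointly Gaussian. -/
theorem IsStationarySolution.isCenteredGaussian [IsProbabilityMeasure P] (hX : IsStationarySolution P p β u X)
    (hp : p.Admissible) {Δ : ℝ} (hΔ : 0 < Δ) {ι : Type*} [Fintype ι] {ξ : ι → Ω → ℝ} {I : ℕ}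
    {g : ι → ℕ → ℕ → ℝ} (hξ : ∀ a, ∀ᵐ ω ∂P, Tendsto (fun n => ∑ ℓ ∈ Finset.range n,
      ∑ i ∈ Finset.range I, g a ℓ i * u ℓ (i * Δ) ω) atTop (𝓝 (ξ a ω)))
    {S : ι → ι → ℝ} (hS : ∀ a b, HasSum (fun ℓ => ∑ i ∈ Finset.range I, ∑ j ∈ Finset.range I,
      g a ℓ i * g b ℓ j * p.modeCov Δ ℓ i j) (S a b)) :
    IsCenteredGaussian P ξ S where
  aemeasurable a := aemeasurable_of_tendsto_metrizable_ae atTop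
    (fun n => Finset.aemeasurable_fun_sum _ fun ℓ _ => Finset.aemeasurable_fun_sum _ fun i _ =>
      (hX.aemeasurable_mode hΔ ℓ i).const_mul _) (hξ a)
  symm a b := by
    refine (hS a b).unique ((hS b a).congr_fun fun ℓ => ?_)
    rw [Finset.sum_comm]
    refine Finset.sum_congr rfl fun i _ => Finset.sum_congr rfl fun j _ => ?_
    rw [Params.modeCov, Params.modeCov, abs_sub_comm]
    ring
  charFun_eq c := by
    set w : ℕ → ℕ → ℝ := fun ℓ i => ∑ a, c a * g a ℓ i with hw
    have h1 : ∀ n ω, ∑ a, c a * ∑ ℓ ∈ Finset.range n, ∑ i ∈ Finset.range I,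
        g a ℓ i * u ℓ (i * Δ) ω =
        ∑ ℓ ∈ Finset.range n, ∑ i ∈ Finset.range I, w ℓ i * u ℓ (i * Δ) ω := by
      intro n ω
      simp_rw [hw, Finset.mul_sum, Finset.sum_mul]
      rw [Finset.sum_comm]
      refine Finset.sum_congr rfl fun ℓ _ => ?_
      rw [Finset.sum_comm]
      exact Finset.sum_congr rfl fun i _ => Finset.sum_congr rfl fun a _ => by ring
    have hlim1 := tendsto_integral_cexp (P := P)
      (f := fun n ω => ∑ ℓ ∈ Finset.range n, ∑ i ∈ Finset.range I, w ℓ i * u ℓ (i * Δ) ω)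
      (g := fun ω => ∑ a, c a * ξ a ω)
      (fun n => Finset.aemeasurable_fun_sum _ fun ℓ _ => Finset.aemeasurable_fun_sum _ fun i _ =>
        (hX.aemeasurable_mode hΔ ℓ i).const_mul _) (by
        filter_upwards [ae_all_iff.2 hξ] with ω hω
        simp_rw [← h1]
        exact tendsto_finsetSum _ fun a _ => (hω a).const_mul _)
    have h2 : HasSum (fun ℓ => ∑ i ∈ Finset.range I, ∑ j ∈ Finset.range I,
        w ℓ i * w ℓ j * p.modeCov Δ ℓ i j) (∑ a, ∑ b, c a * c b * S a b) := by
      have h3 := hasSum_sum fun a (_ : a ∈ Finset.univ) => hasSum_sum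
        fun b (_ : b ∈ Finset.univ) => (hS a b).mul_left (c a * c b)
      refine h3.congr_fun fun ℓ => ?_
      simp_rw [hw, Finset.sum_mul_sum, Finset.sum_mul, Finset.mul_sum]
      rw [Finset.sum_congr rfl fun i _ => Finset.sum_comm, Finset.sum_comm]
      refine Finset.sum_congr rfl fun a _ => ?_
      rw [Finset.sum_congr rfl fun i _ => Finset.sum_congr rfl fun j _ => rfl]
      rw [Finset.sum_congr rfl fun i _ => Finset.sum_comm, Finset.sum_comm]
      exact Finset.sum_congr rfl fun b _ => Finset.sum_congr rfl fun i _ =>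
        Finset.sum_congr rfl fun j _ => by ring
    have hcont : Continuous fun x : ℝ => Complex.exp (-(1 / 2) * (x : ℂ)) := by fun_prop
    refine tendsto_nhds_unique hlim1 ?_
    simp_rw [hX.integral_cexp_modes hp hΔ]
    exact (hcont.tendsto _).comp h2.tendsto_sum_nat

end Observations

theorem tendstoInDistribution_sum_sq_of_row_sums {Ω : Type*} [MeasurableSpace Ω] {P : Measure Ω}
    [IsProbabilityMeasure P] {ι : ℕ → Type*} [∀ n, Fintype (ι n)]
    {Y : ∀ n, ι n → Ω → ℝ} {B : ∀ n, ι n → ι n → ℝ}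
    (hG : ∀ n, IsCenteredGaussian P (Y n) (B n)) {τ : ℕ → ℝ} {v : ℝ}
    (hτ : Tendsto (fun n => ∑ a, B n a a - τ n) atTop (𝓝 0))
    (hv : Tendsto (fun n => 2 * ∑ a, ∑ b, B n a b ^ 2) atTop (𝓝 v))
    (hrow : ∀ ε > 0, ∀ᶠ n in atTop, ∀ a, ∑ b, |B n a b| ≤ ε) :
    TendstoInDistribution (fun n ω => ∑ a, Y n a ω ^ 2 - τ n) atTop (id : ℝ → ℝ)
      (fun _ => P) (gaussianReal 0 v.toNNReal) := by
  refine tendstoInDistribution_sum_sq hG hτ hv (ε := fun n => ⨆ a, ∑ b, |B n a b|) ?_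
    (.of_forall fun n a => le_ciSup (f := fun a => ∑ b, |B n a b|) (Set.finite_range _).bddAbove a)
  rw [Metric.tendsto_nhds]
  intro ε hε
  filter_upwards [hrow (ε / 2) (half_pos hε)] with n hn
  rw [Real.dist_eq, sub_zero, abs_of_nonneg (Real.iSup_nonneg fun a => by positivity)]
  exact (Real.iSup_le hn (by positivity)).trans_lt (half_lt_self hε)

theorem IsCenteredGaussian.const_mul {Ω : Type*} [MeasurableSpace Ω] {P : Measure Ω}
    {ι : Type*} [Fintype ι] {Y : ι → Ω → ℝ} {B : ι → ι → ℝ} (h : IsCenteredGaussian P Y B)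
    (s : ℝ) : IsCenteredGaussian P (fun a ω => s * Y a ω) (fun a b => s ^ 2 * B a b) where
  aemeasurable a := (h.aemeasurable a).const_mul s
  symm a b := by rw [h.symm]
  charFun_eq c := by
    have h1 : ∀ ω, ∑ a, c a * (s * Y a ω) = ∑ a, s * c a * Y a ω :=
      fun ω => Finset.sum_congr rfl fun a _ => by ring
    have h2 : ∑ a, ∑ b, c a * c b * (s ^ 2 * B a b) = ∑ a, ∑ b, s * c a * (s * c b) * B a b :=
      Finset.sum_congr rfl fun a _ => Finset.sum_congr rfl fun b _ => by ring
    simp_rw [h1, h2]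
    exact h.charFun_eq fun a => s * c a

section Box

/-- The lag between two points of a box. -/
def boxLag {N M : ℕ} (a b : Fin N × Fin M) : ℤ × ℤ :=
  ((b.1 : ℤ) - (a.1 : ℤ), (b.2 : ℤ) - (a.2 : ℤ))

theorem boxLag_injective {N M : ℕ} (a : Fin N × Fin M) : Function.Injective (boxLag a) := by
  intro b c h
  simp only [boxLag, Prod.mk.injEq, sub_left_inj] at h
  exact Prod.ext (Fin.ext (by exact_mod_cast h.1)) (Fin.ext (by exact_mod_cast h.2))

/-- The proportion of pairs of points of the box with a given lag. -/
noncomputable def lagDensity (N M : ℕ) (w : ℤ × ℤ) : ℝ :=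
  1 / (M * N) * ∑ a : Fin N × Fin M, ∑ b : Fin N × Fin M, if boxLag a b = w then 1 else 0

theorem sum_ite_boxLag_le {N M : ℕ} (a : Fin N × Fin M) (w : ℤ × ℤ) :
    (∑ b : Fin N × Fin M, if boxLag a b = w then (1 : ℝ) else 0) ≤ 1 := by
  by_cases h : ∃ b, boxLag a b = w
  · obtain ⟨b, rfl⟩ := h
    simp [(boxLag_injective a).eq_iff]
  · push Not at h
    simp [h]

theorem lagDensity_le_one (N M : ℕ) (w : ℤ × ℤ) : lagDensity N M w ≤ 1 := by
  have h := Finset.sum_le_sum fun (a : Fin N × Fin M) (_ : a ∈ Finset.univ) =>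
    sum_ite_boxLag_le a w
  simp only [Finset.sum_const, Finset.card_univ, Fintype.card_prod, Fintype.card_fin,
    nsmul_eq_mul, mul_one] at h
  rw [lagDensity, one_div]
  push_cast at h
  refine inv_mul_le_one_of_le₀ (h.trans_eq (mul_comm _ _)) (by positivity)

theorem sum_ite_sub_eq (N : ℕ) (J : ℤ) :
    (∑ i : Fin N, ∑ j : Fin N, if (j : ℤ) - (i : ℤ) = J then (1 : ℝ) else 0) =
      ((N - J.natAbs : ℕ) : ℝ) := by
  have key : ∀ k : ℕ, (∑ i : Fin N, ∑ j : Fin N, if (j : ℕ) = i + k then (1 : ℝ) else 0) =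
      ((N - k : ℕ) : ℝ) := by
    intro k
    rw [Fin.sum_univ_eq_sum_range (fun i => ∑ j : Fin N, if (j : ℕ) = i + k then (1 : ℝ) else 0) N]
    have h1 : ∀ i, (∑ j : Fin N, if (j : ℕ) = i + k then (1 : ℝ) else 0) =
        if i < N - k then 1 else 0 := by
      intro i
      rw [Fin.sum_univ_eq_sum_range (fun j => if j = i + k then (1 : ℝ) else 0) N,
        Finset.sum_ite_eq']
      exact if_congr (by rw [Finset.mem_range]; omega) rfl rfl
    simp_rw [h1]
    rw [← Finset.sum_filter, Finset.sum_const, nsmul_eq_mul, mul_one]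
    have h2 : (Finset.range N).filter (fun i => i < N - k) = Finset.range (N - k) := by
      ext i
      simp only [Finset.mem_filter, Finset.mem_range]
      omega
    rw [h2, Finset.card_range]
  rcases Int.natAbs_eq J with h | h
  · rw [← key]
    exact Finset.sum_congr rfl fun i _ => Finset.sum_congr rfl fun j _ =>
      if_congr (by omega) rfl rfl
  · rw [← key, Finset.sum_comm]
    exact Finset.sum_congr rfl fun i _ => Finset.sum_congr rfl fun j _ =>
      if_congr (by omega) rfl rfl

theorem lagDensity_eq (N M : ℕ) (w : ℤ × ℤ) :
    lagDensity N M w = ((N - w.1.natAbs : ℕ) : ℝ) / N * (((M - w.2.natAbs : ℕ) : ℝ) / M) := by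
  rw [lagDensity, ← sum_ite_sub_eq, ← sum_ite_sub_eq]
  have h1 : ∀ a b : Fin N × Fin M, (if boxLag a b = w then (1 : ℝ) else 0) =
      (if (b.1 : ℤ) - (a.1 : ℤ) = w.1 then 1 else 0) *
        (if (b.2 : ℤ) - (a.2 : ℤ) = w.2 then 1 else 0) := by
    intro a b
    by_cases h : (b.1 : ℤ) - (a.1 : ℤ) = w.1 <;> by_cases h' : (b.2 : ℤ) - (a.2 : ℤ) = w.2 <;>
      simp [boxLag, Prod.ext_iff, h, h']
  have h2 : ∑ a : Fin N × Fin M, ∑ b : Fin N × Fin M, (if boxLag a b = w then (1 : ℝ) else 0) =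
      (∑ i : Fin N, ∑ j : Fin N, if (j : ℤ) - (i : ℤ) = w.1 then (1 : ℝ) else 0) *
      ∑ k : Fin M, ∑ l : Fin M, if (l : ℤ) - (k : ℤ) = w.2 then (1 : ℝ) else 0 := by
    rw [Finset.sum_mul_sum, Fintype.sum_prod_type]
    refine Finset.sum_congr rfl fun i _ => Finset.sum_congr rfl fun k _ => ?_
    rw [Finset.sum_mul_sum, Fintype.sum_prod_type]
    exact Finset.sum_congr rfl fun j _ => Finset.sum_congr rfl fun l _ => h1 (i, k) (j, l)
  rw [h2, one_div, mul_inv]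
  ring

theorem tendsto_sub_natAbs_div {N : ℕ → ℕ} (hN : Tendsto N atTop atTop) (k : ℕ) :
    Tendsto (fun n => ((N n - k : ℕ) : ℝ) / N n) atTop (𝓝 1) := by
  have h1 : Tendsto (fun n => 1 - (k : ℝ) / N n) atTop (𝓝 1) := by
    simpa using ((tendsto_const_div_atTop_nhds_zero_nat (k : ℝ)).comp hN).const_sub 1
  refine h1.congr' ?_
  filter_upwards [hN.eventually_ge_atTop (k + 1)] with n hn
  have h0 : (N n : ℝ) ≠ 0 := by
    have : 0 < N n := by omega
    positivity
  rw [Nat.cast_sub (by omega)]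
  field_simp

theorem tendsto_lagDensity {N M : ℕ → ℕ} (hN : Tendsto N atTop atTop) (hM : Tendsto M atTop atTop)
    (w : ℤ × ℤ) : Tendsto (fun n => lagDensity (N n) (M n) w) atTop (𝓝 1) := by
  simp_rw [lagDensity_eq]
  simpa using (tendsto_sub_natAbs_div hN w.1.natAbs).mul (tendsto_sub_natAbs_div hM w.2.natAbs)

theorem tendsto_box_sum {N M : ℕ → ℕ} (hN : Tendsto N atTop atTop) (hM : Tendsto M atTop atTop)
    {f : ∀ n, Fin (N n) × Fin (M n) → Fin (N n) × Fin (M n) → ℝ} {D r : ℤ × ℤ → ℝ}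
    (hD : Summable D) (hD0 : ∀ w, 0 ≤ D w) (hbound : ∀ᶠ n in atTop, ∀ a b, |f n a b| ≤ D (boxLag a b))
    (hlim : ∀ w, ∀ ε > 0, ∀ᶠ n in atTop, ∀ a b, boxLag a b = w → |f n a b - r w| ≤ ε) :
    Tendsto (fun n => 1 / ((M n : ℝ) * N n) * ∑ a, ∑ b, f n a b) atTop (𝓝 (∑' w, r w)) := by
  have hswap : ∀ n, 1 / ((M n : ℝ) * N n) * ∑ a, ∑ b, f n a b =
      ∑' w, 1 / ((M n : ℝ) * N n) * ∑ a, ∑ b, if boxLag a b = w then f n a b else 0 := by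
    intro n
    rw [tsum_mul_left]
    congr 1
    have hs : ∀ a b, HasSum (fun w => if boxLag a b = w then f n a b else 0) (f n a b) :=
      fun a b => by simpa [eq_comm] using hasSum_ite_eq (boxLag a b) (f n a b)
    exact (hasSum_sum fun a _ => hasSum_sum fun b _ => hs a b).tsum_eq.symm
  simp_rw [hswap]
  refine tendsto_tsum_of_dominated_convergence hD (fun w => ?_) ?_
  · have h1 : Tendsto (fun n => lagDensity (N n) (M n) w * r w) atTop (𝓝 (r w)) := by
      simpa using (tendsto_lagDensity hN hM w).mul_const (r w)
    refine h1.congr_dist ?_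
    rw [Metric.tendsto_nhds]
    intro ε hε
    filter_upwards [hlim w (ε / 2) (half_pos hε)] with n hn
    rw [dist_zero_right, Real.norm_eq_abs, abs_of_nonneg dist_nonneg, dist_comm, Real.dist_eq]
    refine lt_of_le_of_lt ?_ (half_lt_self hε)
    have h2 : 1 / ((M n : ℝ) * N n) * (∑ a, ∑ b, if boxLag a b = w then f n a b else 0) -
        lagDensity (N n) (M n) w * r w = 1 / ((M n : ℝ) * N n) *
          ∑ a, ∑ b, if boxLag a b = w then f n a b - r w else 0 := by
      rw [lagDensity, mul_assoc, ← mul_sub, Finset.sum_mul, ← Finset.sum_sub_distrib]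
      congr 1
      refine Finset.sum_congr rfl fun a _ => ?_
      rw [Finset.sum_mul, ← Finset.sum_sub_distrib]
      refine Finset.sum_congr rfl fun b _ => ?_
      split_ifs <;> ring
    rw [h2, abs_mul, abs_of_nonneg (by positivity : (0 : ℝ) ≤ 1 / ((M n : ℝ) * N n))]
    have h3 : |∑ a, ∑ b, if boxLag a b = w then f n a b - r w else 0| ≤
        ∑ a : Fin (N n) × Fin (M n), ∑ b : Fin (N n) × Fin (M n),
          (if boxLag a b = w then 1 else 0) * (ε / 2) := by
      refine (Finset.abs_sum_le_sum_abs _ _).trans (Finset.sum_le_sum fun a _ => ?_)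
      refine (Finset.abs_sum_le_sum_abs _ _).trans (Finset.sum_le_sum fun b _ => ?_)
      split_ifs with h
      · simpa using hn a b h
      · simp
    refine (mul_le_mul_of_nonneg_left h3 (by positivity)).trans ?_
    simp_rw [← Finset.sum_mul]
    rw [← mul_assoc]
    exact mul_le_of_le_one_left (half_pos hε).le (lagDensity_le_one _ _ w)
  · filter_upwards [hbound] with n hn w
    rw [Real.norm_eq_abs, abs_mul, abs_of_nonneg (by positivity : (0 : ℝ) ≤ 1 / ((M n : ℝ) * N n))]
    have h3 : |∑ a, ∑ b, if boxLag a b = w then f n a b else 0| ≤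
        ∑ a : Fin (N n) × Fin (M n), ∑ b : Fin (N n) × Fin (M n),
          (if boxLag a b = w then 1 else 0) * D w := by
      refine (Finset.abs_sum_le_sum_abs _ _).trans (Finset.sum_le_sum fun a _ => ?_)
      refine (Finset.abs_sum_le_sum_abs _ _).trans (Finset.sum_le_sum fun b _ => ?_)
      split_ifs with h
      · simpa [h] using hn a b
      · simp
    refine (mul_le_mul_of_nonneg_left h3 (by positivity)).trans ?_
    simp_rw [← Finset.sum_mul]
    rw [← mul_assoc]
    exact mul_le_of_le_one_left (hD0 w) (lagDensity_le_one _ _ w)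

/-- Row sums of arrays dominated by a square summable function of the lag. -/
theorem eventually_row_sum_le {N M : ℕ → ℕ} (hN : Tendsto N atTop atTop)
    (hM : Tendsto M atTop atTop) {d : ℤ × ℤ → ℝ} (hd : Summable fun w => d w ^ 2)
    (hd0 : ∀ w, 0 ≤ d w) {ε : ℝ} (hε : 0 < ε) :
    ∀ᶠ n in atTop, ∀ a : Fin (N n) × Fin (M n),
      ∑ b, d (boxLag a b) ≤ ε * √((M n : ℝ) * N n) := by
  classical
  obtain ⟨W, hW⟩ := summable_iff_vanishing_norm.1 hd ((ε / 2) ^ 2) (by positivity)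
  have hlim : Tendsto (fun n => ε / 2 * √((M n : ℝ) * N n)) atTop atTop := by
    refine Tendsto.const_mul_atTop (half_pos hε) (Real.tendsto_sqrt_atTop.comp ?_)
    exact (tendsto_natCast_atTop_atTop.comp hM).atTop_mul_atTop₀ (tendsto_natCast_atTop_atTop.comp hN)
  filter_upwards [hlim.eventually_ge_atTop (∑ w ∈ W, d w)] with n hn a
  rw [← Finset.sum_filter_add_sum_filter_not Finset.univ (fun b => boxLag a b ∈ W)]
  have h1 : ∑ b with boxLag a b ∈ W, d (boxLag a b) ≤ ∑ w ∈ W, d w := by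
    rw [← Finset.sum_image (f := d) (g := boxLag a) fun b _ c _ h => boxLag_injective a h]
    refine Finset.sum_le_sum_of_subset_of_nonneg ?_ fun w _ _ => hd0 w
    intro w hw
    obtain ⟨b, hb, rfl⟩ := Finset.mem_image.1 hw
    exact (Finset.mem_filter.1 hb).2
  have h2 : ∑ b with boxLag a b ∉ W, d (boxLag a b) ≤ ε / 2 * √((M n : ℝ) * N n) := by
    refine abs_le_of_sq_le_sq' ?_ (by positivity) |>.2
    have h3 := sq_sum_le_card_mul_sum_sq (s := Finset.univ.filter fun b => boxLag a b ∉ W)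
      (f := fun b => d (boxLag a b))
    have h4 : ((Finset.univ.filter fun b => boxLag a b ∉ W).card : ℝ) ≤ (M n : ℝ) * N n := by
      have := Finset.card_le_univ (Finset.univ.filter fun b => boxLag a b ∉ W)
      rw [Fintype.card_prod, Fintype.card_fin, Fintype.card_fin, mul_comm] at this
      exact_mod_cast this
    have h5 : ∑ b with boxLag a b ∉ W, d (boxLag a b) ^ 2 ≤ (ε / 2) ^ 2 := by
      rw [← Finset.sum_image (f := fun w => d w ^ 2) (g := boxLag a)
        fun b _ c _ h => boxLag_injective a h]
      refine (le_abs_self _).trans (hW _ ?_).le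
      refine Finset.disjoint_left.2 fun w hw hwW => ?_
      obtain ⟨b, hb, rfl⟩ := Finset.mem_image.1 hw
      exact (Finset.mem_filter.1 hb).2 hwW
    rw [mul_pow, Real.sq_sqrt (by positivity)]
    calc _ ≤ _ := h3
      _ ≤ (M n : ℝ) * N n * (ε / 2) ^ 2 := mul_le_mul h4 h5 (by positivity) (by positivity)
      _ = _ := by ring
  linarith

/-- Central limit theorem for averages of squares of a Gaussian field on growing boxes whose
covariances are asymptotically a function of the lag and dominated by a square summable function
of the lag. -/
theorem tendstoInDistribution_box {Ω : Type*} [MeasurableSpace Ω] {P : Measure Ω}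
    [IsProbabilityMeasure P] {N M : ℕ → ℕ} (hN : Tendsto N atTop atTop)
    (hM : Tendsto M atTop atTop) {ζ : ∀ n, Fin (N n) × Fin (M n) → Ω → ℝ}
    {ρ : ∀ n, Fin (N n) × Fin (M n) → Fin (N n) × Fin (M n) → ℝ}
    (hG : ∀ n, IsCenteredGaussian P (ζ n) (ρ n)) {d r : ℤ × ℤ → ℝ}
    (hd : Summable fun w => d w ^ 2) (hd0 : ∀ w, 0 ≤ d w)
    (hbound : ∀ᶠ n in atTop, ∀ a b, |ρ n a b| ≤ d (boxLag a b))
    (hlim : ∀ w, ∀ ε > 0, ∀ᶠ n in atTop, ∀ a b, boxLag a b = w → |ρ n a b - r w| ≤ ε)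
    (hbias : ∀ ε > 0, ∀ᶠ n in atTop, ∀ a, |ρ n a a - 1| ≤ ε / √((M n : ℝ) * N n))
    {s : ℝ} (hs : 0 ≤ s) :
    TendstoInDistribution (fun n ω => √((M n : ℝ) * N n) *
        (s * (1 / ((M n : ℝ) * N n) * ∑ a, ζ n a ω ^ 2) - s)) atTop (id : ℝ → ℝ)
      (fun _ => P) (gaussianReal 0 (2 * (∑' w, r w ^ 2) * s ^ 2).toNNReal) := by
  set q : ℕ → ℝ := fun n => √((M n : ℝ) * N n) with hq
  have hq2 : ∀ n, q n ^ 2 = (M n : ℝ) * N n := fun n => Real.sq_sqrt (by positivity)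
  have hq0 : ∀ᶠ n in atTop, 0 < q n := by
    filter_upwards [hN.eventually_gt_atTop 0, hM.eventually_gt_atTop 0] with n h1 h2
    have h1' : (0 : ℝ) < N n := by exact_mod_cast h1
    have h2' : (0 : ℝ) < M n := by exact_mod_cast h2
    exact Real.sqrt_pos.2 (by positivity)
  have hsq : ∀ n, √(s / q n) ^ 2 = s / q n := fun n => Real.sq_sqrt (by positivity)
  have hmain := tendstoInDistribution_sum_sq_of_row_sums (τ := fun n => q n * s)
    (v := 2 * (∑' w, r w ^ 2) * s ^ 2) (fun n => (hG n).const_mul √(s / q n)) ?_ ?_ ?_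
  · convert hmain using 3 with n ω
    simp_rw [mul_pow, hsq, ← Finset.mul_sum]
    change q n * _ = _
    rw [← hq2]
    rcases eq_or_ne (q n) 0 with h | h
    · simp [h]
    · field_simp
  · simp_rw [hsq]
    rw [Metric.tendsto_nhds]
    intro ε hε
    filter_upwards [hbias (ε / (s + 1)) (by positivity), hq0] with n hn hqn
    have h1 : ∑ a, s / q n * ρ n a a - q n * s = s / q n * ∑ a, (ρ n a a - 1) := by
      rw [Finset.sum_sub_distrib, ← Finset.mul_sum]
      simp only [Finset.sum_const, Finset.card_univ, Fintype.card_prod, Fintype.card_fin,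
        nsmul_eq_mul, mul_one, Nat.cast_mul]
      rw [mul_comm (N n : ℝ), ← hq2]
      field_simp
    have h2 : |∑ a, (ρ n a a - 1)| ≤ q n ^ 2 * (ε / (s + 1) / q n) := by
      refine (Finset.abs_sum_le_sum_abs _ _).trans ((Finset.sum_le_sum fun a _ => hn a).trans ?_)
      simp only [Finset.sum_const, Finset.card_univ, Fintype.card_prod, Fintype.card_fin,
        nsmul_eq_mul, Nat.cast_mul]
      rw [hq2, mul_comm (N n : ℝ)]
    rw [dist_zero_right, Real.norm_eq_abs, h1, abs_mul, abs_of_nonneg (by positivity)]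
    refine (mul_le_mul_of_nonneg_left h2 (by positivity)).trans_lt ?_
    have h3 : s / q n * (q n ^ 2 * (ε / (s + 1) / q n)) = ε * (s / (s + 1)) := by
      field_simp
    rw [h3]
    refine mul_lt_of_lt_one_right hε ?_
    rw [div_lt_one (by positivity)]
    linarith
  · have hsum := tendsto_box_sum hN hM (f := fun n a b => ρ n a b ^ 2) (r := fun w => r w ^ 2) hd
      (fun w => sq_nonneg _) (by
        filter_upwards [hbound] with n hn a b
        rw [abs_pow]
        exact pow_le_pow_left₀ (abs_nonneg _) (hn a b) 2) (fun w ε hε => by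
        filter_upwards [hbound, hlim w (ε / (d w + |r w| + 1)) (by
          have := hd0 w
          positivity)] with n hn1 hn2 a b hab
        have h1 : |ρ n a b + r w| ≤ d w + |r w| + 1 := by
          have := hn1 a b
          rw [hab] at this
          linarith [abs_add_le (ρ n a b) (r w)]
        have h0 : 0 < d w + |r w| + 1 := by
          have := hd0 w
          positivity
        rw [sq_sub_sq, abs_mul]
        calc _ ≤ (d w + |r w| + 1) * (ε / (d w + |r w| + 1)) :=
              mul_le_mul h1 (hn2 a b hab) (abs_nonneg _) h0.le
          _ = ε := by field_simp)
    refine ((hsum.const_mul 2).mul_const (s ^ 2)).congr' ?_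
    filter_upwards [hq0] with n hqn
    simp_rw [mul_pow (√(s / q n) ^ 2), hsq, ← Finset.mul_sum]
    rw [← hq2]
    field_simp
  · intro ε hε
    filter_upwards [hbound, eventually_row_sum_le hN hM hd hd0 (ε := ε / (s + 1)) (by positivity),
      hq0] with n hn1 hn2 hqn a
    have h1 : ∀ b, |√(s / q n) ^ 2 * ρ n a b| ≤ s / q n * d (boxLag a b) := by
      intro b
      rw [hsq, abs_mul, abs_of_nonneg (by positivity)]
      exact mul_le_mul_of_nonneg_left (hn1 a b) (by positivity)
    refine (Finset.sum_le_sum fun b _ => h1 b).trans ?_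
    rw [← Finset.mul_sum]
    refine (mul_le_mul_of_nonneg_left (hn2 a) (by positivity)).trans ?_
    have h3 : s / q n * (ε / (s + 1) * q n) = ε * (s / (s + 1)) := by
      field_simp
    rw [h3]
    refine mul_le_of_le_one_right hε.le ?_
    rw [div_le_one (by positivity)]
    linarith

end Box

/-! ### Bounds for the Gaussian heat kernel -/

section HeatKernel

/-- The heat kernel `(4 π s)^{-1/2} exp(-z² / (4 s))`. -/
noncomputable def heatKer (s z : ℝ) : ℝ := (√(4 * Real.pi * s))⁻¹ * Real.exp (-(z ^ 2 / (4 * s)))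

theorem exp_neg_le_sq {x : ℝ} (hx : 0 ≤ x) : Real.exp (-x) ≤ 4 / (1 + x) ^ 2 := by
  have h1 : (1 + x / 2) ≤ Real.exp (x / 2) := by linarith [Real.add_one_le_exp (x / 2)]
  have h2 : (1 + x / 2) ^ 2 ≤ Real.exp x := by
    calc _ ≤ Real.exp (x / 2) ^ 2 := pow_le_pow_left₀ (by positivity) h1 2
      _ = Real.exp x := by rw [← Real.exp_nat_mul]; congr 1; push_cast; ring
  rw [Real.exp_neg, inv_le_comm₀ (Real.exp_pos _) (by positivity), inv_div]
  refine le_trans ?_ h2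
  nlinarith

theorem inv_sqrt_four_pi_mul_le {s : ℝ} (hs : 0 < s) :
    (√(4 * Real.pi * s))⁻¹ ≤ 1 / 2 * (√s)⁻¹ := by
  rw [show 4 * Real.pi * s = 4 * (Real.pi * s) by ring, Real.sqrt_mul (by norm_num),
    show √(4 : ℝ) = 2 by rw [show (4 : ℝ) = 2 ^ 2 by norm_num]; exact Real.sqrt_sq (by norm_num),
    mul_inv, one_div]
  refine mul_le_mul_of_nonneg_left ?_ (by norm_num)
  refine inv_anti₀ (Real.sqrt_pos.2 hs) (Real.sqrt_le_sqrt ?_)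
  nlinarith [Real.pi_gt_three]

theorem heatKer_nonneg (s z : ℝ) : 0 ≤ heatKer s z := by
  unfold heatKer; positivity

theorem heatKer_neg (s z : ℝ) : heatKer s (-z) = heatKer s z := by
  unfold heatKer; rw [neg_sq]

theorem heatKer_le_inv_sqrt {s : ℝ} (hs : 0 < s) (z : ℝ) : heatKer s z ≤ 1 / 2 * (√s)⁻¹ := by
  refine (mul_le_of_le_one_right (by positivity) (Real.exp_le_one_iff.2 ?_)).trans
    (inv_sqrt_four_pi_mul_le hs)
  have : 0 ≤ z ^ 2 / (4 * s) := by positivity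
  linarith

theorem inv_one_add_le {s : ℝ} (hs : 0 < s) (z : ℝ) :
    (1 + z ^ 2 / (4 * s))⁻¹ ≤ 4 * s / (s + z ^ 2) := by
  have h : 1 + z ^ 2 / (4 * s) = (4 * s + z ^ 2) / (4 * s) := by field_simp
  rw [h, inv_div]
  exact div_le_div_of_nonneg_left (by positivity) (by positivity) (by linarith)

theorem heatKer_le {s : ℝ} (hs : 0 < s) (z : ℝ) : heatKer s z ≤ 2 * √s / (s + z ^ 2) := by
  have hx : 0 ≤ z ^ 2 / (4 * s) := by positivity
  have h1 : Real.exp (-(z ^ 2 / (4 * s))) ≤ (1 + z ^ 2 / (4 * s))⁻¹ := by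
    rw [Real.exp_neg]
    exact inv_anti₀ (by positivity) (by linarith [Real.add_one_le_exp (z ^ 2 / (4 * s))])
  calc heatKer s z ≤ (1 / 2 * (√s)⁻¹) * (4 * s / (s + z ^ 2)) :=
        mul_le_mul (inv_sqrt_four_pi_mul_le hs) (h1.trans (inv_one_add_le hs z)) (by positivity)
          (by positivity)
    _ = 2 * √s / (s + z ^ 2) := by
        have : √s ≠ 0 := (Real.sqrt_pos.2 hs).ne'
        field_simp
        rw [Real.sq_sqrt hs.le]
        ring

theorem hasDerivAt_heatKer {s : ℝ} (hs : 0 < s) (z : ℝ) :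
    HasDerivAt (heatKer s) (-(z / (2 * s)) * heatKer s z) z := by
  have h1 : HasDerivAt (fun z : ℝ => -(z ^ 2 / (4 * s))) (-(2 * z / (4 * s))) z := by
    simpa using ((hasDerivAt_pow 2 z).div_const (4 * s)).fun_neg
  refine (h1.exp.const_mul (√(4 * Real.pi * s))⁻¹).congr_deriv ?_
  unfold heatKer
  field_simp
  ring

theorem hasDerivAt_deriv_heatKer {s : ℝ} (hs : 0 < s) (z : ℝ) :
    HasDerivAt (fun z => -(z / (2 * s)) * heatKer s z)
      ((z ^ 2 / (4 * s) - 1 / 2) / s * heatKer s z) z := by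
  have h1 : HasDerivAt (fun z : ℝ => -(z / (2 * s))) (-(1 / (2 * s))) z := by
    simpa using ((hasDerivAt_id z).div_const (2 * s)).fun_neg
  refine (h1.fun_mul (hasDerivAt_heatKer hs z)).congr_deriv ?_
  field_simp
  ring

theorem hasDerivAt_heatKer_time {s : ℝ} (hs : 0 < s) (z : ℝ) :
    HasDerivAt (fun s => heatKer s z) ((z ^ 2 / (4 * s) - 1 / 2) / s * heatKer s z) s := by
  have hpos : 0 < 4 * Real.pi * s := by positivity
  have h1 : HasDerivAt (fun s : ℝ => 4 * Real.pi * s) (4 * Real.pi) s := by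
    simpa using (hasDerivAt_id s).const_mul (4 * Real.pi)
  have h2 := (h1.sqrt hpos.ne').fun_inv (Real.sqrt_pos.2 hpos).ne'
  have h3 : HasDerivAt (fun s : ℝ => -(z ^ 2 / (4 * s))) (z ^ 2 / (4 * s ^ 2)) s := by
    have h4 := ((hasDerivAt_inv hs.ne').const_mul (z ^ 2 / 4)).fun_neg
    have h5 : (fun s : ℝ => -(z ^ 2 / (4 * s))) = fun s => -(z ^ 2 / 4 * s⁻¹) := by
      funext s; rw [← div_eq_mul_inv, div_div]
    rw [h5]
    exact h4.congr_deriv (by field_simp)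
  refine (h2.fun_mul h3.exp).congr_deriv ?_
  unfold heatKer
  rw [Real.sq_sqrt hpos.le]
  have : √(4 * Real.pi * s) ≠ 0 := (Real.sqrt_pos.2 hpos).ne'
  field_simp
  ring

theorem abs_deriv_heatKer_le {s : ℝ} (hs : 0 < s) (z : ℝ) :
    |-(z / (2 * s)) * heatKer s z| ≤ 8 / (s + z ^ 2) := by
  set x := z ^ 2 / (4 * s) with hx
  have hx0 : 0 ≤ x := by positivity
  have h1 : |z| / (2 * √s) ≤ 1 + x := by
    have h2 : (|z| / (2 * √s)) ^ 2 = x := by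
      rw [div_pow, sq_abs, mul_pow, Real.sq_sqrt hs.le, hx]; norm_num
    nlinarith [sq_nonneg (|z| / (2 * √s) - 1)]
  have hss : √s * √s = s := Real.mul_self_sqrt hs.le
  have hs0 : 0 < √s := Real.sqrt_pos.2 hs
  have h3 : |-(z / (2 * s)) * heatKer s z| = (|z| / (2 * √s)) * ((√s)⁻¹ * heatKer s z) := by
    rw [abs_mul, abs_neg, abs_div, abs_of_nonneg (heatKer_nonneg s z),
      abs_of_pos (by positivity : 0 < 2 * s)]
    nth_rewrite 1 [← hss]
    field_simp
  rw [h3]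
  have h4 : heatKer s z ≤ 1 / 2 * (√s)⁻¹ * (4 / (1 + x) ^ 2) :=
    mul_le_mul (inv_sqrt_four_pi_mul_le hs) (exp_neg_le_sq hx0) (by positivity) (by positivity)
  calc (|z| / (2 * √s)) * ((√s)⁻¹ * heatKer s z)
      ≤ (1 + x) * ((√s)⁻¹ * (1 / 2 * (√s)⁻¹ * (4 / (1 + x) ^ 2))) := by
        refine mul_le_mul h1 (by gcongr) ?_ (by positivity)
        exact mul_nonneg (by positivity) (heatKer_nonneg s z)
    _ = 2 / s * (1 + x)⁻¹ := by
        have : (1 + x) ≠ 0 := by positivity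
        field_simp
        rw [Real.sq_sqrt hs.le]
        ring
    _ ≤ 2 / s * (4 * s / (s + z ^ 2)) := by gcongr; exact inv_one_add_le hs z
    _ = 8 / (s + z ^ 2) := by field_simp; ring

theorem abs_deriv_deriv_heatKer_le {s : ℝ} (hs : 0 < s) (z : ℝ) :
    |(z ^ 2 / (4 * s) - 1 / 2) / s * heatKer s z| ≤ 8 * (√s)⁻¹ / (s + z ^ 2) := by
  set x := z ^ 2 / (4 * s) with hx
  have hx0 : 0 ≤ x := by positivity
  have hs0 : 0 < √s := Real.sqrt_pos.2 hs
  have h4 : heatKer s z ≤ 1 / 2 * (√s)⁻¹ * (4 / (1 + x) ^ 2) :=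
    mul_le_mul (inv_sqrt_four_pi_mul_le hs) (exp_neg_le_sq hx0) (by positivity) (by positivity)
  rw [abs_mul, abs_div, abs_of_nonneg (heatKer_nonneg s z), abs_of_pos hs]
  have h5 : |x - 1 / 2| ≤ 1 + x := by rw [abs_le]; constructor <;> linarith
  calc |x - 1 / 2| / s * heatKer s z
      ≤ (1 + x) / s * (1 / 2 * (√s)⁻¹ * (4 / (1 + x) ^ 2)) := by
        gcongr
        exact heatKer_nonneg s z
    _ = 2 / s * (√s)⁻¹ * (1 + x)⁻¹ := by
        have : (1 + x) ≠ 0 := by positivity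
        field_simp
        ring
    _ ≤ 2 / s * (√s)⁻¹ * (4 * s / (s + z ^ 2)) := by gcongr; exact inv_one_add_le hs z
    _ = 8 * (√s)⁻¹ / (s + z ^ 2) := by field_simp; ring

theorem abs_heatKer_sub_le {s δ z B : ℝ} (hs : 0 < s) (hδ : 0 ≤ δ)
    (hB : ∀ x, |x - z| ≤ δ → |-(x / (2 * s)) * heatKer s x| ≤ B) {y : ℝ} (hy : |y - z| ≤ δ) :
    |heatKer s y - heatKer s z| ≤ B * |y - z| := by
  have hconv : Convex ℝ (Metric.closedBall z δ) := convex_closedBall z δ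
  exact hconv.norm_image_sub_le_of_norm_hasDerivWithin_le (f := heatKer s)
    (fun x hx => (hasDerivAt_heatKer hs x).hasDerivWithinAt)
    (fun x hx => hB x (by rwa [Metric.mem_closedBall, Real.dist_eq] at hx))
    (Metric.mem_closedBall_self hδ) (by rwa [Metric.mem_closedBall, Real.dist_eq])

theorem abs_second_diff_heatKer_le {s δ z B : ℝ} (hs : 0 < s) (hδ : 0 ≤ δ)
    (hB : ∀ x, |x - z| ≤ δ → |(x ^ 2 / (4 * s) - 1 / 2) / s * heatKer s x| ≤ B) :
    |heatKer s (z + δ) + heatKer s (z - δ) - 2 * heatKer s z| ≤ 2 * B * δ ^ 2 := by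
  have hconv : Convex ℝ (Metric.closedBall z δ) := convex_closedBall z δ
  set f' : ℝ → ℝ := fun x => -(x / (2 * s)) * heatKer s x
  have hB0 : 0 ≤ B := (abs_nonneg _).trans (hB z (by simpa using hδ))
  have h1 : ∀ t ∈ Set.Icc (0 : ℝ) δ, |f' (z + t) - f' (z - t)| ≤ 2 * B * δ := by
    intro t ht
    have hm : ∀ e : ℝ, |e| ≤ δ → z + e ∈ Metric.closedBall z δ := fun e he => by
      rw [Metric.mem_closedBall, Real.dist_eq]; simpa using he
    have h2 := hconv.norm_image_sub_le_of_norm_hasDerivWithin_le (f := f')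
      (fun x hx => (hasDerivAt_deriv_heatKer hs x).hasDerivWithinAt)
      (fun x hx => hB x (by rwa [Metric.mem_closedBall, Real.dist_eq] at hx))
      (hm (-t) (by rw [abs_neg, abs_of_nonneg ht.1]; exact ht.2))
      (hm t (by rw [abs_of_nonneg ht.1]; exact ht.2))
    rw [Real.norm_eq_abs, Real.norm_eq_abs, ← sub_eq_add_neg] at h2
    refine h2.trans ?_
    rw [show z + t - (z - t) = 2 * t by ring, abs_of_nonneg (by linarith [ht.1])]
    nlinarith [ht.2]
  have h3 : ∀ t ∈ Set.Icc (0 : ℝ) δ, HasDerivWithinAt (fun t => heatKer s (z + t) + heatKer s (z - t))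
      (f' (z + t) - f' (z - t)) (Set.Icc 0 δ) t := by
    intro t _
    have ha : HasDerivAt (fun t => heatKer s (z + t)) (f' (z + t)) t :=
      (hasDerivAt_heatKer hs (z + t)).comp_const_add z t
    have hb : HasDerivAt (fun t => heatKer s (z - t)) (-f' (z - t)) t :=
      (hasDerivAt_heatKer hs (z - t)).comp_const_sub z t
    exact ((ha.fun_add hb).congr_deriv (by ring)).hasDerivWithinAt
  have h4 := (convex_Icc (0 : ℝ) δ).norm_image_sub_le_of_norm_hasDerivWithin_le h3 h1
    (Set.left_mem_Icc.2 hδ) (Set.right_mem_Icc.2 hδ)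
  simp only [Real.norm_eq_abs, add_zero, sub_zero, abs_of_nonneg hδ] at h4
  calc _ = |heatKer s (z + δ) + heatKer s (z - δ) - (heatKer s z + heatKer s z)| := by
        congr 1; ring
    _ ≤ _ := h4
    _ = _ := by ring

end HeatKernel

section HeatKernelDifferences

theorem abs_second_diff_heatKer_le_div {s δ : ℝ} (hs : 0 < s) (hδ : 0 < δ) (z : ℝ) :
    |heatKer s (z + δ) + heatKer s (z - δ) - 2 * heatKer s z| ≤
      96 * δ ^ 2 * (√s)⁻¹ / (s + δ ^ 2 + z ^ 2) := by
  have hi : 0 < (√s)⁻¹ := inv_pos.2 (Real.sqrt_pos.2 hs)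
  have hD : 0 < s + δ ^ 2 + z ^ 2 := by positivity
  rcases le_or_gt (2 * δ) |z| with hz | hz
  · have hz2 : 4 * δ ^ 2 ≤ z ^ 2 := by
      rw [← sq_abs z]; nlinarith
    have h1 := abs_second_diff_heatKer_le (B := 32 * (√s)⁻¹ / (s + z ^ 2)) (z := z) hs hδ.le
      fun x hx => by
        refine (abs_deriv_deriv_heatKer_le hs x).trans ?_
        have h2 : |z| / 2 ≤ |x| := by
          have := abs_sub_abs_le_abs_sub z x
          rw [abs_sub_comm] at this
          linarith
        have h3 : z ^ 2 / 4 ≤ x ^ 2 := by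
          rw [← sq_abs z, ← sq_abs x]
          nlinarith [abs_nonneg z]
        rw [div_le_div_iff₀ (by positivity) (by positivity)]
        nlinarith
    refine h1.trans ?_
    rw [← mul_div_assoc, div_mul_eq_mul_div, div_le_div_iff₀ (by positivity) hD]
    have : 0 < δ ^ 2 * (√s)⁻¹ := by positivity
    nlinarith
  · have hz2 : z ^ 2 ≤ 4 * δ ^ 2 := by
      rw [← sq_abs z]; nlinarith [abs_nonneg z]
    rcases le_or_gt (δ ^ 2) s with hsd | hsd
    · have h1 := abs_second_diff_heatKer_le (B := 8 * (√s)⁻¹ / s) (z := z) hs hδ.le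
        fun x hx => by
          refine (abs_deriv_deriv_heatKer_le hs x).trans ?_
          exact div_le_div_of_nonneg_left (by positivity) hs (by nlinarith [sq_nonneg x])
      refine h1.trans ?_
      rw [← mul_div_assoc, div_mul_eq_mul_div, div_le_div_iff₀ hs hD]
      have : 0 < δ ^ 2 * (√s)⁻¹ := by positivity
      nlinarith
    · have h1 := heatKer_le_inv_sqrt hs (z + δ)
      have h2 := heatKer_le_inv_sqrt hs (z - δ)
      have h3 := heatKer_le_inv_sqrt hs z
      have h4 := heatKer_nonneg s (z + δ)
      have h5 := heatKer_nonneg s (z - δ)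
      have h6 := heatKer_nonneg s z
      have h7 : |heatKer s (z + δ) + heatKer s (z - δ) - 2 * heatKer s z| ≤ (√s)⁻¹ := by
        rw [abs_le]; constructor <;> linarith
      refine h7.trans ?_
      rw [le_div_iff₀ hD]
      nlinarith

theorem abs_symm_diff_heatKer_le {s δ T : ℝ} (hs : 0 < s) (hsT : s ≤ T) (hδ : 0 < δ) (hδ1 : δ ≤ 1)
    (z : ℝ) :
    |heatKer s (z - δ) - heatKer s (z + δ)| ≤
      (96 * √T + 6) * δ * (√s)⁻¹ / (s + δ ^ 2 + z ^ 2) := by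
  have hs0 : 0 < √s := Real.sqrt_pos.2 hs
  have hi : 0 < (√s)⁻¹ := inv_pos.2 hs0
  have hD : 0 < s + δ ^ 2 + z ^ 2 := by positivity
  have hT : 1 ≤ √T * (√s)⁻¹ := by
    rw [← div_eq_mul_inv, one_le_div hs0]; exact Real.sqrt_le_sqrt hsT
  have key : ∀ B : ℝ, 0 ≤ B → (∀ x, |x - z| ≤ δ → |-(x / (2 * s)) * heatKer s x| ≤ B) →
      |heatKer s (z - δ) - heatKer s (z + δ)| ≤ 2 * B * δ := by
    intro B hB0 hB
    have h1 := abs_heatKer_sub_le hs hδ.le hB (y := z - δ) (by simp [abs_of_pos hδ])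
    have h2 := abs_heatKer_sub_le hs hδ.le hB (y := z + δ) (by simp [abs_of_pos hδ])
    rw [show z - δ - z = -δ by ring, abs_neg, abs_of_pos hδ] at h1
    rw [show z + δ - z = δ by ring, abs_of_pos hδ] at h2
    have := abs_sub_le (heatKer s (z - δ)) (heatKer s z) (heatKer s (z + δ))
    rw [abs_sub_comm (heatKer s z)] at this
    linarith
  rcases le_or_gt (2 * δ) |z| with hz | hz
  · have hz2 : 4 * δ ^ 2 ≤ z ^ 2 := by
      rw [← sq_abs z]; nlinarith
    have h1 := key (32 / (s + z ^ 2)) (by positivity)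
      fun x hx => by
        refine (abs_deriv_heatKer_le hs x).trans ?_
        have h2 : |z| / 2 ≤ |x| := by
          have := abs_sub_abs_le_abs_sub z x
          rw [abs_sub_comm] at this
          linarith
        have h3 : z ^ 2 / 4 ≤ x ^ 2 := by
          rw [← sq_abs z, ← sq_abs x]
          nlinarith [abs_nonneg z]
        rw [div_le_div_iff₀ (by positivity) (by positivity)]
        nlinarith
    calc _ ≤ 2 * (32 / (s + z ^ 2)) * δ := h1
      _ ≤ 96 * δ / (s + δ ^ 2 + z ^ 2) := by
        rw [← mul_div_assoc, div_mul_eq_mul_div, div_le_div_iff₀ (by positivity) hD]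
        nlinarith
      _ ≤ _ := by
        gcongr ?_ / _
        nlinarith [mul_pos hδ hi]
  · have hz2 : z ^ 2 ≤ 4 * δ ^ 2 := by
      rw [← sq_abs z]; nlinarith [abs_nonneg z]
    rcases le_or_gt (δ ^ 2) s with hsd | hsd
    · have h1 := key (8 / s) (by positivity)
        fun x hx => by
          refine (abs_deriv_heatKer_le hs x).trans ?_
          exact div_le_div_of_nonneg_left (by positivity) hs (by nlinarith [sq_nonneg x])
      calc _ ≤ 2 * (8 / s) * δ := h1
        _ ≤ 96 * δ / (s + δ ^ 2 + z ^ 2) := by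
          rw [← mul_div_assoc, div_mul_eq_mul_div, div_le_div_iff₀ (by positivity) hD]
          nlinarith
        _ ≤ _ := by
          gcongr ?_ / _
          nlinarith [mul_pos hδ hi]
    · have h1 := heatKer_le_inv_sqrt hs (z + δ)
      have h2 := heatKer_le_inv_sqrt hs (z - δ)
      have h4 := heatKer_nonneg s (z + δ)
      have h5 := heatKer_nonneg s (z - δ)
      have h7 : |heatKer s (z - δ) - heatKer s (z + δ)| ≤ (√s)⁻¹ := by
        rw [abs_le]; constructor <;> linarith
      refine h7.trans ?_
      rw [le_div_iff₀ hD]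
      have h8 : s + δ ^ 2 + z ^ 2 ≤ 6 * δ := by nlinarith
      have h9 : 0 ≤ 96 * √T * δ := by positivity
      nlinarith

theorem heatKer_le_div {s δ T : ℝ} (hs : 0 < s) (hsT : s ≤ T) (hδ1 : δ ^ 2 ≤ 1) (z : ℝ) :
    heatKer s z ≤ (4 * T + 2) * (√s)⁻¹ / (s + δ ^ 2 + z ^ 2) := by
  have hs0 : 0 < √s := Real.sqrt_pos.2 hs
  have hi : 0 < (√s)⁻¹ := inv_pos.2 hs0
  have hD : 0 < s + δ ^ 2 + z ^ 2 := by positivity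
  rcases le_or_gt (δ ^ 2) (s + z ^ 2) with h | h
  · have h1 : 2 * √s = 2 * s * (√s)⁻¹ := by
      have := Real.mul_self_sqrt hs.le
      field_simp
      nlinarith
    refine (heatKer_le hs z).trans ?_
    rw [h1, div_le_div_iff₀ (by positivity) hD]
    have h3 : 2 * s * (s + δ ^ 2 + z ^ 2) ≤ (4 * T + 2) * (s + z ^ 2) := by
      have : 0 ≤ s + z ^ 2 := by positivity
      nlinarith
    nlinarith
  · refine (heatKer_le_inv_sqrt hs z).trans ?_
    rw [le_div_iff₀ hD]
    nlinarith [hs.le.trans hsT]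

theorem abs_heatKer_time_sub_le {s η : ℝ} (hs : 0 < s) (hη : 0 ≤ η) (z : ℝ) :
    |heatKer (s + η) z - heatKer s z| ≤ 8 * η * (√s)⁻¹ / (s + z ^ 2) := by
  have h := (convex_Icc s (s + η)).norm_image_sub_le_of_norm_hasDerivWithin_le
    (f := fun s => heatKer s z) (C := 8 * (√s)⁻¹ / (s + z ^ 2))
    (fun x hx => (hasDerivAt_heatKer_time (hs.trans_le hx.1) z).hasDerivWithinAt)
    (fun x hx => by
      have hx0 := hs.trans_le hx.1
      have hs0 : 0 < √s := Real.sqrt_pos.2 hs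
      refine (abs_deriv_deriv_heatKer_le hx0 z).trans ?_
      gcongr <;> exact hx.1)
    (Set.left_mem_Icc.2 (by linarith)) (Set.right_mem_Icc.2 (by linarith))
  rw [Real.norm_eq_abs, Real.norm_eq_abs, add_sub_cancel_left, abs_of_nonneg hη] at h
  exact h.trans (le_of_eq (by ring))

theorem abs_corner_minus_le {s δ T α K : ℝ} (hs : 0 < s) (hsT : s ≤ T) (hδ : 0 < δ) (hδ1 : δ ≤ 1)
    (hα0 : 0 ≤ α) (hαK : α ≤ K) (hα : |1 - α| ≤ K * δ) (z : ℝ) :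
    |(1 + α ^ 2) * heatKer s z - α * heatKer s (z + δ) - α * heatKer s (z - δ)| ≤
      (96 * K + K ^ 2 * (4 * T + 2)) * δ ^ 2 * (√s)⁻¹ / (s + δ ^ 2 + z ^ 2) := by
  have h1 := abs_second_diff_heatKer_le_div hs hδ z
  have h2 := heatKer_le_div hs hsT (pow_le_one₀ hδ.le hδ1 : δ ^ 2 ≤ 1) z
  have h3 := heatKer_nonneg s z
  have hα2 : (1 - α) ^ 2 ≤ K ^ 2 * δ ^ 2 := by
    rw [← sq_abs, ← mul_pow]; exact pow_le_pow_left₀ (abs_nonneg _) hα 2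
  rw [show (1 + α ^ 2) * heatKer s z - α * heatKer s (z + δ) - α * heatKer s (z - δ) =
    -(α * (heatKer s (z + δ) + heatKer s (z - δ) - 2 * heatKer s z)) +
      (1 - α) ^ 2 * heatKer s z by ring]
  refine (abs_add_le _ _).trans ?_
  rw [abs_neg, abs_mul, abs_of_nonneg hα0, abs_mul, abs_of_nonneg h3, abs_of_nonneg (sq_nonneg (1 - α))]
  have h4 := mul_le_mul hαK h1 (abs_nonneg _) (hα0.trans hαK)
  have h5 := mul_le_mul hα2 h2 h3 (by positivity)
  refine (add_le_add h4 h5).trans (le_of_eq (by ring))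

theorem abs_corner_plus_le {s δ T α K : ℝ} (hs : 0 < s) (hsT : s ≤ T) (hδ : 0 < δ) (hδ1 : δ ≤ 1)
    (hα0 : 0 ≤ α) (hαK : α ≤ K) (hα : |1 - α| ≤ K * δ) (z : ℝ) :
    |α ^ 2 * heatKer s (z + δ) + heatKer s (z - δ) - 2 * α * heatKer s z| ≤
      (96 * K + K * (96 * √T + 6) + 3 * K ^ 2 * (4 * T + 2)) * δ ^ 2 * (√s)⁻¹ /
        (s + δ ^ 2 + z ^ 2) := by
  have h1 := abs_second_diff_heatKer_le_div hs hδ z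
  have h2 := heatKer_le_div hs hsT (pow_le_one₀ hδ.le hδ1 : δ ^ 2 ≤ 1) (z + δ)
  have h3 := heatKer_nonneg s (z + δ)
  have h6 := abs_symm_diff_heatKer_le hs hsT hδ hδ1 z
  have hi : 0 < (√s)⁻¹ := inv_pos.2 (Real.sqrt_pos.2 hs)
  have h2' : heatKer s (z + δ) ≤ 3 * (4 * T + 2) * (√s)⁻¹ / (s + δ ^ 2 + z ^ 2) := by
    refine h2.trans ?_
    rw [div_le_div_iff₀ (by positivity) (by positivity)]
    have hT : 0 ≤ (4 * T + 2) * (√s)⁻¹ := by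
      have := hs.trans_le hsT
      positivity
    have : s + δ ^ 2 + z ^ 2 ≤ 3 * (s + δ ^ 2 + (z + δ) ^ 2) := by
      nlinarith [sq_nonneg (z + 2 * δ), sq_nonneg (2 * z + 3 * δ), sq_nonneg (z + δ)]
    calc _ ≤ (4 * T + 2) * (√s)⁻¹ * (3 * (s + δ ^ 2 + (z + δ) ^ 2)) := by gcongr
      _ = _ := by ring
  have hα2 : (1 - α) ^ 2 ≤ K ^ 2 * δ ^ 2 := by
    rw [← sq_abs, ← mul_pow]; exact pow_le_pow_left₀ (abs_nonneg _) hα 2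
  rw [show α ^ 2 * heatKer s (z + δ) + heatKer s (z - δ) - 2 * α * heatKer s z =
    α * (heatKer s (z + δ) + heatKer s (z - δ) - 2 * heatKer s z) +
      (1 - α) * (heatKer s (z - δ) - heatKer s (z + δ)) + (1 - α) ^ 2 * heatKer s (z + δ) by ring]
  refine (abs_add_three _ _ _).trans ?_
  rw [abs_mul, abs_of_nonneg hα0, abs_mul, abs_mul, abs_of_nonneg h3, abs_of_nonneg (sq_nonneg (1 - α))]
  have h4 := mul_le_mul hαK h1 (abs_nonneg _) (hα0.trans hαK)
  have h5 := mul_le_mul hα2 h2' h3 (by positivity)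
  have h7 := mul_le_mul hα h6 (abs_nonneg _) (mul_nonneg (hα0.trans hαK) hδ.le)
  refine (add_le_add (add_le_add h4 h7) h5).trans (le_of_eq (by ring))

end HeatKernelDifferences

section Images

theorem summable_int_inv_one_add_sq : Summable fun m : ℤ => (1 + (m : ℝ) ^ 2)⁻¹ := by
  refine Summable.of_norm_bounded_eventually
    (Real.summable_one_div_int_pow.2 (by norm_num : 1 < 2)) ?_
  rw [Filter.eventually_cofinite]
  refine (Set.finite_singleton (0 : ℤ)).subset fun m hm => ?_
  by_contra h
  apply hm
  have : (m : ℝ) ≠ 0 := by exact_mod_cast h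
  rw [Real.norm_eq_abs, abs_of_pos (by positivity), one_div]
  exact inv_anti₀ (by positivity) (by linarith)

/-- The constant `∑_{m ∈ ℤ} 1 / (1 + m²)`. -/
noncomputable def imageConst : ℝ := ∑' m : ℤ, (1 + (m : ℝ) ^ 2)⁻¹

theorem imageConst_nonneg : 0 ≤ imageConst := tsum_nonneg fun m => by positivity

theorem abs_image_le {F : ℝ → ℝ} {A A₀ B r z : ℝ} (hA : 0 < A) (hA₀ : A ≤ A₀)
    (hF : ∀ w, |F w| ≤ B / (A + w ^ 2)) (hz : |z| ≤ 2) (hr : 0 ≤ r) (hrz : r ≤ |z|)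
    (hrz' : r ≤ 2 - |z|) (m : ℤ) :
    |F (z + 2 * m)| ≤ 2 * B * (1 + A₀) / (A + r ^ 2) * (1 + (m : ℝ) ^ 2)⁻¹ := by
  have hB : 0 ≤ B := by
    have h := (abs_nonneg _).trans (hF 0)
    by_contra hB
    exact absurd h (not_le.2 (div_neg_of_neg_of_pos (not_le.1 hB) (by positivity)))
  refine (hF _).trans ?_
  rw [← div_eq_mul_inv, div_div, div_le_div_iff₀ (by positivity) (by positivity)]
  have hr1 : r ≤ 1 := by linarith
  have key : (A + r ^ 2) * (1 + (m : ℝ) ^ 2) ≤ 2 * (1 + A₀) * (A + (z + 2 * m) ^ 2) := by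
    have h1 : A + r ^ 2 ≤ 1 + A₀ := by nlinarith
    have habs : 2 * |(m : ℝ)| - |z| ≤ |z + 2 * m| := by
      have h := abs_sub_abs_le_abs_sub (2 * (m : ℝ)) (-z)
      rw [abs_mul, abs_neg, abs_two, sub_neg_eq_add, add_comm _ z] at h
      exact h
    rcases le_or_gt (2 : ℝ) |(m : ℝ)| with hm | hm
    · have h2 : (m : ℝ) ^ 2 ≤ (z + 2 * m) ^ 2 := sq_le_sq.2 (by linarith)
      have h3 : 1 ≤ (m : ℝ) ^ 2 := by rw [← sq_abs]; nlinarith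
      have h4 : (1 + (m : ℝ) ^ 2) ≤ 2 * (A + (z + 2 * m) ^ 2) := by linarith
      calc _ ≤ (1 + A₀) * (2 * (A + (z + 2 * m) ^ 2)) :=
            mul_le_mul h1 h4 (by positivity) (by linarith)
        _ = _ := by ring
    · have hm1 : |m| ≤ 1 := by
        have : |m| < 2 := by exact_mod_cast (show ((|m| : ℤ) : ℝ) < 2 by rwa [Int.cast_abs])
        omega
      have hm2 : (m : ℝ) ^ 2 ≤ 1 := by
        rw [← sq_abs]
        exact pow_le_one₀ (abs_nonneg _) (by exact_mod_cast hm1)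
      have h3 : r ≤ |z + 2 * m| := by
        by_cases h0 : m = 0
        · simpa [h0] using hrz
        · have : (1 : ℝ) ≤ |(m : ℝ)| := by exact_mod_cast Int.one_le_abs h0
          linarith
      have h4 : r ^ 2 ≤ (z + 2 * m) ^ 2 := by rw [← sq_abs (z + 2 * m)]; gcongr
      have h2 : (A + r ^ 2) * (1 + (m : ℝ) ^ 2) ≤ (A + (z + 2 * m) ^ 2) * 2 :=
        mul_le_mul (by linarith) (by linarith) (by positivity) (by positivity)
      have h3 : 0 ≤ A₀ * (A + (z + 2 * m) ^ 2) := mul_nonneg (hA.le.trans hA₀) (by positivity)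
      linarith
  calc B * ((A + r ^ 2) * (1 + (m : ℝ) ^ 2)) ≤ B * (2 * (1 + A₀) * (A + (z + 2 * m) ^ 2)) := by
        gcongr
    _ = _ := by ring

theorem summable_image {F : ℝ → ℝ} {A B z : ℝ} (hA : 0 < A) (hF : ∀ w, |F w| ≤ B / (A + w ^ 2))
    (hz : |z| ≤ 2) : Summable fun m : ℤ => F (z + 2 * m) :=
  Summable.of_norm_bounded (summable_int_inv_one_add_sq.mul_left _) fun m =>
    abs_image_le hA le_rfl hF hz le_rfl (abs_nonneg z) (by linarith) m

theorem abs_tsum_image_le {F : ℝ → ℝ} {A A₀ B r z : ℝ} (hA : 0 < A) (hA₀ : A ≤ A₀)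
    (hF : ∀ w, |F w| ≤ B / (A + w ^ 2)) (hz : |z| ≤ 2) (hr : 0 ≤ r) (hrz : r ≤ |z|)
    (hrz' : r ≤ 2 - |z|) :
    |∑' m : ℤ, F (z + 2 * m)| ≤ 2 * B * (1 + A₀) / (A + r ^ 2) * imageConst := by
  rw [← Real.norm_eq_abs]
  exact tsum_of_norm_bounded (summable_int_inv_one_add_sq.hasSum.mul_left _) fun m =>
    abs_image_le hA hA₀ hF hz hr hrz hrz' m

theorem abs_tsum_image_sub_le {F : ℝ → ℝ} {A B z : ℝ} (hA : 0 < A)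
    (hF : ∀ w, |F w| ≤ B / (A + w ^ 2)) (hz : |z| ≤ 1) :
    |∑' m : ℤ, F (z + 2 * m) - F z| ≤ 2 * B * imageConst := by
  have hB : 0 ≤ B := by
    have h := (abs_nonneg _).trans (hF 0)
    by_contra hB
    exact absurd h (not_le.2 (div_neg_of_neg_of_pos (not_le.1 hB) (by positivity)))
  rw [(summable_image hA hF (by linarith)).tsum_eq_add_tsum_ite 0]
  simp only [Int.cast_zero, mul_zero, add_zero, add_sub_cancel_left]
  rw [← Real.norm_eq_abs]
  refine tsum_of_norm_bounded (summable_int_inv_one_add_sq.hasSum.mul_left _) fun m => ?_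
  split_ifs with hm
  · rw [norm_zero]; positivity
  · have h1 : (1 : ℝ) ≤ |(m : ℝ)| := by exact_mod_cast Int.one_le_abs hm
    have habs : 2 * |(m : ℝ)| - |z| ≤ |z + 2 * m| := by
      have h := abs_sub_abs_le_abs_sub (2 * (m : ℝ)) (-z)
      rw [abs_mul, abs_neg, abs_two, sub_neg_eq_add, add_comm _ z] at h
      exact h
    have h2 : (m : ℝ) ^ 2 ≤ (z + 2 * m) ^ 2 := sq_le_sq.2 (by linarith)
    have h3 : 1 ≤ (m : ℝ) ^ 2 := by rw [← sq_abs]; nlinarith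
    refine (hF _).trans ?_
    rw [← div_eq_mul_inv, div_le_div_iff₀ (by positivity) (by positivity)]
    nlinarith

end Images

section DirichletKernel

/-- The periodized heat kernel on `ℝ / 2ℤ`. -/
noncomputable def thetaKer (s z : ℝ) : ℝ := ∑' m : ℤ, heatKer s (z + 2 * m)

theorem hasSum_thetaKer {s : ℝ} (hs : 0 < s) (z : ℝ) :
    HasSum (fun m : ℤ => heatKer s (z + 2 * m)) (thetaKer s z) ∧
    HasSum (fun ℓ : ℕ => Real.exp (-(Real.pi ^ 2 * ((ℓ : ℝ) + 1) ^ 2 * s)) *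
      Real.cos (Real.pi * ((ℓ : ℝ) + 1) * z)) (thetaKer s z - 1 / 2) := by
  have ht : 0 < 1 / (Real.pi * s) := by positivity
  have h1 := (HurwitzZeta.hasSum_int_evenKernel (z / 2) ht).mul_left (√(4 * Real.pi * s))⁻¹
  have h2 := HurwitzZeta.hasSum_nat_cosKernel₀ (z / 2) (t := Real.pi * s) (by positivity)
  have h3 := HurwitzZeta.evenKernel_functional_equation (z / 2 : ℝ) (1 / (Real.pi * s))
  rw [one_div_one_div, ← Real.sqrt_eq_rpow] at h3
  have hsq : (√(4 * Real.pi * s))⁻¹ * (1 / √(1 / (Real.pi * s))) = 1 / 2 := by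
    rw [one_div (Real.pi * s), Real.sqrt_inv, one_div, inv_inv,
      show 4 * Real.pi * s = 2 ^ 2 * (Real.pi * s) by ring, Real.sqrt_mul (by norm_num),
      Real.sqrt_sq (by norm_num)]
    have : √(Real.pi * s) ≠ 0 := (Real.sqrt_pos.2 (by positivity)).ne'
    field_simp
  have h4 : HasSum (fun m : ℤ => heatKer s (z + 2 * m))
      (1 / 2 * HurwitzZeta.cosKernel (z / 2 : ℝ) (Real.pi * s)) := by
    rw [h3, ← mul_assoc, hsq] at h1
    refine h1.congr_fun fun m => ?_
    unfold heatKer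
    congr 2
    field_simp
    ring
  have h5 : thetaKer s z = 1 / 2 * HurwitzZeta.cosKernel (z / 2 : ℝ) (Real.pi * s) := h4.tsum_eq
  rw [h5]
  refine ⟨h4, ?_⟩
  have h6 := h2.mul_left (1 / 2)
  rw [mul_sub, mul_one] at h6
  refine h6.congr_fun fun ℓ => ?_
  rw [show 2 * Real.pi * (z / 2) * ((ℓ : ℝ) + 1) = Real.pi * ((ℓ : ℝ) + 1) * z by ring,
    show -Real.pi * ((ℓ : ℝ) + 1) ^ 2 * (Real.pi * s) =
      -(Real.pi ^ 2 * ((ℓ : ℝ) + 1) ^ 2 * s) by ring]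
  ring

/-- The Dirichlet heat kernel on `[0, 1]`, as the sum over the reflected sources. -/
noncomputable def dirKer (s x y : ℝ) : ℝ := thetaKer s (x - y) - thetaKer s (x + y)

theorem hasSum_dirKer {s : ℝ} (hs : 0 < s) (x y : ℝ) :
    HasSum (fun ℓ : ℕ => 2 * Real.sin (Real.pi * ((ℓ : ℝ) + 1) * x) *
      Real.sin (Real.pi * ((ℓ : ℝ) + 1) * y) * Real.exp (-(Real.pi ^ 2 * ((ℓ : ℝ) + 1) ^ 2 * s)))
      (dirKer s x y) := by
  have h := (hasSum_thetaKer hs (x - y)).2.sub (hasSum_thetaKer hs (x + y)).2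
  rw [sub_sub_sub_cancel_right] at h
  refine h.congr_fun fun ℓ => ?_
  rw [mul_sub (Real.pi * ((ℓ : ℝ) + 1)), mul_add (Real.pi * ((ℓ : ℝ) + 1)), Real.cos_sub,
    Real.cos_add]
  ring

theorem heatKer_abs_le {s : ℝ} (hs : 0 < s) (w : ℝ) : |heatKer s w| ≤ 2 * √s / (s + w ^ 2) := by
  rw [abs_of_nonneg (heatKer_nonneg s w)]; exact heatKer_le hs w

theorem abs_dirKer_le {s T x y : ℝ} (hs : 0 < s) (hsT : s ≤ T) (hx : x ∈ Set.Icc (0 : ℝ) 1)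
    (hy : y ∈ Set.Icc (0 : ℝ) 1) :
    |dirKer s x y| ≤ 8 * (1 + T) * imageConst * √s / (s + (x - y) ^ 2) := by
  have hxy : |x - y| ≤ 1 := abs_le.2 ⟨by linarith [hx.1, hy.2], by linarith [hx.2, hy.1]⟩
  have hp : |x + y| = x + y := abs_of_nonneg (by linarith [hx.1, hy.1])
  have h1 := abs_tsum_image_le hs hsT (heatKer_abs_le hs) (z := x - y) (r := |x - y|)
    (by linarith) (abs_nonneg _) le_rfl (by linarith)
  have h2 := abs_tsum_image_le hs hsT (heatKer_abs_le hs) (z := x + y) (r := |x - y|)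
    (by rw [hp]; linarith [hx.2, hy.2]) (abs_nonneg _)
    (by rw [hp, abs_le]; constructor <;> linarith [hx.1, hy.1])
    (by rw [hp, abs_le]; constructor <;> linarith [hx.2, hy.2])
  rw [sq_abs] at h1 h2
  refine (abs_sub _ _).trans ((add_le_add h1 h2).trans (le_of_eq ?_))
  ring

theorem abs_dirKer_time_sub_le {s η T x y : ℝ} (hs : 0 < s) (hη : 0 ≤ η) (hsT : s ≤ T)
    (hx : x ∈ Set.Icc (0 : ℝ) 1) (hy : y ∈ Set.Icc (0 : ℝ) 1) :
    |dirKer (s + η) x y - dirKer s x y| ≤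
      32 * (1 + T) * imageConst * η * (√s)⁻¹ / (s + (x - y) ^ 2) := by
  have hxy : |x - y| ≤ 1 := abs_le.2 ⟨by linarith [hx.1, hy.2], by linarith [hx.2, hy.1]⟩
  have hp : |x + y| = x + y := abs_of_nonneg (by linarith [hx.1, hy.1])
  have hF := abs_heatKer_time_sub_le hs hη
  have key : ∀ z, thetaKer (s + η) z - thetaKer s z =
      ∑' m : ℤ, (fun w => heatKer (s + η) w - heatKer s w) (z + 2 * m) := fun z =>
    ((hasSum_thetaKer (by linarith : 0 < s + η) z).1.sub (hasSum_thetaKer hs z).1).tsum_eq.symm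
  have h1 := abs_tsum_image_le hs hsT hF (z := x - y) (r := |x - y|)
    (by linarith) (abs_nonneg _) le_rfl (by linarith)
  have h2 := abs_tsum_image_le hs hsT hF (z := x + y) (r := |x - y|)
    (by rw [hp]; linarith [hx.2, hy.2]) (abs_nonneg _)
    (by rw [hp, abs_le]; constructor <;> linarith [hx.1, hy.1])
    (by rw [hp, abs_le]; constructor <;> linarith [hx.2, hy.2])
  rw [sq_abs, ← key] at h1 h2
  unfold dirKer
  rw [show thetaKer (s + η) (x - y) - thetaKer (s + η) (x + y) -
    (thetaKer s (x - y) - thetaKer s (x + y)) = (thetaKer (s + η) (x - y) - thetaKer s (x - y)) -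
    (thetaKer (s + η) (x + y) - thetaKer s (x + y)) by ring]
  refine (abs_sub _ _).trans ((add_le_add h1 h2).trans (le_of_eq ?_))
  ring

theorem abs_dirKer_sub_heatKer_le {s T b x y : ℝ} (hs : 0 < s) (hsT : s ≤ T) (hb : 0 < b)
    (hx : x ∈ Set.Icc b (1 - b)) (hy : y ∈ Set.Icc b (1 - b)) :
    |dirKer s x y - heatKer s (x - y)| ≤
      (4 * imageConst + (1 + T) / b ^ 2 * imageConst) * √s := by
  have hxy : |x - y| ≤ 1 := abs_le.2 ⟨by linarith [hx.1, hy.2], by linarith [hx.2, hy.1]⟩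
  have hp : |x + y| = x + y := abs_of_nonneg (by linarith [hx.1, hy.1])
  have h1 := abs_tsum_image_sub_le hs (heatKer_abs_le hs) hxy
  have h2 := abs_tsum_image_le hs hsT (heatKer_abs_le hs) (z := x + y) (r := 2 * b)
    (by rw [hp]; linarith [hx.2, hy.2]) (by positivity)
    (by rw [hp]; linarith [hx.1, hy.1]) (by rw [hp]; linarith [hx.2, hy.2])
  have h3 : 2 * (2 * √s) * (1 + T) / (s + (2 * b) ^ 2) * imageConst ≤
      (1 + T) / b ^ 2 * imageConst * √s := by
    have hT : 0 ≤ T := hs.le.trans hsT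
    have : 2 * (2 * √s) * (1 + T) / (s + (2 * b) ^ 2) ≤ 2 * (2 * √s) * (1 + T) / (2 * b) ^ 2 :=
      div_le_div_of_nonneg_left (by positivity) (by positivity) (by linarith)
    refine (mul_le_mul_of_nonneg_right this imageConst_nonneg).trans (le_of_eq ?_)
    field_simp
  unfold dirKer
  rw [show thetaKer s (x - y) - thetaKer s (x + y) - heatKer s (x - y) =
    (thetaKer s (x - y) - heatKer s (x - y)) - thetaKer s (x + y) by ring]
  refine (abs_sub _ _).trans ((add_le_add h1 (h2.trans h3)).trans (le_of_eq ?_))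
  ring

/-- The second order mixed difference of the Dirichlet heat kernel with damping `α`. -/
noncomputable def cornerKer (α δ s x y : ℝ) : ℝ :=
  α ^ 2 * dirKer s (x + δ) (y + δ) + dirKer s x y - α * dirKer s (x + δ) y - α * dirKer s x (y + δ)

/-- The contribution of the main source to `cornerKer`. -/
noncomputable def cornerMain (α δ s z : ℝ) : ℝ :=
  (1 + α ^ 2) * heatKer s z - α * heatKer s (z + δ) - α * heatKer s (z - δ)

theorem cornerKer_eq_sub {α δ s x y : ℝ} (hs : 0 < s) :
    cornerKer α δ s x y = (∑' m : ℤ, cornerMain α δ s (x - y + 2 * m)) -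
      ∑' m : ℤ, (fun v => α ^ 2 * heatKer s (v + δ) + heatKer s (v - δ) - 2 * α * heatKer s v)
        (x + y + δ + 2 * m) := by
  have h1 : HasSum (fun m : ℤ => cornerMain α δ s (x - y + 2 * m))
      ((1 + α ^ 2) * thetaKer s (x - y) - α * thetaKer s (x - y + δ) -
        α * thetaKer s (x - y - δ)) := by
    refine ((((hasSum_thetaKer hs (x - y)).1.mul_left _).sub
      ((hasSum_thetaKer hs (x - y + δ)).1.mul_left _)).sub
      ((hasSum_thetaKer hs (x - y - δ)).1.mul_left _)).congr_fun fun m => ?_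
    unfold cornerMain
    rw [show x - y + 2 * (m : ℝ) + δ = x - y + δ + 2 * m by ring,
      show x - y + 2 * (m : ℝ) - δ = x - y - δ + 2 * m by ring]
  have h2 : HasSum (fun m : ℤ => (fun v => α ^ 2 * heatKer s (v + δ) + heatKer s (v - δ) -
      2 * α * heatKer s v) (x + y + δ + 2 * m))
      (α ^ 2 * thetaKer s (x + y + δ + δ) + thetaKer s (x + y) -
        2 * α * thetaKer s (x + y + δ)) := by
    refine ((((hasSum_thetaKer hs (x + y + δ + δ)).1.mul_left _).add
      ((hasSum_thetaKer hs (x + y)).1)).sub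
      ((hasSum_thetaKer hs (x + y + δ)).1.mul_left _)).congr_fun fun m => ?_
    simp only
    rw [show x + y + δ + 2 * (m : ℝ) + δ = x + y + δ + δ + 2 * m by ring,
      show x + y + δ + 2 * (m : ℝ) - δ = x + y + 2 * m by ring]
  rw [h1.tsum_eq, h2.tsum_eq]
  unfold cornerKer dirKer
  rw [show x + δ - (y + δ) = x - y by ring, show x + δ + (y + δ) = x + y + δ + δ by ring,
    show x + δ - y = x - y + δ by ring, show x + δ + y = x + y + δ by ring,
    show x - (y + δ) = x - y - δ by ring, show x + (y + δ) = x + y + δ by ring]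
  ring

/-- A constant for the bounds on `cornerKer`. -/
noncomputable def cornerConst (K T : ℝ) : ℝ :=
  96 * K + K * (96 * √T + 6) + 3 * K ^ 2 * (4 * T + 2)

theorem cornerConst_nonneg {K T : ℝ} (hK : 0 ≤ K) (hT : 0 ≤ T) : 0 ≤ cornerConst K T := by
  unfold cornerConst; positivity

theorem abs_cornerMain_le {s δ T α K : ℝ} (hs : 0 < s) (hsT : s ≤ T) (hδ : 0 < δ) (hδ1 : δ ≤ 1)
    (hα0 : 0 ≤ α) (hαK : α ≤ K) (hα : |1 - α| ≤ K * δ) (z : ℝ) :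
    |cornerMain α δ s z| ≤ cornerConst K T * δ ^ 2 * (√s)⁻¹ / (s + δ ^ 2 + z ^ 2) := by
  refine (abs_corner_minus_le hs hsT hδ hδ1 hα0 hαK hα z).trans ?_
  have hK : 0 ≤ K := hα0.trans hαK
  have hT : 0 ≤ T := hs.le.trans hsT
  have : 96 * K + K ^ 2 * (4 * T + 2) ≤ cornerConst K T := by
    unfold cornerConst
    have h1 : 0 ≤ K * (96 * √T + 6) := by positivity
    have h2 : 0 ≤ 2 * (K ^ 2 * (4 * T + 2)) := by positivity
    linarith
  gcongr

theorem abs_cornerKer_le {s δ T α K x y : ℝ} (hs : 0 < s) (hsT : s ≤ T) (hδ : 0 < δ) (hδ1 : δ ≤ 1)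
    (hα0 : 0 ≤ α) (hαK : α ≤ K) (hα : |1 - α| ≤ K * δ) (hx0 : 0 ≤ x) (hx1 : x + δ ≤ 1)
    (hy0 : 0 ≤ y) (hy1 : y + δ ≤ 1) :
    |cornerKer α δ s x y| ≤ 4 * (2 + T) * imageConst * cornerConst K T *
      (δ ^ 2 * (√s)⁻¹ / (s + δ ^ 2 + (x - y) ^ 2)) := by
  have hxy : |x - y| ≤ 1 := abs_le.2 ⟨by linarith, by linarith⟩
  have hp : |x + y + δ| = x + y + δ := abs_of_nonneg (by linarith)
  have hA : 0 < s + δ ^ 2 := by positivity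
  have hA₀ : s + δ ^ 2 ≤ T + 1 := add_le_add hsT (pow_le_one₀ hδ.le hδ1)
  have h1 := abs_tsum_image_le hA hA₀ (abs_cornerMain_le hs hsT hδ hδ1 hα0 hαK hα) (z := x - y)
    (r := |x - y|) (by linarith) (abs_nonneg _) le_rfl (by linarith)
  have h2 := abs_tsum_image_le hA hA₀ (abs_corner_plus_le hs hsT hδ hδ1 hα0 hαK hα)
    (z := x + y + δ) (r := |x - y|) (by rw [hp]; linarith) (abs_nonneg _)
    (by rw [hp, abs_le]; constructor <;> linarith)
    (by rw [hp, abs_le]; constructor <;> linarith)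
  rw [sq_abs] at h1 h2
  rw [cornerKer_eq_sub hs]
  refine (abs_sub _ _).trans ((add_le_add h1 h2).trans (le_of_eq ?_))
  unfold cornerConst
  ring

theorem abs_cornerKer_sub_cornerMain_le {s δ T α K b x y : ℝ} (hs : 0 < s) (hsT : s ≤ T)
    (hδ : 0 < δ) (hδ1 : δ ≤ 1) (hb : 0 < b)
    (hα0 : 0 ≤ α) (hαK : α ≤ K) (hα : |1 - α| ≤ K * δ) (hx0 : b ≤ x) (hx1 : x + δ ≤ 1 - b)
    (hy0 : b ≤ y) (hy1 : y + δ ≤ 1 - b) :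
    |cornerKer α δ s x y - cornerMain α δ s (x - y)| ≤
      (2 * imageConst + (2 + T) / b ^ 2 * imageConst) * cornerConst K T * (δ ^ 2 * (√s)⁻¹) := by
  have hK : 0 ≤ K := hα0.trans hαK
  have hT : 0 ≤ T := hs.le.trans hsT
  have hxy : |x - y| ≤ 1 := abs_le.2 ⟨by linarith, by linarith⟩
  have hp : |x + y + δ| = x + y + δ := abs_of_nonneg (by linarith)
  have hA : 0 < s + δ ^ 2 := by positivity
  have hA₀ : s + δ ^ 2 ≤ T + 1 := add_le_add hsT (pow_le_one₀ hδ.le hδ1)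
  have h1 := abs_tsum_image_sub_le hA (abs_cornerMain_le hs hsT hδ hδ1 hα0 hαK hα) hxy
  have h2 := abs_tsum_image_le hA hA₀ (abs_corner_plus_le hs hsT hδ hδ1 hα0 hαK hα)
    (z := x + y + δ) (r := 2 * b) (by rw [hp]; linarith) (by positivity)
    (by rw [hp]; linarith) (by rw [hp]; linarith)
  have hc := cornerConst_nonneg hK hT
  have h3 : 2 * (cornerConst K T * δ ^ 2 * (√s)⁻¹) * (1 + (T + 1)) / (s + δ ^ 2 + (2 * b) ^ 2) *
      imageConst ≤ (2 + T) / b ^ 2 * imageConst * cornerConst K T * (δ ^ 2 * (√s)⁻¹) := by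
    have : 2 * (cornerConst K T * δ ^ 2 * (√s)⁻¹) * (1 + (T + 1)) / (s + δ ^ 2 + (2 * b) ^ 2) ≤
        2 * (cornerConst K T * δ ^ 2 * (√s)⁻¹) * (1 + (T + 1)) / (2 * b ^ 2) :=
      div_le_div_of_nonneg_left (by positivity) (by positivity) (by nlinarith)
    refine (mul_le_mul_of_nonneg_right this imageConst_nonneg).trans (le_of_eq ?_)
    field_simp
    ring
  rw [cornerKer_eq_sub hs, sub_right_comm]
  refine (abs_sub _ _).trans ((add_le_add h1 (h2.trans h3)).trans (le_of_eq ?_))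
  ring

end DirichletKernel

section SpectralIntegral

/-- The eigenvalues `π² (ℓ + 1)² + Γ` of the rescaled operator. -/
noncomputable def specVal (Γ : ℝ) (ℓ : ℕ) : ℝ := Real.pi ^ 2 * ((ℓ : ℝ) + 1) ^ 2 + Γ

theorem le_specVal (Γ : ℝ) (ℓ : ℕ) :
    min (Real.pi ^ 2) (Γ + Real.pi ^ 2) * ((ℓ : ℝ) + 1) ^ 2 ≤ specVal Γ ℓ := by
  unfold specVal
  have h1 := min_le_left (Real.pi ^ 2) (Γ + Real.pi ^ 2)
  have h2 := min_le_right (Real.pi ^ 2) (Γ + Real.pi ^ 2)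
  have h3 : 0 ≤ ((ℓ : ℝ) + 1) ^ 2 - 1 := by nlinarith [Nat.cast_nonneg (α := ℝ) ℓ]
  nlinarith

theorem specVal_pos {Γ : ℝ} (hΓ : 0 < Γ + Real.pi ^ 2) (ℓ : ℕ) : 0 < specVal Γ ℓ :=
  lt_of_lt_of_le (by have := Real.pi_pos; positivity) (le_specVal Γ ℓ)

theorem summable_inv_specVal {Γ : ℝ} (hΓ : 0 < Γ + Real.pi ^ 2) :
    Summable fun ℓ => (specVal Γ ℓ)⁻¹ := by
  set m := min (Real.pi ^ 2) (Γ + Real.pi ^ 2)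
  have hm : 0 < m := lt_min (by have := Real.pi_pos; positivity) hΓ
  have h : Summable fun ℓ : ℕ => m⁻¹ * (((ℓ : ℝ) + 1) ^ 2)⁻¹ := by
    refine Summable.mul_left _ ?_
    have := (summable_nat_add_iff 1).2 (Real.summable_nat_pow_inv.2 (by norm_num : 1 < 2))
    simpa using this
  refine h.of_nonneg_of_le (fun ℓ => (inv_pos.2 (specVal_pos hΓ ℓ)).le) fun ℓ => ?_
  rw [← mul_inv]
  exact inv_anti₀ (by positivity) (le_specVal Γ ℓ)

theorem integrable_of_hasSum {α : Type*} [MeasurableSpace α] {μ : Measure α} {F : ℕ → α → ℝ}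
    {f : α → ℝ} (hF : ∀ i, Integrable (F i) μ) (hs : Summable fun i => ∫ a, ‖F i a‖ ∂μ)
    (hf : ∀ᵐ a ∂μ, HasSum (fun i => F i a) (f a)) :
    Integrable f μ ∧ HasSum (fun i => ∫ a, F i a ∂μ) (∫ a, f a ∂μ) := by
  have h1 : ∀ᵐ a ∂μ, ∑' i, F i a = f a := hf.mono fun a ha => ha.tsum_eq
  have h2 := hasSum_integral_of_summable_integral_norm hF hs
  rw [integral_congr_ae h1] at h2
  refine ⟨⟨?_, ?_⟩, h2⟩
  · exact aestronglyMeasurable_of_tendsto_ae atTop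
      (f := fun n a => ∑ i ∈ Finset.range n, F i a)
      (fun n => (integrable_finsetSum _ fun i _ => hF i).1)
      (hf.mono fun a ha => ha.tendsto_sum_nat)
  · have h3 : ∀ᵐ a ∂μ, ‖f a‖ₑ ≤ ∑' i, ‖F i a‖ₑ := by
      filter_upwards [hf] with a ha
      rw [← ha.tsum_eq]
      exact enorm_tsum_le_tsum_enorm
    refine lt_of_le_of_lt (lintegral_mono_ae h3) ?_
    rw [lintegral_tsum fun i => (hF i).1.enorm]
    have (i : ℕ) : ∫⁻ a, ‖F i a‖ₑ ∂μ = ENNReal.ofReal (∫ a, ‖F i a‖ ∂μ) :=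
      (ofReal_integral_norm_eq_lintegral_enorm (hF i)).symm
    simp_rw [this]
    exact hs.tsum_ofReal_lt_top

theorem integral_exp_neg_mul {μ τ : ℝ} (hμ : μ ≠ 0) :
    ∫ v in (0 : ℝ)..τ, Real.exp (-(μ * v)) = (1 - Real.exp (-(μ * τ))) / μ := by
  have h : ∀ v ∈ Set.uIcc 0 τ,
      HasDerivAt (fun v => -(Real.exp (-(μ * v)) / μ)) (Real.exp (-(μ * v))) v := by
    intro v _
    have h1 : HasDerivAt (fun v => -(μ * v)) (-μ) v := by
      simpa using ((hasDerivAt_id v).const_mul μ).fun_neg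
    refine (h1.exp.div_const μ).fun_neg.congr_deriv ?_
    field_simp
  rw [intervalIntegral.integral_eq_sub_of_hasDerivAt h
    (Continuous.intervalIntegrable (by fun_prop) _ _)]
  simp
  ring

theorem hasSum_spectral_integral {Γ : ℝ} (hΓ : 0 < Γ + Real.pi ^ 2) {c : ℕ → ℝ} {K : ℝ}
    (hc : ∀ ℓ, |c ℓ| ≤ K) {q : ℝ → ℝ} (hq : ∀ s, 0 < s →
      HasSum (fun ℓ : ℕ => c ℓ * Real.exp (-(Real.pi ^ 2 * ((ℓ : ℝ) + 1) ^ 2 * s))) (q s))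
    {τ : ℝ} (hτ : 0 ≤ τ) :
    IntervalIntegrable (fun v => Real.exp (-(Γ * v)) * q v) volume 0 τ ∧
    HasSum (fun ℓ => c ℓ * ((1 - Real.exp (-(specVal Γ ℓ * τ))) / specVal Γ ℓ))
      (∫ v in (0 : ℝ)..τ, Real.exp (-(Γ * v)) * q v) := by
  have h_int : ∀ ℓ, IntervalIntegrable (fun v => c ℓ * Real.exp (-(specVal Γ ℓ * v))) volume 0 τ :=
    fun ℓ => Continuous.intervalIntegrable (by fun_prop) _ _
  have hval : ∀ ℓ, ∫ v in (0 : ℝ)..τ, c ℓ * Real.exp (-(specVal Γ ℓ * v)) =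
      c ℓ * ((1 - Real.exp (-(specVal Γ ℓ * τ))) / specVal Γ ℓ) := fun ℓ => by
    rw [intervalIntegral.integral_const_mul, integral_exp_neg_mul (specVal_pos hΓ ℓ).ne']
  have hnorm : ∀ ℓ, ∫ v in Set.Ioc 0 τ, ‖c ℓ * Real.exp (-(specVal Γ ℓ * v))‖ =
      |c ℓ| * ((1 - Real.exp (-(specVal Γ ℓ * τ))) / specVal Γ ℓ) := fun ℓ => by
    rw [← integral_exp_neg_mul (specVal_pos hΓ ℓ).ne', ← intervalIntegral.integral_const_mul,
      intervalIntegral.integral_of_le hτ]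
    simp
  have hsum : Summable fun ℓ => ∫ v in Set.Ioc 0 τ, ‖c ℓ * Real.exp (-(specVal Γ ℓ * v))‖ := by
    refine ((summable_inv_specVal hΓ).mul_left K).of_nonneg_of_le
      (fun ℓ => integral_nonneg fun v => norm_nonneg _) fun ℓ => ?_
    rw [hnorm]
    have h1 := specVal_pos hΓ ℓ
    have h2 := Real.exp_pos (-(specVal Γ ℓ * τ))
    have h3 : Real.exp (-(specVal Γ ℓ * τ)) ≤ 1 :=
      Real.exp_le_one_iff.2 (by have := mul_nonneg h1.le hτ; linarith)
    refine mul_le_mul (hc ℓ) ?_ (div_nonneg (by linarith) h1.le) ((abs_nonneg _).trans (hc ℓ))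
    rw [div_eq_mul_inv]
    exact mul_le_of_le_one_left (inv_pos.2 h1).le (by linarith)
  have h := integrable_of_hasSum (μ := volume.restrict (Set.Ioc 0 τ))
    (f := fun v => Real.exp (-(Γ * v)) * q v)
    (fun ℓ => (intervalIntegrable_iff_integrableOn_Ioc_of_le hτ).1 (h_int ℓ)) hsum (by
      filter_upwards [ae_restrict_mem measurableSet_Ioc] with v hv
      refine ((hq v hv.1).mul_left (Real.exp (-(Γ * v)))).congr_fun fun ℓ => ?_
      rw [mul_left_comm, ← Real.exp_add]
      unfold specVal
      congr 2
      ring)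
  refine ⟨(intervalIntegrable_iff_integrableOn_Ioc_of_le hτ).2 h.1, ?_⟩
  rw [intervalIntegral.integral_of_le hτ]
  refine h.2.congr_fun fun ℓ => ?_
  rw [← hval, intervalIntegral.integral_of_le hτ]

end SpectralIntegral

section IntegralBounds

theorem hasDerivAt_two_sqrt {v : ℝ} (hv : 0 < v) : HasDerivAt (fun v => 2 * √v) (√v)⁻¹ v := by
  refine ((Real.hasDerivAt_sqrt hv.ne').const_mul 2).congr_deriv ?_
  field_simp

theorem integral_inv_sqrt {τ : ℝ} (hτ : 0 ≤ τ) :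
    IntervalIntegrable (fun v => (√v)⁻¹) volume 0 τ ∧ ∫ v in (0 : ℝ)..τ, (√v)⁻¹ = 2 * √τ := by
  have hc : ContinuousOn (fun v => 2 * √v) (Set.Icc 0 τ) := by fun_prop
  have hd : ∀ v ∈ Set.Ioo 0 τ, HasDerivAt (fun v => 2 * √v) (√v)⁻¹ v :=
    fun v hv => hasDerivAt_two_sqrt hv.1
  have hi : IntervalIntegrable (fun v => (√v)⁻¹) volume 0 τ := by
    refine intervalIntegral.intervalIntegrable_deriv_of_nonneg (by rwa [Set.uIcc_of_le hτ])
      (by rw [min_eq_left hτ, max_eq_right hτ]; exact hd) fun v _ => by positivity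
  refine ⟨hi, ?_⟩
  rw [intervalIntegral.integral_eq_sub_of_hasDerivAt_of_le hτ hc hd hi]
  simp

theorem integral_inv_sqrt_div_le {τ a : ℝ} (hτ : 0 ≤ τ) (ha : 0 < a) :
    IntervalIntegrable (fun v => (√v)⁻¹ / (v + a ^ 2)) volume 0 τ ∧
      ∫ v in (0 : ℝ)..τ, (√v)⁻¹ / (v + a ^ 2) ≤ Real.pi / a := by
  have hc : ContinuousOn (fun v => 2 / a * Real.arctan (√v / a)) (Set.Icc 0 τ) := by fun_prop
  have hd : ∀ v ∈ Set.Ioo 0 τ, HasDerivAt (fun v => 2 / a * Real.arctan (√v / a))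
      ((√v)⁻¹ / (v + a ^ 2)) v := by
    intro v hv
    refine ((((Real.hasDerivAt_sqrt hv.1.ne').div_const a).arctan).const_mul (2 / a)).congr_deriv ?_
    have h1 : 0 < √v := Real.sqrt_pos.2 hv.1
    have h2 : 0 < v + a ^ 2 := by have := hv.1; positivity
    have h3 : 1 + v / a ^ 2 = (v + a ^ 2) / a ^ 2 := by field_simp; ring
    rw [div_pow, Real.sq_sqrt hv.1.le, h3]
    field_simp
  have hi : IntervalIntegrable (fun v => (√v)⁻¹ / (v + a ^ 2)) volume 0 τ := by
    refine intervalIntegral.intervalIntegrable_deriv_of_nonneg (by rwa [Set.uIcc_of_le hτ])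
      (by rw [min_eq_left hτ, max_eq_right hτ]; exact hd) fun v hv => ?_
    rw [min_eq_left hτ] at hv
    have := hv.1
    positivity
  refine ⟨hi, ?_⟩
  rw [intervalIntegral.integral_eq_sub_of_hasDerivAt_of_le hτ hc hd hi]
  simp only [Real.sqrt_zero, zero_div, Real.arctan_zero, mul_zero, sub_zero]
  have := (Real.arctan_lt_pi_div_two (√τ / a)).le
  calc _ ≤ 2 / a * (Real.pi / 2) := by gcongr
    _ = _ := by ring

theorem abs_integral_le_of_abs_le {f g : ℝ → ℝ} {a b : ℝ} (hab : a ≤ b)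
    (hg : IntervalIntegrable g volume a b) (h : ∀ v ∈ Set.Ioc a b, |f v| ≤ g v) :
    |∫ v in a..b, f v| ≤ ∫ v in a..b, g v := by
  rw [← Real.norm_eq_abs]
  refine intervalIntegral.norm_integral_le_of_norm_le hab ?_ hg
  exact .of_forall fun v hv => h v hv

end IntegralBounds

section SecondDifference

/-- The second order difference at `J` of the primitive of `f`, taken on the grid of mesh `η`. -/
noncomputable def secondDiff (f : ℝ → ℝ) (η : ℝ) (J : ℤ) : ℝ :=
  (∫ v in (0 : ℝ)..|(J : ℝ) + 1| * η, f v) + (∫ v in (0 : ℝ)..|(J : ℝ) - 1| * η, f v) -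
    2 * ∫ v in (0 : ℝ)..|(J : ℝ)| * η, f v

theorem secondDiff_neg (f : ℝ → ℝ) (η : ℝ) (J : ℤ) : secondDiff f η (-J) = secondDiff f η J := by
  unfold secondDiff
  push_cast
  rw [show -(J : ℝ) + 1 = -(J - 1) by ring, show -(J : ℝ) - 1 = -(J + 1) by ring, abs_neg, abs_neg,
    abs_neg]
  ring

theorem secondDiff_zero (f : ℝ → ℝ) (η : ℝ) :
    secondDiff f η 0 = 2 * ∫ v in (0 : ℝ)..η, f v := by
  simp [secondDiff]; ring

variable {f : ℝ → ℝ} {η T : ℝ}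

theorem secondDiff_one (f : ℝ → ℝ) (η : ℝ) :
    secondDiff f η 1 = (∫ v in (0 : ℝ)..2 * η, f v) - 2 * ∫ v in (0 : ℝ)..η, f v := by
  norm_num [secondDiff]

theorem secondDiff_eq (hη : 0 ≤ η) (hf : ∀ τ, 0 ≤ τ → IntervalIntegrable f volume 0 τ)
    {J : ℤ} (hJ : 1 ≤ J) : secondDiff f η J =
      (∫ v in (J : ℝ) * η..((J : ℝ) + 1) * η, f v) -
        ∫ v in ((J : ℝ) - 1) * η..(J : ℝ) * η, f v := by
  have hJ' : (1 : ℝ) ≤ J := by exact_mod_cast hJ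
  have h0 : 0 ≤ ((J : ℝ) - 1) * η := mul_nonneg (by linarith) hη
  have h1 : 0 ≤ (J : ℝ) * η := mul_nonneg (by linarith) hη
  have h2 : 0 ≤ ((J : ℝ) + 1) * η := mul_nonneg (by linarith) hη
  unfold secondDiff
  rw [abs_of_pos (by linarith : 0 < (J : ℝ) + 1), abs_of_nonneg (by linarith : 0 ≤ (J : ℝ) - 1),
    abs_of_pos (by linarith : 0 < (J : ℝ)),
    ← intervalIntegral.integral_interval_sub_left (hf _ h2) (hf _ h1),
    ← intervalIntegral.integral_interval_sub_left (hf _ h1) (hf _ h0)]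
  ring

theorem secondDiff_eq_integral_sub (hη : 0 ≤ η)
    (hf : ∀ τ, 0 ≤ τ → IntervalIntegrable f volume 0 τ) {J : ℤ} (hJ : 1 ≤ J) :
    secondDiff f η J = ∫ v in ((J : ℝ) - 1) * η..(J : ℝ) * η, (f (v + η) - f v) := by
  have hJ' : (1 : ℝ) ≤ J := by exact_mod_cast hJ
  have h0 : 0 ≤ ((J : ℝ) - 1) * η := mul_nonneg (by linarith) hη
  have h1 : 0 ≤ (J : ℝ) * η := mul_nonneg (by linarith) hη
  have h2 : 0 ≤ ((J : ℝ) + 1) * η := mul_nonneg (by linarith) hη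
  have hi : IntervalIntegrable f volume ((J : ℝ) * η) (((J : ℝ) + 1) * η) :=
    (hf _ h1).symm.trans (hf _ h2)
  have hi' : IntervalIntegrable (fun v => f (v + η)) volume (((J : ℝ) - 1) * η) ((J : ℝ) * η) := by
    have := hi.comp_add_right η
    rwa [show (J : ℝ) * η - η = ((J : ℝ) - 1) * η by ring,
      show ((J : ℝ) + 1) * η - η = (J : ℝ) * η by ring] at this
  rw [secondDiff_eq hη hf hJ, intervalIntegral.integral_sub hi' ((hf _ h0).symm.trans (hf _ h1)),
    intervalIntegral.integral_comp_add_right f η,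
    show ((J : ℝ) - 1) * η + η = (J : ℝ) * η by ring,
    show (J : ℝ) * η + η = ((J : ℝ) + 1) * η by ring]

/-- Domination of second differences by means of the time regularity of the integrand. -/
theorem abs_secondDiff_le_of_time {C a c ℓ : ℝ} (hη : 0 < η) (hC : 0 ≤ C) (hc : 0 < c)
    (hc1 : c ≤ 1) (ha : c * η * ℓ ^ 2 ≤ a ^ 2)
    (hf : ∀ τ, 0 ≤ τ → IntervalIntegrable f volume 0 τ)
    (h1 : ∀ v, 0 < v → v ≤ T → |f v| ≤ C * √v / (v + a ^ 2))
    (h2 : ∀ v, 0 < v → v + η ≤ T → |f (v + η) - f v| ≤ C * η * (√v)⁻¹ / (v + a ^ 2))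
    {J : ℤ} (hJ : (|(J : ℝ)| + 1) * η ≤ T) :
    |secondDiff f η J| ≤ 36 * (C / c) * √η / ((1 + |(J : ℝ)|) * √(1 + ℓ ^ 2)) := by
  have hη0 : 0 < √η := Real.sqrt_pos.2 hη
  wlog hJ0 : 0 ≤ J generalizing J
  · have := this (J := -J) (by simpa using hJ) (by omega)
    rwa [secondDiff_neg, Int.cast_neg, abs_neg] at this
  have hJ0' : (0 : ℝ) ≤ J := by exact_mod_cast hJ0
  rw [abs_of_nonneg hJ0'] at hJ ⊢
  have hℓ1 : 1 ≤ √(1 + ℓ ^ 2) := Real.one_le_sqrt.2 (by nlinarith [sq_nonneg ℓ])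
  have hℓ2 : √(1 + ℓ ^ 2) ^ 2 = 1 + ℓ ^ 2 := Real.sq_sqrt (by positivity)
  have hG : ∀ τ, 0 ≤ τ → τ ≤ 2 * η → τ ≤ T →
      |∫ v in (0 : ℝ)..τ, f v| ≤ 6 * (C / c) * √η / (1 + ℓ ^ 2) := by
    intro τ hτ hτη hτT
    have hi := integral_inv_sqrt hτ
    have h3 := abs_integral_le_of_abs_le (f := f)
      (g := fun v => C * (2 / (c * (1 + ℓ ^ 2))) * (√v)⁻¹) hτ (hi.1.const_mul _) fun v hv => by
      refine (h1 v hv.1 (hv.2.trans hτT)).trans ?_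
      have hv0 : 0 < √v := Real.sqrt_pos.2 hv.1
      have hvv : √v = v * (√v)⁻¹ := by
        rw [← div_eq_mul_inv, eq_div_iff hv0.ne']; exact Real.mul_self_sqrt hv.1.le
      have h4 : v / (v + a ^ 2) ≤ 2 / (c * (1 + ℓ ^ 2)) := by
        have := hv.1
        rw [div_le_div_iff₀ (by positivity) (by positivity)]
        have h5 : v * (c * ℓ ^ 2) ≤ 2 * η * (c * ℓ ^ 2) :=
          mul_le_mul_of_nonneg_right (hv.2.trans hτη) (by positivity)
        nlinarith
      calc C * √v / (v + a ^ 2) = C * (v / (v + a ^ 2)) * (√v)⁻¹ := by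
            nth_rewrite 1 [hvv]; ring
        _ ≤ _ := by gcongr
    refine h3.trans ?_
    rw [intervalIntegral.integral_const_mul, hi.2]
    have h5 : √τ ≤ 3 / 2 * √η := by
      rw [show (3 / 2 : ℝ) = √(9 / 4) by
        rw [show (9 / 4 : ℝ) = (3 / 2) ^ 2 by norm_num]; exact (Real.sqrt_sq (by norm_num)).symm,
        ← Real.sqrt_mul (by norm_num)]
      exact Real.sqrt_le_sqrt (by linarith)
    calc C * (2 / (c * (1 + ℓ ^ 2))) * (2 * √τ) ≤ C * (2 / (c * (1 + ℓ ^ 2))) * (2 * (3 / 2 * √η)) := by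
          gcongr
      _ = _ := by field_simp; ring
  have hsmall : 18 * (C / c) * √η / (1 + ℓ ^ 2) ≤
      36 * (C / c) * √η / (2 * √(1 + ℓ ^ 2)) := by
    rw [div_le_div_iff₀ (by positivity) (by positivity)]
    have h5 : √(1 + ℓ ^ 2) ≤ 1 + ℓ ^ 2 := by nlinarith
    have : 0 ≤ 36 * (C / c) * √η := by positivity
    nlinarith
  rcases (by omega : J = 0 ∨ J = 1 ∨ 2 ≤ J) with rfl | rfl | hJ2
  · rw [secondDiff_zero, abs_mul, abs_two]
    simp only [Int.cast_zero, zero_add, one_mul, add_zero] at hJ ⊢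
    have h3 := hG η hη.le (by linarith) hJ
    calc _ ≤ 2 * (6 * (C / c) * √η / (1 + ℓ ^ 2)) := by gcongr
      _ ≤ 18 * (C / c) * √η / (1 + ℓ ^ 2) := by
        rw [← mul_div_assoc]; gcongr ?_ / _
        have : 0 ≤ (C / c) * √η := by positivity
        linarith
      _ ≤ _ := hsmall
      _ ≤ _ := by
        refine div_le_div_of_nonneg_left (by positivity) (by positivity) ?_
        linarith
  · rw [secondDiff_one]
    norm_num at hJ ⊢
    have h3 := hG η hη.le (by linarith) (by linarith)
    have h4 := hG (2 * η) (by linarith) le_rfl hJ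
    calc _ ≤ |∫ v in (0 : ℝ)..2 * η, f v| + |2 * ∫ v in (0 : ℝ)..η, f v| := abs_sub _ _
      _ ≤ 6 * (C / c) * √η / (1 + ℓ ^ 2) + 2 * (6 * (C / c) * √η / (1 + ℓ ^ 2)) := by
        rw [abs_mul, abs_two]; gcongr
      _ = 18 * (C / c) * √η / (1 + ℓ ^ 2) := by ring
      _ ≤ _ := hsmall
  · have hm : (1 : ℝ) ≤ (J : ℝ) - 1 := by
      have : (2 : ℝ) ≤ J := by exact_mod_cast hJ2
      linarith
    set m := (J : ℝ) - 1 with hm_def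
    have hm0 : 0 < √m := Real.sqrt_pos.2 (by linarith)
    have hmη : 0 < m * η := by positivity
    rw [secondDiff_eq_integral_sub hη.le hf (by omega)]
    have hbound : ∀ v ∈ Set.Ioc (m * η) ((J : ℝ) * η), |f (v + η) - f v| ≤
        C * η * (√(m * η))⁻¹ / (m * η + a ^ 2) := fun v hv => by
      have hv0 : 0 < v := hmη.trans hv.1
      refine (h2 v hv0 (by nlinarith [hv.2])).trans ?_
      have : 0 < √(m * η) := Real.sqrt_pos.2 hmη
      gcongr
      · exact hv.1.le
      · exact hv.1.le
    have h3 := abs_integral_le_of_abs_le (f := fun v => f (v + η) - f v)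
      (g := fun _ => C * η * (√(m * η))⁻¹ / (m * η + a ^ 2)) (by nlinarith)
      (intervalIntegrable_const) hbound
    refine h3.trans ?_
    rw [intervalIntegral.integral_const, smul_eq_mul, Real.sqrt_mul (by linarith),
      show (J : ℝ) * η - m * η = η by rw [hm_def]; ring]
    have h4 : m * η + a ^ 2 ≥ c * η * (m + ℓ ^ 2) := by nlinarith
    have h5 : √m * √(1 + ℓ ^ 2) ≤ m + ℓ ^ 2 := by
      rw [← Real.sqrt_mul (by linarith)]
      refine Real.sqrt_le_iff.2 ⟨by positivity, ?_⟩
      nlinarith [sq_nonneg ℓ, mul_nonneg (by linarith : 0 ≤ m) (sq_nonneg ℓ), sq_nonneg (ℓ ^ 2)]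
    have h6 : √m * √m = m := Real.mul_self_sqrt (by linarith)
    have hηη : √η * √η = η := Real.mul_self_sqrt hη.le
    have h7 : 1 + (J : ℝ) ≤ 3 * m := by rw [hm_def]; linarith
    calc η * (C * η * (√m * √η)⁻¹ / (m * η + a ^ 2))
        ≤ η * (C * η * (√m * √η)⁻¹ / (c * η * (√m * √(1 + ℓ ^ 2)))) := by
          gcongr
          exact le_trans (by gcongr) h4
      _ = (C / c) * √η / (m * √(1 + ℓ ^ 2)) := by
          nth_rewrite 1 [← hηη]
          conv_rhs => rw [← h6]
          field_simp
      _ ≤ 36 * (C / c) * √η / ((1 + (J : ℝ)) * √(1 + ℓ ^ 2)) := by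
          rw [div_le_div_iff₀ (by positivity) (by positivity)]
          have : 0 ≤ (C / c) * √η * √(1 + ℓ ^ 2) := by positivity
          nlinarith

/-- Domination of second differences by means of the space regularity of the integrand. -/
theorem abs_secondDiff_le_of_space {C δ w : ℝ} (hη : 0 < η) (hC : 0 ≤ C) (hδ : 0 < δ) (hw : 0 < w)
    (hf : ∀ τ, 0 ≤ τ → IntervalIntegrable f volume 0 τ)
    (h1 : ∀ v, 0 < v → v ≤ T → |f v| ≤ C * δ ^ 2 * ((√v)⁻¹ / (v + (w * δ) ^ 2)))
    {J : ℤ} (hJ : (|(J : ℝ)| + 1) * η ≤ T) :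
    |secondDiff f η J| ≤ 24 * C * δ / ((1 + |(J : ℝ)|) * w) := by
  wlog hJ0 : 0 ≤ J generalizing J
  · have := this (J := -J) (by simpa using hJ) (by omega)
    rwa [secondDiff_neg, Int.cast_neg, abs_neg] at this
  have hJ0' : (0 : ℝ) ≤ J := by exact_mod_cast hJ0
  rw [abs_of_nonneg hJ0'] at hJ ⊢
  have hG : ∀ τ, 0 ≤ τ → τ ≤ T → |∫ v in (0 : ℝ)..τ, f v| ≤ 4 * C * δ / w := by
    intro τ hτ hτT
    have hi := integral_inv_sqrt_div_le hτ (mul_pos hw hδ)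
    have h3 := abs_integral_le_of_abs_le (f := f)
      (g := fun v => C * δ ^ 2 * ((√v)⁻¹ / (v + (w * δ) ^ 2))) hτ (hi.1.const_mul _)
      fun v hv => h1 v hv.1 (hv.2.trans hτT)
    refine h3.trans ?_
    rw [intervalIntegral.integral_const_mul]
    calc _ ≤ C * δ ^ 2 * (4 / (w * δ)) := by
          gcongr
          refine hi.2.trans ?_
          gcongr
          exact Real.pi_le_four
      _ = _ := by field_simp
  rcases (by omega : J = 0 ∨ J = 1 ∨ 2 ≤ J) with rfl | rfl | hJ2
  · rw [secondDiff_zero, abs_mul, abs_two]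
    simp only [Int.cast_zero, zero_add, one_mul, add_zero] at hJ ⊢
    have h3 := hG η hη.le hJ
    calc _ ≤ 2 * (4 * C * δ / w) := by gcongr
      _ ≤ _ := by
        rw [← mul_div_assoc]; gcongr ?_ / _
        have : 0 ≤ C * δ := by positivity
        linarith
  · rw [secondDiff_one]
    norm_num at hJ ⊢
    have h3 := hG η hη.le (by linarith)
    have h4 := hG (2 * η) (by linarith) hJ
    calc _ ≤ |∫ v in (0 : ℝ)..2 * η, f v| + |2 * ∫ v in (0 : ℝ)..η, f v| := abs_sub _ _
      _ ≤ 4 * C * δ / w + 2 * (4 * C * δ / w) := by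
        rw [abs_mul, abs_two]; gcongr
      _ = _ := by field_simp; ring
  · have hm : (1 : ℝ) ≤ (J : ℝ) - 1 := by
      have : (2 : ℝ) ≤ J := by exact_mod_cast hJ2
      linarith
    set m := (J : ℝ) - 1 with hm_def
    have hmη : 0 < m * η := by positivity
    have hsq : √(m * η) * √(m * η) = m * η := Real.mul_self_sqrt hmη.le
    have hs0 : 0 < √(m * η) := Real.sqrt_pos.2 hmη
    have hbound : ∀ v, m * η < v → v ≤ T → |f v| ≤ C * δ / (2 * (m * η) * w) := fun v hv hvT => by
      have hv0 : 0 < v := hmη.trans hv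
      refine (h1 v hv0 hvT).trans ?_
      calc C * δ ^ 2 * ((√v)⁻¹ / (v + (w * δ) ^ 2))
          ≤ C * δ ^ 2 * ((√(m * η))⁻¹ / (2 * (√(m * η) * (w * δ)))) := by
            gcongr
            nlinarith [sq_nonneg (√(m * η) - w * δ)]
        _ = C * δ / (2 * (√(m * η) * √(m * η)) * w) := by field_simp
        _ = _ := by rw [hsq]
    rw [secondDiff_eq hη.le hf (by omega)]
    have h3 := abs_integral_le_of_abs_le (f := f) (a := (J : ℝ) * η) (b := ((J : ℝ) + 1) * η)
      (g := fun _ => C * δ / (2 * (m * η) * w)) (by nlinarith) (intervalIntegrable_const)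
      fun v hv => hbound v (by nlinarith [hv.1]) (hv.2.trans hJ)
    have h4 := abs_integral_le_of_abs_le (f := f) (a := m * η) (b := (J : ℝ) * η)
      (g := fun _ => C * δ / (2 * (m * η) * w)) (by nlinarith) (intervalIntegrable_const)
      fun v hv => hbound v hv.1 (by nlinarith [hv.2])
    rw [intervalIntegral.integral_const, smul_eq_mul] at h3 h4
    have h7 : 1 + (J : ℝ) ≤ 3 * m := by rw [hm_def]; linarith
    calc _ ≤ _ := abs_sub _ _
      _ ≤ (((J : ℝ) + 1) * η - (J : ℝ) * η) * (C * δ / (2 * (m * η) * w)) +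
          ((J : ℝ) * η - m * η) * (C * δ / (2 * (m * η) * w)) := add_le_add h3 h4
      _ = C * δ / (m * w) := by
          rw [show (J : ℝ) = m + 1 by rw [hm_def]; ring]
          field_simp
          ring
      _ ≤ _ := by
          rw [div_le_div_iff₀ (by positivity) (by positivity)]
          have : 0 ≤ C * δ * w := by positivity
          nlinarith

end SecondDifference

section Fields

/-- The sine coefficients `√2 sin(π (ℓ + 1) y)`. -/
noncomputable def sinCoef (y : ℝ) (ℓ : ℕ) : ℝ := √2 * Real.sin (Real.pi * ((ℓ : ℝ) + 1) * y)

/-- The coefficients of damped spatial increments. -/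
noncomputable def incCoef (α δ y : ℝ) (ℓ : ℕ) : ℝ := α * sinCoef (y + δ) ℓ - sinCoef y ℓ

theorem abs_sinCoef_le (y : ℝ) (ℓ : ℕ) : |sinCoef y ℓ| ≤ √2 := by
  rw [sinCoef, abs_mul, abs_of_nonneg (Real.sqrt_nonneg 2)]
  exact mul_le_of_le_one_right (Real.sqrt_nonneg 2) (Real.abs_sin_le_one _)

theorem abs_incCoef_le (α δ y : ℝ) (ℓ : ℕ) : |incCoef α δ y ℓ| ≤ (|α| + 1) * √2 := by
  refine (abs_sub _ _).trans ?_
  rw [abs_mul, add_mul, one_mul]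
  exact add_le_add (mul_le_mul_of_nonneg_left (abs_sinCoef_le _ _) (abs_nonneg _))
    (abs_sinCoef_le _ _)

theorem hasSum_sinCoef {s : ℝ} (hs : 0 < s) (x y : ℝ) :
    HasSum (fun ℓ : ℕ => sinCoef x ℓ * sinCoef y ℓ *
      Real.exp (-(Real.pi ^ 2 * ((ℓ : ℝ) + 1) ^ 2 * s))) (dirKer s x y) := by
  refine (hasSum_dirKer hs x y).congr_fun fun ℓ => ?_
  unfold sinCoef
  have h : √(2 : ℝ) * √2 = 2 := Real.mul_self_sqrt (by norm_num)
  linear_combination (Real.sin (Real.pi * ((ℓ : ℝ) + 1) * x) *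
    Real.sin (Real.pi * ((ℓ : ℝ) + 1) * y) * Real.exp (-(Real.pi ^ 2 * ((ℓ : ℝ) + 1) ^ 2 * s))) * h

theorem hasSum_incCoef {s : ℝ} (hs : 0 < s) (α δ x y : ℝ) :
    HasSum (fun ℓ : ℕ => incCoef α δ x ℓ * incCoef α δ y ℓ *
      Real.exp (-(Real.pi ^ 2 * ((ℓ : ℝ) + 1) ^ 2 * s))) (cornerKer α δ s x y) := by
  refine (((((hasSum_sinCoef hs (x + δ) (y + δ)).mul_left (α ^ 2)).add
    (hasSum_sinCoef hs x y)).sub ((hasSum_sinCoef hs (x + δ) y).mul_left α)).sub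
    ((hasSum_sinCoef hs x (y + δ)).mul_left α)).congr_fun fun ℓ => ?_
  unfold incCoef
  ring

theorem exp_mul_eigenfunction (p : Params) (ℓ : ℕ) (y : ℝ) :
    Real.exp (p.κ * y / 2) * p.eigenfunction (ℓ + 1) y = sinCoef y ℓ := by
  unfold Params.eigenfunction sinCoef
  rw [mul_left_comm, ← Real.exp_add]
  push_cast
  simp

theorem exp_mul_eigenfunction_add (p : Params) (ℓ : ℕ) (y δ : ℝ) :
    Real.exp (p.κ * y / 2) * p.eigenfunction (ℓ + 1) (y + δ) =
      Real.exp (-(p.κ * δ / 2)) * sinCoef (y + δ) ℓ := by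
  rw [← exp_mul_eigenfunction p, ← mul_assoc, ← Real.exp_add]
  congr 2
  ring

theorem Params.eigenvalue_eq (p : Params) (ℓ : ℕ) :
    p.eigenvalue (ℓ + 1) = p.θ₂ * specVal p.Γ ℓ := by
  unfold Params.eigenvalue specVal; push_cast; ring

variable {Ω : Type*} [MeasurableSpace Ω] {P : Measure Ω} [IsProbabilityMeasure P]
  {p : Params} {β : ℕ → ℝ≥0 → Ω → ℝ} {u : ℕ → ℝ → Ω → ℝ} {X : ℝ → ℝ → Ω → ℝ}

theorem IsCenteredGaussian.of_isEmpty {ι : Type*} [Fintype ι] [IsEmpty ι] (Y : ι → Ω → ℝ)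
    (B : ι → ι → ℝ) : IsCenteredGaussian P Y B where
  aemeasurable a := isEmptyElim a
  symm a := isEmptyElim a
  charFun_eq c := by simp

/-- Temporal increments of weighted Fourier modes have second differences as covariances. -/
theorem IsStationarySolution.isCenteredGaussian_increment (hX : IsStationarySolution P p β u X)
    (hp : p.Admissible) {Δ : ℝ} (hΔ : 0 < Δ) {N : ℕ} {ι : Type*} [Fintype ι]
    {ξ : Fin N × ι → Ω → ℝ} {s : ι → ℕ → ℝ} {K : ℝ} (hs : ∀ k ℓ, |s k ℓ| ≤ K)
    {q : ι → ι → ℝ → ℝ} (hq : ∀ k l v, 0 < v → HasSum (fun ℓ : ℕ => s k ℓ * s l ℓ *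
      Real.exp (-(Real.pi ^ 2 * ((ℓ : ℝ) + 1) ^ 2 * v))) (q k l v))
    (hξ : ∀ a, ∀ᵐ ω ∂P, Tendsto (fun n => ∑ ℓ ∈ Finset.range n,
      s a.2 ℓ * (u ℓ (((a.1 : ℕ) + 1 : ℕ) * Δ) ω - u ℓ ((a.1 : ℕ) * Δ) ω)) atTop (𝓝 (ξ a ω))) :
    IsCenteredGaussian P ξ (fun a b => p.σ ^ 2 / (2 * p.θ₂) *
      secondDiff (fun v => Real.exp (-(p.Γ * v)) * q a.2 b.2 v) (p.θ₂ * Δ)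
        ((a.1 : ℕ) - (b.1 : ℕ) : ℤ)) := by
  have hθ := hp.diffusivity_pos
  have hsum : ∀ (w : ℕ → ℝ) (i : Fin N), ∑ j ∈ Finset.range (N + 1),
      ((if j = (i : ℕ) + 1 then 1 else 0) - (if j = (i : ℕ) then 1 else 0)) * w j =
      w (i + 1) - w i := by
    intro w i
    have h1 : (i : ℕ) + 1 ∈ Finset.range (N + 1) := by simp
    have h2 : (i : ℕ) ∈ Finset.range (N + 1) := by
      rw [Finset.mem_range]; exact i.2.trans (Nat.lt_succ_self N)
    simp_rw [sub_mul, Finset.sum_sub_distrib, ite_mul, one_mul, zero_mul, Finset.sum_ite_eq' ,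
      if_pos h1, if_pos h2]
  refine hX.isCenteredGaussian hp hΔ (I := N + 1) (g := fun a ℓ j => s a.2 ℓ *
    ((if j = (a.1 : ℕ) + 1 then 1 else 0) - (if j = (a.1 : ℕ) then 1 else 0))) (fun a => ?_)
    fun a b => ?_
  · filter_upwards [hξ a] with ω hω
    refine hω.congr fun n => Finset.sum_congr rfl fun ℓ _ => ?_
    simp_rw [mul_assoc]
    rw [← Finset.mul_sum, hsum (fun j => u ℓ (j * Δ) ω)]
  · have hΓ : 0 < p.Γ + Real.pi ^ 2 := hp.spectral_gap
    have hK : ∀ ℓ, |s a.2 ℓ * s b.2 ℓ| ≤ K * K := fun ℓ => by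
      rw [abs_mul]
      exact mul_le_mul (hs _ _) (hs _ _) (abs_nonneg _) ((abs_nonneg _).trans (hs a.2 ℓ))
    have hG := fun (τ : ℝ) (hτ : 0 ≤ τ) =>
      (hasSum_spectral_integral hΓ hK (hq a.2 b.2) hτ).2
    set J : ℝ := ((a.1 : ℕ) : ℝ) - ((b.1 : ℕ) : ℝ) with hJ
    have hη : 0 ≤ p.θ₂ * Δ := by positivity
    have h := ((hG (|J + 1| * (p.θ₂ * Δ)) (by positivity)).add
      (hG (|J - 1| * (p.θ₂ * Δ)) (by positivity))).sub
      ((hG (|J| * (p.θ₂ * Δ)) (by positivity)).mul_left 2)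
    have hJ' : (((a.1 : ℕ) - (b.1 : ℕ) : ℤ) : ℝ) = J := by rw [hJ]; push_cast; rfl
    simp only [secondDiff, hJ']
    refine (h.mul_left (p.σ ^ 2 / (2 * p.θ₂))).congr_fun fun ℓ => ?_
    have e1 : ∀ i, ∑ j ∈ Finset.range (N + 1), s a.2 ℓ *
        ((if i = (a.1 : ℕ) + 1 then 1 else 0) - (if i = (a.1 : ℕ) then 1 else 0)) * (s b.2 ℓ *
        ((if j = (b.1 : ℕ) + 1 then 1 else 0) - (if j = (b.1 : ℕ) then 1 else 0))) *
        p.modeCov Δ ℓ i j = s a.2 ℓ * s b.2 ℓ * (((if i = (a.1 : ℕ) + 1 then 1 else 0) -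
        (if i = (a.1 : ℕ) then 1 else 0)) *
        (p.modeCov Δ ℓ i (b.1 + 1) - p.modeCov Δ ℓ i b.1)) := by
      intro i
      rw [← hsum (fun j => p.modeCov Δ ℓ i j) b.1, Finset.mul_sum, Finset.mul_sum]
      exact Finset.sum_congr rfl fun j _ => by ring
    simp_rw [e1]
    rw [← Finset.mul_sum, hsum (fun i => p.modeCov Δ ℓ i (b.1 + 1) - p.modeCov Δ ℓ i b.1)]
    simp only [Params.modeCov, p.eigenvalue_eq]
    push_cast
    rw [show ((a.1 : ℕ) : ℝ) + 1 - (((b.1 : ℕ) : ℝ) + 1) = J by rw [hJ]; ring,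
      show ((a.1 : ℕ) : ℝ) + 1 - ((b.1 : ℕ) : ℝ) = J + 1 by rw [hJ]; ring,
      show ((a.1 : ℕ) : ℝ) - (((b.1 : ℕ) : ℝ) + 1) = J - 1 by rw [hJ]; ring, ← hJ]
    have hμ := (specVal_pos hΓ ℓ).ne'
    rw [show p.θ₂ * specVal p.Γ ℓ * (|J| * Δ) = specVal p.Γ ℓ * (|J| * (p.θ₂ * Δ)) by ring,
      show p.θ₂ * specVal p.Γ ℓ * (|J + 1| * Δ) = specVal p.Γ ℓ * (|J + 1| * (p.θ₂ * Δ)) by ring,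
      show p.θ₂ * specVal p.Γ ℓ * (|J - 1| * Δ) = specVal p.Γ ℓ * (|J - 1| * (p.θ₂ * Δ)) by ring]
    field_simp
    ring

/-- The covariances of weighted Fourier modes. -/
theorem IsStationarySolution.isCenteredGaussian_static (hX : IsStationarySolution P p β u X)
    (hp : p.Admissible) {Δ : ℝ} (hΔ : 0 < Δ) {N : ℕ} {ι : Type*} [Fintype ι]
    {ξ : Fin N × ι → Ω → ℝ} {s : ι → ℕ → ℝ}
    (hξ : ∀ a, ∀ᵐ ω ∂P, Tendsto (fun n => ∑ ℓ ∈ Finset.range n,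
      s a.2 ℓ * u ℓ ((a.1 : ℕ) * Δ) ω) atTop (𝓝 (ξ a ω)))
    {S : Fin N × ι → Fin N × ι → ℝ} (hS : ∀ a b, HasSum (fun ℓ => s a.2 ℓ * s b.2 ℓ *
      (Real.exp (-(specVal p.Γ ℓ * (|((a.1 : ℕ) : ℝ) - (b.1 : ℕ)| * (p.θ₂ * Δ)))) /
        specVal p.Γ ℓ)) (S a b)) :
    IsCenteredGaussian P ξ (fun a b => p.σ ^ 2 / (2 * p.θ₂) * S a b) := by
  have hθ := hp.diffusivity_pos
  have hsum : ∀ (w : ℕ → ℝ) (i : Fin N), ∑ j ∈ Finset.range N,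
      (if j = (i : ℕ) then 1 else 0) * w j = w i := by
    intro w i
    simp_rw [ite_mul, one_mul, zero_mul, Finset.sum_ite_eq', Finset.mem_range, if_pos i.2]
  refine hX.isCenteredGaussian hp hΔ (I := N) (g := fun a ℓ j => s a.2 ℓ *
    (if j = (a.1 : ℕ) then 1 else 0)) (fun a => ?_) fun a b => ?_
  · filter_upwards [hξ a] with ω hω
    refine hω.congr fun n => Finset.sum_congr rfl fun ℓ _ => ?_
    simp_rw [mul_assoc]
    rw [← Finset.mul_sum, hsum (fun j => u ℓ (j * Δ) ω)]
  · refine ((hS a b).mul_left (p.σ ^ 2 / (2 * p.θ₂))).congr_fun fun ℓ => ?_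
    have e1 : ∀ i, ∑ j ∈ Finset.range N, s a.2 ℓ *
        (if i = (a.1 : ℕ) then 1 else 0) * (s b.2 ℓ * (if j = (b.1 : ℕ) then 1 else 0)) *
        p.modeCov Δ ℓ i j = s a.2 ℓ * s b.2 ℓ * ((if i = (a.1 : ℕ) then 1 else 0) *
        p.modeCov Δ ℓ i b.1) := by
      intro i
      rw [← hsum (fun j => p.modeCov Δ ℓ i j) b.1, Finset.mul_sum, Finset.mul_sum]
      exact Finset.sum_congr rfl fun j _ => by ring
    simp_rw [e1]
    rw [← Finset.mul_sum, hsum (fun i => p.modeCov Δ ℓ i b.1)]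
    simp only [Params.modeCov, p.eigenvalue_eq]
    have hμ := (specVal_pos hp.spectral_gap ℓ).ne'
    rw [show p.θ₂ * specVal p.Γ ℓ * (|((a.1 : ℕ) : ℝ) - (b.1 : ℕ)| * Δ) =
      specVal p.Γ ℓ * (|((a.1 : ℕ) : ℝ) - (b.1 : ℕ)| * (p.θ₂ * Δ)) by ring]
    field_simp

end Fields

section Grid

variable {b : ℝ} {M : ℕ}

theorem spaceMesh_pos (hb₁ : b < 1 / 2) (hM : 0 < M) : 0 < spaceMesh b M := by
  unfold spaceMesh
  have : (0 : ℝ) < M := by exact_mod_cast hM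
  exact div_pos (by linarith) this

theorem gridPoint_succ (b : ℝ) (M k : ℕ) :
    gridPoint b M (k + 1) = gridPoint b M k + spaceMesh b M := by
  unfold gridPoint; push_cast; ring

theorem gridPoint_mem (hb₁ : b < 1 / 2) (hM : 0 < M) {k : ℕ} (hk : k ≤ M) :
    gridPoint b M k ∈ Set.Icc b (1 - b) := by
  have hM' : (0 : ℝ) < M := by exact_mod_cast hM
  have hδ := spaceMesh_pos hb₁ hM
  have h1 : (M : ℝ) * spaceMesh b M = 1 - 2 * b := by
    unfold spaceMesh; field_simp
  have h2 : (k : ℝ) * spaceMesh b M ≤ M * spaceMesh b M :=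
    mul_le_mul_of_nonneg_right (by exact_mod_cast hk) hδ.le
  unfold gridPoint
  constructor
  · have : 0 ≤ (k : ℝ) * spaceMesh b M := by positivity
    linarith
  · linarith

theorem gridPoint_sub (b : ℝ) (M k l : ℕ) :
    gridPoint b M k - gridPoint b M l = ((k : ℝ) - l) * spaceMesh b M := by
  unfold gridPoint; ring

end Grid

section ObservedFields

variable {Ω : Type*} [MeasurableSpace Ω] {P : Measure Ω}
  {p : Params} {β : ℕ → ℝ≥0 → Ω → ℝ} {u : ℕ → ℝ → Ω → ℝ} {X : ℝ → ℝ → Ω → ℝ}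
  {T b : ℝ} {N M : ℕ}

theorem IsStationarySolution.tendsto_observe (hX : IsStationarySolution P p β u X) (hT : 0 < T)
    (hb₀ : 0 ≤ b) (hb₁ : b < 1 / 2) (hM : 0 < M) (N i : ℕ) {k : ℕ} (hk : k ≤ M) :
    ∀ᵐ ω ∂P, Tendsto (fun n => ∑ ℓ ∈ Finset.range n,
      u ℓ (i * timeMesh T N) ω * p.eigenfunction (ℓ + 1) (gridPoint b M k)) atTop
      (𝓝 (observe X T b N M ω i k)) := by
  have hy := gridPoint_mem hb₁ hM hk
  exact hX.expansion _ (by unfold timeMesh; positivity) _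
    ⟨hb₀.trans hy.1, by linarith [hy.2]⟩

/-- The damping factor of the spatial increments. -/
noncomputable def damping (p : Params) (δ : ℝ) : ℝ := Real.exp (-(p.κ * δ / 2))

theorem timeMesh_pos (hT : 0 < T) (hN : 0 < N) : 0 < timeMesh T N := by
  have : (0 : ℝ) < N := by exact_mod_cast hN
  exact div_pos hT this

theorem pos_of_fin_prod (a : Fin N × Fin M) : 0 < N ∧ 0 < M :=
  ⟨a.1.pos, a.2.pos⟩

theorem IsStationarySolution.isCenteredGaussian_temporal [IsProbabilityMeasure P]
    (hX : IsStationarySolution P p β u X)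
    (hp : p.Admissible) (hT : 0 < T) (hb₀ : 0 ≤ b) (hb₁ : b < 1 / 2) (N M : ℕ) :
    IsCenteredGaussian P (fun (a : Fin N × Fin M) ω => Real.exp (p.κ * gridPoint b M a.2 / 2) *
      (observe X T b N M ω (a.1 + 1) a.2 - observe X T b N M ω a.1 a.2))
      (fun a b' => p.σ ^ 2 / (2 * p.θ₂) * secondDiff (fun v => Real.exp (-(p.Γ * v)) *
        dirKer v (gridPoint b M a.2) (gridPoint b M b'.2)) (p.θ₂ * timeMesh T N)
        ((a.1 : ℕ) - (b'.1 : ℕ) : ℤ)) := by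
  rcases isEmpty_or_nonempty (Fin N × Fin M) with h | ⟨⟨a₀⟩⟩
  · exact .of_isEmpty _ _
  obtain ⟨hN, hM⟩ := pos_of_fin_prod a₀
  refine hX.isCenteredGaussian_increment hp (timeMesh_pos hT hN)
    (s := fun k : Fin M => sinCoef (gridPoint b M k))
    (q := fun k l v => dirKer v (gridPoint b M k) (gridPoint b M l))
    (fun k ℓ => abs_sinCoef_le _ _) (fun k l v hv => hasSum_sinCoef hv _ _) fun a => ?_
  filter_upwards [hX.tendsto_observe hT hb₀ hb₁ hM N (a.1 + 1) a.2.2.le,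
    hX.tendsto_observe hT hb₀ hb₁ hM N a.1 a.2.2.le] with ω h1 h2
  refine ((h1.sub h2).const_mul (Real.exp (p.κ * gridPoint b M a.2 / 2))).congr fun n => ?_
  rw [← Finset.sum_sub_distrib, Finset.mul_sum]
  refine Finset.sum_congr rfl fun ℓ _ => ?_
  rw [← exp_mul_eigenfunction p]
  ring

theorem IsStationarySolution.isCenteredGaussian_double [IsProbabilityMeasure P]
    (hX : IsStationarySolution P p β u X)
    (hp : p.Admissible) (hT : 0 < T) (hb₀ : 0 ≤ b) (hb₁ : b < 1 / 2) (N M : ℕ) :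
    IsCenteredGaussian P (fun (a : Fin N × Fin M) ω => Real.exp (p.κ * gridPoint b M a.2 / 2) *
      doubleIncrement (observe X T b N M ω) a.1 a.2)
      (fun a b' => p.σ ^ 2 / (2 * p.θ₂) * secondDiff (fun v => Real.exp (-(p.Γ * v)) *
        cornerKer (damping p (spaceMesh b M)) (spaceMesh b M) v (gridPoint b M a.2)
          (gridPoint b M b'.2)) (p.θ₂ * timeMesh T N) ((a.1 : ℕ) - (b'.1 : ℕ) : ℤ)) := by
  rcases isEmpty_or_nonempty (Fin N × Fin M) with h | ⟨⟨a₀⟩⟩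
  · exact .of_isEmpty _ _
  obtain ⟨hN, hM⟩ := pos_of_fin_prod a₀
  set δ := spaceMesh b M with hδ
  refine hX.isCenteredGaussian_increment hp (timeMesh_pos hT hN)
    (s := fun k : Fin M => incCoef (damping p δ) δ (gridPoint b M k))
    (q := fun k l v => cornerKer (damping p δ) δ v (gridPoint b M k) (gridPoint b M l))
    (fun k ℓ => abs_incCoef_le _ _ _ _) (fun k l v hv => hasSum_incCoef hv _ _ _ _) fun a => ?_
  filter_upwards [hX.tendsto_observe hT hb₀ hb₁ hM N (a.1 + 1) a.2.2.le,
    hX.tendsto_observe hT hb₀ hb₁ hM N a.1 a.2.2.le,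
    hX.tendsto_observe hT hb₀ hb₁ hM N (a.1 + 1) (Nat.succ_le_of_lt a.2.2),
    hX.tendsto_observe hT hb₀ hb₁ hM N a.1 (Nat.succ_le_of_lt a.2.2)] with ω h1 h2 h3 h4
  refine ((((h3.sub h1).sub h4).add h2).const_mul
    (Real.exp (p.κ * gridPoint b M a.2 / 2))).congr fun n => ?_
  rw [← Finset.sum_sub_distrib, ← Finset.sum_sub_distrib, ← Finset.sum_add_distrib, Finset.mul_sum]
  refine Finset.sum_congr rfl fun ℓ _ => ?_
  rw [incCoef, damping, ← exp_mul_eigenfunction_add p, ← exp_mul_eigenfunction p,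
    Nat.succ_eq_add_one, gridPoint_succ]
  ring

theorem IsStationarySolution.isCenteredGaussian_spatial [IsProbabilityMeasure P]
    (hX : IsStationarySolution P p β u X)
    (hp : p.Admissible) (hT : 0 < T) (hb₀ : 0 ≤ b) (hb₁ : b < 1 / 2) (N M : ℕ)
    {S : Fin N × Fin M → Fin N × Fin M → ℝ}
    (hS : ∀ a b', HasSum (fun ℓ => incCoef (damping p (spaceMesh b M)) (spaceMesh b M)
      (gridPoint b M a.2) ℓ * incCoef (damping p (spaceMesh b M)) (spaceMesh b M)
      (gridPoint b M b'.2) ℓ * (Real.exp (-(specVal p.Γ ℓ *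
        (|((a.1 : ℕ) : ℝ) - (b'.1 : ℕ)| * (p.θ₂ * timeMesh T N)))) / specVal p.Γ ℓ)) (S a b')) :
    IsCenteredGaussian P (fun (a : Fin N × Fin M) ω => Real.exp (p.κ * gridPoint b M a.2 / 2) *
      (observe X T b N M ω a.1 (a.2 + 1) - observe X T b N M ω a.1 a.2))
      (fun a b' => p.σ ^ 2 / (2 * p.θ₂) * S a b') := by
  rcases isEmpty_or_nonempty (Fin N × Fin M) with h | ⟨⟨a₀⟩⟩
  · exact .of_isEmpty _ _
  obtain ⟨hN, hM⟩ := pos_of_fin_prod a₀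
  refine hX.isCenteredGaussian_static hp (timeMesh_pos hT hN)
    (s := fun k : Fin M => incCoef (damping p (spaceMesh b M)) (spaceMesh b M) (gridPoint b M k))
    (fun a => ?_) hS
  filter_upwards [hX.tendsto_observe hT hb₀ hb₁ hM N a.1 (Nat.succ_le_of_lt a.2.2),
    hX.tendsto_observe hT hb₀ hb₁ hM N a.1 a.2.2.le] with ω h1 h2
  refine ((h1.sub h2).const_mul (Real.exp (p.κ * gridPoint b M a.2 / 2))).congr fun n => ?_
  rw [← Finset.sum_sub_distrib, Finset.mul_sum]
  refine Finset.sum_congr rfl fun ℓ _ => ?_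
  rw [incCoef, damping, ← exp_mul_eigenfunction_add p, ← exp_mul_eigenfunction p,
    Nat.succ_eq_add_one, gridPoint_succ]
  ring

end ObservedFields

section Estimators

variable {p : Params} {T b : ℝ} {N M : ℕ}

theorem exp_half_mul_sq (x y : ℝ) : (Real.exp (x / 2) * y) ^ 2 = Real.exp x * y ^ 2 := by
  rw [mul_pow, ← Real.exp_nat_mul]
  congr 2
  push_cast
  ring

theorem sum_fin_prod (F : ℕ → ℕ → ℝ) : ∑ a : Fin N × Fin M, F a.1 a.2 =
    ∑ i ∈ Finset.range N, ∑ k ∈ Finset.range M, F i k := by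
  rw [Fintype.sum_prod_type, Finset.sum_range fun i => ∑ k ∈ Finset.range M, F i k]
  exact Finset.sum_congr rfl fun i _ => (Finset.sum_range fun k => F i k).symm

theorem sigmaSqTemporal_eq (hσ : 0 < p.σ ^ 2) (Z : ℕ → ℕ → ℝ) :
    sigmaSqTemporal p.θ₂ p.κ T b N M Z = p.σ ^ 2 * (1 / ((M : ℝ) * N) * ∑ a : Fin N × Fin M,
      (√(√(Real.pi * p.θ₂) / (√(timeMesh T N) * p.σ ^ 2)) *
        (Real.exp (p.κ * gridPoint b M a.2 / 2) * (Z (a.1 + 1) a.2 - Z a.1 a.2))) ^ 2) := by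
  have h : ∀ a : Fin N × Fin M, (√(√(Real.pi * p.θ₂) / (√(timeMesh T N) * p.σ ^ 2)) *
      (Real.exp (p.κ * gridPoint b M a.2 / 2) * (Z (a.1 + 1) a.2 - Z a.1 a.2))) ^ 2 =
      √(Real.pi * p.θ₂) / (√(timeMesh T N) * p.σ ^ 2) * (fun i k : ℕ =>
        Real.exp (p.κ * gridPoint b M k) * (Z (i + 1) k - Z i k) ^ 2) a.1 a.2 := fun a => by
    rw [mul_pow, Real.sq_sqrt (by positivity), exp_half_mul_sq]
  simp_rw [h, ← Finset.mul_sum]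
  rw [sum_fin_prod (fun i k => Real.exp (p.κ * gridPoint b M k) * (Z (i + 1) k - Z i k) ^ 2)]
  unfold sigmaSqTemporal temporalVariation
  generalize ∑ i ∈ Finset.range N, ∑ k ∈ Finset.range M,
    Real.exp (p.κ * gridPoint b M k) * (Z (i + 1) k - Z i k) ^ 2 = V
  have hσ0 : p.σ ≠ 0 := fun h0 => by simp [h0] at hσ
  field_simp

theorem sigmaSqDouble_eq (hσ : 0 < p.σ ^ 2)
    (hΦ : 0 ≤ doubleΦ p.θ₂ p.κ (spaceMesh b M) (timeMesh T N)) (Z : ℕ → ℕ → ℝ) :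
    sigmaSqDouble p.θ₂ p.κ T b N M Z = p.σ ^ 2 * (1 / ((M : ℝ) * N) * ∑ a : Fin N × Fin M,
      (√(1 / (doubleΦ p.θ₂ p.κ (spaceMesh b M) (timeMesh T N) * p.σ ^ 2)) *
        (Real.exp (p.κ * gridPoint b M a.2 / 2) * doubleIncrement Z a.1 a.2)) ^ 2) := by
  have h : ∀ a : Fin N × Fin M,
      (√(1 / (doubleΦ p.θ₂ p.κ (spaceMesh b M) (timeMesh T N) * p.σ ^ 2)) *
      (Real.exp (p.κ * gridPoint b M a.2 / 2) * doubleIncrement Z a.1 a.2)) ^ 2 =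
      1 / (doubleΦ p.θ₂ p.κ (spaceMesh b M) (timeMesh T N) * p.σ ^ 2) * (fun i k : ℕ =>
        Real.exp (p.κ * gridPoint b M k) * doubleIncrement Z i k ^ 2) a.1 a.2 := fun a => by
    rw [mul_pow, Real.sq_sqrt (by positivity), exp_half_mul_sq]
  simp_rw [h, ← Finset.mul_sum]
  rw [sum_fin_prod (fun i k => Real.exp (p.κ * gridPoint b M k) * doubleIncrement Z i k ^ 2),
    Finset.sum_comm]
  unfold sigmaSqDouble doubleVariation
  generalize ∑ k ∈ Finset.range M, ∑ i ∈ Finset.range N,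
    Real.exp (p.κ * gridPoint b M k) * doubleIncrement Z i k ^ 2 = V
  have hσ0 : p.σ ≠ 0 := fun h0 => by simp [h0] at hσ
  field_simp

theorem sigmaSqSpatial_eq (hσ : 0 < p.σ ^ 2) (hθ : 0 < p.θ₂) (hδ : 0 ≤ spaceMesh b M)
    (Z : ℕ → ℕ → ℝ) :
    sigmaSqSpatial p.θ₂ p.κ b N M Z = p.σ ^ 2 * (1 / ((M : ℝ) * N) * ∑ a : Fin N × Fin M,
      (√(2 * p.θ₂ / (spaceMesh b M * p.σ ^ 2)) *
        (Real.exp (p.κ * gridPoint b M a.2 / 2) * (Z a.1 (a.2 + 1) - Z a.1 a.2))) ^ 2) := by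
  have h : ∀ a : Fin N × Fin M, (√(2 * p.θ₂ / (spaceMesh b M * p.σ ^ 2)) *
      (Real.exp (p.κ * gridPoint b M a.2 / 2) * (Z a.1 (a.2 + 1) - Z a.1 a.2))) ^ 2 =
      2 * p.θ₂ / (spaceMesh b M * p.σ ^ 2) * (fun i k : ℕ =>
        Real.exp (p.κ * gridPoint b M k) * (Z i (k + 1) - Z i k) ^ 2) a.1 a.2 := fun a => by
    rw [mul_pow, Real.sq_sqrt (by positivity), exp_half_mul_sq]
  simp_rw [h, ← Finset.mul_sum]
  rw [sum_fin_prod (fun i k => Real.exp (p.κ * gridPoint b M k) * (Z i (k + 1) - Z i k) ^ 2)]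
  unfold sigmaSqSpatial spatialVariation
  generalize ∑ i ∈ Finset.range N, ∑ k ∈ Finset.range M,
    Real.exp (p.κ * gridPoint b M k) * (Z i (k + 1) - Z i k) ^ 2 = V
  have hσ0 : p.σ ≠ 0 := fun h0 => by simp [h0] at hσ
  field_simp

end Estimators

section TimeRegularity

/-- Bounds of heat kernel type on a function of time and on its increments. -/
structure TimeRegular (T C A : ℝ) (q : ℝ → ℝ) : Prop where
  abs_le : ∀ v, 0 < v → v ≤ T → |q v| ≤ C * √v / (v + A)
  abs_sub_le : ∀ v η, 0 < v → 0 ≤ η → v + η ≤ T → |q (v + η) - q v| ≤ C * η * (√v)⁻¹ / (v + A)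

variable {T C C' A : ℝ} {q q' : ℝ → ℝ}

theorem TimeRegular.const_mul (h : TimeRegular T C A q) (c : ℝ) :
    TimeRegular T (|c| * C) A (fun v => c * q v) where
  abs_le v hv hvT := by
    rw [abs_mul, mul_assoc, mul_div_assoc]
    exact mul_le_mul_of_nonneg_left (h.abs_le v hv hvT) (abs_nonneg c)
  abs_sub_le v η hv hη hvT := by
    rw [← mul_sub, abs_mul, mul_assoc, mul_assoc, mul_div_assoc, ← mul_assoc C]
    exact mul_le_mul_of_nonneg_left (h.abs_sub_le v η hv hη hvT) (abs_nonneg c)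

theorem TimeRegular.add (h : TimeRegular T C A q) (h' : TimeRegular T C' A q') :
    TimeRegular T (C + C') A (fun v => q v + q' v) where
  abs_le v hv hvT := (abs_add_le _ _).trans <|
    (add_le_add (h.abs_le v hv hvT) (h'.abs_le v hv hvT)).trans (le_of_eq (by ring))
  abs_sub_le v η hv hη hvT := by
    rw [add_sub_add_comm]
    exact (abs_add_le _ _).trans <| (add_le_add (h.abs_sub_le v η hv hη hvT)
      (h'.abs_sub_le v η hv hη hvT)).trans (le_of_eq (by ring))

theorem abs_exp_sub_exp_le {x y m : ℝ} (hx : x ≤ m) (hy : y ≤ m) :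
    |Real.exp x - Real.exp y| ≤ Real.exp m * |x - y| := by
  wlog h : y ≤ x generalizing x y
  · rw [abs_sub_comm, abs_sub_comm x]; exact this hy hx (le_of_not_ge h)
  rw [abs_of_nonneg (sub_nonneg.2 (Real.exp_le_exp.2 h)), abs_of_nonneg (sub_nonneg.2 h)]
  have h1 : Real.exp x - Real.exp y = Real.exp x * (1 - Real.exp (y - x)) := by
    rw [mul_sub, ← Real.exp_add]; simp
  have h2 := Real.add_one_le_exp (y - x)
  rw [h1]
  exact mul_le_mul (Real.exp_le_exp.2 hx) (by linarith)
    (by have := Real.exp_le_one_iff.2 (sub_nonpos.2 h); linarith) (Real.exp_pos m).le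

theorem neg_mul_le_abs_mul {Γ v T : ℝ} (hv : 0 ≤ v) (hvT : v ≤ T) : -(Γ * v) ≤ |Γ| * T := by
  calc -(Γ * v) ≤ |Γ * v| := neg_le_abs _
    _ = |Γ| * v := by rw [abs_mul, abs_of_nonneg hv]
    _ ≤ |Γ| * T := by gcongr

theorem TimeRegular.exp_mul (h : TimeRegular T C A q) (hC : 0 ≤ C) (hA : 0 ≤ A) (Γ : ℝ) :
    TimeRegular T (Real.exp (|Γ| * T) * (1 + |Γ| * T) * C) A
      (fun v => Real.exp (-(Γ * v)) * q v) where
  abs_le v hv hvT := by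
    rw [abs_mul, Real.abs_exp]
    have hT : 0 ≤ T := hv.le.trans hvT
    have h1 := mul_le_mul (Real.exp_le_exp.2 (neg_mul_le_abs_mul (Γ := Γ) hv.le hvT))
      (h.abs_le v hv hvT) (abs_nonneg _) (Real.exp_pos _).le
    refine h1.trans ?_
    rw [← mul_div_assoc]
    refine div_le_div_of_nonneg_right ?_ (by positivity)
    calc Real.exp (|Γ| * T) * (C * √v) ≤ Real.exp (|Γ| * T) * (C * √v) * (1 + |Γ| * T) :=
          le_mul_of_one_le_right (by positivity) (by
            have : 0 ≤ |Γ| * T := by positivity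
            linarith)
      _ = _ := by ring
  abs_sub_le v η hv hη hvT := by
    have hT : v ≤ T := by linarith
    have hv0 : 0 < √v := Real.sqrt_pos.2 hv
    have h1 := h.abs_sub_le v η hv hη hvT
    have h2 := h.abs_le v hv hT
    have h3 := neg_mul_le_abs_mul (Γ := Γ) (by linarith : 0 ≤ v + η) hvT
    have h4 := neg_mul_le_abs_mul (Γ := Γ) hv.le hT
    have h5 := abs_exp_sub_exp_le h3 h4
    rw [show -(Γ * (v + η)) - -(Γ * v) = -(Γ * η) by ring, abs_neg, abs_mul, abs_of_nonneg hη] at h5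
    have h6 : √v ≤ T * (√v)⁻¹ := by
      rw [← div_eq_mul_inv, le_div_iff₀ hv0, Real.mul_self_sqrt hv.le]; exact hT
    rw [show Real.exp (-(Γ * (v + η))) * q (v + η) - Real.exp (-(Γ * v)) * q v =
      Real.exp (-(Γ * (v + η))) * (q (v + η) - q v) +
        (Real.exp (-(Γ * (v + η))) - Real.exp (-(Γ * v))) * q v by ring]
    refine (abs_add_le _ _).trans ?_
    rw [abs_mul, abs_mul, Real.abs_exp]
    calc _ ≤ Real.exp (|Γ| * T) * (C * η * (√v)⁻¹ / (v + A)) +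
          Real.exp (|Γ| * T) * (|Γ| * η) * (C * (T * (√v)⁻¹) / (v + A)) := by
          refine add_le_add (mul_le_mul (Real.exp_le_exp.2 h3) h1 (abs_nonneg _)
            (Real.exp_pos _).le) (mul_le_mul h5 (h2.trans ?_) (abs_nonneg _) (by positivity))
          gcongr
      _ = _ := by ring

theorem timeRegular_dirKer {x y : ℝ} (hT : 0 ≤ T) (hx : x ∈ Set.Icc (0 : ℝ) 1)
    (hy : y ∈ Set.Icc (0 : ℝ) 1) (hA0 : 0 ≤ A) (hA : A ≤ (x - y) ^ 2) :
    TimeRegular T (32 * (1 + T) * imageConst) A (fun v => dirKer v x y) where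
  abs_le v hv hvT := by
    refine (abs_dirKer_le hv hvT hx hy).trans ?_
    have := imageConst_nonneg
    gcongr
    norm_num
  abs_sub_le v η hv hη hvT := by
    refine (abs_dirKer_time_sub_le (T := T) hv hη (by linarith) hx hy).trans ?_
    have := imageConst_nonneg
    have : 0 < √v := Real.sqrt_pos.2 hv
    gcongr

theorem timeRegular_cornerKer {α K δ x y : ℝ} (hT : 0 ≤ T) (hα0 : 0 ≤ α) (hαK : α ≤ K)
    (hδ : 0 ≤ δ) (hx0 : 0 ≤ x) (hx1 : x + δ ≤ 1) (hy0 : 0 ≤ y) (hy1 : y + δ ≤ 1) (hA0 : 0 ≤ A)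
    (hA1 : A ≤ (x - y) ^ 2) (hA2 : A ≤ (x + δ - y) ^ 2) (hA3 : A ≤ (x - (y + δ)) ^ 2) :
    TimeRegular T ((1 + K) ^ 2 * (32 * (1 + T) * imageConst)) A
      (fun v => cornerKer α δ v x y) := by
  have hx : x ∈ Set.Icc (0 : ℝ) 1 := ⟨hx0, by linarith⟩
  have hy : y ∈ Set.Icc (0 : ℝ) 1 := ⟨hy0, by linarith⟩
  have hx' : x + δ ∈ Set.Icc (0 : ℝ) 1 := ⟨by linarith, hx1⟩
  have hy' : y + δ ∈ Set.Icc (0 : ℝ) 1 := ⟨by linarith, hy1⟩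
  have h := ((((timeRegular_dirKer hT hx' hy' hA0 (by rwa [add_sub_add_right_eq_sub])).const_mul
    (α ^ 2)).add (timeRegular_dirKer hT hx hy hA0 hA1)).add
    ((timeRegular_dirKer hT hx' hy hA0 hA2).const_mul (-α))).add
    ((timeRegular_dirKer hT hx hy' hA0 hA3).const_mul (-α))
  have hK : 0 ≤ K := hα0.trans hαK
  have hc : |α ^ 2| * (32 * (1 + T) * imageConst) + 32 * (1 + T) * imageConst +
      |-α| * (32 * (1 + T) * imageConst) + |-α| * (32 * (1 + T) * imageConst) ≤
      (1 + K) ^ 2 * (32 * (1 + T) * imageConst) := by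
    rw [abs_neg, abs_of_nonneg hα0, abs_of_nonneg (sq_nonneg α)]
    have := imageConst_nonneg
    calc _ = (1 + α) ^ 2 * (32 * (1 + T) * imageConst) := by ring
      _ ≤ _ := by gcongr
  have he : (fun v => cornerKer α δ v x y) = fun v => α ^ 2 * dirKer v (x + δ) (y + δ) +
      dirKer v x y + -α * dirKer v (x + δ) y + -α * dirKer v x (y + δ) := by
    funext v; unfold cornerKer; ring
  rw [he]
  refine ⟨fun v hv hvT => (h.abs_le v hv hvT).trans ?_,
    fun v η hv hη hvT => (h.abs_sub_le v η hv hη hvT).trans ?_⟩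
  · gcongr
  · have : 0 < √v := Real.sqrt_pos.2 hv
    gcongr

end TimeRegularity

section AuxH

theorem integrable_exp_neg_sq : Integrable fun z : ℝ => Real.exp (-z ^ 2) := by
  simpa using integrable_exp_neg_mul_sq (b := 1) one_pos

/-- The complementary Gaussian integral. -/
noncomputable def gaussTail (y : ℝ) : ℝ := ∫ z in Set.Ioi y, Real.exp (-z ^ 2)

theorem gaussTail_zero : gaussTail 0 = √Real.pi / 2 := by
  have := integral_gaussian_Ioi 1
  simpa [gaussTail] using this

theorem gaussTail_eq (y : ℝ) :
    gaussTail y = √Real.pi / 2 - ∫ z in (0 : ℝ)..y, Real.exp (-z ^ 2) := by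
  have h := intervalIntegral.integral_interval_add_Ioi (a := 0) (b := y)
    (integrable_exp_neg_sq.integrableOn) (integrable_exp_neg_sq.integrableOn)
  rw [← gaussTail_zero]
  unfold gaussTail
  linarith

theorem hasDerivAt_gaussTail (y : ℝ) : HasDerivAt gaussTail (-Real.exp (-y ^ 2)) y := by
  have hc : Continuous fun z : ℝ => Real.exp (-z ^ 2) := by fun_prop
  have h := (intervalIntegral.integral_hasDerivAt_right (hc.intervalIntegrable 0 y)
    (hc.stronglyMeasurableAtFilter _ _) hc.continuousAt).const_sub (√Real.pi / 2)
  have he : gaussTail = fun y => √Real.pi / 2 - ∫ z in (0 : ℝ)..y, Real.exp (-z ^ 2) :=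
    funext gaussTail_eq
  rw [he]
  exact h

theorem auxH_eq (x : ℝ) :
    auxH x = 1 / (2 * √Real.pi) * (Real.exp (-(x ^ 2 / 4)) - x * gaussTail (x / 2)) := rfl

theorem hasDerivAt_auxH (x : ℝ) :
    HasDerivAt auxH (-(1 / (2 * √Real.pi)) * gaussTail (x / 2)) x := by
  have h1 : HasDerivAt (fun x : ℝ => -(x ^ 2 / 4)) (-(x / 2)) x :=
    ((hasDerivAt_pow 2 x).div_const 4).fun_neg.congr_deriv (by simp; ring)
  have h2 : HasDerivAt (fun x : ℝ => gaussTail (x / 2)) (-Real.exp (-(x / 2) ^ 2) * (1 / 2)) x :=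
    HasDerivAt.comp (h₂ := gaussTail) (h := fun x : ℝ => x / 2) x (hasDerivAt_gaussTail (x / 2))
      ((hasDerivAt_id' x).div_const 2)
  have h3 := (h1.exp.fun_sub ((hasDerivAt_id' x).fun_mul h2)).const_mul (1 / (2 * √Real.pi))
  refine (h3.congr_deriv ?_).congr_of_eventuallyEq (.of_forall fun y => auxH_eq y)
  rw [show -(x / 2) ^ 2 = -(x ^ 2 / 4) by ring]
  ring

theorem auxH_zero : auxH 0 = 1 / (2 * √Real.pi) := by
  simp [auxH]

theorem hasDerivAt_auxH_zero : HasDerivAt auxH (-(1 / 4)) 0 := by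
  refine (hasDerivAt_auxH 0).congr_deriv ?_
  rw [zero_div, gaussTail_zero]
  have : √Real.pi ≠ 0 := (Real.sqrt_pos.2 Real.pi_pos).ne'
  field_simp
  norm_num

theorem gaussTail_nonneg (y : ℝ) : 0 ≤ gaussTail y :=
  integral_nonneg fun _ => (Real.exp_pos _).le

theorem mul_gaussTail_le (y : ℝ) : y * gaussTail y ≤ 1 / 2 * Real.exp (-y ^ 2) := by
  have hd : ∀ z ∈ Set.Ici y, HasDerivAt (fun z : ℝ => -(1 / 2 * Real.exp (-z ^ 2)))
      (z * Real.exp (-z ^ 2)) z := fun z _ => by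
    have h1 : HasDerivAt (fun z : ℝ => -z ^ 2) (-(2 * z)) z := by
      simpa using (hasDerivAt_pow 2 z).fun_neg
    exact (h1.exp.const_mul (1 / 2)).fun_neg.congr_deriv (by ring)
  have hi : IntegrableOn (fun z : ℝ => z * Real.exp (-z ^ 2)) (Set.Ioi y) := by
    have := integrable_mul_exp_neg_mul_sq (b := 1) one_pos
    simp only [neg_mul, one_mul] at this
    exact this.integrableOn
  have ht : Tendsto (fun z : ℝ => -(1 / 2 * Real.exp (-z ^ 2))) atTop (𝓝 (-(1 / 2 * 0))) := by
    refine ((Real.tendsto_exp_atBot.comp ?_).const_mul (1 / 2)).neg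
    exact tendsto_neg_atTop_atBot.comp (tendsto_pow_atTop two_ne_zero)
  have h := integral_Ioi_of_hasDerivAt_of_tendsto' hd hi ht
  unfold gaussTail
  rw [← integral_const_mul]
  calc _ ≤ ∫ z in Set.Ioi y, z * Real.exp (-z ^ 2) := by
        refine setIntegral_mono_on (integrable_exp_neg_sq.integrableOn.const_mul y) hi
          measurableSet_Ioi fun z hz => ?_
        exact mul_le_mul_of_nonneg_right (le_of_lt hz) (Real.exp_pos _).le
    _ = _ := by rw [h]; ring

theorem abs_auxH_le {x : ℝ} (hx : 0 ≤ x) :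
    |auxH x| ≤ 1 / (2 * √Real.pi) * Real.exp (-(x ^ 2 / 4)) := by
  have h := mul_gaussTail_le (x / 2)
  rw [show -(x / 2) ^ 2 = -(x ^ 2 / 4) by ring] at h
  have h2 := mul_nonneg hx (gaussTail_nonneg (x / 2))
  rw [auxH_eq, abs_mul, abs_of_nonneg (by positivity : 0 ≤ 1 / (2 * √Real.pi))]
  refine mul_le_mul_of_nonneg_left ?_ (by positivity)
  rw [abs_le]
  constructor <;> linarith

theorem tendsto_auxH_atTop : Tendsto auxH atTop (𝓝 0) := by
  refine squeeze_zero_norm' ?_ (a := fun x => 1 / (2 * √Real.pi) * Real.exp (-(x ^ 2 / 4))) ?_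
  · filter_upwards [eventually_ge_atTop 0] with x hx using abs_auxH_le hx
  · rw [← mul_zero (1 / (2 * √Real.pi))]
    refine (Real.tendsto_exp_atBot.comp ?_).const_mul _
    exact tendsto_neg_atTop_atBot.comp
      ((tendsto_pow_atTop two_ne_zero).atTop_div_const (by norm_num))

theorem hasDerivAt_two_sqrt_mul_auxH {z v : ℝ} (hv : 0 < v) :
    HasDerivAt (fun v => 2 * √v * auxH (z / √v)) (heatKer v z) v := by
  have hs : 0 < √v := Real.sqrt_pos.2 hv
  have h1 := (hasDerivAt_two_sqrt hv)
  have h2 : HasDerivAt (fun v => z / √v) (-(z / (2 * v * √v))) v := by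
    refine (((Real.hasDerivAt_sqrt hv.ne').fun_inv hs.ne').const_mul z).congr_deriv ?_
    rw [Real.sq_sqrt hv.le]
    field_simp
  have h3 := h1.fun_mul ((hasDerivAt_auxH (z / √v)).comp v h2)
  refine h3.congr_deriv ?_
  simp only [Function.comp]
  rw [auxH_eq]
  unfold heatKer
  rw [show 4 * Real.pi * v = 2 ^ 2 * (Real.pi * v) by ring, Real.sqrt_mul (by norm_num),
    Real.sqrt_sq (by norm_num), Real.sqrt_mul Real.pi_pos.le, div_pow, Real.sq_sqrt hv.le,
    show -(z ^ 2 / v / 4) = -(z ^ 2 / (4 * v)) by rw [div_div, mul_comm v]]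
  have hp : √Real.pi ≠ 0 := (Real.sqrt_pos.2 Real.pi_pos).ne'
  have hv2 : √v * √v = v := Real.mul_self_sqrt hv.le
  generalize gaussTail (z / √v / 2) = Q
  generalize Real.exp (-(z ^ 2 / (4 * v))) = E
  field_simp
  rw [Real.sq_sqrt hv.le]
  ring

theorem integral_heatKer {τ : ℝ} (hτ : 0 ≤ τ) (z : ℝ) :
    IntervalIntegrable (fun v => heatKer v z) volume 0 τ ∧
      ∫ v in (0 : ℝ)..τ, heatKer v z = 2 * √τ * auxH (|z| / √τ) := by
  wlog hz : 0 ≤ z generalizing z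
  · have := this (-z) (by linarith)
    simpa only [heatKer_neg, abs_neg] using this
  rw [abs_of_nonneg hz]
  have hd : ∀ v ∈ Set.Ioo 0 τ, HasDerivAt (fun v => 2 * √v * auxH (z / √v)) (heatKer v z) v :=
    fun v hv => hasDerivAt_two_sqrt_mul_auxH hv.1
  have hc : ContinuousOn (fun v => 2 * √v * auxH (z / √v)) (Set.Icc 0 τ) := by
    intro v hv
    rcases hv.1.eq_or_lt with h0 | h0
    · subst h0
      refine ContinuousAt.continuousWithinAt ?_
      unfold ContinuousAt
      simp only [Real.sqrt_zero, mul_zero, zero_mul]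
      refine squeeze_zero_norm (a := fun v => 2 * √v * (1 / (2 * √Real.pi))) (fun v => ?_) ?_
      · rw [norm_mul, Real.norm_of_nonneg (by positivity)]
        refine mul_le_mul_of_nonneg_left ?_ (by positivity)
        refine (abs_auxH_le (by positivity)).trans (mul_le_of_le_one_right (by positivity) ?_)
        exact Real.exp_le_one_iff.2 (by
          have : 0 ≤ (z / √v) ^ 2 / 4 := by positivity
          linarith)
      · have : Continuous fun v : ℝ => 2 * √v * (1 / (2 * √Real.pi)) := by fun_prop
        simpa using this.tendsto 0
    · exact (hasDerivAt_two_sqrt_mul_auxH h0).continuousAt.continuousWithinAt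
  have hi : IntervalIntegrable (fun v => heatKer v z) volume 0 τ :=
    intervalIntegral.intervalIntegrable_deriv_of_nonneg (by rwa [Set.uIcc_of_le hτ])
      (by rw [min_eq_left hτ, max_eq_right hτ]; exact hd) fun v _ => heatKer_nonneg v z
  refine ⟨hi, ?_⟩
  rw [intervalIntegral.integral_eq_sub_of_hasDerivAt_of_le hτ hc hd hi]
  simp

end AuxH

section LatticeSums

theorem summable_latticeBound (C : ℝ) : Summable fun w : ℤ × ℤ =>
    (C / ((1 + |(w.1 : ℝ)|) * √(1 + (w.2 : ℝ) ^ 2))) ^ 2 := by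
  have h := (summable_int_inv_one_add_sq.mul_of_nonneg summable_int_inv_one_add_sq
    (fun _ => by positivity) (fun _ => by positivity)).mul_left (C ^ 2)
  refine h.of_nonneg_of_le (fun _ => sq_nonneg _) fun w => ?_
  rw [div_pow, mul_pow, Real.sq_sqrt (by positivity), div_eq_mul_inv, ← mul_inv]
  refine mul_le_mul_of_nonneg_left (inv_anti₀ (by positivity) ?_) (sq_nonneg C)
  refine mul_le_mul_of_nonneg_right ?_ (by positivity)
  nlinarith [abs_nonneg (w.1 : ℝ), sq_abs (w.1 : ℝ)]

/-- The second order differences of the square root. -/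
noncomputable def sqrtDiff (J : ℤ) : ℝ :=
  √|(J : ℝ) + 1| + √|(J : ℝ) - 1| - 2 * √|(J : ℝ)|

theorem secondDiff_heatKer_zero {η : ℝ} (hη : 0 ≤ η) (J : ℤ) :
    secondDiff (fun v => heatKer v 0) η J = √η / √Real.pi * sqrtDiff J := by
  unfold secondDiff sqrtDiff
  rw [(integral_heatKer (by positivity) 0).2, (integral_heatKer (by positivity) 0).2,
    (integral_heatKer (by positivity) 0).2, Real.sqrt_mul (abs_nonneg _),
    Real.sqrt_mul (abs_nonneg _), Real.sqrt_mul (abs_nonneg _)]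
  simp only [abs_zero, zero_div, auxH_zero]
  have : √Real.pi ≠ 0 := (Real.sqrt_pos.2 Real.pi_pos).ne'
  field_simp

theorem abs_sqrtDiff_le (J : ℤ) : |sqrtDiff J| ≤ 288 * √Real.pi / (1 + |(J : ℝ)|) := by
  have h := abs_secondDiff_le_of_time (f := fun v => heatKer v 0) (η := 1) (T := |(J : ℝ)| + 1)
    (C := 8) (a := 0) (c := 1) (ℓ := 0) one_pos (by norm_num) one_pos le_rfl (by norm_num)
    (fun τ hτ => (integral_heatKer hτ 0).1)
    (fun v hv _ => (heatKer_abs_le hv 0).trans (by gcongr; norm_num))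
    (fun v hv _ => by simpa using abs_heatKer_time_sub_le hv zero_le_one 0) (J := J) (by simp)
  rw [secondDiff_heatKer_zero zero_le_one] at h
  have hπ : 0 < √Real.pi := Real.sqrt_pos.2 Real.pi_pos
  rw [Real.sqrt_one, abs_mul, abs_of_pos (by positivity)] at h
  norm_num at h
  rw [inv_mul_le_iff₀ hπ] at h
  exact h.trans (le_of_eq (by ring))

theorem sqrtDiff_neg (J : ℤ) : sqrtDiff (-J) = sqrtDiff J := by
  unfold sqrtDiff
  push_cast
  rw [show -(J : ℝ) + 1 = -(J - 1) by ring, show -(J : ℝ) - 1 = -(J + 1) by ring, abs_neg, abs_neg,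
    abs_neg]
  ring

theorem summable_sqrtDiff_sq : Summable fun J : ℤ => sqrtDiff J ^ 2 := by
  refine (summable_int_inv_one_add_sq.mul_left ((288 * √Real.pi) ^ 2)).of_nonneg_of_le
    (fun _ => sq_nonneg _) fun J => ?_
  rw [← sq_abs (sqrtDiff J)]
  refine (pow_le_pow_left₀ (abs_nonneg _) (abs_sqrtDiff_le J) 2).trans ?_
  rw [div_pow, div_eq_mul_inv]
  refine mul_le_mul_of_nonneg_left (inv_anti₀ (by positivity) ?_) (by positivity)
  nlinarith [abs_nonneg (J : ℝ), sq_abs (J : ℝ)]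

theorem tsum_sqrtDiff_sq : ∑' J : ℤ, sqrtDiff J ^ 2 =
    4 + 2 * ∑' J : ℕ, (2 * √((J : ℝ) + 1) - √((J : ℝ) + 2) - √(J : ℝ)) ^ 2 := by
  rw [tsum_int_eq_zero_add_two_mul_tsum_pnat (fun J => by rw [sqrtDiff_neg]) summable_sqrtDiff_sq]
  congr 1
  · norm_num [sqrtDiff]
  · rw [nsmul_eq_mul, Nat.cast_ofNat,
      tsum_pnat_eq_tsum_succ (f := fun n : ℕ => sqrtDiff (n : ℤ) ^ 2)]
    congr 1
    refine tsum_congr fun n => ?_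
    unfold sqrtDiff
    push_cast
    rw [abs_of_nonneg (by positivity : (0 : ℝ) ≤ (n : ℝ) + 1 + 1), add_sub_cancel_right,
      abs_of_nonneg (by positivity : (0 : ℝ) ≤ (n : ℝ) + 1),
      abs_of_nonneg (by positivity : (0 : ℝ) ≤ (n : ℝ)), add_assoc, one_add_one_eq_two]
    ring

end LatticeSums

section TemporalCovariance

theorem abs_secondDiff_sub_le {f g : ℝ → ℝ} {η E : ℝ} {J : ℤ} (hη : 0 ≤ η)
    (h : ∀ τ, 0 ≤ τ → τ ≤ (|(J : ℝ)| + 1) * η →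
      |(∫ v in (0 : ℝ)..τ, f v) - ∫ v in (0 : ℝ)..τ, g v| ≤ E) :
    |secondDiff f η J - secondDiff g η J| ≤ 4 * E := by
  have h1 := h (|(J : ℝ) + 1| * η) (by positivity) (by
    gcongr; exact (abs_add_le _ _).trans (by simp))
  have h2 := h (|(J : ℝ) - 1| * η) (by positivity) (by
    gcongr; exact (abs_sub _ _).trans (by simp))
  have h3 := h (|(J : ℝ)| * η) (by positivity) (by gcongr; linarith)
  unfold secondDiff
  rw [abs_le] at *
  constructor <;> linarith [h1.1, h1.2, h2.1, h2.2, h3.1, h3.2]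

theorem abs_integral_sub_le {f g : ℝ → ℝ} {τ B : ℝ} (hτ : 0 ≤ τ)
    (hf : IntervalIntegrable f volume 0 τ) (hg : IntervalIntegrable g volume 0 τ)
    (h : ∀ v, 0 < v → v ≤ τ → |f v - g v| ≤ B) :
    |(∫ v in (0 : ℝ)..τ, f v) - ∫ v in (0 : ℝ)..τ, g v| ≤ B * τ := by
  rw [← intervalIntegral.integral_sub hf hg, ← Real.norm_eq_abs]
  have := intervalIntegral.norm_integral_le_of_norm_le_const (a := 0) (b := τ) (C := B)
    (f := fun v => f v - g v) fun v hv => by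
      rw [Set.uIoc_of_le hτ] at hv
      exact h v hv.1 hv.2
  rwa [sub_zero, abs_of_nonneg hτ] at this

variable {p : Params} {T b : ℝ}

theorem mul_timeMesh {N : ℕ} (hN : 0 < N) :
    (N : ℝ) * (p.θ₂ * timeMesh T N) = p.θ₂ * T := by
  have : (N : ℝ) ≠ 0 := by exact_mod_cast hN.ne'
  unfold timeMesh
  field_simp

theorem abs_lag_add_one_le {N : ℕ} (i j : Fin N) :
    |(((i : ℕ) - (j : ℕ) : ℤ) : ℝ)| + 1 ≤ N := by
  have h : |((i : ℕ) - (j : ℕ) : ℤ)| + 1 ≤ N := by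
    have := i.2; have := j.2
    rw [← le_sub_iff_add_le, abs_le]
    constructor <;> omega
  exact_mod_cast h

theorem intervalIntegrable_exp_mul_dirKer (hp : p.Admissible) (x y : ℝ) {τ : ℝ} (hτ : 0 ≤ τ) :
    IntervalIntegrable (fun v => Real.exp (-(p.Γ * v)) * dirKer v x y) volume 0 τ :=
  (hasSum_spectral_integral hp.spectral_gap (c := fun ℓ => sinCoef x ℓ * sinCoef y ℓ)
    (K := √2 * √2) (fun ℓ => by
      rw [abs_mul]
      exact mul_le_mul (abs_sinCoef_le _ _) (abs_sinCoef_le _ _) (abs_nonneg _)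
        (Real.sqrt_nonneg 2)) (fun s hs => hasSum_sinCoef hs x y) hτ).1

theorem exists_temporal_bound (hp : p.Admissible) (hT : 0 < T) (hb₀ : 0 ≤ b) (hb₁ : b < 1 / 2) :
    ∃ C, 0 < C ∧ ∀ (N M : ℕ) (a c : Fin N × Fin M), |secondDiff (fun v => Real.exp (-(p.Γ * v)) *
      dirKer v (gridPoint b M a.2) (gridPoint b M c.2)) (p.θ₂ * timeMesh T N)
      ((a.1 : ℕ) - (c.1 : ℕ) : ℤ)| ≤ C * √(p.θ₂ * timeMesh T N) /
        ((1 + |(((a.1 : ℕ) - (c.1 : ℕ) : ℤ) : ℝ)|) *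
          √(1 + ((((a.2 : ℕ) : ℝ) - (c.2 : ℕ)) * spaceMesh b M / √(p.θ₂ * timeMesh T N)) ^ 2)) := by
  set T' := p.θ₂ * T with hT'
  have hθ := hp.diffusivity_pos
  have hT'0 : 0 ≤ T' := by positivity
  have hc₀ := imageConst_nonneg
  set C := Real.exp (|p.Γ| * T') * (1 + |p.Γ| * T') * (32 * (1 + T') * imageConst) with hC
  have hC0 : 0 ≤ C := by positivity
  refine ⟨36 * C + 1, by positivity, fun N M a c => ?_⟩
  obtain ⟨hN, hM⟩ := pos_of_fin_prod a
  have hη : 0 < p.θ₂ * timeMesh T N := mul_pos hθ (timeMesh_pos hT hN)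
  set η := p.θ₂ * timeMesh T N with hη_def
  have hη0 : 0 < √η := Real.sqrt_pos.2 hη
  have hx := gridPoint_mem hb₁ hM a.2.2.le
  have hy := gridPoint_mem hb₁ hM c.2.2.le
  have hreg := (timeRegular_dirKer hT'0 ⟨hb₀.trans hx.1, by linarith [hx.2]⟩
    ⟨hb₀.trans hy.1, by linarith [hy.2]⟩ (sq_nonneg _) le_rfl).exp_mul (by positivity)
    (sq_nonneg _) p.Γ
  rw [gridPoint_sub] at hreg
  have h := abs_secondDiff_le_of_time (c := 1)
    (ℓ := (((a.2 : ℕ) : ℝ) - (c.2 : ℕ)) * spaceMesh b M / √η) hη hC0 one_pos le_rfl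
    (by rw [div_pow, Real.sq_sqrt hη.le]; apply le_of_eq; field_simp)
    (fun τ hτ => intervalIntegrable_exp_mul_dirKer hp _ _ hτ) hreg.abs_le
    (fun v hv hvT => hreg.abs_sub_le v η hv hη.le hvT)
    (J := ((a.1 : ℕ) - (c.1 : ℕ) : ℤ)) (by
      rw [hT', ← mul_timeMesh (p := p) (T := T) hN]
      exact mul_le_mul_of_nonneg_right (abs_lag_add_one_le a.1 c.1) hη.le)
  refine h.trans ?_
  gcongr
  rw [div_one]
  linarith

theorem exists_temporal_diagonal (hp : p.Admissible) (hT : 0 < T) (hb₀ : 0 < b)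
    (hb₁ : b < 1 / 2) : ∃ C, 0 < C ∧ ∀ (N M : ℕ) (a c : Fin N × Fin M), a.2 = c.2 →
    |secondDiff (fun v => Real.exp (-(p.Γ * v)) *
      dirKer v (gridPoint b M a.2) (gridPoint b M c.2)) (p.θ₂ * timeMesh T N)
      ((a.1 : ℕ) - (c.1 : ℕ) : ℤ) - √(p.θ₂ * timeMesh T N) / √Real.pi *
        sqrtDiff ((a.1 : ℕ) - (c.1 : ℕ) : ℤ)| ≤
      C * (√((|(((a.1 : ℕ) - (c.1 : ℕ) : ℤ) : ℝ)| + 1) * (p.θ₂ * timeMesh T N)) *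
        ((|(((a.1 : ℕ) - (c.1 : ℕ) : ℤ) : ℝ)| + 1) * (p.θ₂ * timeMesh T N))) := by
  set T' := p.θ₂ * T with hT'
  have hθ := hp.diffusivity_pos
  have hT'0 : 0 ≤ T' := by positivity
  have hc₀ := imageConst_nonneg
  set C := Real.exp (|p.Γ| * T') * |p.Γ| * (8 * (1 + T') * imageConst) +
    (4 * imageConst + (1 + T') / b ^ 2 * imageConst) with hC
  have hC0 : 0 ≤ C := by positivity
  refine ⟨4 * C + 1, by positivity, fun N M a c hac => ?_⟩
  obtain ⟨hN, hM⟩ := pos_of_fin_prod a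
  have hη : 0 < p.θ₂ * timeMesh T N := mul_pos hθ (timeMesh_pos hT hN)
  set η := p.θ₂ * timeMesh T N with hη_def
  have hx := gridPoint_mem hb₁ hM a.2.2.le
  rw [← hac]
  set x := gridPoint b M a.2
  set J : ℤ := ((a.1 : ℕ) - (c.1 : ℕ) : ℤ)
  set τ₀ := (|(J : ℝ)| + 1) * η with hτ₀
  have hτ₀0 : 0 ≤ τ₀ := by positivity
  have hτ₀T : τ₀ ≤ T' := by
    rw [hT', ← mul_timeMesh (p := p) (T := T) hN]
    exact mul_le_mul_of_nonneg_right (abs_lag_add_one_le a.1 c.1) hη.le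
  have hpt : ∀ v, 0 < v → v ≤ τ₀ →
      |Real.exp (-(p.Γ * v)) * dirKer v x x - heatKer v 0| ≤ C * √τ₀ := by
    intro v hv hvτ
    have hvT := hvτ.trans hτ₀T
    have hx' : x ∈ Set.Icc (0 : ℝ) 1 := ⟨hb₀.le.trans hx.1, by linarith [hx.2]⟩
    have h1 := abs_dirKer_le hv hvT hx' hx'
    have h2 := abs_dirKer_sub_heatKer_le hv hvT hb₀ hx hx
    have h3 := abs_exp_sub_exp_le (neg_mul_le_abs_mul (Γ := p.Γ) hv.le hvT)
      (by positivity : (0 : ℝ) ≤ |p.Γ| * T')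
    rw [sub_self] at h1 h2
    rw [Real.exp_zero, sub_zero, abs_neg, abs_mul, abs_of_pos hv] at h3
    rw [show Real.exp (-(p.Γ * v)) * dirKer v x x - heatKer v 0 =
      (Real.exp (-(p.Γ * v)) - 1) * dirKer v x x + (dirKer v x x - heatKer v 0) by ring]
    refine (abs_add_le _ _).trans ?_
    rw [abs_mul]
    calc _ ≤ Real.exp (|p.Γ| * T') * (|p.Γ| * v) *
            (8 * (1 + T') * imageConst * √v / (v + 0 ^ 2)) +
          (4 * imageConst + (1 + T') / b ^ 2 * imageConst) * √v :=
          add_le_add (mul_le_mul h3 h1 (abs_nonneg _) (by positivity)) h2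
      _ = C * √v := by rw [hC]; field_simp; ring
      _ ≤ C * √τ₀ := by gcongr
  rw [← secondDiff_heatKer_zero hη.le]
  refine (abs_secondDiff_sub_le (E := C * √τ₀ * τ₀) hη.le fun τ hτ hττ₀ => ?_).trans ?_
  · refine (abs_integral_sub_le hτ (intervalIntegrable_exp_mul_dirKer hp x x hτ)
      (integral_heatKer hτ 0).1 fun v hv hvτ => hpt v hv (hvτ.trans hττ₀)).trans ?_
    gcongr
  · have : 0 ≤ √τ₀ * τ₀ := by positivity
    nlinarith

end TemporalCovariance

section Meshes

variable {p : Params} {T b : ℝ} {N M : ℕ → ℕ}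

theorem tendsto_timeMesh (T : ℝ) (hN : Tendsto N atTop atTop) :
    Tendsto (fun n => timeMesh T (N n)) atTop (𝓝 0) :=
  tendsto_const_nhds.div_atTop (tendsto_natCast_atTop_atTop.comp hN)

theorem tendsto_spaceMesh (b : ℝ) (hM : Tendsto M atTop atTop) :
    Tendsto (fun n => spaceMesh b (M n)) atTop (𝓝 0) :=
  tendsto_const_nhds.div_atTop (tendsto_natCast_atTop_atTop.comp hM)

theorem eventually_pos (hN : Tendsto N atTop atTop) : ∀ᶠ n in atTop, 0 < N n :=
  hN.eventually_gt_atTop 0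

/-- The ratio of the parabolic time scale and the spatial mesh. -/
theorem sqrt_timeMesh_div_spaceMesh (hθ : 0 ≤ p.θ₂) (hT : 0 ≤ T) (N M : ℕ) :
    √(p.θ₂ * timeMesh T N) / spaceMesh b M = √(p.θ₂ * T) / (1 - 2 * b) * (M / √(N : ℝ)) := by
  unfold timeMesh spaceMesh
  rw [← mul_div_assoc, Real.sqrt_div (by positivity), div_div_div_eq, div_mul_div_comm,
    mul_comm (√(N : ℝ))]

theorem tendsto_sqrt_timeMesh_div_spaceMesh (hp : p.Admissible) (hT : 0 < T)
    (h : (fun n => (M n : ℝ)) =o[atTop] (fun n => √(N n : ℝ))) :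
    Tendsto (fun n => √(p.θ₂ * timeMesh T (N n)) / spaceMesh b (M n)) atTop (𝓝 0) := by
  simp_rw [sqrt_timeMesh_div_spaceMesh hp.diffusivity_pos.le hT.le]
  simpa using h.tendsto_div_nhds_zero.const_mul (√(p.θ₂ * T) / (1 - 2 * b))

end Meshes

section TemporalCLT

variable {Ω : Type*} [MeasurableSpace Ω] {P : Measure Ω} [IsProbabilityMeasure P]
  {p : Params} {β : ℕ → ℝ≥0 → Ω → ℝ} {u : ℕ → ℝ → Ω → ℝ} {X : ℝ → ℝ → Ω → ℝ}
  {T b : ℝ} {N M : ℕ → ℕ}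

/-- The limiting correlations of the temporal increments. -/
noncomputable def temporalLimit (w : ℤ × ℤ) : ℝ := if w.2 = 0 then 1 / 2 * sqrtDiff w.1 else 0

theorem tsum_temporalLimit_sq : 2 * ∑' w, temporalLimit w ^ 2 = constB := by
  have h1 : ∑' w, temporalLimit w ^ 2 = ∑' J : ℤ, (1 / 2 * sqrtDiff J) ^ 2 := by
    have hinj : Function.Injective fun J : ℤ => (J, (0 : ℤ)) := fun a b h => (Prod.ext_iff.1 h).1
    rw [← hinj.tsum_eq]
    · exact tsum_congr fun J => by simp [temporalLimit]
    · intro w hw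
      by_contra hcon
      apply hw
      have : w.2 ≠ 0 := fun h0 => hcon ⟨w.1, Prod.ext rfl h0.symm⟩
      simp [temporalLimit, this]
  rw [h1]
  simp_rw [mul_pow]
  rw [tsum_mul_left, tsum_sqrtDiff_sq, constB]
  ring

theorem temporal_scale {σ θ Δ : ℝ} (hσ : 0 < σ ^ 2) (hθ : 0 < θ) (hΔ : 0 < Δ) :
    √(√(Real.pi * θ) / (√Δ * σ ^ 2)) ^ 2 * (σ ^ 2 / (2 * θ)) = √Real.pi / (2 * √(θ * Δ)) := by
  have h1 : 0 < √Δ := Real.sqrt_pos.2 hΔ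
  have h2 : 0 < √θ := Real.sqrt_pos.2 hθ
  have hσ0 : σ ≠ 0 := fun h0 => by simp [h0] at hσ
  rw [Real.sq_sqrt (by positivity), Real.sqrt_mul Real.pi_pos.le, Real.sqrt_mul hθ.le]
  field_simp
  exact Real.sq_sqrt hθ.le

theorem clt_temporal (hX : IsStationarySolution P p β u X) (hp : p.Admissible) (hT : 0 < T)
    (hb₀ : 0 < b) (hb₁ : b < 1 / 2) (hN : Tendsto N atTop atTop) (hM : Tendsto M atTop atTop)
    (h : (fun n => (M n : ℝ)) =o[atTop] (fun n => √(N n : ℝ))) :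
    CLT P N M (fun n ω => sigmaSqTemporal p.θ₂ p.κ T b (N n) (M n)
      (observe X T b (N n) (M n) ω)) (p.σ ^ 2) (constB * p.σ ^ 4) := by
  have hθ := hp.diffusivity_pos
  obtain ⟨C₁, hC₁, hB⟩ := exists_temporal_bound hp hT hb₀.le hb₁
  obtain ⟨C₂, hC₂, hD⟩ := exists_temporal_diagonal hp hT hb₀ hb₁
  have hx := tendsto_sqrt_timeMesh_div_spaceMesh (b := b) hp hT h
  have hπ : 0 < √Real.pi := Real.sqrt_pos.2 Real.pi_pos
  have hη0 : Tendsto (fun n => p.θ₂ * timeMesh T (N n)) atTop (𝓝 0) := by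
    simpa using (tendsto_timeMesh T hN).const_mul p.θ₂
  unfold CLT
  simp_rw [sigmaSqTemporal_eq hp.sq_pos]
  rw [← tsum_temporalLimit_sq, show p.σ ^ 4 = (p.σ ^ 2) ^ 2 by ring]
  have hscale : ∀ n (a : Fin (N n) × Fin (M n)), 0 < p.θ₂ * timeMesh T (N n) ∧
      √(√(Real.pi * p.θ₂) / (√(timeMesh T (N n)) * p.σ ^ 2)) ^ 2 * (p.σ ^ 2 / (2 * p.θ₂)) =
      √Real.pi / (2 * √(p.θ₂ * timeMesh T (N n))) := fun n a =>
    ⟨mul_pos hθ (timeMesh_pos hT a.1.pos), temporal_scale hp.sq_pos hθ (timeMesh_pos hT a.1.pos)⟩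
  have hcov : ∀ n (a c : Fin (N n) × Fin (M n)), |√Real.pi / (2 * √(p.θ₂ * timeMesh T (N n))) *
      secondDiff (fun v => Real.exp (-(p.Γ * v)) * dirKer v (gridPoint b (M n) a.2)
        (gridPoint b (M n) c.2)) (p.θ₂ * timeMesh T (N n)) ((a.1 : ℕ) - (c.1 : ℕ) : ℤ)| ≤
      C₁ * √Real.pi / ((1 + |((boxLag a c).1 : ℝ)|) * √(1 + (((boxLag a c).2 : ℝ) *
        spaceMesh b (M n) / √(p.θ₂ * timeMesh T (N n))) ^ 2)) := by
    intro n a c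
    have hη := Real.sqrt_pos.2 (hscale n a).1
    rw [abs_mul, abs_of_pos (by positivity)]
    refine (mul_le_mul_of_nonneg_left (hB (N n) (M n) a c) (by positivity)).trans ?_
    have e1 : |(((a.1 : ℕ) - (c.1 : ℕ) : ℤ) : ℝ)| = |((boxLag a c).1 : ℝ)| := by
      rw [boxLag]; push_cast; exact abs_sub_comm _ _
    have e2 : ((((a.2 : ℕ) : ℝ) - (c.2 : ℕ)) * spaceMesh b (M n) /
        √(p.θ₂ * timeMesh T (N n))) ^ 2 = (((boxLag a c).2 : ℝ) *
        spaceMesh b (M n) / √(p.θ₂ * timeMesh T (N n))) ^ 2 := by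
      rw [boxLag]; push_cast; ring
    rw [e1, e2, ← mul_div_assoc]
    gcongr ?_ / _
    rw [div_mul_eq_mul_div, div_le_iff₀ (by positivity)]
    nlinarith [mul_pos hC₁ (mul_pos hπ hη)]
  have hdiag : ∀ n (a c : Fin (N n) × Fin (M n)), a.2 = c.2 →
      |√Real.pi / (2 * √(p.θ₂ * timeMesh T (N n))) *
      secondDiff (fun v => Real.exp (-(p.Γ * v)) * dirKer v (gridPoint b (M n) a.2)
        (gridPoint b (M n) c.2)) (p.θ₂ * timeMesh T (N n)) ((a.1 : ℕ) - (c.1 : ℕ) : ℤ) -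
        1 / 2 * sqrtDiff (boxLag a c).1| ≤ C₂ * √Real.pi * (√(|((boxLag a c).1 : ℝ)| + 1) *
        (|((boxLag a c).1 : ℝ)| + 1)) * (p.θ₂ * timeMesh T (N n)) := by
    intro n a c hac
    have hη' := (hscale n a).1
    have hη := Real.sqrt_pos.2 hη'
    have h1 := hD (N n) (M n) a c hac
    have e3 : boxLag a c = (-((a.1 : ℕ) - (c.1 : ℕ) : ℤ), -((a.2 : ℕ) - (c.2 : ℕ) : ℤ)) := by
      rw [boxLag]; simp
    have e1 : |(((a.1 : ℕ) - (c.1 : ℕ) : ℤ) : ℝ)| = |((boxLag a c).1 : ℝ)| := by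
      rw [e3]; simp only [Int.cast_neg, abs_neg]
    have e2 : sqrtDiff ((a.1 : ℕ) - (c.1 : ℕ) : ℤ) = sqrtDiff (boxLag a c).1 := by
      rw [e3, sqrtDiff_neg]
    rw [e1, e2] at h1
    generalize secondDiff (fun v => Real.exp (-(p.Γ * v)) * dirKer v (gridPoint b (M n) a.2)
      (gridPoint b (M n) c.2)) (p.θ₂ * timeMesh T (N n)) ((a.1 : ℕ) - (c.1 : ℕ) : ℤ) = D at h1 ⊢
    generalize p.θ₂ * timeMesh T (N n) = η at h1 hη hη' ⊢
    set k := |((boxLag a c).1 : ℝ)| + 1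
    have hk : 0 ≤ k := by positivity
    have e4 : √Real.pi / (2 * √η) * D - 1 / 2 * sqrtDiff (boxLag a c).1 =
        √Real.pi / (2 * √η) * (D - √η / √Real.pi * sqrtDiff (boxLag a c).1) := by
      field_simp
    rw [e4, abs_mul, abs_of_pos (by positivity)]
    rw [Real.sqrt_mul hk] at h1
    calc _ ≤ √Real.pi / (2 * √η) * (C₂ * (√k * √η * (k * η))) := by gcongr
      _ = 1 / 2 * (C₂ * √Real.pi * (√k * k) * η) := by field_simp
      _ ≤ _ := by
          have : 0 ≤ C₂ * √Real.pi * (√k * k) * η := by positivity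
          linarith
  refine tendstoInDistribution_box hN hM
    (d := fun w => C₁ * √Real.pi / ((1 + |(w.1 : ℝ)|) * √(1 + (w.2 : ℝ) ^ 2)))
    (fun n => (hX.isCenteredGaussian_temporal hp hT hb₀.le hb₁ (N n) (M n)).const_mul _)
    (summable_latticeBound _) (fun w => by positivity) ?_ ?_ ?_ hp.sq_pos.le
  · filter_upwards [hx.eventually (ge_mem_nhds zero_lt_one)] with n hn a c
    rw [← mul_assoc, (hscale n a).2]
    refine (hcov n a c).trans ?_
    have hη := Real.sqrt_pos.2 (hscale n a).1
    have hδ := spaceMesh_pos hb₁ a.2.pos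
    rw [div_le_one hδ] at hn
    have : 1 ≤ spaceMesh b (M n) / √(p.θ₂ * timeMesh T (N n)) := (one_le_div hη).2 hn
    refine div_le_div_of_nonneg_left (by positivity) (by positivity) ?_
    refine mul_le_mul_of_nonneg_left (Real.sqrt_le_sqrt (add_le_add_right ?_ 1)) (by positivity)
    rw [mul_div_assoc, mul_pow]
    exact le_mul_of_one_le_right (sq_nonneg _) (one_le_pow₀ this)
  · intro w ε hε
    by_cases hw : w.2 = 0
    · have hlim : Tendsto (fun n => C₂ * √Real.pi * (√(|(w.1 : ℝ)| + 1) * (|(w.1 : ℝ)| + 1)) *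
          (p.θ₂ * timeMesh T (N n))) atTop (𝓝 0) := by
        simpa using hη0.const_mul (C₂ * √Real.pi * (√(|(w.1 : ℝ)| + 1) * (|(w.1 : ℝ)| + 1)))
      filter_upwards [hlim.eventually (ge_mem_nhds hε)] with n hn a c hac
      rw [← mul_assoc, (hscale n a).2]
      have h2 : a.2 = c.2 := by
        have : (boxLag a c).2 = 0 := by rw [hac, hw]
        rw [boxLag] at this
        ext
        simp only at this
        omega
      have h3 := hdiag n a c h2
      rw [hac] at h3
      simp only [temporalLimit, if_pos hw]
      exact h3.trans hn
    · have hlim : Tendsto (fun n => C₁ * √Real.pi * (√(p.θ₂ * timeMesh T (N n)) /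
          spaceMesh b (M n))) atTop (𝓝 0) := by
        simpa using hx.const_mul (C₁ * √Real.pi)
      filter_upwards [hlim.eventually (ge_mem_nhds hε)] with n hn a c hac
      rw [← mul_assoc, (hscale n a).2]
      simp only [temporalLimit, if_neg hw, sub_zero]
      refine (hcov n a c).trans (le_trans ?_ hn)
      have hη := Real.sqrt_pos.2 (hscale n a).1
      have hδ := spaceMesh_pos hb₁ a.2.pos
      rw [hac]
      have h1 : (1 : ℝ) ≤ |(w.2 : ℝ)| := by exact_mod_cast Int.one_le_abs hw
      have h2 : spaceMesh b (M n) / √(p.θ₂ * timeMesh T (N n)) ≤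
          √(1 + ((w.2 : ℝ) * spaceMesh b (M n) / √(p.θ₂ * timeMesh T (N n))) ^ 2) := by
        refine Real.le_sqrt_of_sq_le ?_
        rw [mul_div_assoc, mul_pow, ← sq_abs (w.2 : ℝ)]
        have : 1 ≤ |(w.2 : ℝ)| ^ 2 := one_le_pow₀ h1
        nlinarith [sq_nonneg (spaceMesh b (M n) / √(p.θ₂ * timeMesh T (N n)))]
      calc _ ≤ C₁ * √Real.pi / (1 * (spaceMesh b (M n) / √(p.θ₂ * timeMesh T (N n)))) := by
            gcongr
            linarith [abs_nonneg (w.1 : ℝ)]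
        _ = _ := by field_simp
  · intro ε hε
    have hlim : Tendsto (fun n => C₂ * √Real.pi * (p.θ₂ * T) *
        (√((M n : ℝ) / √(N n)) * (√(√(N n : ℝ)))⁻¹)) atTop (𝓝 0) := by
      have h1 : Tendsto (fun n => √((M n : ℝ) / √(N n))) atTop (𝓝 0) := by
        simpa using h.tendsto_div_nhds_zero.sqrt
      have h2 : Tendsto (fun n => (√(√(N n : ℝ)))⁻¹) atTop (𝓝 0) :=
        tendsto_inv_atTop_zero.comp (Real.tendsto_sqrt_atTop.comp
          (Real.tendsto_sqrt_atTop.comp (tendsto_natCast_atTop_atTop.comp hN)))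
      simpa using (h1.mul h2).const_mul (C₂ * √Real.pi * (p.θ₂ * T))
    filter_upwards [hlim.eventually (ge_mem_nhds hε)] with n hn a
    have hN0 : (0 : ℝ) < N n := by exact_mod_cast a.1.pos
    have hM0 : (0 : ℝ) < M n := by exact_mod_cast a.2.pos
    have h3 := hdiag n a a rfl
    have h4 : boxLag a a = 0 := by rw [boxLag]; simp
    rw [h4] at h3
    have h5 : 1 / 2 * sqrtDiff (0 : ℤ × ℤ).1 = 1 := by norm_num [sqrtDiff]
    rw [h5] at h3
    rw [← mul_assoc, (hscale n a).2]
    refine h3.trans ?_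
    rw [le_div_iff₀ (Real.sqrt_pos.2 (by positivity))]
    refine le_trans (le_of_eq ?_) hn
    simp only [Prod.fst_zero, Int.cast_zero, abs_zero, zero_add, Real.sqrt_one, mul_one]
    unfold timeMesh
    rw [Real.sqrt_div hM0.le, Real.sqrt_mul hM0.le]
    have h6 : 0 < √(√(N n : ℝ)) := Real.sqrt_pos.2 (Real.sqrt_pos.2 hN0)
    have h7 : √(√(N n : ℝ)) * √(√(N n : ℝ)) = √(N n : ℝ) := Real.mul_self_sqrt (Real.sqrt_nonneg _)
    have h8 : √(N n : ℝ) * √(N n : ℝ) = N n := Real.mul_self_sqrt hN0.le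
    have h9 : 0 < √(N n : ℝ) := Real.sqrt_pos.2 hN0
    have h10 : √(M n : ℝ) / √(√(N n : ℝ)) * (√(√(N n : ℝ)))⁻¹ =
        √(M n : ℝ) * √(N n : ℝ) / N n := by
      rw [div_mul_eq_mul_div, ← div_eq_mul_inv, div_div, h7]
      nth_rewrite 3 [← h8]
      field_simp
    rw [h10]
    ring

end TemporalCLT

section Normalization

theorem hasSum_doubleF {θ Δ : ℝ} (hθ : 0 < θ) (hΔ : 0 ≤ Δ) (z : ℝ) :
    IntervalIntegrable (fun v => thetaKer v z - 1 / 2) volume 0 (θ * Δ) ∧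
    HasSum (fun ℓ : ℕ => (1 - Real.exp (-(Real.pi ^ 2 * θ * ((ℓ : ℝ) + 1) ^ 2 * Δ))) /
      (Real.pi ^ 2 * θ * ((ℓ : ℝ) + 1) ^ 2) * Real.cos (Real.pi * ((ℓ : ℝ) + 1) * z))
      (1 / θ * ∫ v in (0 : ℝ)..θ * Δ, (thetaKer v z - 1 / 2)) := by
  have h := hasSum_spectral_integral (Γ := 0) (by have := Real.pi_pos; positivity)
    (c := fun ℓ => Real.cos (Real.pi * ((ℓ : ℝ) + 1) * z)) (K := 1)
    (fun ℓ => Real.abs_cos_le_one _) (q := fun v => thetaKer v z - 1 / 2)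
    (fun s hs => (hasSum_thetaKer hs z).2.congr_fun fun ℓ => mul_comm _ _)
    (mul_nonneg hθ.le hΔ)
  simp only [zero_mul, neg_zero, Real.exp_zero, one_mul] at h
  refine ⟨h.1, (h.2.mul_left (1 / θ)).congr_fun fun ℓ => ?_⟩
  unfold specVal
  rw [add_zero, show Real.pi ^ 2 * θ * ((ℓ : ℝ) + 1) ^ 2 * Δ =
    Real.pi ^ 2 * ((ℓ : ℝ) + 1) ^ 2 * (θ * Δ) by ring]
  field_simp

theorem doubleF_eq {θ Δ : ℝ} (hθ : 0 < θ) (hΔ : 0 ≤ Δ) (z : ℝ) :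
    doubleF θ z Δ = 1 / θ * ∫ v in (0 : ℝ)..θ * Δ, (thetaKer v z - 1 / 2) :=
  (hasSum_doubleF hθ hΔ z).2.tsum_eq

theorem damping_sq (p : Params) (δ : ℝ) : damping p δ ^ 2 = Real.exp (-(p.κ * δ)) := by
  unfold damping
  rw [← Real.exp_nat_mul]
  congr 1
  push_cast
  ring

theorem doubleΦ_nonneg (p : Params) {Δ : ℝ} (hθ : 0 < p.θ₂) (hΔ : 0 ≤ Δ) (δ : ℝ) :
    0 ≤ doubleΦ p.θ₂ p.κ δ Δ := by
  have h0 := (hasSum_doubleF hθ hΔ 0).2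
  have h1 := (hasSum_doubleF hθ hΔ δ).2
  rw [← doubleF_eq hθ hΔ] at h0 h1
  have h := (h0.mul_right (1 + Real.exp (-(p.κ * δ)))).sub
    ((h1.mul_left 2).mul_right (Real.exp (-(p.κ * δ / 2))))
  unfold doubleΦ
  refine h.nonneg fun ℓ => ?_
  rw [← damping_sq]
  change 0 ≤ _ - 2 * _ * damping p δ
  have hw : 0 ≤ (1 - Real.exp (-(Real.pi ^ 2 * p.θ₂ * ((ℓ : ℝ) + 1) ^ 2 * Δ))) /
      (Real.pi ^ 2 * p.θ₂ * ((ℓ : ℝ) + 1) ^ 2) := by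
    refine div_nonneg (sub_nonneg.2 (Real.exp_le_one_iff.2 ?_)) (by positivity)
    have : 0 ≤ Real.pi ^ 2 * p.θ₂ * ((ℓ : ℝ) + 1) ^ 2 * Δ := by positivity
    linarith
  have hα : 0 < damping p δ := Real.exp_pos _
  have hc := Real.cos_le_one (Real.pi * ((ℓ : ℝ) + 1) * δ)
  rw [mul_zero, Real.cos_zero, mul_one]
  set W := (1 - Real.exp (-(Real.pi ^ 2 * p.θ₂ * ((ℓ : ℝ) + 1) ^ 2 * Δ))) /
      (Real.pi ^ 2 * p.θ₂ * ((ℓ : ℝ) + 1) ^ 2)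
  have : 0 ≤ 1 + damping p δ ^ 2 - 2 * (Real.cos (Real.pi * ((ℓ : ℝ) + 1) * δ) * damping p δ) := by
    nlinarith [sq_nonneg (1 - damping p δ)]
  nlinarith [mul_nonneg hw this]

/-- The integrand of the normalization of the double increments. -/
noncomputable def phiKer (α δ v : ℝ) : ℝ :=
  (1 + α ^ 2) * (thetaKer v 0 - 1 / 2) - 2 * α * (thetaKer v δ - 1 / 2)

theorem doubleΦ_eq (p : Params) {Δ : ℝ} (hθ : 0 < p.θ₂) (hΔ : 0 ≤ Δ) (δ : ℝ) :
    IntervalIntegrable (phiKer (damping p δ) δ) volume 0 (p.θ₂ * Δ) ∧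
    p.θ₂ * doubleΦ p.θ₂ p.κ δ Δ = ∫ v in (0 : ℝ)..p.θ₂ * Δ, phiKer (damping p δ) δ v := by
  have h0 := (hasSum_doubleF hθ hΔ 0).1.const_mul (1 + damping p δ ^ 2)
  have h1 := (hasSum_doubleF hθ hΔ δ).1.const_mul (2 * damping p δ)
  refine ⟨h0.sub h1, ?_⟩
  unfold phiKer
  rw [intervalIntegral.integral_sub h0 h1, intervalIntegral.integral_const_mul,
    intervalIntegral.integral_const_mul, damping_sq]
  unfold doubleΦ damping
  rw [doubleF_eq hθ hΔ, doubleF_eq hθ hΔ]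
  generalize ∫ v in (0 : ℝ)..p.θ₂ * Δ, (thetaKer v 0 - 1 / 2) = A
  generalize ∫ v in (0 : ℝ)..p.θ₂ * Δ, (thetaKer v δ - 1 / 2) = B
  field_simp

end Normalization

section DoubleCovariance

/-- A bound for `damping` and its distance to `1`. -/
noncomputable def dampConst (p : Params) : ℝ := Real.exp (|p.κ| / 2) * (|p.κ| / 2 + 1)

theorem damping_bounds (p : Params) {δ : ℝ} (hδ : 0 ≤ δ) (hδ1 : δ ≤ 1) :
    0 ≤ damping p δ ∧ damping p δ ≤ dampConst p ∧ |1 - damping p δ| ≤ dampConst p * δ := by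
  have h1 : -(p.κ * δ / 2) ≤ |p.κ| / 2 := by
    have : |p.κ * δ| ≤ |p.κ| * 1 := by
      rw [abs_mul, abs_of_nonneg hδ]; gcongr
    linarith [neg_abs_le (p.κ * δ)]
  have h2 := Real.exp_pos (|p.κ| / 2)
  refine ⟨(Real.exp_pos _).le, ?_, ?_⟩
  · refine (Real.exp_le_exp.2 h1).trans (le_mul_of_one_le_right h2.le ?_)
    linarith [abs_nonneg p.κ]
  · have h3 := abs_exp_sub_exp_le (by positivity : (0 : ℝ) ≤ |p.κ| / 2) h1
    rw [Real.exp_zero, zero_sub, neg_neg, abs_div, abs_mul, abs_two, abs_of_nonneg hδ] at h3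
    refine h3.trans ?_
    unfold dampConst
    nlinarith [mul_nonneg h2.le hδ]

theorem dampConst_nonneg (p : Params) : 0 ≤ dampConst p := by
  unfold dampConst; positivity

theorem intervalIntegrable_exp_mul_cornerKer {p : Params} (hp : p.Admissible) (α δ x y : ℝ) {τ : ℝ}
    (hτ : 0 ≤ τ) :
    IntervalIntegrable (fun v => Real.exp (-(p.Γ * v)) * cornerKer α δ v x y) volume 0 τ :=
  (hasSum_spectral_integral hp.spectral_gap (c := fun ℓ => incCoef α δ x ℓ * incCoef α δ y ℓ)
    (K := ((|α| + 1) * √2) * ((|α| + 1) * √2)) (fun ℓ => by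
      rw [abs_mul]
      exact mul_le_mul (abs_incCoef_le _ _ _ _) (abs_incCoef_le _ _ _ _) (abs_nonneg _)
        (by positivity)) (fun s hs => hasSum_incCoef hs α δ x y) hτ).1

theorem spaceMesh_le_one {b : ℝ} {M : ℕ} (hb₀ : 0 ≤ b) (hM : 0 < M) : spaceMesh b M ≤ 1 := by
  have : (1 : ℝ) ≤ M := by exact_mod_cast hM
  unfold spaceMesh
  rw [div_le_one (by linarith)]
  linarith

variable {p : Params} {T b : ℝ}

/-- The integrand of the covariances of the double increments. -/
noncomputable def doubleKer (p : Params) (b : ℝ) (M : ℕ) (k l : ℕ) (v : ℝ) : ℝ :=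
  Real.exp (-(p.Γ * v)) * cornerKer (damping p (spaceMesh b M)) (spaceMesh b M) v
    (gridPoint b M k) (gridPoint b M l)

theorem exists_double_space_bound (hp : p.Admissible) (hT : 0 < T) (hb₀ : 0 ≤ b)
    (hb₁ : b < 1 / 2) : ∃ C, 0 < C ∧ ∀ (N M : ℕ) (a c : Fin N × Fin M),
    |secondDiff (doubleKer p b M a.2 c.2) (p.θ₂ * timeMesh T N) ((a.1 : ℕ) - (c.1 : ℕ) : ℤ)| ≤
      C * spaceMesh b M / ((1 + |(((a.1 : ℕ) - (c.1 : ℕ) : ℤ) : ℝ)|) *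
          √(1 + (((a.2 : ℕ) : ℝ) - (c.2 : ℕ)) ^ 2)) := by
  set T' := p.θ₂ * T with hT'
  have hθ := hp.diffusivity_pos
  have hT'0 : 0 ≤ T' := by positivity
  have hc₀ := imageConst_nonneg
  have hK := dampConst_nonneg p
  have hc₁ := cornerConst_nonneg hK hT'0
  set C := Real.exp (|p.Γ| * T') * (4 * (2 + T') * imageConst * cornerConst (dampConst p) T')
    with hC
  have hC0 : 0 ≤ C := by positivity
  refine ⟨24 * C + 1, by positivity, fun N M a c => ?_⟩
  obtain ⟨hN, hM⟩ := pos_of_fin_prod a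
  have hη : 0 < p.θ₂ * timeMesh T N := mul_pos hθ (timeMesh_pos hT hN)
  set η := p.θ₂ * timeMesh T N with hη_def
  have hδ := spaceMesh_pos hb₁ hM
  have hδ1 := spaceMesh_le_one hb₀ hM
  have hx := gridPoint_mem hb₁ hM a.2.2.le
  have hy := gridPoint_mem hb₁ hM c.2.2.le
  have hx' := gridPoint_mem hb₁ hM (Nat.succ_le_of_lt a.2.2)
  have hy' := gridPoint_mem hb₁ hM (Nat.succ_le_of_lt c.2.2)
  rw [Nat.succ_eq_add_one, gridPoint_succ] at hx' hy'
  obtain ⟨hα0, hαK, hα⟩ := damping_bounds p hδ.le hδ1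
  set L : ℝ := ((a.2 : ℕ) : ℝ) - (c.2 : ℕ) with hL
  have hw : 0 < √(1 + L ^ 2) := Real.sqrt_pos.2 (by positivity)
  have h := abs_secondDiff_le_of_space (f := doubleKer p b M a.2 c.2) (T := T') (C := C)
    (w := √(1 + L ^ 2)) hη hC0 hδ hw
    (fun τ hτ => intervalIntegrable_exp_mul_cornerKer hp _ _ _ _ hτ) (fun v hv hvT => by
      have h1 := abs_cornerKer_le hv hvT hδ hδ1 hα0 hαK hα (hb₀.trans hx.1) (by linarith [hx'.2])
        (hb₀.trans hy.1) (by linarith [hy'.2])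
      rw [gridPoint_sub, ← hL] at h1
      unfold doubleKer
      rw [abs_mul, Real.abs_exp, mul_pow, Real.sq_sqrt (by positivity)]
      refine (mul_le_mul (Real.exp_le_exp.2 (neg_mul_le_abs_mul (Γ := p.Γ) hv.le hvT)) h1
        (abs_nonneg _) (Real.exp_pos _).le).trans (le_of_eq ?_)
      rw [hC, show v + spaceMesh b M ^ 2 + (L * spaceMesh b M) ^ 2 =
        v + (1 + L ^ 2) * spaceMesh b M ^ 2 by ring]
      ring)
    (J := ((a.1 : ℕ) - (c.1 : ℕ) : ℤ)) (by
      rw [hT', ← mul_timeMesh (p := p) (T := T) hN]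
      exact mul_le_mul_of_nonneg_right (abs_lag_add_one_le a.1 c.1) hη.le)
  refine h.trans ?_
  gcongr
  linarith

theorem exists_double_time_bound (hp : p.Admissible) (hT : 0 < T) (hb₀ : 0 ≤ b)
    (hb₁ : b < 1 / 2) : ∃ C, 0 < C ∧ ∀ (N M : ℕ) (a c : Fin N × Fin M),
    p.θ₂ * timeMesh T N ≤ spaceMesh b M ^ 2 →
    |secondDiff (doubleKer p b M a.2 c.2) (p.θ₂ * timeMesh T N) ((a.1 : ℕ) - (c.1 : ℕ) : ℤ)| ≤
      C * √(p.θ₂ * timeMesh T N) / ((1 + |(((a.1 : ℕ) - (c.1 : ℕ) : ℤ) : ℝ)|) *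
          √(1 + (((a.2 : ℕ) : ℝ) - (c.2 : ℕ)) ^ 2)) := by
  set T' := p.θ₂ * T with hT'
  have hθ := hp.diffusivity_pos
  have hT'0 : 0 ≤ T' := by positivity
  have hc₀ := imageConst_nonneg
  have hK := dampConst_nonneg p
  set C := Real.exp (|p.Γ| * T') * (1 + |p.Γ| * T') *
    ((1 + dampConst p) ^ 2 * (32 * (1 + T') * imageConst)) with hC
  have hC0 : 0 ≤ C := by positivity
  refine ⟨72 * C + 1, by positivity, fun N M a c hηδ => ?_⟩
  obtain ⟨hN, hM⟩ := pos_of_fin_prod a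
  have hη : 0 < p.θ₂ * timeMesh T N := mul_pos hθ (timeMesh_pos hT hN)
  set η := p.θ₂ * timeMesh T N with hη_def
  have hδ := spaceMesh_pos hb₁ hM
  have hδ1 := spaceMesh_le_one hb₀ hM
  have hx := gridPoint_mem hb₁ hM a.2.2.le
  have hy := gridPoint_mem hb₁ hM c.2.2.le
  have hx' := gridPoint_mem hb₁ hM (Nat.succ_le_of_lt a.2.2)
  have hy' := gridPoint_mem hb₁ hM (Nat.succ_le_of_lt c.2.2)
  rw [Nat.succ_eq_add_one, gridPoint_succ] at hx' hy'
  obtain ⟨hα0, hαK, hα⟩ := damping_bounds p hδ.le hδ1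
  have hxy := gridPoint_sub b M a.2 c.2
  set L : ℝ := ((a.2 : ℕ) : ℝ) - (c.2 : ℕ) with hL
  set δ := spaceMesh b M
  set ℓ : ℝ := max (|L| - 1) 0 with hℓ
  have hℓ0 : 0 ≤ ℓ := le_max_right _ _
  have hA : ∀ z : ℝ, |L| - 1 ≤ |z| → (ℓ * δ) ^ 2 ≤ (z * δ) ^ 2 := fun z hz => by
    rw [mul_pow, mul_pow, ← sq_abs z]
    exact mul_le_mul_of_nonneg_right (pow_le_pow_left₀ hℓ0 (max_le hz (abs_nonneg _)) 2)
      (sq_nonneg _)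
  have hreg := (timeRegular_cornerKer (A := (ℓ * δ) ^ 2) hT'0 hα0 hαK hδ.le (hb₀.trans hx.1)
    (by linarith [hx'.2]) (hb₀.trans hy.1) (by linarith [hy'.2]) (sq_nonneg _)
    (by rw [hxy]; exact hA L (by linarith))
    (by
      rw [show gridPoint b M a.2 + δ - gridPoint b M c.2 = (L + 1) * δ by linarith]
      refine hA _ ?_
      have := abs_sub_abs_le_abs_sub L (-1)
      rw [abs_neg, abs_one, sub_neg_eq_add] at this
      exact this)
    (by
      rw [show gridPoint b M a.2 - (gridPoint b M c.2 + δ) = (L - 1) * δ by linarith]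
      refine hA _ ?_
      have := abs_sub_abs_le_abs_sub L 1
      rw [abs_one] at this
      exact this)).exp_mul (by positivity) (sq_nonneg _) p.Γ
  have h := abs_secondDiff_le_of_time (f := doubleKer p b M a.2 c.2) (c := 1) (ℓ := ℓ) hη hC0
    one_pos le_rfl (a := ℓ * δ) (by rw [one_mul, mul_pow, mul_comm]; gcongr)
    (fun τ hτ => intervalIntegrable_exp_mul_cornerKer hp _ _ _ _ hτ) hreg.abs_le
    (fun v hv hvT => hreg.abs_sub_le v η hv hη.le hvT)
    (J := ((a.1 : ℕ) - (c.1 : ℕ) : ℤ)) (by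
      rw [hT', ← mul_timeMesh (p := p) (T := T) hN]
      exact mul_le_mul_of_nonneg_right (abs_lag_add_one_le a.1 c.1) hη.le)
  refine h.trans ?_
  have hLℓ : √(1 + L ^ 2) ≤ 2 * √(1 + ℓ ^ 2) := by
    rw [show (2 : ℝ) = √(2 ^ 2) from (Real.sqrt_sq (by norm_num)).symm,
      ← Real.sqrt_mul (by norm_num)]
    refine Real.sqrt_le_sqrt ?_
    have h1 : |L| - 1 ≤ ℓ := le_max_left _ _
    rw [← sq_abs L]
    nlinarith [abs_nonneg L, sq_nonneg (ℓ - 1)]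
  have hη0 : 0 < √η := Real.sqrt_pos.2 hη
  rw [div_one, div_le_div_iff₀ (by positivity) (by positivity)]
  set R := 1 + |(((a.1 : ℕ) - (c.1 : ℕ) : ℤ) : ℝ)|
  have hR : 0 < R := by positivity
  calc 36 * C * √η * (R * √(1 + L ^ 2)) ≤ 36 * C * √η * (R * (2 * √(1 + ℓ ^ 2))) := by gcongr
    _ = 72 * C * √η * (R * √(1 + ℓ ^ 2)) := by ring
    _ ≤ _ := by gcongr; linarith

end DoubleCovariance

section MainTerm

/-- The integral of `cornerMain` over the time interval `[0, τ]`. -/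
noncomputable def mainInt (α δ τ z : ℝ) : ℝ :=
  2 * √τ * ((1 + α ^ 2) * auxH (|z| / √τ) - α * auxH (|z + δ| / √τ) - α * auxH (|z - δ| / √τ))

theorem integral_cornerMain (α δ z : ℝ) {τ : ℝ} (hτ : 0 ≤ τ) :
    IntervalIntegrable (fun v => cornerMain α δ v z) volume 0 τ ∧
      ∫ v in (0 : ℝ)..τ, cornerMain α δ v z = mainInt α δ τ z := by
  have h0 := (integral_heatKer hτ z).1.const_mul (1 + α ^ 2)
  have h1 := (integral_heatKer hτ (z + δ)).1.const_mul α
  have h2 := (integral_heatKer hτ (z - δ)).1.const_mul α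
  refine ⟨(h0.sub h1).sub h2, ?_⟩
  unfold cornerMain
  rw [intervalIntegral.integral_sub (h0.sub h1) h2, intervalIntegral.integral_sub h0 h1,
    intervalIntegral.integral_const_mul, intervalIntegral.integral_const_mul,
    intervalIntegral.integral_const_mul, (integral_heatKer hτ z).2, (integral_heatKer hτ (z + δ)).2,
    (integral_heatKer hτ (z - δ)).2]
  unfold mainInt
  ring

/-- The order of the error made by replacing `cornerKer` by `cornerMain`. -/
noncomputable def errBd (δ τ : ℝ) : ℝ := min (δ ^ 2 * √τ) (τ * √τ + δ ^ 2 * τ)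

theorem abs_integral_sub_le_errBd {f g : ℝ → ℝ} {τ T C δ : ℝ} (hτ : 0 ≤ τ) (hτT : τ ≤ T)
    (hC : 0 ≤ C) (hf : IntervalIntegrable f volume 0 τ) (hg : IntervalIntegrable g volume 0 τ)
    (h1 : ∀ v, 0 < v → v ≤ T → |f v - g v| ≤ C * (δ ^ 2 * (√v)⁻¹))
    (h2 : ∀ v, 0 < v → v ≤ T → |f v - g v| ≤ C * (√v + δ ^ 2)) :
    |(∫ v in (0 : ℝ)..τ, f v) - ∫ v in (0 : ℝ)..τ, g v| ≤ 2 * C * errBd δ τ := by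
  unfold errBd
  rw [mul_min_of_nonneg _ _ (by positivity), le_min_iff]
  constructor
  · have hi := integral_inv_sqrt hτ
    rw [← intervalIntegral.integral_sub hf hg]
    refine (abs_integral_le_of_abs_le (f := fun v => f v - g v)
      (g := fun v => C * (δ ^ 2 * (√v)⁻¹)) hτ ((hi.1.const_mul _).const_mul _)
      fun v hv => h1 v hv.1 (hv.2.trans hτT)).trans ?_
    rw [intervalIntegral.integral_const_mul, intervalIntegral.integral_const_mul, hi.2]
    exact le_of_eq (by ring)
  · refine (abs_integral_sub_le (B := C * (√τ + δ ^ 2)) hτ hf hg fun v hv hvτ =>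
      (h2 v hv (hvτ.trans hτT)).trans (by gcongr)).trans ?_
    have : 0 ≤ C * (τ * √τ + δ ^ 2 * τ) := by positivity
    nlinarith

theorem thetaKer_corner_eq {v : ℝ} (hv : 0 < v) (α δ : ℝ) :
    phiKer α δ v = (∑' m : ℤ, cornerMain α δ v (0 + 2 * m)) - 1 / 2 * (1 - α) ^ 2 := by
  have h : HasSum (fun m : ℤ => cornerMain α δ v (0 + 2 * m))
      ((1 + α ^ 2) * thetaKer v 0 - α * thetaKer v δ - α * thetaKer v (-δ)) := by
    refine ((((hasSum_thetaKer hv 0).1.mul_left _).sub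
      ((hasSum_thetaKer hv δ).1.mul_left _)).sub
      ((hasSum_thetaKer hv (-δ)).1.mul_left _)).congr_fun fun m => ?_
    unfold cornerMain
    rw [show 0 + 2 * (m : ℝ) + δ = δ + 2 * m by ring,
      show 0 + 2 * (m : ℝ) - δ = -δ + 2 * m by ring]
  have hneg : thetaKer v (-δ) = thetaKer v δ := by
    have h1 := (hasSum_thetaKer hv δ).2
    have h2 := (hasSum_thetaKer hv (-δ)).2
    simp only [mul_neg, Real.cos_neg] at h2
    linarith [h1.unique h2]
  rw [h.tsum_eq, hneg]
  unfold phiKer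
  ring

theorem phiKer_sub_le_of_space {v δ T α K : ℝ} (hv : 0 < v) (hvT : v ≤ T) (hδ : 0 < δ)
    (hδ1 : δ ≤ 1) (hα0 : 0 ≤ α) (hαK : α ≤ K) (hα : |1 - α| ≤ K * δ) :
    |phiKer α δ v - cornerMain α δ v 0| ≤
      (2 * cornerConst K T * imageConst + K ^ 2 * √T) * (δ ^ 2 * (√v)⁻¹) := by
  have h1 := abs_tsum_image_sub_le (add_pos hv (by positivity : 0 < δ ^ 2))
    (abs_cornerMain_le hv hvT hδ hδ1 hα0 hαK hα) (z := 0) (by simp)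
  have hα2 : (1 - α) ^ 2 ≤ K ^ 2 * δ ^ 2 := by
    rw [← sq_abs, ← mul_pow]; exact pow_le_pow_left₀ (abs_nonneg _) hα 2
  have hv0 : 0 < √v := Real.sqrt_pos.2 hv
  have hT : 1 ≤ √T * (√v)⁻¹ := by
    rw [← div_eq_mul_inv, one_le_div hv0]; exact Real.sqrt_le_sqrt hvT
  rw [thetaKer_corner_eq hv, sub_right_comm]
  refine (abs_sub _ _).trans ((add_le_add (c := |1 / 2 * (1 - α) ^ 2|) h1
    (d := K ^ 2 * δ ^ 2 * (√T * (√v)⁻¹)) ?_).trans (le_of_eq (by ring)))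
  rw [abs_of_nonneg (by positivity)]
  refine le_trans ?_ (le_mul_of_one_le_right (by positivity) hT)
  linarith [sq_nonneg (1 - α)]

theorem abs_cornerMain_far_le {v w δ α K : ℝ} (hv : 0 < v) (hα0 : 0 ≤ α) (hαK : α ≤ K)
    {A : ℝ} (h1 : A ≤ w ^ 2) (h2 : A ≤ (w + δ) ^ 2) (h3 : A ≤ (w - δ) ^ 2) (hA : 0 ≤ A) :
    |cornerMain α δ v w| ≤ (1 + K) ^ 2 * (2 * √v / (v + A)) := by
  have hb : ∀ z : ℝ, A ≤ z ^ 2 → heatKer v z ≤ 2 * √v / (v + A) := fun z hz =>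
    (heatKer_le hv z).trans (by gcongr)
  have e1 := hb w h1
  have e2 := hb _ h2
  have e3 := hb _ h3
  have n1 := heatKer_nonneg v w
  have n2 := heatKer_nonneg v (w + δ)
  have n3 := heatKer_nonneg v (w - δ)
  unfold cornerMain
  calc _ ≤ (1 + α ^ 2) * heatKer v w + α * heatKer v (w + δ) + α * heatKer v (w - δ) := by
        rw [abs_le]
        have m1 := mul_nonneg hα0 n2
        have m2 := mul_nonneg hα0 n3
        have m3 : 0 ≤ (1 + α ^ 2) * heatKer v w := by positivity
        constructor <;> linarith
    _ ≤ (1 + α ^ 2) * (2 * √v / (v + A)) + α * (2 * √v / (v + A)) + α * (2 * √v / (v + A)) := by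
        gcongr
    _ = (1 + α) ^ 2 * (2 * √v / (v + A)) := by ring
    _ ≤ _ := by gcongr

theorem phiKer_sub_le_of_time {v δ α K : ℝ} (hv : 0 < v) (hδ : 0 < δ)
    (hδ1 : δ ≤ 1) (hα0 : 0 ≤ α) (hαK : α ≤ K) (hα : |1 - α| ≤ K * δ) :
    |phiKer α δ v - cornerMain α δ v 0| ≤
      ((1 + K) ^ 2 * 4 * imageConst + K ^ 2) * (√v + δ ^ 2) := by
  have hK : 0 ≤ K := hα0.trans hαK
  have hα2 : (1 - α) ^ 2 ≤ K ^ 2 * δ ^ 2 := by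
    rw [← sq_abs, ← mul_pow]; exact pow_le_pow_left₀ (abs_nonneg _) hα 2
  have hc := imageConst_nonneg
  have key : |∑' m : ℤ, cornerMain α δ v (0 + 2 * m) - cornerMain α δ v 0| ≤
      (1 + K) ^ 2 * 4 * √v * imageConst := by
    have hs : Summable fun m : ℤ => cornerMain α δ v (0 + 2 * m) := by
      refine ((((hasSum_thetaKer hv 0).1.mul_left (1 + α ^ 2)).sub
        ((hasSum_thetaKer hv δ).1.mul_left α)).sub
        ((hasSum_thetaKer hv (-δ)).1.mul_left α)).summable.congr fun m => ?_
      unfold cornerMain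
      rw [show 0 + 2 * (m : ℝ) + δ = δ + 2 * m by ring,
        show 0 + 2 * (m : ℝ) - δ = -δ + 2 * m by ring]
    rw [hs.tsum_eq_add_tsum_ite 0]
    simp only [Int.cast_zero, mul_zero, add_zero, add_sub_cancel_left]
    rw [← Real.norm_eq_abs]
    refine tsum_of_norm_bounded (summable_int_inv_one_add_sq.hasSum.mul_left _) fun m => ?_
    split_ifs with hm
    · rw [norm_zero]; positivity
    · have hm1 : (1 : ℝ) ≤ |(m : ℝ)| := by exact_mod_cast Int.one_le_abs hm
      have hfar : ∀ e : ℝ, |e| ≤ 1 → (m : ℝ) ^ 2 ≤ (0 + 2 * m + e) ^ 2 := fun e he => by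
        refine sq_le_sq.2 ?_
        have := abs_sub_abs_le_abs_sub (2 * (m : ℝ)) (-e)
        rw [abs_mul, abs_neg, abs_two, sub_neg_eq_add] at this
        rw [zero_add]
        linarith
      have h1 := abs_cornerMain_far_le (w := 0 + 2 * (m : ℝ)) (δ := δ) hv hα0 hαK
        (by simpa using hfar 0 (by simp)) (hfar δ (by rwa [abs_of_pos hδ]))
        (by simpa [sub_eq_add_neg] using hfar (-δ) (by rwa [abs_neg, abs_of_pos hδ]))
        (sq_nonneg (m : ℝ))
      refine h1.trans ?_
      have h2 : 1 ≤ (m : ℝ) ^ 2 := by rw [← sq_abs]; nlinarith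
      rw [mul_assoc ((1 + K) ^ 2), mul_assoc ((1 + K) ^ 2)]
      refine mul_le_mul_of_nonneg_left ?_ (sq_nonneg _)
      rw [ ← div_eq_mul_inv, div_le_div_iff₀ (by positivity) (by positivity)]
      have := Real.sqrt_nonneg v
      nlinarith
  rw [thetaKer_corner_eq hv, sub_right_comm]
  refine (abs_sub _ _).trans ((add_le_add (c := |1 / 2 * (1 - α) ^ 2|) (d := K ^ 2 * δ ^ 2) key ?_).trans ?_)
  · rw [abs_of_nonneg (by positivity)]
    linarith [sq_nonneg (1 - α)]
  · have e1 : 0 ≤ (1 + K) ^ 2 * 4 * imageConst * δ ^ 2 := by positivity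
    have e2 : 0 ≤ K ^ 2 * √v := by positivity
    nlinarith

variable {p : Params} {T b : ℝ}

theorem exists_phi_error (hp : p.Admissible) (hT : 0 < T) (hb₀ : 0 ≤ b) (hb₁ : b < 1 / 2) :
    ∃ C, 0 < C ∧ ∀ N M : ℕ, 0 < N → 0 < M →
    |p.θ₂ * doubleΦ p.θ₂ p.κ (spaceMesh b M) (timeMesh T N) -
      mainInt (damping p (spaceMesh b M)) (spaceMesh b M) (p.θ₂ * timeMesh T N) 0| ≤
      C * errBd (spaceMesh b M) (p.θ₂ * timeMesh T N) := by
  have hθ := hp.diffusivity_pos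
  set T' := p.θ₂ * T with hT'
  have hT'0 : 0 ≤ T' := by positivity
  set K := dampConst p
  have hK : 0 ≤ K := dampConst_nonneg p
  have hc₀ := imageConst_nonneg
  have hc₁ := cornerConst_nonneg hK hT'0
  set C := (2 * cornerConst K T' * imageConst + K ^ 2 * √T') +
    ((1 + K) ^ 2 * 4 * imageConst + K ^ 2) + 1 with hC
  have hC0 : 0 < C := by positivity
  refine ⟨2 * C, by positivity, fun N M hN hM => ?_⟩
  have hΔ := timeMesh_pos hT hN
  have hδ := spaceMesh_pos hb₁ hM
  have hδ1 := spaceMesh_le_one hb₀ hM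
  obtain ⟨hα0, hαK, hα⟩ := damping_bounds p hδ.le hδ1
  have hη : 0 ≤ p.θ₂ * timeMesh T N := by positivity
  have hηT : p.θ₂ * timeMesh T N ≤ T' := by
    rw [hT', ← mul_timeMesh (p := p) (T := T) hN]
    exact le_mul_of_one_le_left hη (by exact_mod_cast hN)
  obtain ⟨hi, he⟩ := doubleΦ_eq p hθ hΔ.le (spaceMesh b M)
  rw [he, ← (integral_cornerMain _ _ 0 hη).2]
  refine abs_integral_sub_le_errBd hη hηT hC0.le hi (integral_cornerMain _ _ 0 hη).1
    (fun v hv hvT => (phiKer_sub_le_of_space hv hvT hδ hδ1 hα0 hαK hα).trans ?_)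
    (fun v hv hvT => (phiKer_sub_le_of_time hv hδ hδ1 hα0 hαK hα).trans ?_)
  · have : 0 ≤ (1 + K) ^ 2 * 4 * imageConst + K ^ 2 := by positivity
    gcongr
    linarith
  · have : 0 ≤ 2 * cornerConst K T' * imageConst + K ^ 2 * √T' := by positivity
    gcongr
    linarith

theorem exists_double_error (hp : p.Admissible) (hT : 0 < T) (hb₀ : 0 < b) (hb₁ : b < 1 / 2) :
    ∃ C, 0 < C ∧ ∀ (M : ℕ) (k l : Fin M) (τ : ℝ), 0 ≤ τ → τ ≤ p.θ₂ * T →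
    |(∫ v in (0 : ℝ)..τ, doubleKer p b M k l v) - mainInt (damping p (spaceMesh b M))
      (spaceMesh b M) τ ((((k : ℕ) : ℝ) - (l : ℕ)) * spaceMesh b M)| ≤
      C * errBd (spaceMesh b M) τ := by
  have hθ := hp.diffusivity_pos
  set T' := p.θ₂ * T with hT'
  have hT'0 : 0 ≤ T' := by positivity
  set K := dampConst p
  have hK : 0 ≤ K := dampConst_nonneg p
  have hc₀ := imageConst_nonneg
  have hc₁ := cornerConst_nonneg hK hT'0
  set E := Real.exp (|p.Γ| * T') * |p.Γ| with hE
  have hE0 : 0 ≤ E := by positivity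
  set C₁ := E * (4 * (2 + T') * imageConst * cornerConst K T') +
    (2 * imageConst + (2 + T') / b ^ 2 * imageConst) * cornerConst K T' with hC₁
  set C₂ := E * ((1 + K) ^ 2 * (32 * (1 + T') * imageConst)) +
    (1 + K) ^ 2 * (4 * imageConst + (1 + T') / b ^ 2 * imageConst) with hC₂
  have hC₁0 : 0 ≤ C₁ := by positivity
  have hC₂0 : 0 ≤ C₂ := by positivity
  refine ⟨2 * (C₁ + C₂ + 1), by positivity, fun M k l τ hτ hτT => ?_⟩
  have hM : 0 < M := k.pos
  have hδ := spaceMesh_pos hb₁ hM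
  have hδ1 := spaceMesh_le_one hb₀.le hM
  obtain ⟨hα0, hαK, hα⟩ := damping_bounds p hδ.le hδ1
  have hx := gridPoint_mem hb₁ hM k.2.le
  have hy := gridPoint_mem hb₁ hM l.2.le
  have hx' := gridPoint_mem hb₁ hM (Nat.succ_le_of_lt k.2)
  have hy' := gridPoint_mem hb₁ hM (Nat.succ_le_of_lt l.2)
  rw [Nat.succ_eq_add_one, gridPoint_succ] at hx' hy'
  have hxy := gridPoint_sub b M k l
  unfold doubleKer
  set δ := spaceMesh b M
  set α := damping p δ
  set x := gridPoint b M k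
  set y := gridPoint b M l
  rw [← hxy, ← (integral_cornerMain _ _ _ hτ).2]
  have hexp : ∀ v, 0 < v → v ≤ T' → |Real.exp (-(p.Γ * v)) - 1| ≤ E * v := fun v hv hvT => by
    have h3 := abs_exp_sub_exp_le (neg_mul_le_abs_mul (Γ := p.Γ) hv.le hvT)
      (by positivity : (0 : ℝ) ≤ |p.Γ| * T')
    rw [Real.exp_zero, sub_zero, abs_neg, abs_mul, abs_of_pos hv] at h3
    rwa [hE, mul_assoc]
  have hsplit : ∀ v, Real.exp (-(p.Γ * v)) * cornerKer α δ v x y - cornerMain α δ v (x - y) =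
      (Real.exp (-(p.Γ * v)) - 1) * cornerKer α δ v x y +
        (cornerKer α δ v x y - cornerMain α δ v (x - y)) := fun v => by ring
  refine abs_integral_sub_le_errBd hτ hτT (by positivity)
    (intervalIntegrable_exp_mul_cornerKer hp _ _ _ _ hτ) (integral_cornerMain _ _ _ hτ).1
    (fun v hv hvT => ?_) (fun v hv hvT => ?_)
  · have h1 := abs_cornerKer_le hv hvT hδ hδ1 hα0 hαK hα (hb₀.le.trans hx.1)
      (by linarith [hx'.2]) (hb₀.le.trans hy.1) (by linarith [hy'.2])
    have h2 := abs_cornerKer_sub_cornerMain_le hv hvT hδ hδ1 hb₀ hα0 hαK hα hx.1 hx'.2 hy.1 hy'.2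
    have hv0 : 0 < √v := Real.sqrt_pos.2 hv
    have h3 : v * (δ ^ 2 * (√v)⁻¹ / (v + δ ^ 2 + (x - y) ^ 2)) ≤ δ ^ 2 * (√v)⁻¹ := by
      rw [mul_div_assoc', div_le_iff₀ (by positivity), mul_comm]
      gcongr
      nlinarith [sq_nonneg δ, sq_nonneg (x - y)]
    rw [hsplit]
    refine (abs_add_le _ _).trans ?_
    rw [abs_mul]
    refine (add_le_add (mul_le_mul (hexp v hv hvT) h1 (abs_nonneg _) (by positivity)) h2).trans ?_
    calc _ = E * (4 * (2 + T') * imageConst * cornerConst K T') *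
            (v * (δ ^ 2 * (√v)⁻¹ / (v + δ ^ 2 + (x - y) ^ 2))) +
          (2 * imageConst + (2 + T') / b ^ 2 * imageConst) * cornerConst K T' *
            (δ ^ 2 * (√v)⁻¹) := by ring
      _ ≤ E * (4 * (2 + T') * imageConst * cornerConst K T') * (δ ^ 2 * (√v)⁻¹) +
          (2 * imageConst + (2 + T') / b ^ 2 * imageConst) * cornerConst K T' *
            (δ ^ 2 * (√v)⁻¹) := by gcongr
      _ = C₁ * (δ ^ 2 * (√v)⁻¹) := by rw [hC₁]; ring
      _ ≤ _ := by gcongr; linarith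
  · have hreg := (timeRegular_cornerKer (A := 0) hT'0 hα0 hαK hδ.le (hb₀.le.trans hx.1)
      (by linarith [hx'.2]) (hb₀.le.trans hy.1) (by linarith [hy'.2]) le_rfl (sq_nonneg _)
      (sq_nonneg _) (sq_nonneg _)).abs_le v hv hvT
    have hxm : x ∈ Set.Icc b (1 - b) := hx
    have hd1 := abs_dirKer_sub_heatKer_le hv hvT hb₀ hx' hy'
    have hd2 := abs_dirKer_sub_heatKer_le hv hvT hb₀ hx hy
    have hd3 := abs_dirKer_sub_heatKer_le hv hvT hb₀ hx' hy
    have hd4 := abs_dirKer_sub_heatKer_le hv hvT hb₀ hx hy'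
    rw [add_sub_add_right_eq_sub] at hd1
    rw [show x + δ - y = x - y + δ by ring] at hd3
    rw [show x - (y + δ) = x - y - δ by ring] at hd4
    set D := (4 * imageConst + (1 + T') / b ^ 2 * imageConst) * √v with hD
    have hD0 : 0 ≤ D := by positivity
    have h2 : |cornerKer α δ v x y - cornerMain α δ v (x - y)| ≤ (1 + K) ^ 2 * D := by
      rw [show cornerKer α δ v x y - cornerMain α δ v (x - y) =
        α ^ 2 * (dirKer v (x + δ) (y + δ) - heatKer v (x - y)) +
        (dirKer v x y - heatKer v (x - y)) +
        -α * (dirKer v (x + δ) y - heatKer v (x - y + δ)) +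
        -α * (dirKer v x (y + δ) - heatKer v (x - y - δ)) by
          unfold cornerKer cornerMain; ring]
      refine (abs_add_le _ _).trans ((add_le_add_left (abs_add_three _ _ _) _).trans ?_)
      rw [abs_mul, abs_mul, abs_mul, abs_neg, abs_of_nonneg hα0, abs_of_nonneg (sq_nonneg α)]
      calc _ ≤ α ^ 2 * D + D + α * D + α * D := by gcongr
        _ = (1 + α) ^ 2 * D := by ring
        _ ≤ _ := by gcongr
    rw [hsplit]
    refine (abs_add_le _ _).trans ?_
    rw [abs_mul]
    refine (add_le_add (mul_le_mul (hexp v hv hvT) hreg (abs_nonneg _) (by positivity)) h2).trans ?_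
    have hvv : v * v⁻¹ = 1 := mul_inv_cancel₀ hv.ne'
    calc _ = C₂ * √v := by
          rw [hC₂, hD, add_zero, div_eq_mul_inv]
          linear_combination (E * ((1 + K) ^ 2 * (32 * (1 + T') * imageConst) * √v)) * hvv
      _ ≤ (C₁ + C₂ + 1) * (√v + δ ^ 2) := by
        gcongr
        · linarith
        · linarith [sq_nonneg δ]

end MainTerm

section DoubleCLT

variable {Ω : Type*} [MeasurableSpace Ω] {P : Measure Ω} [IsProbabilityMeasure P]
  {p : Params} {β : ℕ → ℝ≥0 → Ω → ℝ} {u : ℕ → ℝ → Ω → ℝ} {X : ℝ → ℝ → Ω → ℝ}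
  {T b : ℝ} {N M : ℕ → ℕ}

theorem mainInt_neg (α δ τ z : ℝ) : mainInt α δ τ (-z) = mainInt α δ τ z := by
  unfold mainInt
  rw [abs_neg, show -z + δ = -(z - δ) by ring, show -z - δ = -(z + δ) by ring, abs_neg, abs_neg]
  ring

/-- The limiting correlations of the double increments in terms of the limits `m` of the rescaled
main terms. -/
noncomputable def doubleLimit (m : ℕ → ℤ → ℝ) (w : ℤ × ℤ) : ℝ :=
  (m (w.1 + 1).natAbs w.2 + m (w.1 - 1).natAbs w.2 - 2 * m w.1.natAbs w.2) / (2 * m 1 0)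

theorem cast_natAbs_add_one (J : ℤ) : (((J + 1).natAbs : ℕ) : ℝ) = |(J : ℝ) + 1| := by
  rw [Nat.cast_natAbs]; push_cast; rfl

theorem cast_natAbs_sub_one (J : ℤ) : (((J - 1).natAbs : ℕ) : ℝ) = |(J : ℝ) - 1| := by
  rw [Nat.cast_natAbs]; push_cast; rfl

theorem cast_natAbs_eq (J : ℤ) : ((J.natAbs : ℕ) : ℝ) = |(J : ℝ)| := by
  rw [Nat.cast_natAbs]; push_cast; rfl

theorem clt_double_of_limits (hX : IsStationarySolution P p β u X) (hp : p.Admissible) (hT : 0 < T)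
    (hb₀ : 0 < b) (hb₁ : b < 1 / 2) (hN : Tendsto N atTop atTop) (hM : Tendsto M atTop atTop)
    {ν : ℕ → ℝ} (hν : ∀ᶠ n in atTop, 0 < ν n) {m : ℕ → ℤ → ℝ} (hφ : 0 < m 1 0)
    (hm : ∀ (j : ℕ) (L : ℤ), Tendsto (fun n => mainInt (damping p (spaceMesh b (M n))) (spaceMesh b (M n))
      (j * (p.θ₂ * timeMesh T (N n))) (L * spaceMesh b (M n)) / ν n) atTop (𝓝 (m j L)))
    (herr : ∀ j : ℕ, Tendsto (fun n => errBd (spaceMesh b (M n))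
      (j * (p.θ₂ * timeMesh T (N n))) / ν n) atTop (𝓝 0))
    (hbias : Tendsto (fun n => √((M n : ℝ) * N n) * (errBd (spaceMesh b (M n))
      (p.θ₂ * timeMesh T (N n)) / ν n)) atTop (𝓝 0))
    {D : ℝ} (hD : 0 ≤ D) (hdom : ∀ᶠ n in atTop, ∀ a c : Fin (N n) × Fin (M n),
      |secondDiff (doubleKer p b (M n) a.2 c.2) (p.θ₂ * timeMesh T (N n))
        ((a.1 : ℕ) - (c.1 : ℕ) : ℤ)| ≤ D * ν n / ((1 + |(((a.1 : ℕ) - (c.1 : ℕ) : ℤ) : ℝ)|) *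
          √(1 + (((a.2 : ℕ) : ℝ) - (c.2 : ℕ)) ^ 2))) :
    CLT P N M (fun n ω => sigmaSqDouble p.θ₂ p.κ T b (N n) (M n)
      (observe X T b (N n) (M n) ω)) (p.σ ^ 2) (2 * (∑' w, doubleLimit m w ^ 2) * p.σ ^ 4) := by
  have hθ := hp.diffusivity_pos
  obtain ⟨C₁, hC₁, hE⟩ := exists_double_error hp hT hb₀ hb₁
  obtain ⟨C₂, hC₂, hPhi⟩ := exists_phi_error hp hT hb₀.le hb₁
  set η : ℕ → ℝ := fun n => p.θ₂ * timeMesh T (N n) with hη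
  set δ : ℕ → ℝ := fun n => spaceMesh b (M n) with hδ
  set Ψ : ℕ → ℝ := fun n => p.θ₂ * doubleΦ p.θ₂ p.κ (spaceMesh b (M n)) (timeMesh T (N n)) with hΨ
  set φ := m 1 0
  have hpos : ∀ᶠ n in atTop, 0 < N n ∧ 0 < M n ∧ 0 < ν n :=
    (eventually_pos hN).and ((eventually_pos hM).and hν)
  have hΨlim : Tendsto (fun n => Ψ n / ν n) atTop (𝓝 φ) := by
    have h1 := hm 1 0
    have h2 : Tendsto (fun n => C₂ * (errBd (δ n) (η n) / ν n)) atTop (𝓝 0) := by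
      simpa using (herr 1).const_mul C₂
    simp only [Nat.cast_one, one_mul, Int.cast_zero, zero_mul] at h1
    have h3 : Tendsto (fun n => Ψ n / ν n - mainInt (damping p (δ n)) (δ n) (η n) 0 / ν n) atTop
        (𝓝 0) := by
      refine squeeze_zero_norm' ?_ h2
      filter_upwards [hpos] with n hn
      rw [← sub_div, norm_div, Real.norm_eq_abs, Real.norm_of_nonneg hn.2.2.le, ← mul_div_assoc]
      exact div_le_div_of_nonneg_right (hPhi (N n) (M n) hn.1 hn.2.1) hn.2.2.le
    have h4 := h3.add h1
    rw [zero_add] at h4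
    exact h4.congr fun n => sub_add_cancel _ _
  have hΨev : ∀ᶠ n in atTop, φ / 2 * ν n ≤ Ψ n ∧ 0 < Ψ n := by
    filter_upwards [hΨlim.eventually (lt_mem_nhds (half_lt_self hφ)), hpos] with n h1 h2
    have h3 := (lt_div_iff₀ h2.2.2).1 h1
    have : 0 < φ / 2 * ν n := mul_pos (half_pos hφ) h2.2.2
    exact ⟨h3.le, this.trans h3⟩
  have hscale : ∀ n (a : Fin (N n) × Fin (M n)), √(1 / (doubleΦ p.θ₂ p.κ (spaceMesh b (M n))
      (timeMesh T (N n)) * p.σ ^ 2)) ^ 2 * (p.σ ^ 2 / (2 * p.θ₂)) = 1 / (2 * Ψ n) := fun n a => by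
    have h1 := doubleΦ_nonneg p hθ (timeMesh_pos hT a.1.pos).le (spaceMesh b (M n))
    have hσ := hp.sq_pos
    have hσ0 : p.σ ≠ 0 := fun h0 => by simp [h0] at hσ
    rw [Real.sq_sqrt (by positivity), hΨ]
    rcases h1.eq_or_lt with h0 | h0
    · simp [← h0]
    · field_simp
  unfold CLT
  have heq : ∀ n ω, sigmaSqDouble p.θ₂ p.κ T b (N n) (M n) (observe X T b (N n) (M n) ω) = _ :=
    fun n ω => sigmaSqDouble_eq hp.sq_pos
      (doubleΦ_nonneg p hθ (by unfold timeMesh; positivity) _) _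
  simp_rw [heq]
  rw [show p.σ ^ 4 = (p.σ ^ 2) ^ 2 by ring]
  have hlagT : ∀ n (a c : Fin (N n) × Fin (M n)) (x : ℝ), 0 ≤ x →
      x ≤ |(((a.1 : ℕ) - (c.1 : ℕ) : ℤ) : ℝ)| + 1 → 0 ≤ x * η n ∧ x * η n ≤ p.θ₂ * T := by
    intro n a c x hx0 hx
    have hη0 : 0 ≤ η n := (mul_pos hθ (timeMesh_pos hT a.1.pos)).le
    refine ⟨mul_nonneg hx0 hη0, ?_⟩
    rw [← mul_timeMesh (p := p) (T := T) a.1.pos]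
    exact mul_le_mul_of_nonneg_right (hx.trans (abs_lag_add_one_le a.1 c.1)) hη0
  have hmain : ∀ n (a c : Fin (N n) × Fin (M n)) (w : ℤ × ℤ), boxLag a c = w →
      |secondDiff (doubleKer p b (M n) a.2 c.2) (η n) ((a.1 : ℕ) - (c.1 : ℕ) : ℤ) -
        (mainInt (damping p (δ n)) (δ n) ((w.1 + 1).natAbs * η n) (w.2 * δ n) +
        mainInt (damping p (δ n)) (δ n) ((w.1 - 1).natAbs * η n) (w.2 * δ n) -
        2 * mainInt (damping p (δ n)) (δ n) (w.1.natAbs * η n) (w.2 * δ n))| ≤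
      C₁ * (errBd (δ n) ((w.1 + 1).natAbs * η n) + errBd (δ n) ((w.1 - 1).natAbs * η n) +
        2 * errBd (δ n) (w.1.natAbs * η n)) := by
    intro n a c w hw
    have hw1 : ((a.1 : ℕ) - (c.1 : ℕ) : ℤ) = -w.1 := by rw [← hw, boxLag]; simp
    have hw2 : (((a.2 : ℕ) : ℝ) - (c.2 : ℕ)) * spaceMesh b (M n) = -((w.2 : ℝ) * δ n) := by
      rw [← hw, boxLag]; push_cast; ring
    have hl := hlagT n a c
    rw [hw1, Int.cast_neg, abs_neg] at hl
    have key : ∀ x : ℝ, 0 ≤ x → x ≤ |(w.1 : ℝ)| + 1 →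
        |(∫ v in (0 : ℝ)..x * η n, doubleKer p b (M n) a.2 c.2 v) -
          mainInt (damping p (δ n)) (δ n) (x * η n) (w.2 * δ n)| ≤ C₁ * errBd (δ n) (x * η n) := by
      intro x hx0 hx
      obtain ⟨h1, h2⟩ := hl x hx0 hx
      have := hE (M n) a.2 c.2 _ h1 h2
      rwa [hw2, mainInt_neg] at this
    have k1 := key |(w.1 : ℝ) + 1| (abs_nonneg _) ((abs_add_le _ _).trans (by simp))
    have k2 := key |(w.1 : ℝ) - 1| (abs_nonneg _) ((abs_sub _ _).trans (by simp))
    have k3 := key |(w.1 : ℝ)| (abs_nonneg _) (by linarith)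
    rw [hw1, secondDiff_neg, cast_natAbs_add_one, cast_natAbs_sub_one, cast_natAbs_eq]
    unfold secondDiff
    rw [abs_le] at *
    constructor <;> linarith [k1.1, k1.2, k2.1, k2.2, k3.1, k3.2]
  refine tendstoInDistribution_box hN hM
    (d := fun w => D / φ / ((1 + |(w.1 : ℝ)|) * √(1 + (w.2 : ℝ) ^ 2))) (r := doubleLimit m)
    (fun n => (hX.isCenteredGaussian_double hp hT hb₀.le hb₁ (N n) (M n)).const_mul _)
    (summable_latticeBound _) (fun w => by positivity) ?_ ?_ ?_ hp.sq_pos.le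
  · filter_upwards [hdom, hΨev, hpos] with n h1 h2 h3 a c
    rw [← mul_assoc, hscale n a, abs_mul, abs_of_pos (by have := h2.2; positivity)]
    refine (mul_le_mul_of_nonneg_left (h1 a c) (by have := h2.2; positivity)).trans ?_
    have e1 : |(((a.1 : ℕ) - (c.1 : ℕ) : ℤ) : ℝ)| = |((boxLag a c).1 : ℝ)| := by
      rw [boxLag]; push_cast; exact abs_sub_comm _ _
    have e2 : (((a.2 : ℕ) : ℝ) - (c.2 : ℕ)) ^ 2 = ((boxLag a c).2 : ℝ) ^ 2 := by
      rw [boxLag]; push_cast; ring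
    rw [e1, e2, ← mul_div_assoc]
    refine div_le_div_of_nonneg_right ?_ (by positivity)
    rw [one_div, inv_mul_le_iff₀ (by have := h2.2; positivity)]
    calc D * ν n = 2 * (φ / 2 * ν n) * (D / φ) := by field_simp
      _ ≤ 2 * Ψ n * (D / φ) := by
        have := h2.1
        gcongr
  · intro w ε hε
    set S : ℕ → ℝ := fun n =>
      (mainInt (damping p (δ n)) (δ n) ((w.1 + 1).natAbs * η n) (w.2 * δ n) +
        mainInt (damping p (δ n)) (δ n) ((w.1 - 1).natAbs * η n) (w.2 * δ n) -
        2 * mainInt (damping p (δ n)) (δ n) (w.1.natAbs * η n) (w.2 * δ n)) with hS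
    set R : ℕ → ℝ := fun n => C₁ * (errBd (δ n) ((w.1 + 1).natAbs * η n) +
        errBd (δ n) ((w.1 - 1).natAbs * η n) + 2 * errBd (δ n) (w.1.natAbs * η n)) with hR
    have hSlim : Tendsto (fun n => S n / ν n / (2 * (Ψ n / ν n))) atTop (𝓝 (doubleLimit m w)) := by
      refine Tendsto.div ?_ (hΨlim.const_mul 2) (by positivity)
      have := ((hm (w.1 + 1).natAbs w.2).add (hm (w.1 - 1).natAbs w.2)).sub
        ((hm w.1.natAbs w.2).const_mul 2)
      refine this.congr fun n => ?_
      simp only [hS, hη, hδ]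
      ring
    have hRlim : Tendsto (fun n => R n / ν n / (2 * (Ψ n / ν n))) atTop (𝓝 0) := by
      have h1 : Tendsto (fun n => R n / ν n) atTop (𝓝 0) := by
        have := (((herr (w.1 + 1).natAbs).add (herr (w.1 - 1).natAbs)).add
          ((herr w.1.natAbs).const_mul 2)).const_mul C₁
        simp only [add_zero, mul_zero] at this
        refine this.congr fun n => ?_
        simp only [hR, hη, hδ]
        ring
      have h2 := h1.div (hΨlim.const_mul 2) (by positivity)
      rw [zero_div] at h2
      exact h2
    have hSabs : Tendsto (fun n => |S n / ν n / (2 * (Ψ n / ν n)) - doubleLimit m w| +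
        R n / ν n / (2 * (Ψ n / ν n))) atTop (𝓝 0) := by
      have := (hSlim.sub_const (doubleLimit m w)).abs.add hRlim
      simpa using this
    filter_upwards [hSabs.eventually (ge_mem_nhds hε), hΨev, hpos] with n h1 h2 h3 a c hac
    rw [← mul_assoc, hscale n a]
    have h4 := hmain n a c w hac
    have hν0 := h3.2.2
    have hΨ0 := h2.2
    have e1 : ∀ x : ℝ, x / ν n / (2 * (Ψ n / ν n)) = 1 / (2 * Ψ n) * x := fun x => by
      field_simp
    rw [e1, e1] at h1
    refine le_trans ?_ h1
    refine le_trans ?_ (add_le_add_right (mul_le_mul_of_nonneg_left h4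
      (by positivity : 0 ≤ 1 / (2 * Ψ n))) _)
    rw [← abs_of_pos (by positivity : 0 < 1 / (2 * Ψ n)), ← abs_mul,
      abs_of_pos (by positivity : 0 < 1 / (2 * Ψ n))]
    refine le_trans (le_of_eq ?_) (abs_add_le _ _)
    congr 1
    simp only [hS]
    unfold doubleKer
    ring
  · intro ε hε
    have h0 : Tendsto (fun n => (C₁ + C₂) * (2 / φ) * (√((M n : ℝ) * N n) * (errBd (δ n) (η n) /
        ν n))) atTop (𝓝 0) := by
      simpa using hbias.const_mul ((C₁ + C₂) * (2 / φ))
    filter_upwards [h0.eventually (ge_mem_nhds hε), hΨev, hpos] with n h1 h2 h3 a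
    rw [← mul_assoc, hscale n a]
    have hN0 : (0 : ℝ) < N n := by exact_mod_cast h3.1
    have hM0 : (0 : ℝ) < M n := by exact_mod_cast h3.2.1
    have hν0 := h3.2.2
    have hΨ0 := h2.2
    rw [sub_self, secondDiff_zero, le_div_iff₀ (Real.sqrt_pos.2 (by positivity))]
    have hl := hlagT n a a 1 zero_le_one (by linarith [abs_nonneg (((a.1 : ℕ) - (a.1 : ℕ) : ℤ) : ℝ)])
    rw [one_mul] at hl
    have k1 := hE (M n) a.2 a.2 _ hl.1 hl.2
    rw [sub_self, zero_mul] at k1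
    have k2 := hPhi (N n) (M n) h3.1 h3.2.1
    have k3 : |(∫ v in (0 : ℝ)..η n, doubleKer p b (M n) a.2 a.2 v) - Ψ n| ≤
        (C₁ + C₂) * errBd (δ n) (η n) := by
      have k4 := abs_sub_le (∫ v in (0 : ℝ)..η n, doubleKer p b (M n) a.2 a.2 v)
        (mainInt (damping p (δ n)) (δ n) (η n) 0) (Ψ n)
      rw [abs_sub_comm (mainInt (damping p (δ n)) (δ n) (η n) 0)] at k4
      linarith
    have e1 : 1 / (2 * Ψ n) * (2 * ∫ v in (0 : ℝ)..η n, doubleKer p b (M n) a.2 a.2 v) - 1 =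
        ((∫ v in (0 : ℝ)..η n, doubleKer p b (M n) a.2 a.2 v) - Ψ n) / Ψ n := by
      field_simp
    change |1 / (2 * Ψ n) * (2 * ∫ v in (0 : ℝ)..η n, doubleKer p b (M n) a.2 a.2 v) - 1| * _ ≤ ε
    rw [e1, abs_div, abs_of_pos hΨ0]
    have herr0 : 0 ≤ (C₁ + C₂) * errBd (δ n) (η n) := (abs_nonneg _).trans k3
    calc _ ≤ (C₁ + C₂) * errBd (δ n) (η n) / (φ / 2 * ν n) * √((M n : ℝ) * N n) := by
          gcongr
          exact h2.1
      _ = (C₁ + C₂) * (2 / φ) * (√((M n : ℝ) * N n) * (errBd (δ n) (η n) / ν n)) := by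
          field_simp
      _ ≤ ε := h1

end DoubleCLT

section AuxH

theorem gaussTail_pos (y : ℝ) : 0 < gaussTail y := by
  have : NeZero (volume.restrict (Set.Ioi y)) := ⟨by simp⟩
  exact integral_exp_pos integrable_exp_neg_sq.restrict

theorem strictAnti_auxH : StrictAnti auxH :=
  strictAnti_of_hasDerivAt_neg hasDerivAt_auxH fun x => by
    have h1 := gaussTail_pos (x / 2)
    have h2 : 0 < 1 / (2 * √Real.pi) := by positivity
    rw [neg_mul, neg_lt_zero]
    positivity

theorem tendsto_auxH_mul_sub_div {ι : Type*} {l : Filter ι} {h : ι → ℝ} (hh : Tendsto h l (𝓝 0))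
    (hpos : ∀ᶠ n in l, 0 < h n) (c : ℝ) :
    Tendsto (fun n => (auxH (c * h n) - auxH 0) / h n) l (𝓝 (-(c / 4))) := by
  have h1 : HasDerivAt (fun x => auxH (c * x)) (-(c / 4)) 0 := by
    have h2 : HasDerivAt (fun x : ℝ => c * x) c 0 := by
      simpa using (hasDerivAt_id' (0 : ℝ)).const_mul c
    have h3 : HasDerivAt auxH (-(1 / 4)) (c * 0) := by rw [mul_zero]; exact hasDerivAt_auxH_zero
    exact (HasDerivAt.comp (h₂ := auxH) 0 h3 h2).congr_deriv (by ring)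
  have h2 : Tendsto h l (𝓝[≠] 0) := tendsto_nhdsWithin_iff.2 ⟨hh, hpos.mono fun n hn => hn.ne'⟩
  refine ((hasDerivAt_iff_tendsto_slope.1 h1).comp h2).congr fun n => ?_
  simp only [Function.comp_apply, slope_def_field, mul_zero, sub_zero]

end AuxH

section DoubleRegimes

variable {Ω : Type*} [MeasurableSpace Ω] {P : Measure Ω} [IsProbabilityMeasure P]
  {p : Params} {β : ℕ → ℝ≥0 → Ω → ℝ} {u : ℕ → ℝ → Ω → ℝ} {X : ℝ → ℝ → Ω → ℝ}
  {T b : ℝ} {N M : ℕ → ℕ}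

theorem mainInt_scaled (η α δ : ℝ) (hδ : 0 ≤ δ) (j : ℕ) (L : ℤ) :
    mainInt α δ (j * η) (L * δ) = √η * (2 * √(j : ℝ) * ((1 + α ^ 2) *
      auxH (|(L : ℝ)| / √(j : ℝ) * (δ / √η)) - α * auxH (|(L : ℝ) + 1| / √(j : ℝ) * (δ / √η)) -
      α * auxH (|(L : ℝ) - 1| / √(j : ℝ) * (δ / √η)))) := by
  have key : ∀ x : ℝ, |x * δ| / √(j * η) = |x| / √(j : ℝ) * (δ / √η) := fun x => by
    rw [abs_mul, abs_of_nonneg hδ, Real.sqrt_mul (Nat.cast_nonneg j), mul_div_mul_comm]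
  unfold mainInt
  rw [show (L : ℝ) * δ + δ = (L + 1) * δ by ring, show (L : ℝ) * δ - δ = (L - 1) * δ by ring,
    key, key, key, Real.sqrt_mul (Nat.cast_nonneg j)]
  ring

theorem tendsto_damping (p : Params) (b : ℝ) (hM : Tendsto M atTop atTop) :
    Tendsto (fun n => damping p (spaceMesh b (M n))) atTop (𝓝 1) := by
  have h1 : Tendsto (fun n => -(p.κ * spaceMesh b (M n) / 2)) atTop (𝓝 0) := by
    simpa using (((tendsto_spaceMesh b hM).const_mul p.κ).div_const 2).neg
  rw [← Real.exp_zero]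
  exact Real.continuous_exp.continuousAt.tendsto.comp h1

theorem errBd_nonneg {τ : ℝ} (hτ : 0 ≤ τ) (δ : ℝ) : 0 ≤ errBd δ τ :=
  le_min (by positivity) (by positivity)

theorem errBd_le_space (δ τ : ℝ) : errBd δ τ ≤ δ ^ 2 * √τ := min_le_left _ _

theorem errBd_le_time (δ τ : ℝ) : errBd δ τ ≤ τ * √τ + δ ^ 2 * τ := min_le_right _ _

theorem mul_spaceMesh (b : ℝ) {M : ℕ} (hM : 0 < M) : M * spaceMesh b M = 1 - 2 * b := by
  have : (M : ℝ) ≠ 0 := by positivity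
  unfold spaceMesh
  field_simp

theorem eventually_mesh_pos (hp : p.Admissible) (hT : 0 < T) (hb₁ : b < 1 / 2)
    (hN : Tendsto N atTop atTop) (hM : Tendsto M atTop atTop) :
    ∀ᶠ n in atTop, 0 < N n ∧ 0 < M n ∧ 0 < p.θ₂ * timeMesh T (N n) ∧ 0 < spaceMesh b (M n) := by
  filter_upwards [eventually_pos hN, eventually_pos hM] with n h1 h2
  exact ⟨h1, h2, mul_pos hp.diffusivity_pos (timeMesh_pos hT h1), spaceMesh_pos hb₁ h2⟩

/-! #### Comparable meshes -/

/-- The limits of the rescaled main terms for comparable meshes. -/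
noncomputable def balancedLimit (h : ℝ) (j : ℕ) (L : ℤ) : ℝ :=
  2 * √(j : ℝ) * (2 * auxH (|(L : ℝ)| / √(j : ℝ) * h) - auxH (|(L : ℝ) + 1| / √(j : ℝ) * h) -
    auxH (|(L : ℝ) - 1| / √(j : ℝ) * h))

theorem add_abs_of_even {f : ℤ → ℝ} (hf : ∀ x, f (-x) = f x) (J : ℤ) :
    f (|J| + 1) + f (|J| - 1) - 2 * f |J| = f (J + 1) + f (J - 1) - 2 * f J := by
  rcases abs_choice J with h | h <;> rw [h]
  rw [show -J + 1 = -(J - 1) by ring, show -J - 1 = -(J + 1) by ring, hf, hf, hf]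
  ring

theorem auxG_eq (h : ℝ) (j l : ℤ) :
    auxG h j l = √(j.natAbs : ℝ) * auxH (|(l : ℝ)| / √(j.natAbs : ℝ) * h) := by
  unfold auxG
  rw [cast_natAbs_eq]
  split_ifs with h0
  · simp [h0]
  · rw [mul_comm h, mul_div_right_comm]

theorem auxΛ_eq (h : ℝ) (w : ℤ × ℤ) : auxΛ h w.1 w.2 = -(1 / 2) *
    (balancedLimit h (w.1 + 1).natAbs w.2 + balancedLimit h (w.1 - 1).natAbs w.2 -
      2 * balancedLimit h w.1.natAbs w.2) := by
  have e1 : ∀ j : ℤ, -(1 / 2) * balancedLimit h j.natAbs w.2 =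
      auxG h j (w.2 + 1) + auxG h j (w.2 - 1) - 2 * auxG h j w.2 := fun j => by
    simp only [auxG_eq]
    unfold balancedLimit
    push_cast
    ring
  have e2 : ∀ j : ℤ, diffY (auxG h) j (|w.2| - 1) = -(1 / 2) * balancedLimit h j.natAbs w.2 :=
    fun j => by
    rw [e1, ← add_abs_of_even (f := auxG h j) fun l => by simp [auxG_eq]]
    unfold diffY
    rw [show |w.2| - 1 + 2 = |w.2| + 1 by ring, show |w.2| - 1 + 1 = |w.2| by ring]
  unfold auxΛ diffX
  rw [e2, e2, e2, show |w.1| - 1 + 2 = |w.1| + 1 by ring, show |w.1| - 1 + 1 = |w.1| by ring]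
  have := add_abs_of_even (f := fun j => -(1 / 2) * balancedLimit h j.natAbs w.2)
    (fun x => by simp) w.1
  rw [this]
  ring

theorem two_mul_tsum_doubleLimit_balanced {h : ℝ} (hh : 0 < h) :
    2 * ∑' w, doubleLimit (balancedLimit h) w ^ 2 = constC (ENNReal.ofReal h) := by
  have h0 : auxΛ h 0 0 = -(balancedLimit h 1 0) := by
    have := auxΛ_eq h (0, 0)
    simp only [zero_add, zero_sub, Int.natAbs_neg, Int.natAbs_zero, Int.natAbs_one] at this
    rw [this]
    have : balancedLimit h 0 0 = 0 := by simp [balancedLimit]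
    rw [this]
    ring
  have e : ∀ w, doubleLimit (balancedLimit h) w = auxΛ h w.1 w.2 / auxΛ h 0 0 := fun w => by
    rw [auxΛ_eq, h0]
    unfold doubleLimit
    rw [neg_mul, neg_div_neg_eq, div_mul_eq_mul_div, one_mul, div_div]
  unfold constC
  rw [if_neg (by simpa using hh), if_neg ENNReal.ofReal_ne_top, ENNReal.toReal_ofReal hh.le]
  simp_rw [e, div_pow, tsum_div_const]
  ring

theorem clt_double_balanced (hX : IsStationarySolution P p β u X) (hp : p.Admissible) (hT : 0 < T)
    (hb₀ : 0 < b) (hb₁ : b < 1 / 2) (hN : Tendsto N atTop atTop) (hM : Tendsto M atTop atTop)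
    {r₀ : ℝ} (hr₀ : 0 < r₀) (h : ∀ n, √(N n : ℝ) = r₀ * (M n : ℝ)) :
    CLT P N M (fun n ω => sigmaSqDouble p.θ₂ p.κ T b (N n) (M n)
      (observe X T b (N n) (M n) ω)) (p.σ ^ 2)
      (constC (ENNReal.ofReal (r₀ * ((1 - 2 * b) / √T) / √p.θ₂)) * p.σ ^ 4) := by
  have hθ := hp.diffusivity_pos
  set r := r₀ * ((1 - 2 * b) / √T) / √p.θ₂ with hr
  have hr0 : 0 < r := by
    have : 0 < 1 - 2 * b := by linarith
    positivity
  have hpos := eventually_mesh_pos hp hT hb₁ hN hM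
  have hratio : ∀ᶠ n in atTop, spaceMesh b (M n) = r * √(p.θ₂ * timeMesh T (N n)) := by
    filter_upwards [hpos] with n hn
    have hN0 : 0 < √(N n : ℝ) := Real.sqrt_pos.2 (by exact_mod_cast hn.1)
    have hM0 : (0 : ℝ) < M n := by exact_mod_cast hn.2.1
    have e : √(p.θ₂ * timeMesh T (N n)) = √p.θ₂ * √T / (r₀ * M n) := by
      unfold timeMesh
      rw [← mul_div_assoc, Real.sqrt_div (by positivity), Real.sqrt_mul hθ.le, h n]
    rw [hr, e]
    unfold spaceMesh
    field_simp
  have hη0 : Tendsto (fun n => p.θ₂ * timeMesh T (N n)) atTop (𝓝 0) := by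
    simpa using (tendsto_timeMesh T hN).const_mul p.θ₂
  have hδ0 := tendsto_spaceMesh b hM
  have hα := tendsto_damping p b hM
  rw [← two_mul_tsum_doubleLimit_balanced hr0]
  obtain ⟨C, hC, hdom⟩ := exists_double_space_bound hp hT hb₀.le hb₁
  have hφ : 0 < balancedLimit r 1 0 := by
    have := strictAnti_auxH hr0
    unfold balancedLimit
    simp
    linarith
  refine clt_double_of_limits hX hp hT hb₀ hb₁ hN hM (ν := fun n => √(p.θ₂ * timeMesh T (N n)))
    (D := C * r) (hpos.mono fun n hn => Real.sqrt_pos.2 hn.2.2.1) hφ (fun j L => ?_) (fun j => ?_)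
    ?_ (by positivity) ?_
  · have h1 := ((((hα.pow 2).const_add 1).mul_const (auxH (|(L : ℝ)| / √(j : ℝ) * r))).sub
      (hα.mul_const (auxH (|(L : ℝ) + 1| / √(j : ℝ) * r)))).sub
      (hα.mul_const (auxH (|(L : ℝ) - 1| / √(j : ℝ) * r)))
    have h2 := h1.const_mul (2 * √(j : ℝ))
    rw [one_pow, one_mul, one_mul, one_add_one_eq_two] at h2
    refine h2.congr' ?_
    filter_upwards [hpos, hratio] with n hn hrn
    have hs := Real.sqrt_pos.2 hn.2.2.1
    rw [mainInt_scaled _ _ _ hn.2.2.2.le, (div_eq_iff hs.ne').2 hrn]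
    field_simp
  · have h1 : Tendsto (fun n => √(j : ℝ) * spaceMesh b (M n) ^ 2) atTop (𝓝 0) := by
      simpa using (hδ0.pow 2).const_mul (√(j : ℝ))
    refine squeeze_zero' ?_ ?_ h1
    · filter_upwards [hpos] with n hn
      exact div_nonneg (errBd_nonneg (mul_nonneg j.cast_nonneg hn.2.2.1.le) _) (Real.sqrt_nonneg _)
    · filter_upwards [hpos] with n hn
      rw [div_le_iff₀ (Real.sqrt_pos.2 hn.2.2.1)]
      refine (errBd_le_space _ _).trans (le_of_eq ?_)
      rw [Real.sqrt_mul j.cast_nonneg]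
      ring
  · have h1 : Tendsto (fun n => r₀ * (1 - 2 * b) * √(1 - 2 * b) * √(spaceMesh b (M n))) atTop
        (𝓝 0) := by
      simpa using hδ0.sqrt.const_mul (r₀ * (1 - 2 * b) * √(1 - 2 * b))
    refine squeeze_zero' ?_ ?_ h1
    · filter_upwards [hpos] with n hn
      exact mul_nonneg (Real.sqrt_nonneg _)
        (div_nonneg (errBd_nonneg hn.2.2.1.le _) (Real.sqrt_nonneg _))
    · filter_upwards [hpos] with n hn
      have hs := Real.sqrt_pos.2 hn.2.2.1
      have e1 : errBd (spaceMesh b (M n)) (p.θ₂ * timeMesh T (N n)) /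
          √(p.θ₂ * timeMesh T (N n)) ≤ spaceMesh b (M n) ^ 2 := by
        rw [div_le_iff₀ hs]; exact errBd_le_space _ _
      have hM0 : (0 : ℝ) ≤ M n := Nat.cast_nonneg _
      have e2 : √(1 - 2 * b) = √(M n : ℝ) * √(spaceMesh b (M n)) := by
        rw [← mul_spaceMesh b hn.2.1, Real.sqrt_mul hM0]
      have e3 : √(spaceMesh b (M n)) ^ 2 = spaceMesh b (M n) := Real.sq_sqrt hn.2.2.2.le
      refine (mul_le_mul_of_nonneg_left e1 (Real.sqrt_nonneg _)).trans (le_of_eq ?_)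
      rw [e2, Real.sqrt_mul hM0, h n, ← mul_spaceMesh b hn.2.1]
      linear_combination (-r₀ * √(M n : ℝ) * M n * spaceMesh b (M n)) * e3
  · filter_upwards [hratio] with n hrn a c
    refine (hdom (N n) (M n) a c).trans (le_of_eq ?_)
    rw [hrn]
    ring

/-! #### Temporal mesh much finer than the squared spatial mesh -/

/-- The limits of the rescaled main terms in the time dominated regime. -/
noncomputable def temporalDoubleLimit (j : ℕ) (L : ℤ) : ℝ :=
  2 * √(j : ℝ) * (2 * (if L = 0 then auxH 0 else 0) - (if L + 1 = 0 then auxH 0 else 0) -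
    (if L - 1 = 0 then auxH 0 else 0))

theorem hasSum_lag_sq {c : ℝ} {f : ℤ → ℝ} (h0 : f 0 = c) (h1 : f 1 = -(c / 2))
    (h2 : f (-1) = -(c / 2)) (h3 : ∀ x, x ≠ 0 → x ≠ 1 → x ≠ -1 → f x = 0) :
    HasSum (fun x => f x ^ 2) (3 / 2 * c ^ 2) := by
  have : 3 / 2 * c ^ 2 = ∑ x ∈ ({0, 1, -1} : Finset ℤ), f x ^ 2 := by
    rw [Finset.sum_insert (by decide), Finset.sum_insert (by decide), Finset.sum_singleton, h0, h1,
      h2]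
    ring
  rw [this]
  refine hasSum_sum_of_ne_finset_zero fun x hx => ?_
  simp only [Finset.mem_insert, Finset.mem_singleton, not_or] at hx
  rw [h3 x hx.1 hx.2.1 hx.2.2]
  simp

theorem two_mul_tsum_doubleLimit_temporal :
    2 * ∑' w, doubleLimit temporalDoubleLimit w ^ 2 = constC ⊤ := by
  have hH : auxH 0 ≠ 0 := by rw [auxH_zero]; positivity
  set g : ℤ → ℝ := fun L => 1 / 2 * (2 * (if L = 0 then 1 else 0) - (if L + 1 = 0 then 1 else 0) -
    (if L - 1 = 0 then 1 else 0)) with hg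
  have e : ∀ w, doubleLimit temporalDoubleLimit w ^ 2 =
      (1 / 4 * sqrtDiff w.1 ^ 2) * g w.2 ^ 2 := fun w => by
    have h1 : ∀ c : Prop, [Decidable c] → (if c then auxH 0 else 0) =
      auxH 0 * (if c then (1 : ℝ) else 0) := fun c _ => by simp
    rw [show (1 / 4 * sqrtDiff w.1 ^ 2) * g w.2 ^ 2 = (1 / 2 * sqrtDiff w.1 * g w.2) ^ 2 by ring]
    congr 1
    have h2 : temporalDoubleLimit 1 0 = 4 * auxH 0 := by
      norm_num [temporalDoubleLimit]
      ring
    unfold doubleLimit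
    rw [h2]
    unfold temporalDoubleLimit sqrtDiff
    rw [cast_natAbs_add_one, cast_natAbs_sub_one, cast_natAbs_eq]
    simp only [h1, hg]
    field_simp
    ring
  have hgs : HasSum (fun x => g x ^ 2) (3 / 2 * 1 ^ 2) := by
    refine hasSum_lag_sq (by norm_num [hg]) (by norm_num [hg]) (by norm_num [hg])
      fun x h0 h1 h2 => ?_
    simp only [hg]
    rw [if_neg h0, if_neg (by omega), if_neg (by omega)]
    norm_num
  simp_rw [e]
  rw [← tsum_mul_tsum_of_summable_norm (f := fun J : ℤ => 1 / 4 * sqrtDiff J ^ 2)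
    (g := fun L => g L ^ 2) (summable_sqrtDiff_sq.mul_left _).norm hgs.summable.norm, hgs.tsum_eq,
    tsum_mul_left, tsum_sqrtDiff_sq]
  unfold constC
  rw [if_neg ENNReal.top_ne_zero, if_pos rfl]
  have : ∀ J : ℕ, (√(J : ℝ) + √((J : ℝ) + 2) - 2 * √((J : ℝ) + 1)) ^ 2 =
    (2 * √((J : ℝ) + 1) - √((J : ℝ) + 2) - √(J : ℝ)) ^ 2 := fun J => by ring
  simp_rw [this]
  ring

theorem clt_double_temporal (hX : IsStationarySolution P p β u X) (hp : p.Admissible) (hT : 0 < T)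
    (hb₀ : 0 < b) (hb₁ : b < 1 / 2) (hN : Tendsto N atTop atTop) (hM : Tendsto M atTop atTop)
    (h : (fun n => (M n : ℝ)) =o[atTop] (fun n => √(N n : ℝ))) :
    CLT P N M (fun n ω => sigmaSqDouble p.θ₂ p.κ T b (N n) (M n)
      (observe X T b (N n) (M n) ω)) (p.σ ^ 2) (constC ⊤ * p.σ ^ 4) := by
  have hθ := hp.diffusivity_pos
  have hpos := eventually_mesh_pos hp hT hb₁ hN hM
  have hx := tendsto_sqrt_timeMesh_div_spaceMesh (b := b) hp hT h
  have hη0 : Tendsto (fun n => p.θ₂ * timeMesh T (N n)) atTop (𝓝 0) := by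
    simpa using (tendsto_timeMesh T hN).const_mul p.θ₂
  have hδ0 := tendsto_spaceMesh b hM
  have hα := tendsto_damping p b hM
  have hratio : Tendsto (fun n => spaceMesh b (M n) / √(p.θ₂ * timeMesh T (N n))) atTop atTop := by
    have : Tendsto (fun n => √(p.θ₂ * timeMesh T (N n)) / spaceMesh b (M n)) atTop (𝓝[>] 0) :=
      tendsto_nhdsWithin_iff.2 ⟨hx, hpos.mono fun n hn =>
        div_pos (Real.sqrt_pos.2 hn.2.2.1) hn.2.2.2⟩
    refine (tendsto_inv_nhdsGT_zero.comp this).congr fun n => ?_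
    simp
  rw [← two_mul_tsum_doubleLimit_temporal]
  obtain ⟨C, hC, hdom⟩ := exists_double_time_bound hp hT hb₀.le hb₁
  have hφ : 0 < temporalDoubleLimit 1 0 := by
    have : 0 < auxH 0 := by rw [auxH_zero]; positivity
    unfold temporalDoubleLimit
    simpa using this
  refine clt_double_of_limits hX hp hT hb₀ hb₁ hN hM (ν := fun n => √(p.θ₂ * timeMesh T (N n)))
    (D := C) (hpos.mono fun n hn => Real.sqrt_pos.2 hn.2.2.1) hφ (fun j L => ?_) (fun j => ?_)
    ?_ hC.le ?_
  · rcases Nat.eq_zero_or_pos j with rfl | hj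
    · simp [mainInt, temporalDoubleLimit]
    have hj0 : 0 < √(j : ℝ) := Real.sqrt_pos.2 (by exact_mod_cast hj)
    have hlim : ∀ K : ℤ, Tendsto (fun n => auxH (|(K : ℝ)| / √(j : ℝ) *
        (spaceMesh b (M n) / √(p.θ₂ * timeMesh T (N n))))) atTop
        (𝓝 (if K = 0 then auxH 0 else 0)) := fun K => by
      split_ifs with hK
      · simp [hK]
      · have : 0 < |(K : ℝ)| / √(j : ℝ) :=
          div_pos (abs_pos.2 (by exact_mod_cast hK)) hj0
        exact tendsto_auxH_atTop.comp (hratio.const_mul_atTop this)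
    have h2 := ((((((hα.pow 2).const_add 1).mul (hlim L)).sub (hα.mul (hlim (L + 1)))).sub
      (hα.mul (hlim (L - 1))))).const_mul (2 * √(j : ℝ))
    rw [one_pow, one_mul, one_mul, one_add_one_eq_two] at h2
    refine h2.congr' ?_
    filter_upwards [hpos] with n hn
    have hs := Real.sqrt_pos.2 hn.2.2.1
    rw [mainInt_scaled _ _ _ hn.2.2.2.le, mul_div_cancel_left₀ _ hs.ne']
    push_cast
    rfl
  · have h1 : Tendsto (fun n => √(j : ℝ) * spaceMesh b (M n) ^ 2) atTop (𝓝 0) := by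
      simpa using (hδ0.pow 2).const_mul (√(j : ℝ))
    refine squeeze_zero' ?_ ?_ h1
    · filter_upwards [hpos] with n hn
      exact div_nonneg (errBd_nonneg (mul_nonneg j.cast_nonneg hn.2.2.1.le) _) (Real.sqrt_nonneg _)
    · filter_upwards [hpos] with n hn
      rw [div_le_iff₀ (Real.sqrt_pos.2 hn.2.2.1)]
      refine (errBd_le_space _ _).trans (le_of_eq ?_)
      rw [Real.sqrt_mul j.cast_nonneg]
      ring
  · have h1 : Tendsto (fun n => √((M n : ℝ) / √(N n : ℝ)) * (p.θ₂ * T * (√(√(N n : ℝ)))⁻¹) +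
        √(p.θ₂ * T) * √(1 - 2 * b) * (spaceMesh b (M n) * √(spaceMesh b (M n)))) atTop (𝓝 0) := by
      have h1 : Tendsto (fun n => √((M n : ℝ) / √(N n))) atTop (𝓝 0) := by
        simpa using h.tendsto_div_nhds_zero.sqrt
      have h2 : Tendsto (fun n => (√(√(N n : ℝ)))⁻¹) atTop (𝓝 0) :=
        tendsto_inv_atTop_zero.comp (Real.tendsto_sqrt_atTop.comp
          (Real.tendsto_sqrt_atTop.comp (tendsto_natCast_atTop_atTop.comp hN)))
      simpa using (h1.mul (h2.const_mul (p.θ₂ * T))).add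
        ((hδ0.mul hδ0.sqrt).const_mul (√(p.θ₂ * T) * √(1 - 2 * b)))
    refine squeeze_zero' ?_ ?_ h1
    · filter_upwards [hpos] with n hn
      exact mul_nonneg (Real.sqrt_nonneg _)
        (div_nonneg (errBd_nonneg hn.2.2.1.le _) (Real.sqrt_nonneg _))
    · filter_upwards [hpos, hx.eventually (ge_mem_nhds zero_lt_one)] with n hn hx1
      have hs := Real.sqrt_pos.2 hn.2.2.1
      have hM0 : (0 : ℝ) < M n := by exact_mod_cast hn.2.1
      have hN0 : (0 : ℝ) < N n := by exact_mod_cast hn.1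
      have hss := Real.mul_self_sqrt hn.2.2.1.le
      have e1 : errBd (spaceMesh b (M n)) (p.θ₂ * timeMesh T (N n)) /
          √(p.θ₂ * timeMesh T (N n)) ≤ p.θ₂ * timeMesh T (N n) +
            spaceMesh b (M n) ^ 2 * √(p.θ₂ * timeMesh T (N n)) := by
        rw [div_le_iff₀ hs]
        refine (errBd_le_time _ _).trans (le_of_eq ?_)
        linear_combination (-spaceMesh b (M n) ^ 2) * hss
      refine (mul_le_mul_of_nonneg_left e1 (Real.sqrt_nonneg _)).trans (le_of_eq ?_)
      have e2 : √(1 - 2 * b) = √(M n : ℝ) * √(spaceMesh b (M n)) := by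
        rw [← mul_spaceMesh b hn.2.1, Real.sqrt_mul hM0.le]
      have e3 : √(spaceMesh b (M n)) ^ 2 = spaceMesh b (M n) := Real.sq_sqrt hn.2.2.2.le
      have e4 : √(N n : ℝ) * √(p.θ₂ * timeMesh T (N n)) = √(p.θ₂ * T) := by
        rw [← Real.sqrt_mul hN0.le, mul_timeMesh hn.1]
      have h6 : 0 < √(√(N n : ℝ)) := Real.sqrt_pos.2 (Real.sqrt_pos.2 hN0)
      have h7 : √(√(N n : ℝ)) * √(√(N n : ℝ)) = √(N n : ℝ) :=
        Real.mul_self_sqrt (Real.sqrt_nonneg _)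
      have h8 : √(N n : ℝ) * √(N n : ℝ) = N n := Real.mul_self_sqrt hN0.le
      have h9 : 0 < √(N n : ℝ) := Real.sqrt_pos.2 hN0
      have e5 : √((M n : ℝ) / √(N n : ℝ)) * (p.θ₂ * T * (√(√(N n : ℝ)))⁻¹) =
          √(M n : ℝ) * √(N n : ℝ) * (p.θ₂ * timeMesh T (N n)) := by
        rw [Real.sqrt_div hM0.le]
        unfold timeMesh
        calc _ = √(M n : ℝ) * (p.θ₂ * T) / (√(√(N n : ℝ)) * √(√(N n : ℝ))) := by field_simp
          _ = √(M n : ℝ) * √(N n : ℝ) * (p.θ₂ * T) / (√(N n : ℝ) * √(N n : ℝ)) := by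
            rw [h7]; field_simp
          _ = _ := by rw [h8]; ring
      rw [e5, e2, ← e4, Real.sqrt_mul hM0.le]
      linear_combination (-√(M n : ℝ) * √(N n : ℝ) * √(p.θ₂ * timeMesh T (N n)) *
        spaceMesh b (M n)) * e3
  · filter_upwards [hpos, hx.eventually (ge_mem_nhds zero_lt_one)] with n hn hx1 a c
    refine hdom (N n) (M n) a c ?_
    rw [div_le_one hn.2.2.2] at hx1
    rw [← Real.sq_sqrt hn.2.2.1.le]
    exact pow_le_pow_left₀ (Real.sqrt_nonneg _) hx1 2

end DoubleRegimes

section DoubleSpatialRegime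

variable {Ω : Type*} [MeasurableSpace Ω] {P : Measure Ω} [IsProbabilityMeasure P]
  {p : Params} {β : ℕ → ℝ≥0 → Ω → ℝ} {u : ℕ → ℝ → Ω → ℝ} {X : ℝ → ℝ → Ω → ℝ}
  {T b : ℝ} {N M : ℕ → ℕ}

/-- The limits of the rescaled main terms in the space dominated regime. -/
noncomputable def spatialDoubleLimit (j : ℕ) (L : ℤ) : ℝ :=
  if j = 0 then 0 else (|(L : ℝ) + 1| + |(L : ℝ) - 1| - 2 * |(L : ℝ)|) / 2

theorem abs_second_difference (L : ℤ) :
    |(L : ℝ) + 1| + |(L : ℝ) - 1| - 2 * |(L : ℝ)| = if L = 0 then 2 else 0 := by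
  split_ifs with h
  · norm_num [h]
  · rcases lt_or_gt_of_ne h with h | h
    · have h1 : (L : ℝ) + 1 ≤ 0 := by exact_mod_cast h
      rw [abs_of_nonpos h1, abs_of_neg (by linarith), abs_of_neg (by linarith)]
      ring
    · have h1 : (1 : ℝ) ≤ L := by exact_mod_cast h
      rw [abs_of_nonneg (by linarith), abs_of_nonneg (by linarith), abs_of_nonneg (by linarith)]
      ring

theorem two_mul_tsum_doubleLimit_spatial :
    2 * ∑' w, doubleLimit spatialDoubleLimit w ^ 2 = constC 0 := by
  have hφ : spatialDoubleLimit 1 0 = 1 := by norm_num [spatialDoubleLimit]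
  have hs : HasSum (fun J => doubleLimit spatialDoubleLimit (J, 0) ^ 2) (3 / 2 * 1 ^ 2) := by
    refine hasSum_lag_sq ?_ ?_ ?_ fun J h0 h1 h2 => ?_
    · norm_num [doubleLimit, spatialDoubleLimit]
    · norm_num [doubleLimit, spatialDoubleLimit]
    · norm_num [doubleLimit, spatialDoubleLimit]
    · have e1 : (J + 1).natAbs ≠ 0 := by omega
      have e2 : (J - 1).natAbs ≠ 0 := by omega
      have e3 : J.natAbs ≠ 0 := by omega
      simp only [doubleLimit, spatialDoubleLimit, if_neg e1, if_neg e2, if_neg e3]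
      norm_num
  have hinj : Function.Injective fun J : ℤ => (J, (0 : ℤ)) := fun a b h => (Prod.ext_iff.1 h).1
  have h1 : ∑' w, doubleLimit spatialDoubleLimit w ^ 2 = 3 / 2 := by
    rw [← hinj.tsum_eq, hs.tsum_eq]
    · norm_num
    · intro w hw
      by_contra hne
      have hw2 : w.2 ≠ 0 := fun h0 => hne ⟨w.1, Prod.ext rfl h0.symm⟩
      refine hw ?_
      have e : ∀ j, spatialDoubleLimit j w.2 = 0 := fun j => by
        unfold spatialDoubleLimit
        rw [abs_second_difference, if_neg hw2]
        simp
      simp [doubleLimit, e]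
  rw [h1]
  unfold constC
  norm_num

theorem clt_double_spatial (hX : IsStationarySolution P p β u X) (hp : p.Admissible) (hT : 0 < T)
    (hb₀ : 0 < b) (hb₁ : b < 1 / 2) (hN : Tendsto N atTop atTop) (hM : Tendsto M atTop atTop)
    (h : (fun n => √(N n : ℝ)) =o[atTop] (fun n => (M n : ℝ))) :
    CLT P N M (fun n ω => sigmaSqDouble p.θ₂ p.κ T b (N n) (M n)
      (observe X T b (N n) (M n) ω)) (p.σ ^ 2) (constC 0 * p.σ ^ 4) := by
  have hθ := hp.diffusivity_pos
  have hpos := eventually_mesh_pos hp hT hb₁ hN hM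
  have hη0 : Tendsto (fun n => p.θ₂ * timeMesh T (N n)) atTop (𝓝 0) := by
    simpa using (tendsto_timeMesh T hN).const_mul p.θ₂
  have hδ0 := tendsto_spaceMesh b hM
  have hα := tendsto_damping p b hM
  have hratio : Tendsto (fun n => spaceMesh b (M n) / √(p.θ₂ * timeMesh T (N n))) atTop
      (𝓝 0) := by
    have h1 := h.tendsto_div_nhds_zero.const_mul ((1 - 2 * b) / √(p.θ₂ * T))
    rw [mul_zero] at h1
    refine h1.congr fun n => ?_
    rw [← inv_div (√(p.θ₂ * timeMesh T (N n))), sqrt_timeMesh_div_spaceMesh hθ.le hT.le, mul_inv,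
      inv_div, inv_div]
  rw [← two_mul_tsum_doubleLimit_spatial]
  obtain ⟨C, hC, hdom⟩ := exists_double_space_bound hp hT hb₀.le hb₁
  have hφ : 0 < spatialDoubleLimit 1 0 := by norm_num [spatialDoubleLimit]
  have herr : ∀ᶠ n in atTop, ∀ j : ℕ, errBd (spaceMesh b (M n)) (j * (p.θ₂ * timeMesh T (N n))) /
      spaceMesh b (M n) ≤ √(j : ℝ) * (spaceMesh b (M n) * √(p.θ₂ * timeMesh T (N n))) := by
    filter_upwards [hpos] with n hn j
    rw [div_le_iff₀ hn.2.2.2]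
    refine (errBd_le_space _ _).trans (le_of_eq ?_)
    rw [Real.sqrt_mul j.cast_nonneg]
    ring
  have hδη : Tendsto (fun n => spaceMesh b (M n) * √(p.θ₂ * timeMesh T (N n))) atTop (𝓝 0) := by
    simpa using hδ0.mul hη0.sqrt
  refine clt_double_of_limits hX hp hT hb₀ hb₁ hN hM (ν := fun n => spaceMesh b (M n))
    (D := C) (hpos.mono fun n hn => hn.2.2.2) hφ (fun j L => ?_) (fun j => ?_) ?_ hC.le
    (.of_forall fun n a c => hdom (N n) (M n) a c)
  · rcases Nat.eq_zero_or_pos j with rfl | hj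
    · simp [mainInt, spatialDoubleLimit]
    have hj0 : 0 < √(j : ℝ) := Real.sqrt_pos.2 (by exact_mod_cast hj)
    have hrpos : ∀ᶠ n in atTop, 0 < spaceMesh b (M n) / √(p.θ₂ * timeMesh T (N n)) :=
      hpos.mono fun n hn => div_pos hn.2.2.2 (Real.sqrt_pos.2 hn.2.2.1)
    have hlim := fun c : ℝ => tendsto_auxH_mul_sub_div hratio hrpos (|c| / √(j : ℝ))
    have hcont : Tendsto (fun n => auxH (|(L : ℝ)| / √(j : ℝ) *
        (spaceMesh b (M n) / √(p.θ₂ * timeMesh T (N n))))) atTop (𝓝 (auxH 0)) := by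
      refine (hasDerivAt_auxH 0).continuousAt.tendsto.comp ?_
      simpa using hratio.const_mul (|(L : ℝ)| / √(j : ℝ))
    have hsq : Tendsto (fun n => (1 - damping p (spaceMesh b (M n))) ^ 2 /
        (spaceMesh b (M n) / √(p.θ₂ * timeMesh T (N n)))) atTop (𝓝 0) := by
      have h1 : Tendsto (fun n => dampConst p ^ 2 *
          (spaceMesh b (M n) * √(p.θ₂ * timeMesh T (N n)))) atTop (𝓝 0) := by
        simpa using hδη.const_mul (dampConst p ^ 2)
      refine squeeze_zero' ?_ ?_ h1
      · filter_upwards [hrpos] with n hn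
        positivity
      · filter_upwards [hpos, hrpos] with n hn hr
        have h2 := (damping_bounds p hn.2.2.2.le (spaceMesh_le_one hb₀.le hn.2.1)).2.2
        have h3 := pow_le_pow_left₀ (abs_nonneg _) h2 2
        rw [sq_abs] at h3
        rw [div_le_iff₀ hr]
        refine h3.trans (le_of_eq ?_)
        have := (Real.sqrt_pos.2 hn.2.2.1).ne'
        field_simp
    have h2 := ((hα.mul ((((hlim L).const_mul 2).sub (hlim (L + 1))).sub (hlim (L - 1)))).add
      (hsq.mul hcont)).const_mul (2 * √(j : ℝ))
    have e : 2 * √(j : ℝ) * (1 * (2 * -(|(L : ℝ)| / √(j : ℝ) / 4) - -(|(L : ℝ) + 1| / √(j : ℝ) / 4) -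
        -(|(L : ℝ) - 1| / √(j : ℝ) / 4)) + 0 * auxH 0) = spatialDoubleLimit j L := by
      rw [spatialDoubleLimit, if_neg hj.ne']
      field_simp
      ring
    rw [e] at h2
    refine h2.congr' ?_
    filter_upwards [hpos] with n hn
    have hs := (Real.sqrt_pos.2 hn.2.2.1).ne'
    have hd := hn.2.2.2.ne'
    rw [mainInt_scaled _ _ _ hn.2.2.2.le]
    field_simp
    ring
  · have h1 : Tendsto (fun n => √(j : ℝ) * (spaceMesh b (M n) * √(p.θ₂ * timeMesh T (N n)))) atTop
        (𝓝 0) := by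
      simpa using hδη.const_mul (√(j : ℝ))
    refine squeeze_zero' ?_ (herr.mono fun n hn => hn j) h1
    filter_upwards [hpos] with n hn
    exact div_nonneg (errBd_nonneg (mul_nonneg j.cast_nonneg hn.2.2.1.le) _) hn.2.2.2.le
  · have h1 : Tendsto (fun n => √(p.θ₂ * T) * √(1 - 2 * b) * √(spaceMesh b (M n))) atTop
        (𝓝 0) := by
      simpa using hδ0.sqrt.const_mul (√(p.θ₂ * T) * √(1 - 2 * b))
    refine squeeze_zero' ?_ ?_ h1
    · filter_upwards [hpos] with n hn
      exact mul_nonneg (Real.sqrt_nonneg _) (div_nonneg (errBd_nonneg hn.2.2.1.le _) hn.2.2.2.le)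
    · filter_upwards [hpos, herr] with n hn he
      have hM0 : (0 : ℝ) ≤ M n := Nat.cast_nonneg _
      have he1 := he 1
      rw [Nat.cast_one, one_mul, Real.sqrt_one, one_mul] at he1
      refine (mul_le_mul_of_nonneg_left he1 (Real.sqrt_nonneg _)).trans (le_of_eq ?_)
      have e2 : √(1 - 2 * b) = √(M n : ℝ) * √(spaceMesh b (M n)) := by
        rw [← mul_spaceMesh b hn.2.1, Real.sqrt_mul hM0]
      have e3 : √(spaceMesh b (M n)) ^ 2 = spaceMesh b (M n) := Real.sq_sqrt hn.2.2.2.le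
      have e4 : √(N n : ℝ) * √(p.θ₂ * timeMesh T (N n)) = √(p.θ₂ * T) := by
        rw [← Real.sqrt_mul (Nat.cast_nonneg _), mul_timeMesh hn.1]
      rw [e2, ← e4, Real.sqrt_mul hM0]
      linear_combination (-√(M n : ℝ) * √(N n : ℝ) * √(p.θ₂ * timeMesh T (N n))) * e3

end DoubleSpatialRegime

section GreenFunction

theorem hasSum_cos_div_sq {z : ℝ} (hz : z ∈ Set.Icc (0 : ℝ) 2) :
    HasSum (fun ℓ : ℕ => Real.cos (Real.pi * ((ℓ : ℝ) + 1) * z) / (Real.pi ^ 2 * ((ℓ : ℝ) + 1) ^ 2))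
      (z ^ 2 / 4 - z / 2 + 1 / 6) := by
  have h := hasSum_one_div_nat_pow_mul_cos one_ne_zero
    (x := z / 2) ⟨by linarith [hz.1], by linarith [hz.2]⟩
  rw [← hasSum_nat_add_iff' 1] at h
  have hB : (Polynomial.map (algebraMap ℚ ℝ) (Polynomial.bernoulli (2 * 1))).eval (z / 2) =
      z ^ 2 / 4 - z / 2 + 1 / 6 := by
    rw [mul_one, Polynomial.bernoulli]
    simp [Finset.sum_range_succ, bernoulli_two, bernoulli_one]
    ring
  rw [hB] at h
  have hπ := Real.pi_pos.ne'
  have h2 := h.mul_left (1 / Real.pi ^ 2)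
  have e : 1 / Real.pi ^ 2 * ((-1 : ℝ) ^ (1 + 1) * (2 * Real.pi) ^ (2 * 1) / 2 /
      ((2 * 1).factorial : ℝ) * (z ^ 2 / 4 - z / 2 + 1 / 6) - ∑ i ∈ Finset.range 1,
      1 / (i : ℝ) ^ (2 * 1) * Real.cos (2 * Real.pi * i * (z / 2))) =
      z ^ 2 / 4 - z / 2 + 1 / 6 := by
    simp [Nat.factorial]
    field_simp
  rw [e] at h2
  refine h2.congr_fun fun ℓ => ?_
  push_cast
  rw [show 2 * Real.pi * ((ℓ : ℝ) + 1) * (z / 2) = Real.pi * ((ℓ : ℝ) + 1) * z by ring]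
  have : (ℓ : ℝ) + 1 ≠ 0 := by positivity
  field_simp

/-- The Green function of `-∂²` with Dirichlet boundary conditions on the unit interval. -/
theorem hasSum_sinCoef_div {x y : ℝ} (hx : x ∈ Set.Icc (0 : ℝ) 1) (hy : y ∈ Set.Icc (0 : ℝ) 1) :
    HasSum (fun ℓ : ℕ => sinCoef x ℓ * sinCoef y ℓ / (Real.pi ^ 2 * ((ℓ : ℝ) + 1) ^ 2))
      (min x y - x * y) := by
  have h1 := hasSum_cos_div_sq (z := |x - y|) ⟨abs_nonneg _, by
    rw [abs_le]; constructor <;> linarith [hx.1, hx.2, hy.1, hy.2]⟩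
  have h2 := hasSum_cos_div_sq (z := x + y) ⟨by linarith [hx.1, hy.1], by linarith [hx.2, hy.2]⟩
  have e : min x y - x * y = |x - y| ^ 2 / 4 - |x - y| / 2 + 1 / 6 -
      ((x + y) ^ 2 / 4 - (x + y) / 2 + 1 / 6) := by
    rw [sq_abs]
    rcases le_total x y with h | h
    · rw [min_eq_left h, abs_of_nonpos (by linarith)]; ring
    · rw [min_eq_right h, abs_of_nonneg (by linarith)]; ring
  rw [e]
  refine (h1.sub h2).congr_fun fun ℓ => ?_
  rw [← sub_div]
  congr 1
  have hc : Real.cos (Real.pi * ((ℓ : ℝ) + 1) * |x - y|) =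
      Real.cos (Real.pi * ((ℓ : ℝ) + 1) * x - Real.pi * ((ℓ : ℝ) + 1) * y) := by
    rw [← mul_sub]
    rcases abs_choice (x - y) with h | h <;> rw [h]
    rw [mul_neg, Real.cos_neg]
  rw [hc, mul_add _ x y, Real.cos_sub, Real.cos_add, sinCoef, sinCoef]
  have h : √(2 : ℝ) * √2 = 2 := Real.mul_self_sqrt (by norm_num)
  linear_combination (Real.sin (Real.pi * ((ℓ : ℝ) + 1) * x) *
    Real.sin (Real.pi * ((ℓ : ℝ) + 1) * y)) * h

theorem abs_incCoef_le_mul {α δ K : ℝ} (hδ : 0 ≤ δ) (hα0 : 0 ≤ α) (hαK : α ≤ K)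
    (hα : |1 - α| ≤ K * δ) (y : ℝ) (ℓ : ℕ) :
    |incCoef α δ y ℓ| ≤ √2 * (K * (Real.pi + 1)) * (δ * ((ℓ : ℝ) + 1)) := by
  set w := Real.pi * ((ℓ : ℝ) + 1) with hw
  have hw0 : 0 ≤ w := by have := Real.pi_pos; positivity
  have h1 : |Real.sin (w * (y + δ)) - Real.sin (w * y)| ≤ w * δ := by
    have := Real.abs_sin_sub_sin_le (w * (y + δ)) (w * y)
    rwa [mul_add, add_sub_cancel_left, abs_of_nonneg (mul_nonneg hw0 hδ), ← mul_add] at this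
  have e : incCoef α δ y ℓ = √2 * (α * (Real.sin (w * (y + δ)) - Real.sin (w * y)) +
      -((1 - α) * Real.sin (w * y))) := by
    rw [incCoef, sinCoef, sinCoef]; ring
  rw [e, abs_mul, abs_of_nonneg (Real.sqrt_nonneg 2), mul_assoc (√2) (K * (Real.pi + 1))]
  refine mul_le_mul_of_nonneg_left ((abs_add_le _ _).trans ?_) (Real.sqrt_nonneg 2)
  rw [abs_neg, abs_mul, abs_mul, abs_of_nonneg hα0]
  have hK := hα0.trans hαK
  calc _ ≤ K * (w * δ) + K * δ * 1 := by
        gcongr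
        exact Real.abs_sin_le_one _
    _ ≤ K * (w * δ) + K * δ * ((ℓ : ℝ) + 1) := by
        gcongr
        linarith [Nat.cast_nonneg (α := ℝ) ℓ]
    _ = _ := by rw [hw]; ring

theorem hasSum_incCoef_div {α δ x y : ℝ} (hx : 0 ≤ x) (hx' : x + δ ≤ 1) (hy : 0 ≤ y)
    (hy' : y + δ ≤ 1) (hδ : 0 < δ) (hxy : x + δ ≤ y ∨ x = y ∨ y + δ ≤ x) :
    HasSum (fun ℓ : ℕ => incCoef α δ x ℓ * incCoef α δ y ℓ / (Real.pi ^ 2 * ((ℓ : ℝ) + 1) ^ 2))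
      ((α * (min x y + δ) - min x y) * (α * (1 - max x y - δ) - (1 - max x y)) +
        if x = y then α * δ else 0) := by
  have mx : x ∈ Set.Icc (0 : ℝ) 1 := ⟨hx, by linarith⟩
  have mx' : x + δ ∈ Set.Icc (0 : ℝ) 1 := ⟨by linarith, hx'⟩
  have my : y ∈ Set.Icc (0 : ℝ) 1 := ⟨hy, by linarith⟩
  have my' : y + δ ∈ Set.Icc (0 : ℝ) 1 := ⟨by linarith, hy'⟩
  have h := ((((hasSum_sinCoef_div mx' my').mul_left (α ^ 2)).add
    (hasSum_sinCoef_div mx my)).sub ((hasSum_sinCoef_div mx' my).mul_left α)).sub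
    ((hasSum_sinCoef_div mx my').mul_left α)
  have e : (α * (min x y + δ) - min x y) * (α * (1 - max x y - δ) - (1 - max x y)) +
      (if x = y then α * δ else 0) = α ^ 2 * (min (x + δ) (y + δ) - (x + δ) * (y + δ)) +
      (min x y - x * y) - α * (min (x + δ) y - (x + δ) * y) -
      α * (min x (y + δ) - x * (y + δ)) := by
    rcases hxy with h | h | h
    · rw [if_neg (by rintro rfl; linarith), min_eq_left (by linarith : x ≤ y), max_eq_right (by linarith),
        min_eq_left (by linarith), min_eq_left h, min_eq_left (by linarith)]
      ring
    · subst h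
      rw [if_pos rfl, min_self, max_self, min_self, min_eq_right (by linarith),
        min_eq_left (by linarith)]
      ring
    · rw [if_neg (by rintro rfl; linarith), min_eq_right (by linarith : y ≤ x), max_eq_left (by linarith),
        min_eq_right (by linarith), min_eq_right h, min_eq_right (by linarith)]
      ring
  rw [e]
  refine h.congr_fun fun ℓ => ?_
  unfold incCoef
  ring

end GreenFunction

section SpatialCovariance

theorem summable_spectral {Γ : ℝ} (hΓ : 0 < Γ + Real.pi ^ 2) {c : ℕ → ℝ} {K : ℝ}
    (hc : ∀ ℓ, |c ℓ| ≤ K) {τ : ℝ} (hτ : 0 ≤ τ) :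
    Summable fun ℓ => c ℓ * (Real.exp (-(specVal Γ ℓ * τ)) / specVal Γ ℓ) := by
  refine ((summable_inv_specVal hΓ).mul_left K).of_norm_bounded fun ℓ => ?_
  have hμ := specVal_pos hΓ ℓ
  rw [Real.norm_eq_abs, abs_mul, abs_of_pos (by positivity : 0 < Real.exp _ / _), div_eq_mul_inv]
  refine mul_le_mul (hc ℓ) (mul_le_of_le_one_left (by positivity) ?_) (by positivity)
    ((abs_nonneg _).trans (hc ℓ))
  exact Real.exp_le_one_iff.2 (by nlinarith)

theorem abs_tsum_spectral_tail_le {Γ : ℝ} (hΓ : 0 < Γ + Real.pi ^ 2) {c : ℕ → ℝ} {E : ℝ}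
    (hc : ∀ ℓ, |c ℓ| ≤ E * ((ℓ : ℝ) + 1) ^ 2) {τ : ℝ} (hτ : 1 ≤ τ) :
    |∑' ℓ, c ℓ * (Real.exp (-(specVal Γ ℓ * τ)) / specVal Γ ℓ)| ≤
      E * ((min (Real.pi ^ 2) (Γ + Real.pi ^ 2))⁻¹ * ∑' ℓ, (specVal Γ ℓ)⁻¹) := by
  set m := min (Real.pi ^ 2) (Γ + Real.pi ^ 2)
  have hm : 0 < m := lt_min (by have := Real.pi_pos; positivity) hΓ
  have hE : 0 ≤ E := by simpa using (abs_nonneg _).trans (hc 0)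
  rw [← Real.norm_eq_abs]
  refine tsum_of_norm_bounded
    ((((summable_inv_specVal hΓ).hasSum).mul_left _).mul_left _) fun ℓ => ?_
  have hμ := specVal_pos hΓ ℓ
  have h1 : Real.exp (-(specVal Γ ℓ * τ)) ≤ (specVal Γ ℓ)⁻¹ := by
    rw [Real.exp_neg]
    refine inv_anti₀ hμ ?_
    have := Real.add_one_le_exp (specVal Γ ℓ * τ)
    nlinarith
  have h2 : ((ℓ : ℝ) + 1) ^ 2 * (specVal Γ ℓ)⁻¹ ≤ m⁻¹ := by
    rw [← div_eq_mul_inv, div_le_iff₀ hμ, ← div_eq_inv_mul, le_div_iff₀ hm, mul_comm]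
    exact le_specVal Γ ℓ
  rw [Real.norm_eq_abs, abs_mul, abs_of_pos (by positivity : 0 < Real.exp _ / _), div_eq_mul_inv]
  calc _ ≤ E * ((ℓ : ℝ) + 1) ^ 2 * ((specVal Γ ℓ)⁻¹ * (specVal Γ ℓ)⁻¹) := by
        gcongr
        exact hc ℓ
    _ = E * (((ℓ : ℝ) + 1) ^ 2 * (specVal Γ ℓ)⁻¹ * (specVal Γ ℓ)⁻¹) := by ring
    _ ≤ _ := by gcongr

theorem tsum_spectral_sub {Γ : ℝ} (hΓ : 0 < Γ + Real.pi ^ 2) {c : ℕ → ℝ} {K : ℝ}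
    (hc : ∀ ℓ, |c ℓ| ≤ K) {q : ℝ → ℝ} (hq : ∀ s, 0 < s →
      HasSum (fun ℓ : ℕ => c ℓ * Real.exp (-(Real.pi ^ 2 * ((ℓ : ℝ) + 1) ^ 2 * s))) (q s))
    {τ τ' : ℝ} (hτ : 0 ≤ τ) (hτ' : τ ≤ τ') :
    (∑' ℓ, c ℓ * (Real.exp (-(specVal Γ ℓ * τ)) / specVal Γ ℓ)) -
      ∑' ℓ, c ℓ * (Real.exp (-(specVal Γ ℓ * τ')) / specVal Γ ℓ) =
      ∫ v in τ..τ', Real.exp (-(Γ * v)) * q v := by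
  have h0 := hasSum_spectral_integral hΓ hc hq hτ
  have h1 := hasSum_spectral_integral hΓ hc hq (hτ.trans hτ')
  rw [← intervalIntegral.integral_interval_sub_left h1.1 h0.1, ← (h1.2.sub h0.2).tsum_eq,
    ← (summable_spectral hΓ hc hτ).tsum_sub (summable_spectral hΓ hc (hτ.trans hτ'))]
  refine tsum_congr fun ℓ => ?_
  ring

theorem abs_tsum_div_specVal_sub_le {Γ : ℝ} (hΓ : 0 < Γ + Real.pi ^ 2) {c : ℕ → ℝ} {K E s : ℝ}
    (hK : ∀ ℓ, |c ℓ| ≤ K) (hE : ∀ ℓ, |c ℓ| ≤ E * ((ℓ : ℝ) + 1) ^ 2)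
    (hs : HasSum (fun ℓ : ℕ => c ℓ / (Real.pi ^ 2 * ((ℓ : ℝ) + 1) ^ 2)) s) :
    |(∑' ℓ, c ℓ * (Real.exp (-(specVal Γ ℓ * 0)) / specVal Γ ℓ)) - s| ≤
      E * (|Γ| * (Real.pi ^ 2)⁻¹ * ∑' ℓ, (specVal Γ ℓ)⁻¹) := by
  have hπ := Real.pi_pos
  rw [← hs.tsum_eq, ← (summable_spectral hΓ hK le_rfl).tsum_sub hs.summable, ← Real.norm_eq_abs]
  refine tsum_of_norm_bounded
    ((((summable_inv_specVal hΓ).hasSum).mul_left _).mul_left _) fun ℓ => ?_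
  have hμ := specVal_pos hΓ ℓ
  have hℓ : (0 : ℝ) < (ℓ : ℝ) + 1 := by positivity
  have e : c ℓ * (Real.exp (-(specVal Γ ℓ * 0)) / specVal Γ ℓ) -
      c ℓ / (Real.pi ^ 2 * ((ℓ : ℝ) + 1) ^ 2) =
      c ℓ * (-Γ * ((Real.pi ^ 2)⁻¹ * (((ℓ : ℝ) + 1) ^ 2)⁻¹ * (specVal Γ ℓ)⁻¹)) := by
    rw [mul_zero, neg_zero, Real.exp_zero]
    field_simp
    unfold specVal
    ring
  rw [e, Real.norm_eq_abs, abs_mul, abs_mul, abs_neg,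
    abs_of_pos (by positivity : 0 < (Real.pi ^ 2)⁻¹ * (((ℓ : ℝ) + 1) ^ 2)⁻¹ * (specVal Γ ℓ)⁻¹)]
  refine (mul_le_mul_of_nonneg_right (hE ℓ) (by positivity)).trans (le_of_eq ?_)
  field_simp

/-- The covariances of the damped spatial increments at time lag `τ / θ₂`, up to a constant. -/
noncomputable def spatialCov (p : Params) (b : ℝ) (M k l : ℕ) (τ : ℝ) : ℝ :=
  ∑' ℓ, incCoef (damping p (spaceMesh b M)) (spaceMesh b M) (gridPoint b M k) ℓ *
    incCoef (damping p (spaceMesh b M)) (spaceMesh b M) (gridPoint b M l) ℓ *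
    (Real.exp (-(specVal p.Γ ℓ * τ)) / specVal p.Γ ℓ)

theorem abs_incCoef_mul_le (α δ x y : ℝ) (ℓ : ℕ) :
    |incCoef α δ x ℓ * incCoef α δ y ℓ| ≤ (|α| + 1) * √2 * ((|α| + 1) * √2) := by
  rw [abs_mul]
  exact mul_le_mul (abs_incCoef_le _ _ _ _) (abs_incCoef_le _ _ _ _) (abs_nonneg _) (by positivity)

theorem abs_incCoef_mul_le_mul {α δ K : ℝ} (hδ : 0 ≤ δ) (hα0 : 0 ≤ α) (hαK : α ≤ K)
    (hα : |1 - α| ≤ K * δ) (x y : ℝ) (ℓ : ℕ) :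
    |incCoef α δ x ℓ * incCoef α δ y ℓ| ≤
      2 * (K * (Real.pi + 1)) ^ 2 * δ ^ 2 * ((ℓ : ℝ) + 1) ^ 2 := by
  have h2 : √(2 : ℝ) * √2 = 2 := Real.mul_self_sqrt (by norm_num)
  rw [abs_mul]
  refine (mul_le_mul (abs_incCoef_le_mul hδ hα0 hαK hα x ℓ) (abs_incCoef_le_mul hδ hα0 hαK hα y ℓ)
    (abs_nonneg _) ((abs_nonneg _).trans (abs_incCoef_le_mul hδ hα0 hαK hα x ℓ))).trans
    (le_of_eq ?_)
  linear_combination ((K * (Real.pi + 1)) ^ 2 * δ ^ 2 * ((ℓ : ℝ) + 1) ^ 2) * h2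

variable {p : Params} {T b : ℝ}

theorem hasSum_spatialCov (hp : p.Admissible) (M k l : ℕ) {τ : ℝ} (hτ : 0 ≤ τ) :
    HasSum (fun ℓ => incCoef (damping p (spaceMesh b M)) (spaceMesh b M) (gridPoint b M k) ℓ *
      incCoef (damping p (spaceMesh b M)) (spaceMesh b M) (gridPoint b M l) ℓ *
      (Real.exp (-(specVal p.Γ ℓ * τ)) / specVal p.Γ ℓ)) (spatialCov p b M k l τ) :=
  (summable_spectral hp.spectral_gap (abs_incCoef_mul_le _ _ _ _) hτ).hasSum

theorem exists_spatialCov_zero (hp : p.Admissible) (hb₀ : 0 ≤ b) (hb₁ : b < 1 / 2) :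
    ∃ C, 0 < C ∧ ∀ (M : ℕ) (k l : Fin M),
      |spatialCov p b M k l 0 - if k = l then spaceMesh b M else 0| ≤ C * spaceMesh b M ^ 2 := by
  set K := dampConst p
  have hK : 0 ≤ K := dampConst_nonneg p
  have hΓ := hp.spectral_gap
  have hS : 0 ≤ ∑' ℓ, (specVal p.Γ ℓ)⁻¹ := tsum_nonneg fun ℓ => (inv_pos.2 (specVal_pos hΓ ℓ)).le
  set C₁ := 2 * (K * (Real.pi + 1)) ^ 2 * (|p.Γ| * (Real.pi ^ 2)⁻¹ * ∑' ℓ, (specVal p.Γ ℓ)⁻¹)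
    with hC₁
  have hC₁0 : 0 ≤ C₁ := by positivity
  refine ⟨C₁ + (2 * K) ^ 2 + K + 1, by positivity, fun M k l => ?_⟩
  have hM := k.pos
  have hδ := spaceMesh_pos hb₁ hM
  have hδ1 := spaceMesh_le_one hb₀ hM
  have hx := gridPoint_mem hb₁ hM k.2.le
  have hy := gridPoint_mem hb₁ hM l.2.le
  have hx' := gridPoint_mem hb₁ hM (Nat.succ_le_of_lt k.2)
  have hy' := gridPoint_mem hb₁ hM (Nat.succ_le_of_lt l.2)
  rw [Nat.succ_eq_add_one, gridPoint_succ] at hx' hy'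
  obtain ⟨hα0, hαK, hα⟩ := damping_bounds p hδ.le hδ1
  have hgrid : gridPoint b M k + spaceMesh b M ≤ gridPoint b M l ∨ gridPoint b M k = gridPoint b M l ∨
      gridPoint b M l + spaceMesh b M ≤ gridPoint b M k := by
    have hsub := gridPoint_sub b M k l
    rcases lt_trichotomy (k : ℕ) l with h | h | h
    · have : ((k : ℕ) : ℝ) + 1 ≤ (l : ℕ) := by exact_mod_cast h
      left; nlinarith
    · right; left; rw [h]
    · have : ((l : ℕ) : ℝ) + 1 ≤ (k : ℕ) := by exact_mod_cast h
      right; right; nlinarith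
  have hiff : gridPoint b M k = gridPoint b M l ↔ k = l := by
    refine ⟨fun h => ?_, fun h => by rw [h]⟩
    have hsub := gridPoint_sub b M k l
    rw [h, sub_self, eq_comm, mul_eq_zero, sub_eq_zero] at hsub
    exact Fin.ext (by exact_mod_cast hsub.resolve_right hδ.ne')
  have h1 := abs_tsum_div_specVal_sub_le hΓ (abs_incCoef_mul_le _ _ _ _)
    (abs_incCoef_mul_le_mul hδ.le hα0 hαK hα _ _)
    (hasSum_incCoef_div (α := damping p (spaceMesh b M)) (hb₀.trans hx.1) (by linarith [hx'.2])
      (hb₀.trans hy.1) (by linarith [hy'.2]) hδ hgrid)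
  simp only [hiff] at h1
  change |spatialCov p b M k l 0 - _| ≤ _ at h1
  have hmin0 : 0 ≤ min (gridPoint b M k) (gridPoint b M l) :=
    le_min (hb₀.trans hx.1) (hb₀.trans hy.1)
  have hmin1 : min (gridPoint b M k) (gridPoint b M l) ≤ 1 :=
    (min_le_left _ _).trans (by linarith [hx.2])
  have hmax0 : 0 ≤ max (gridPoint b M k) (gridPoint b M l) :=
    le_max_of_le_left (hb₀.trans hx.1)
  have hmax1 : max (gridPoint b M k) (gridPoint b M l) ≤ 1 :=
    max_le (by linarith [hx.2]) (by linarith [hy.2])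
  generalize min (gridPoint b M k) (gridPoint b M l) = u at *
  generalize max (gridPoint b M k) (gridPoint b M l) = w at *
  generalize damping p (spaceMesh b M) = α at *
  generalize spaceMesh b M = δ at *
  have hfac : ∀ z d : ℝ, 0 ≤ z → z ≤ 1 → |d| = δ → |α * (z + d) - z| ≤ 2 * K * δ := by
    intro z d hz0 hz1 hd
    rw [show α * (z + d) - z = α * d + -((1 - α) * z) by ring]
    refine (abs_add_le _ _).trans ?_
    rw [abs_neg, abs_mul, abs_mul, hd, abs_of_nonneg hα0, abs_of_nonneg hz0]
    calc _ ≤ K * δ + K * δ * 1 := by gcongr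
      _ = _ := by ring
  have hprod : |(α * (u + δ) - u) * (α * (1 - w - δ) - (1 - w))| ≤ (2 * K) ^ 2 * δ ^ 2 := by
    rw [abs_mul]
    refine (mul_le_mul (hfac u δ hmin0 hmin1 (abs_of_pos hδ)) (hfac (1 - w) (-δ) (by linarith)
      (by linarith) (by rw [abs_neg, abs_of_pos hδ])) (abs_nonneg _) (by positivity)).trans
      (le_of_eq (by ring))
  have hdiag : |(if k = l then α * δ else 0) - if k = l then δ else 0| ≤ K * δ ^ 2 := by
    split_ifs
    · rw [show α * δ - δ = -((1 - α) * δ) by ring, abs_neg, abs_mul, abs_of_pos hδ]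
      nlinarith
    · rw [sub_zero, abs_zero]; positivity
  generalize (if k = l then α * δ else 0) = e₁ at *
  generalize (if k = l then δ else 0) = e₂ at *
  have hδ2 : 0 ≤ δ ^ 2 := sq_nonneg δ
  have h2 : 2 * (K * (Real.pi + 1)) ^ 2 * δ ^ 2 * (|p.Γ| * (Real.pi ^ 2)⁻¹ *
    ∑' ℓ, (specVal p.Γ ℓ)⁻¹) = C₁ * δ ^ 2 := by rw [hC₁]; ring
  rw [h2] at h1
  rw [abs_le] at *
  constructor <;> linarith [h1.1, h1.2, hprod.1, hprod.2, hdiag.1, hdiag.2]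

theorem abs_integral_unit_le {f : ℝ → ℝ} {τ A C : ℝ} (hτ : 0 ≤ τ) (hA : 0 < A) (hC : 0 ≤ C)
    (h : ∀ v ∈ Set.Ioc τ (τ + 1), |f v| ≤ C * ((√v)⁻¹ / (v + A))) :
    |∫ v in τ..τ + 1, f v| ≤ 2 * C * (Real.pi / √(τ + A)) := by
  have hA0 : 0 < τ + A := by positivity
  obtain ⟨hgi, hgb⟩ := integral_inv_sqrt_div_le (by linarith : 0 ≤ τ + 1) (Real.sqrt_pos.2 hA0)
  rw [Real.sq_sqrt hA0.le] at hgb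
  simp only [Real.sq_sqrt hA0.le] at hgi
  have hgi' : IntervalIntegrable (fun v => (√v)⁻¹ / (v + (τ + A))) volume τ (τ + 1) :=
    hgi.mono_set (by
      rw [Set.uIcc_of_le (by linarith), Set.uIcc_of_le (by linarith)]
      exact Set.Icc_subset_Icc_left hτ)
  refine (abs_integral_le_of_abs_le (g := fun v => 2 * C * ((√v)⁻¹ / (v + (τ + A))))
    (by linarith) (hgi'.const_mul _) fun v hv => (h v hv).trans ?_).trans ?_
  · have hv0 : 0 < v := hτ.trans_lt hv.1
    rw [mul_comm 2 C, mul_assoc]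
    refine mul_le_mul_of_nonneg_left ?_ hC
    rw [← mul_div_assoc, div_le_div_iff₀ (by positivity) (by positivity)]
    have h3 : v + (τ + A) ≤ 2 * (v + A) := by linarith [hv.1]
    have h4 : 0 ≤ (√v)⁻¹ := by positivity
    nlinarith
  · rw [intervalIntegral.integral_const_mul]
    refine mul_le_mul_of_nonneg_left (le_trans ?_ hgb) (by positivity)
    refine intervalIntegral.integral_mono_interval hτ (by linarith) le_rfl ?_ hgi
    filter_upwards [ae_restrict_mem measurableSet_Ioc] with v hv
    have := hv.1
    simp only [Pi.zero_apply]
    positivity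

theorem exists_spatialCov_bound (hp : p.Admissible) (hT : 0 < T) (hb₀ : 0 ≤ b) (hb₁ : b < 1 / 2) :
    ∃ C, 0 < C ∧ ∀ (M : ℕ) (k l : Fin M) (τ : ℝ), 0 < τ → τ ≤ p.θ₂ * T →
      |spatialCov p b M k l τ| ≤ C * spaceMesh b M ^ 2 *
        ((√(τ + (((k : ℕ) : ℝ) - (l : ℕ)) ^ 2 * spaceMesh b M ^ 2))⁻¹ + 1) := by
  have hθ := hp.diffusivity_pos
  have hΓ := hp.spectral_gap
  have hπ := Real.pi_pos
  set T' := p.θ₂ * T + 1 with hT'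
  have hT'0 : 0 ≤ T' := by positivity
  set K := dampConst p
  have hK : 0 ≤ K := dampConst_nonneg p
  have hc₀ := imageConst_nonneg
  have hc₁ := cornerConst_nonneg hK hT'0
  have hS : 0 ≤ ∑' ℓ, (specVal p.Γ ℓ)⁻¹ := tsum_nonneg fun ℓ => (inv_pos.2 (specVal_pos hΓ ℓ)).le
  have hm : 0 < min (Real.pi ^ 2) (p.Γ + Real.pi ^ 2) := lt_min (by positivity) hΓ
  set C₁ := Real.exp (|p.Γ| * T') * (4 * (2 + T') * imageConst * cornerConst K T') with hC₁
  set C₂ := 2 * (K * (Real.pi + 1)) ^ 2 *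
    ((min (Real.pi ^ 2) (p.Γ + Real.pi ^ 2))⁻¹ * ∑' ℓ, (specVal p.Γ ℓ)⁻¹) with hC₂
  have hC₁0 : 0 ≤ C₁ := by positivity
  have hC₂0 : 0 ≤ C₂ := by positivity
  refine ⟨2 * C₁ * Real.pi + C₂ + 1, by positivity, fun M k l τ hτ hτT => ?_⟩
  have hM := k.pos
  have hδ := spaceMesh_pos hb₁ hM
  have hδ1 := spaceMesh_le_one hb₀ hM
  have hx := gridPoint_mem hb₁ hM k.2.le
  have hy := gridPoint_mem hb₁ hM l.2.le
  have hx' := gridPoint_mem hb₁ hM (Nat.succ_le_of_lt k.2)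
  have hy' := gridPoint_mem hb₁ hM (Nat.succ_le_of_lt l.2)
  rw [Nat.succ_eq_add_one, gridPoint_succ] at hx' hy'
  obtain ⟨hα0, hαK, hα⟩ := damping_bounds p hδ.le hδ1
  have hsub := gridPoint_sub b M k l
  have htail := abs_tsum_spectral_tail_le hΓ (abs_incCoef_mul_le_mul hδ.le hα0 hαK hα
    (gridPoint b M k) (gridPoint b M l)) (by linarith : 1 ≤ τ + 1)
  have hdiff := tsum_spectral_sub hΓ (abs_incCoef_mul_le (damping p (spaceMesh b M))
    (spaceMesh b M) (gridPoint b M k) (gridPoint b M l))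
    (fun s hs => hasSum_incCoef hs _ _ _ _) hτ.le (by linarith : τ ≤ τ + 1)
  change spatialCov p b M k l τ - spatialCov p b M k l (τ + 1) = _ at hdiff
  change |spatialCov p b M k l (τ + 1)| ≤ _ at htail
  set L : ℝ := ((k : ℕ) : ℝ) - (l : ℕ) with hL
  set δ := spaceMesh b M
  have h_int : |∫ v in τ..τ + 1, Real.exp (-(p.Γ * v)) *
      cornerKer (damping p δ) δ v (gridPoint b M k) (gridPoint b M l)| ≤
      2 * (C₁ * δ ^ 2) * (Real.pi / √(τ + (1 + L ^ 2) * δ ^ 2)) := by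
    refine abs_integral_unit_le hτ.le (by positivity) (by positivity) fun v hv => ?_
    have hv0 : 0 < v := hτ.trans hv.1
    have hvT : v ≤ T' := by linarith [hv.2]
    have h1 := abs_cornerKer_le hv0 hvT hδ hδ1 hα0 hαK hα (hb₀.trans hx.1)
      (by linarith [hx'.2]) (hb₀.trans hy.1) (by linarith [hy'.2])
    rw [hsub] at h1
    rw [abs_mul, Real.abs_exp]
    refine (mul_le_mul (Real.exp_le_exp.2 (neg_mul_le_abs_mul (Γ := p.Γ) hv0.le hvT)) h1
      (abs_nonneg _) (Real.exp_pos _).le).trans (le_of_eq ?_)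
    rw [hC₁, show v + δ ^ 2 + (L * δ) ^ 2 = v + (1 + L ^ 2) * δ ^ 2 by ring]
    ring
  have e : spatialCov p b M k l τ = (∫ v in τ..τ + 1, Real.exp (-(p.Γ * v)) *
      cornerKer (damping p δ) δ v (gridPoint b M k) (gridPoint b M l)) +
      spatialCov p b M k l (τ + 1) := by
    rw [← hdiff]; ring
  rw [e]
  refine (abs_add_le _ _).trans ((add_le_add h_int htail).trans ?_)
  have h5 : (√(τ + (1 + L ^ 2) * δ ^ 2))⁻¹ ≤ (√(τ + L ^ 2 * δ ^ 2))⁻¹ := by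
    refine inv_anti₀ (Real.sqrt_pos.2 (by positivity)) (Real.sqrt_le_sqrt ?_)
    nlinarith [sq_nonneg δ]
  have h6 : 0 ≤ (√(τ + L ^ 2 * δ ^ 2))⁻¹ := by positivity
  generalize (√(τ + L ^ 2 * δ ^ 2))⁻¹ = R at h5 h6 ⊢
  rw [div_eq_mul_inv]
  calc _ ≤ 2 * (C₁ * δ ^ 2) * (Real.pi * R) + C₂ * δ ^ 2 := by
        rw [hC₂]
        refine add_le_add (by gcongr) (le_of_eq (by ring))
    _ ≤ (2 * C₁ * Real.pi + C₂ + 1) * δ ^ 2 * R + (2 * C₁ * Real.pi + C₂ + 1) * δ ^ 2 := by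
        have : 2 * (C₁ * δ ^ 2) * (Real.pi * R) = 2 * C₁ * Real.pi * δ ^ 2 * R := by ring
        rw [this]
        have e1 : 0 ≤ 2 * C₁ * Real.pi := by positivity
        refine add_le_add ?_ ?_
        · gcongr
          linarith
        · gcongr
          linarith
    _ = _ := by ring

end SpatialCovariance

section NearIdentity

theorem tendstoInDistribution_of_near_identity {Ω : Type*} [MeasurableSpace Ω] {P : Measure Ω}
    [IsProbabilityMeasure P] {N M : ℕ → ℕ} (hN : Tendsto N atTop atTop)
    (hM : Tendsto M atTop atTop) {ζ : ∀ n, Fin (N n) × Fin (M n) → Ω → ℝ}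
    {ρ : ∀ n, Fin (N n) × Fin (M n) → Fin (N n) × Fin (M n) → ℝ}
    (hG : ∀ n, IsCenteredGaussian P (ζ n) (ρ n))
    (hrow : ∀ ε > 0, ∀ᶠ n in atTop, ∀ a, ∑ c, (ρ n a c - if a = c then 1 else 0) ^ 2 ≤ ε)
    (hbias : ∀ ε > 0, ∀ᶠ n in atTop, ∀ a, |ρ n a a - 1| ≤ ε / √((M n : ℝ) * N n))
    {s : ℝ} (hs : 0 ≤ s) :
    TendstoInDistribution (fun n ω => √((M n : ℝ) * N n) *
        (s * (1 / ((M n : ℝ) * N n) * ∑ a, ζ n a ω ^ 2) - s)) atTop (id : ℝ → ℝ)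
      (fun _ => P) (gaussianReal 0 (2 * s ^ 2).toNNReal) := by
  set q : ℕ → ℝ := fun n => √((M n : ℝ) * N n) with hq
  have hq2 : ∀ n, q n ^ 2 = (M n : ℝ) * N n := fun n => Real.sq_sqrt (by positivity)
  have hqlim : Tendsto q atTop atTop := Real.tendsto_sqrt_atTop.comp
    ((tendsto_natCast_atTop_atTop.comp hM).atTop_mul_atTop₀ (tendsto_natCast_atTop_atTop.comp hN))
  have hq0 : ∀ᶠ n in atTop, 0 < q n := hqlim.eventually_gt_atTop 0
  have hcard : ∀ n, (Fintype.card (Fin (N n) × Fin (M n)) : ℝ) = q n ^ 2 := fun n => by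
    rw [hq2]; simp [mul_comm]
  have hsq : ∀ n, √(s / q n) ^ 2 = s / q n := fun n => Real.sq_sqrt (by positivity)
  have hmain := tendstoInDistribution_sum_sq_of_row_sums (τ := fun n => q n * s)
    (v := 2 * s ^ 2) (fun n => (hG n).const_mul √(s / q n)) ?_ ?_ ?_
  · convert hmain using 3 with n ω
    simp_rw [mul_pow, hsq, ← Finset.mul_sum]
    change q n * _ = _
    rw [← hq2]
    rcases eq_or_ne (q n) 0 with h | h
    · simp [h]
    · field_simp
  · simp_rw [hsq]
    rw [Metric.tendsto_nhds]
    intro ε hε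
    filter_upwards [hbias (ε / (s + 1)) (by positivity), hq0] with n hn hqn
    have h1 : ∑ a, s / q n * ρ n a a - q n * s = s / q n * ∑ a, (ρ n a a - 1) := by
      rw [Finset.sum_sub_distrib, ← Finset.mul_sum]
      simp only [Finset.sum_const, Finset.card_univ, nsmul_eq_mul, mul_one, hcard]
      field_simp
    have h2 : |∑ a, (ρ n a a - 1)| ≤ q n ^ 2 * (ε / (s + 1) / q n) := by
      refine (Finset.abs_sum_le_sum_abs _ _).trans ((Finset.sum_le_sum fun a _ => hn a).trans ?_)
      simp only [Finset.sum_const, Finset.card_univ, nsmul_eq_mul, hcard]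
      exact le_rfl
    rw [dist_zero_right, Real.norm_eq_abs, h1, abs_mul, abs_of_nonneg (by positivity)]
    refine (mul_le_mul_of_nonneg_left h2 (by positivity)).trans_lt ?_
    rw [show s / q n * (q n ^ 2 * (ε / (s + 1) / q n)) = ε * (s / (s + 1)) by field_simp]
    refine mul_lt_of_lt_one_right hε ((div_lt_one (by positivity)).2 (by linarith))
  · simp_rw [hsq]
    rw [Metric.tendsto_nhds]
    intro ε hε
    obtain ⟨e, he, hes⟩ : ∃ e > 0, 2 * s ^ 2 * (e ^ 2 + 2 * e) < ε := by
      have hc : Tendsto (fun e : ℝ => 2 * s ^ 2 * (e ^ 2 + 2 * e)) (𝓝[>] 0) (𝓝 0) := by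
        have : ContinuousAt (fun e : ℝ => 2 * s ^ 2 * (e ^ 2 + 2 * e)) 0 := by fun_prop
        simpa using this.tendsto.mono_left nhdsWithin_le_nhds
      obtain ⟨e, h1, h2⟩ := ((hc.eventually (gt_mem_nhds hε)).and self_mem_nhdsWithin).exists
      exact ⟨e, h2, h1⟩
    filter_upwards [hrow (e ^ 2) (by positivity), hq0] with n hn hqn
    have hrow' : ∀ a, |∑ c, ρ n a c ^ 2 - 1| ≤ e ^ 2 + 2 * e := fun a => by
      have h1 := hn a
      set r : Fin (N n) × Fin (M n) → ℝ := fun c => ρ n a c - if a = c then 1 else 0 with hr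
      have h2 : ∑ c, ρ n a c ^ 2 = ∑ c, r c ^ 2 + 2 * r a + 1 := by
        have h3 : ∀ c, ρ n a c ^ 2 = r c ^ 2 + (if a = c then 2 * r c + 1 else 0) := fun c => by
          simp only [hr]; split_ifs <;> ring
        simp_rw [h3, Finset.sum_add_distrib, Finset.sum_ite_eq, Finset.mem_univ, if_true]
        ring
      have h4 : r a ^ 2 ≤ e ^ 2 :=
        (Finset.single_le_sum (f := fun c => r c ^ 2) (fun c _ => sq_nonneg _)
          (Finset.mem_univ a)).trans h1
      have h5 := abs_le.1 (abs_le_of_sq_le_sq h4 he.le)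
      have h6 : 0 ≤ ∑ c, r c ^ 2 := Finset.sum_nonneg fun c _ => sq_nonneg _
      change ∑ c, r c ^ 2 ≤ e ^ 2 at h1
      rw [h2, abs_le]
      constructor <;> nlinarith [h5.1, h5.2]
    have h7 : 2 * ∑ a, ∑ c, (s / q n * ρ n a c) ^ 2 - 2 * s ^ 2 =
        2 * s ^ 2 / q n ^ 2 * ∑ a, (∑ c, ρ n a c ^ 2 - 1) := by
      simp_rw [mul_pow, ← Finset.mul_sum]
      rw [Finset.sum_sub_distrib]
      simp only [Finset.sum_const, Finset.card_univ, nsmul_eq_mul, mul_one, hcard]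
      field_simp
    have h8 : |∑ a, (∑ c, ρ n a c ^ 2 - 1)| ≤ q n ^ 2 * (e ^ 2 + 2 * e) := by
      refine (Finset.abs_sum_le_sum_abs _ _).trans
        ((Finset.sum_le_sum fun a _ => hrow' a).trans ?_)
      simp only [Finset.sum_const, Finset.card_univ, nsmul_eq_mul, hcard]
      exact le_rfl
    rw [Real.dist_eq, h7, abs_mul, abs_of_nonneg (by positivity)]
    refine (mul_le_mul_of_nonneg_left h8 (by positivity)).trans_lt (lt_of_eq_of_lt ?_ hes)
    field_simp
  · intro ε hε
    simp_rw [hsq]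
    have hlim : Tendsto (fun n => s / q n) atTop (𝓝 0) := tendsto_const_nhds.div_atTop hqlim
    set e := ε / 2 / (s + 1) with he
    have he0 : 0 < e := by positivity
    filter_upwards [hrow (e ^ 2) (by positivity), hq0,
      hlim.eventually (gt_mem_nhds (half_pos hε))] with n hn hqn hsn a
    have h1 : ∑ c, |ρ n a c - if a = c then 1 else 0| ≤ q n * e := by
      have h2 := sq_sum_le_card_mul_sum_sq (s := Finset.univ)
        (f := fun c => |ρ n a c - if a = c then 1 else 0|)
      simp only [sq_abs, Finset.card_univ] at h2
      rw [hcard] at h2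
      refine abs_le_of_sq_le_sq' ?_ (by positivity) |>.2
      refine h2.trans ?_
      rw [mul_pow]
      exact mul_le_mul_of_nonneg_left (hn a) (sq_nonneg _)
    have h3 : ∑ c, |ρ n a c| ≤ q n * e + 1 := by
      refine (Finset.sum_le_sum fun c _ => ?_).trans (?_ : ∑ c, (|ρ n a c - if a = c then 1 else 0| +
        if a = c then 1 else 0) ≤ _)
      · have := abs_sub_abs_le_abs_sub (ρ n a c) (if a = c then 1 else 0)
        have h4 : |(if a = c then (1 : ℝ) else 0)| = if a = c then 1 else 0 := by
          split_ifs <;> simp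
        linarith
      · rw [Finset.sum_add_distrib]
        simpa using h1
    simp_rw [abs_mul, abs_of_nonneg (by positivity : 0 ≤ s / q n)]
    rw [← Finset.mul_sum]
    calc _ ≤ s / q n * (q n * e + 1) := by gcongr
      _ = s * e + s / q n := by field_simp
      _ ≤ ε / 2 + ε / 2 := by
        refine add_le_add ?_ hsn.le
        rw [he, mul_div_assoc', div_le_iff₀ (by positivity)]
        nlinarith
      _ = ε := add_halves ε

end NearIdentity

section LagSums

theorem sum_natAbs_sub_le {f : ℕ → ℝ} (hf : ∀ n, 0 ≤ f n) {N : ℕ} (i : Fin N) :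
    ∑ j : Fin N, f ((i : ℕ) - (j : ℕ) : ℤ).natAbs ≤ 2 * ∑ m ∈ Finset.range N, f m := by
  classical
  have key : ∀ s : Finset (Fin N), Set.InjOn (fun j : Fin N => ((i : ℕ) - (j : ℕ) : ℤ).natAbs) s →
      ∑ j ∈ s, f ((i : ℕ) - (j : ℕ) : ℤ).natAbs ≤ ∑ m ∈ Finset.range N, f m := fun s hs => by
    rw [← Finset.sum_image (f := f) (g := fun j : Fin N => ((i : ℕ) - (j : ℕ) : ℤ).natAbs) hs]
    refine Finset.sum_le_sum_of_subset_of_nonneg (fun m hm => ?_) fun m _ _ => hf m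
    obtain ⟨j, -, rfl⟩ := Finset.mem_image.1 hm
    have := i.2
    have := j.2
    simp only [Finset.mem_range]
    omega
  rw [← Finset.sum_filter_add_sum_filter_not Finset.univ (fun j => j ≤ i), two_mul]
  refine add_le_add (key _ fun j hj k hk h => ?_) (key _ fun j hj k hk h => ?_)
  · simp only [Finset.coe_filter, Finset.mem_univ, true_and, Set.mem_ofPred_eq, Fin.le_def] at hj hk
    simp only at h
    exact Fin.ext (by omega)
  · simp only [Finset.coe_filter, Finset.mem_univ, true_and, Set.mem_ofPred_eq, Fin.le_def] at hj hk
    simp only at h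
    exact Fin.ext (by omega)

theorem sum_inv_add_sq_le {t : ℝ} (ht : 1 ≤ t) (m : ℕ) :
    ∑ L ∈ Finset.range m, (t ^ 2 + (L : ℝ) ^ 2)⁻¹ ≤ 4 / t := by
  have h : ∑ L ∈ Finset.range m, (t ^ 2 + (L : ℝ) ^ 2)⁻¹ ≤ 4 * (1 / t - 1 / (t + m)) := by
    induction m with
    | zero => simp
    | succ m ih =>
      rw [Finset.sum_range_succ]
      have hm : (0 : ℝ) ≤ m := m.cast_nonneg
      have h1 : (t ^ 2 + (m : ℝ) ^ 2)⁻¹ ≤ 4 * (1 / (t + m) - 1 / (t + (m + 1))) := by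
        rw [show 4 * (1 / (t + m) - 1 / (t + (m + 1))) = 4 / ((t + m) * (t + m + 1)) by
          field_simp; ring, ← one_div, div_le_div_iff₀ (by positivity) (by positivity)]
        nlinarith [sq_nonneg (t - m)]
      push_cast
      linarith
  refine h.trans ?_
  have : 0 ≤ 1 / (t + m) := by positivity
  rw [show 4 / t = 4 * (1 / t) by ring]
  linarith

theorem sum_inv_sqrt_le (n : ℕ) : ∑ m ∈ Finset.range n, (√(m : ℝ))⁻¹ ≤ 2 * √(n : ℝ) := by
  have h : ∀ n : ℕ, ∑ m ∈ Finset.range (n + 1), (√(m : ℝ))⁻¹ ≤ 2 * √(n : ℝ) := fun n => by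
    induction n with
    | zero => simp
    | succ n ih =>
      rw [Finset.sum_range_succ]
      have h1 : 0 < √((n : ℝ) + 1) := Real.sqrt_pos.2 (by positivity)
      have h2 : √((n : ℝ) + 1) ^ 2 = n + 1 := Real.sq_sqrt (by positivity)
      have h3 : √(n : ℝ) ^ 2 = n := Real.sq_sqrt (by positivity)
      have h4 : (√((n : ℝ) + 1))⁻¹ ≤ 2 * √((n : ℝ) + 1) - 2 * √(n : ℝ) := by
        rw [inv_le_iff_one_le_mul₀ h1]
        nlinarith [sq_nonneg (√((n : ℝ) + 1) - √(n : ℝ))]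
      push_cast
      linarith
  refine (Finset.sum_le_sum_of_subset_of_nonneg (Finset.range_mono n.le_succ)
    fun m _ _ => by positivity).trans (h n)

end LagSums

section SpatialCLT

variable {Ω : Type*} [MeasurableSpace Ω] {P : Measure Ω} [IsProbabilityMeasure P]
  {p : Params} {β : ℕ → ℝ≥0 → Ω → ℝ} {u : ℕ → ℝ → Ω → ℝ} {X : ℝ → ℝ → Ω → ℝ}
  {T b : ℝ} {N M : ℕ → ℕ}

theorem sum_lag_inv_le {η δ : ℝ} (hη : 0 < η) (hδ : 0 < δ) (hδη : δ ^ 2 ≤ η) {N M : ℕ}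
    (a : Fin N × Fin M) :
    ∑ c : Fin N × Fin M, (if a.1 = c.1 then 0 else
      δ ^ 2 * (|((a.1 : ℕ) : ℝ) - (c.1 : ℕ)| * η +
        (((a.2 : ℕ) : ℝ) - (c.2 : ℕ)) ^ 2 * δ ^ 2)⁻¹) ≤ 32 * (δ * √(N : ℝ) / √η) := by
  have hs := Real.sqrt_pos.2 hη
  have hcast : ∀ {K : ℕ} (i j : Fin K), ((((i : ℕ) - (j : ℕ) : ℤ).natAbs : ℕ) : ℝ) =
      |((i : ℕ) : ℝ) - (j : ℕ)| := fun i j => by rw [Nat.cast_natAbs]; push_cast; rfl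
  have hinner : ∀ j : Fin N, ∑ l : Fin M, (if a.1 = j then 0 else
      δ ^ 2 * (|((a.1 : ℕ) : ℝ) - (j : ℕ)| * η +
        (((a.2 : ℕ) : ℝ) - (l : ℕ)) ^ 2 * δ ^ 2)⁻¹) ≤
      8 * (δ / √η) * (√((((a.1 : ℕ) - (j : ℕ) : ℤ).natAbs : ℕ) : ℝ))⁻¹ := fun j => by
    split_ifs with h
    · rw [Finset.sum_const_zero]; positivity
    · set J : ℝ := |((a.1 : ℕ) : ℝ) - (j : ℕ)| with hJ
      have hJ1 : 1 ≤ J := by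
        rw [hJ, ← hcast]
        have : ((a.1 : ℕ) - (j : ℕ) : ℤ) ≠ 0 := fun h0 => h (Fin.ext (by omega))
        exact_mod_cast Int.natAbs_pos.2 this
      have hJ0 : 0 < √J := Real.sqrt_pos.2 (by linarith)
      set t := √J * √η / δ with ht
      have ht1 : 1 ≤ t := by
        rw [ht, one_le_div hδ, ← Real.sqrt_mul (by linarith)]
        refine Real.le_sqrt_of_sq_le ?_
        nlinarith
      have ht2 : t ^ 2 = J * η / δ ^ 2 := by
        rw [ht, div_pow, mul_pow, Real.sq_sqrt (by linarith), Real.sq_sqrt hη.le]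
      have e : ∀ l : Fin M, δ ^ 2 * (J * η + (((a.2 : ℕ) : ℝ) - (l : ℕ)) ^ 2 * δ ^ 2)⁻¹ =
          (t ^ 2 + ((((a.2 : ℕ) - (l : ℕ) : ℤ).natAbs : ℕ) : ℝ) ^ 2)⁻¹ := fun l => by
        rw [hcast, sq_abs, ht2]
        field_simp
      simp_rw [e]
      refine (sum_natAbs_sub_le (f := fun L => (t ^ 2 + (L : ℝ) ^ 2)⁻¹)
        (fun L => by positivity) a.2).trans ?_
      refine (mul_le_mul_of_nonneg_left (sum_inv_add_sq_le ht1 M) zero_le_two).trans (le_of_eq ?_)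
      rw [hcast, ← hJ, ht]
      field_simp
      norm_num
  rw [Fintype.sum_prod_type]
  refine (Finset.sum_le_sum fun j _ => hinner j).trans ?_
  rw [← Finset.mul_sum]
  refine (mul_le_mul_of_nonneg_left ((sum_natAbs_sub_le (f := fun m => (√(m : ℝ))⁻¹)
    (fun m => by positivity) a.1).trans (mul_le_mul_of_nonneg_left (sum_inv_sqrt_le N)
    zero_le_two)) (by positivity)).trans (le_of_eq ?_)
  ring

theorem exists_spatial_row_bound (hp : p.Admissible) (hT : 0 < T) (hb₀ : 0 ≤ b) (hb₁ : b < 1 / 2) :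
    ∃ C, 0 < C ∧ ∀ N M : ℕ, spaceMesh b M ^ 2 ≤ p.θ₂ * timeMesh T N → ∀ a : Fin N × Fin M,
      |1 / spaceMesh b M * spatialCov p b M a.2 a.2 0 - 1| ≤ C * spaceMesh b M ∧
      ∑ c : Fin N × Fin M, (1 / spaceMesh b M * spatialCov p b M a.2 c.2
        (|((a.1 : ℕ) : ℝ) - (c.1 : ℕ)| * (p.θ₂ * timeMesh T N)) - if a = c then 1 else 0) ^ 2 ≤
      2 * C ^ 2 * (spaceMesh b M ^ 2 * (N * M) +
        32 * (spaceMesh b M * √(N : ℝ) / √(p.θ₂ * timeMesh T N))) := by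
  obtain ⟨C₀, hC₀, h0⟩ := exists_spatialCov_zero hp hb₀ hb₁
  obtain ⟨C₁, hC₁, h1⟩ := exists_spatialCov_bound hp hT hb₀ hb₁
  refine ⟨C₀ + C₁, by positivity, fun N M hδη a => ?_⟩
  obtain ⟨hN, hM⟩ := pos_of_fin_prod a
  have hη : 0 < p.θ₂ * timeMesh T N := mul_pos hp.diffusivity_pos (timeMesh_pos hT hN)
  have hηT := mul_timeMesh (p := p) (T := T) hN
  have hδ := spaceMesh_pos hb₁ hM
  have hzero : ∀ k l : Fin M, |1 / spaceMesh b M * spatialCov p b M k l 0 - if k = l then 1 else 0| ≤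
      (C₀ + C₁) * spaceMesh b M := fun k l => by
    have h2 := h0 M k l
    have e : 1 / spaceMesh b M * spatialCov p b M k l 0 - (if k = l then (1 : ℝ) else 0) =
        1 / spaceMesh b M * (spatialCov p b M k l 0 - if k = l then spaceMesh b M else 0) := by
      split_ifs
      · field_simp
      · simp
    rw [e, abs_mul, abs_of_pos (by positivity), one_div, inv_mul_le_iff₀ hδ]
    refine h2.trans ?_
    have : 0 ≤ C₁ * spaceMesh b M ^ 2 := by positivity
    nlinarith
  refine ⟨by simpa using hzero a.2 a.2, ?_⟩
  generalize p.θ₂ * timeMesh T N = η at *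
  have hterm : ∀ c : Fin N × Fin M, (1 / spaceMesh b M * spatialCov p b M a.2 c.2
      (|((a.1 : ℕ) : ℝ) - (c.1 : ℕ)| * η) - if a = c then 1 else 0) ^ 2 ≤
      2 * (C₀ + C₁) ^ 2 * (spaceMesh b M ^ 2 + if a.1 = c.1 then 0 else
        spaceMesh b M ^ 2 * (|((a.1 : ℕ) : ℝ) - (c.1 : ℕ)| * η +
        (((a.2 : ℕ) : ℝ) - (c.2 : ℕ)) ^ 2 * spaceMesh b M ^ 2)⁻¹) := fun c => by
    by_cases h : a.1 = c.1
    · have hac : a = c ↔ a.2 = c.2 := by rw [Prod.ext_iff]; simp [h]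
      have h2 := hzero a.2 c.2
      simp only [hac, h, if_true, sub_self, abs_zero, zero_mul, add_zero]
      rw [← sq_abs]
      refine (pow_le_pow_left₀ (abs_nonneg _) h2 2).trans ?_
      rw [mul_pow]
      have : 0 ≤ (C₀ + C₁) ^ 2 * spaceMesh b M ^ 2 := by positivity
      linarith
    · have hac : a ≠ c := fun h' => h (by rw [h'])
      have hJ : 1 ≤ |((a.1 : ℕ) : ℝ) - (c.1 : ℕ)| := by
        have : ((a.1 : ℕ) - (c.1 : ℕ) : ℤ) ≠ 0 := fun h0 => h (Fin.ext (by omega))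
        exact_mod_cast Int.one_le_abs this
      have hJN : |((a.1 : ℕ) : ℝ) - (c.1 : ℕ)| ≤ N := by
        have := abs_lag_add_one_le a.1 c.1
        push_cast at this
        linarith
      have h2 := h1 M a.2 c.2 (|((a.1 : ℕ) : ℝ) - (c.1 : ℕ)| * η) (by positivity)
        (by rw [← hηT]; gcongr)
      rw [if_neg hac, if_neg h, sub_zero]
      generalize |((a.1 : ℕ) : ℝ) - (c.1 : ℕ)| = J at *
      set A := J * η + (((a.2 : ℕ) : ℝ) - (c.2 : ℕ)) ^ 2 * spaceMesh b M ^ 2 with hA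
      have hA0 : 0 < A := by positivity
      have h3 : |1 / spaceMesh b M * spatialCov p b M a.2 c.2 (J * η)| ≤
          (C₀ + C₁) * spaceMesh b M * ((√A)⁻¹ + 1) := by
        rw [abs_mul, abs_of_pos (by positivity), one_div, inv_mul_le_iff₀ hδ]
        refine h2.trans ?_
        have : 0 ≤ C₀ * spaceMesh b M ^ 2 * ((√A)⁻¹ + 1) := by positivity
        nlinarith
      rw [← sq_abs]
      refine (pow_le_pow_left₀ (abs_nonneg _) h3 2).trans ?_
      have h4 : ((√A)⁻¹) ^ 2 = A⁻¹ := by rw [inv_pow, Real.sq_sqrt hA0.le]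
      have h5 : ((√A)⁻¹ + 1) ^ 2 ≤ 2 * (1 + A⁻¹) := by
        rw [← h4]; nlinarith [sq_nonneg ((√A)⁻¹ - 1)]
      calc _ = (C₀ + C₁) ^ 2 * spaceMesh b M ^ 2 * ((√A)⁻¹ + 1) ^ 2 := by ring
        _ ≤ (C₀ + C₁) ^ 2 * spaceMesh b M ^ 2 * (2 * (1 + A⁻¹)) := by gcongr
        _ = _ := by ring
  refine (Finset.sum_le_sum fun c _ => hterm c).trans ?_
  rw [← Finset.mul_sum, Finset.sum_add_distrib]
  refine mul_le_mul_of_nonneg_left (add_le_add (le_of_eq ?_) (sum_lag_inv_le hη hδ hδη a))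
    (by positivity)
  simp [mul_comm]

theorem clt_spatial (hX : IsStationarySolution P p β u X) (hp : p.Admissible) (hT : 0 < T)
    (hb₀ : 0 ≤ b) (hb₁ : b < 1 / 2) (hN : Tendsto N atTop atTop) (hM : Tendsto M atTop atTop)
    (h : (fun n => (N n : ℝ)) =o[atTop] (fun n => (M n : ℝ))) :
    CLT P N M (fun n ω => sigmaSqSpatial p.θ₂ p.κ b (N n) (M n)
      (observe X T b (N n) (M n) ω)) (p.σ ^ 2) (2 * p.σ ^ 4) := by
  have hθ := hp.diffusivity_pos
  have hpos := eventually_mesh_pos hp hT hb₁ hN hM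
  have hratio := h.tendsto_div_nhds_zero
  obtain ⟨C, hC, hbd⟩ := exists_spatial_row_bound hp hT hb₀ hb₁
  have hb' : 0 < 1 - 2 * b := by linarith
  have hmesh : ∀ᶠ n in atTop, spaceMesh b (M n) ^ 2 ≤ p.θ₂ * timeMesh T (N n) := by
    have h1 : Tendsto (fun n => (1 - 2 * b) ^ 2 * ((N n : ℝ) / M n)) atTop (𝓝 0) := by
      simpa using hratio.const_mul ((1 - 2 * b) ^ 2)
    have h2 : 0 < p.θ₂ * T := by positivity
    filter_upwards [hpos, h1.eventually (ge_mem_nhds h2)] with n hn h3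
    have hN0 : (0 : ℝ) < N n := by exact_mod_cast hn.1
    have hM1 : (1 : ℝ) ≤ M n := by exact_mod_cast hn.2.1
    unfold spaceMesh timeMesh
    rw [← mul_div_assoc, div_pow, div_le_div_iff₀ (by positivity) hN0]
    rw [mul_div_assoc', div_le_iff₀ (by positivity)] at h3
    refine h3.trans ?_
    gcongr
    nlinarith
  have hscale : ∀ n (a : Fin (N n) × Fin (M n)),
      √(2 * p.θ₂ / (spaceMesh b (M n) * p.σ ^ 2)) ^ 2 * (p.σ ^ 2 / (2 * p.θ₂)) =
      1 / spaceMesh b (M n) := fun n a => by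
    have hδ := spaceMesh_pos hb₁ a.2.pos
    have hσ := hp.sq_pos
    have hσ0 : p.σ ≠ 0 := fun h0 => by simp [h0] at hσ
    rw [Real.sq_sqrt (by positivity)]
    field_simp
  unfold CLT
  have heq : ∀ n ω, sigmaSqSpatial p.θ₂ p.κ b (N n) (M n) (observe X T b (N n) (M n) ω) = _ :=
    fun n ω => sigmaSqSpatial_eq hp.sq_pos hθ (by unfold spaceMesh; positivity) _
  simp_rw [heq]
  rw [show p.σ ^ 4 = (p.σ ^ 2) ^ 2 by ring]
  have hG : ∀ n, IsCenteredGaussian P (fun (a : Fin (N n) × Fin (M n)) ω =>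
      Real.exp (p.κ * gridPoint b (M n) a.2 / 2) * (observe X T b (N n) (M n) ω a.1 (a.2 + 1) -
        observe X T b (N n) (M n) ω a.1 a.2)) (fun a c => p.σ ^ 2 / (2 * p.θ₂) *
        spatialCov p b (M n) a.2 c.2
          (|((a.1 : ℕ) : ℝ) - (c.1 : ℕ)| * (p.θ₂ * timeMesh T (N n)))) := fun n =>
    hX.isCenteredGaussian_spatial hp hT hb₀ hb₁ (N n) (M n) fun a c =>
      hasSum_spatialCov hp _ _ _ (mul_nonneg (abs_nonneg _)
        (mul_pos hθ (timeMesh_pos hT a.1.pos)).le)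
  refine tendstoInDistribution_of_near_identity hN hM (fun n => (hG n).const_mul _) ?_ ?_
    hp.sq_pos.le
  · intro ε hε
    have hlim : Tendsto (fun n => 2 * C ^ 2 * ((1 - 2 * b) ^ 2 * ((N n : ℝ) / M n) +
        32 * ((1 - 2 * b) / √(p.θ₂ * T) * ((N n : ℝ) / M n)))) atTop (𝓝 0) := by
      simpa using ((hratio.const_mul ((1 - 2 * b) ^ 2)).add ((hratio.const_mul
        ((1 - 2 * b) / √(p.θ₂ * T))).const_mul 32)).const_mul (2 * C ^ 2)
    filter_upwards [hpos, hmesh, hlim.eventually (ge_mem_nhds hε)] with n hn h1 h2 a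
    simp_rw [← mul_assoc, hscale n a]
    have h3 := (hbd (N n) (M n) h1 a).2
    simp_rw [mul_assoc]
    refine h3.trans (le_trans (le_of_eq ?_) h2)
    have hN0 : (0 : ℝ) < N n := by exact_mod_cast hn.1
    have hM0 : (0 : ℝ) < M n := by exact_mod_cast hn.2.1
    have hNN := Real.mul_self_sqrt hN0.le
    have hs : 0 < √(N n : ℝ) := Real.sqrt_pos.2 hN0
    have e1 : √(p.θ₂ * timeMesh T (N n)) = √(p.θ₂ * T) / √(N n : ℝ) := by
      unfold timeMesh
      rw [← mul_div_assoc, Real.sqrt_div (by positivity)]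
    have hs' : 0 < √(p.θ₂ * T) := Real.sqrt_pos.2 (by positivity)
    have e2 : spaceMesh b (M n) * √(N n : ℝ) / √(p.θ₂ * timeMesh T (N n)) =
        (1 - 2 * b) / √(p.θ₂ * T) * ((N n : ℝ) / M n) := by
      rw [e1]
      unfold spaceMesh
      nth_rewrite 3 [← hNN]
      field_simp
    have e3 : spaceMesh b (M n) ^ 2 * ((N n : ℝ) * M n) =
        (1 - 2 * b) ^ 2 * ((N n : ℝ) / M n) := by
      unfold spaceMesh
      field_simp
    rw [e2, e3]
  · intro ε hε
    have hlim : Tendsto (fun n => C * (1 - 2 * b) * √((N n : ℝ) / M n)) atTop (𝓝 0) := by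
      simpa using hratio.sqrt.const_mul (C * (1 - 2 * b))
    filter_upwards [hpos, hmesh, hlim.eventually (ge_mem_nhds hε)] with n hn h1 h2 a
    rw [← mul_assoc, hscale n a, sub_self, abs_zero, zero_mul]
    have hN0 : (0 : ℝ) < N n := by exact_mod_cast hn.1
    have hM0 : (0 : ℝ) < M n := by exact_mod_cast hn.2.1
    refine (hbd (N n) (M n) h1 a).1.trans ?_
    rw [le_div_iff₀ (Real.sqrt_pos.2 (by positivity))]
    refine le_trans (le_of_eq ?_) h2
    have hMM := Real.mul_self_sqrt hM0.le
    have hs : 0 < √(M n : ℝ) := Real.sqrt_pos.2 hM0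
    rw [Real.sqrt_div hN0.le, Real.sqrt_mul hM0.le]
    unfold spaceMesh
    nth_rewrite 1 [← hMM]
    field_simp

end SpatialCLT

end SPDEVolatility

theorem mainTheorem10 {Ω : Type*} [MeasurableSpace Ω] (P : Measure Ω) [IsProbabilityMeasure P]
    (p : SPDEVolatility.Params) (hp : p.Admissible)
    (β : ℕ → ℝ≥0 → Ω → ℝ) (u : ℕ → ℝ → Ω → ℝ) (X : ℝ → ℝ → Ω → ℝ)
    (hX : SPDEVolatility.IsStationarySolution P p β u X)
    (T : ℝ) (hT : 0 < T) (b : ℝ) (hb₀ : 0 ≤ b) (hb₁ : b < 1 / 2)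
    (N M : ℕ → ℕ) (hN : Tendsto N atTop atTop) (hM : Tendsto M atTop atTop) :
    -- spatial increments
    ((fun n => (N n : ℝ)) =o[atTop] (fun n => (M n : ℝ)) →
      SPDEVolatility.CLT P N M
        (fun n ω => SPDEVolatility.sigmaSqSpatial p.θ₂ p.κ b (N n) (M n)
          (SPDEVolatility.observe X T b (N n) (M n) ω))
        (p.σ ^ 2) (2 * p.σ ^ 4)) ∧
    -- temporal increments
    (0 < b → ∀ ρ ∈ Set.Ioo (0 : ℝ) (1 / 2),
      (fun n => (M n : ℝ)) =o[atTop] (fun n => (N n : ℝ) ^ ρ) →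
      SPDEVolatility.CLT P N M
        (fun n ω => SPDEVolatility.sigmaSqTemporal p.θ₂ p.κ T b (N n) (M n)
          (SPDEVolatility.observe X T b (N n) (M n) ω))
        (p.σ ^ 2) (SPDEVolatility.constB * p.σ ^ 4)) ∧
    -- double increments, in the three sampling regimes
    (0 < b →
      ((fun n => √(N n : ℝ)) =o[atTop] (fun n => (M n : ℝ)) →
        SPDEVolatility.CLT P N M
          (fun n ω => SPDEVolatility.sigmaSqDouble p.θ₂ p.κ T b (N n) (M n)
            (SPDEVolatility.observe X T b (N n) (M n) ω))
          (p.σ ^ 2) (SPDEVolatility.constC 0 * p.σ ^ 4)) ∧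
      ((fun n => (M n : ℝ)) =o[atTop] (fun n => √(N n : ℝ)) →
        SPDEVolatility.CLT P N M
          (fun n ω => SPDEVolatility.sigmaSqDouble p.θ₂ p.κ T b (N n) (M n)
            (SPDEVolatility.observe X T b (N n) (M n) ω))
          (p.σ ^ 2) (SPDEVolatility.constC ⊤ * p.σ ^ 4)) ∧
      (∀ r₀ : ℝ, 0 < r₀ → (∀ n, √(N n : ℝ) = r₀ * (M n : ℝ)) →
        SPDEVolatility.CLT P N M
          (fun n ω => SPDEVolatility.sigmaSqDouble p.θ₂ p.κ T b (N n) (M n)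
            (SPDEVolatility.observe X T b (N n) (M n) ω))
          (p.σ ^ 2)
          (SPDEVolatility.constC (ENNReal.ofReal (r₀ * ((1 - 2 * b) / √T) / √p.θ₂))
            * p.σ ^ 4))) := by
  refine ⟨fun h => SPDEVolatility.clt_spatial hX hp hT hb₀ hb₁ hN hM h, fun hb ρ hρ h => ?_,
    fun hb => ⟨fun h => SPDEVolatility.clt_double_spatial hX hp hT hb hb₁ hN hM h,
      fun h => SPDEVolatility.clt_double_temporal hX hp hT hb hb₁ hN hM h,
      fun r₀ hr₀ h => SPDEVolatility.clt_double_balanced hX hp hT hb hb₁ hN hM hr₀ h⟩⟩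
  refine SPDEVolatility.clt_temporal hX hp hT hb hb₁ hN hM
    (h.trans_isBigO (IsBigO.of_bound 1 ?_))
  filter_upwards [SPDEVolatility.eventually_pos hN] with n hn
  rw [Real.norm_of_nonneg (by positivity), Real.norm_of_nonneg (by positivity), one_mul,
    Real.sqrt_eq_rpow]
  exact Real.rpow_le_rpow_of_exponent_le (by exact_mod_cast hn) hρ.2.le
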